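/- **Setting (2DCLH).** Consider the $L\times L$ square lattice, $N=L^2$ sites, each with a Hilbert space of dimension $D\ge 1$. An instance consists of a projector $Q_Z$ supported on the four sites of $Z$, for each plaquette $Z$, with $[Q_Y,Q_Z]=0$ for all $Y,Z$; put $P_Z=1-Q_Z$ and $H=\sum_Z Q_Z$. Columns are numbered $C=0,\dots,L-1$. Let $P_{C,C+1}=\prod_{Z\subset C\cup C+1}P_Z$ (empty products are $1$). The interaction algebra of an operator (or an algebra of operators) on a tensor factor $\mathcal H_1$ of $\mathcal H_1\otimes\mathcal H_2$ is the unital algebra generated by all $\mathrm{tr}_2(O(1\otimes B))$, with $B$ an operator on $\mathcal H_2$ and $O$ the operator (or in the algebra). The interaction algebra of $C-1,C$ on $C$ is that of the algebra generated by the $Q_Z$ with $Z\subset C-1\cup C$. An operator $B$ on column $C$ is a mask if for each operator $O$ on column $C-1$ there is a scalar $x$ with $\mathrm{tr}_{C-1\cup C}(O\,P_{C-1,C}\,B\,P_{C,C+1})=x\,\mathrm{tr}_C(B\,P_{C,C+1})$. A projector is consistent with $H$ if its range contains a zero energy ground state of $H$. **Four-site problems.** For each column $C$ and $1\le i\le L-2$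 (vertical coordinates are $0,\dots,L-1$), let $1$, $2$, $3$ be the sites of column $C$ with vertical coordinate less than, equal to, greater than $i$, and let $X$ be column $C-1$. Let $Q_{12X}$ be the sum of the $Q_Z$ with $Z\subset 1\cup2\cup X$, and $Q_{2X3}=\sum_Z w_ZQ_Z$ over $Z\subset 2\cup X\cup 3$, with positive weights $w_Z$ that are generic: every operator which commutes with $Q_{2X3}$ commutes with each of these $Q_Z$. **Conditions with ratio at most $r$ (where $r\ge1$).** For all $C,i$ as above (and some such weights) there are integers $D_{3^1},K$ with $D_{3^1}/K\le r$ such that: $\mathcal H_3=\mathcal H_3^1\otimes\mathcal H_3^2$ with $\dim\mathcal H_3^1=D_{3^1}$, and the interaction algebra of $Q_{2X3}$ on $3$ acts only on $\mathcal H_3^1$, so that $Q_{2X3}$ is an operator $Q'$ on $\mathcal H_{2X}\otimes\mathcal H_3^1$; there is a minimal projector $P^0$ of the center of the algebra on $\mathcal H_{2X}$ generated by the interaction algebras of $Q_{12X}$ and $Q'$, such that $P^0\psi=\psi$ whenever $Q'\psi=0$; the range of $P^0$ is a tensor product $\mathcal H^0_{2X\to1}\otimes\mathcal H^0_{2X\to3}$,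 with $Q_{12X}$ acting only on the first factor and $Q'$ only on the second; and $Q'$ has a unique zero energy state on $\mathcal H^0_{2X\to3}\otimes\mathcal H_3^1$, whose reduced density matrix on $\mathcal H_3^1$ has rank $K$. **Theorem.** There is a classical verifier $V$, a single program for a random access machine with exact complex arithmetic (unit cost field operations, conjugation and test for zero; natural number registers, for loop counters and array indices, with addition, subtraction and comparison), whose input is an instance together with, as proposed witness, one matrix product operator of bond dimension $\chi$ for each column, such that: 1. $V$ always halts in time polynomial in $N+D+\chi$. 2. If $V$ accepts an instance with some witness, then $H$ has a zero energy ground state. 3. For every polynomial $p$ there is a polynomial $t$ such that, for every instance with $D\le p(N)$ that has a zero energy ground state and satisfies the conditions above with some $r\le p(N)$, there are minimal projectors $O_C$ of the center of the interaction algebra of $C-1,C$ on $C$, one for each column, and operators $O_C^{mps}$ given by matrix product operators of a common bond dimension $\chi\le D^2 r$, such that, with $O_C=O_C^{mps}+O_C^\perp$: $O_C^{mps}$ and $O_C^\perp$ are projectors, $O_C^\perp P_{C-1,C}=P_{C-1,C}O_C^\perp=0$, $[O_C^{mps},P_{C-1,C}]=0$, $O_C^{mps}$ is a mask, $\prod_C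 O_C^{mps}$ is consistent with $H$, the matrix product operators have at most $t(N)$ entries, and $V$ accepts them as witness in at most $t(N)$ steps. -/

import Mathlib

open scoped Matrix Kronecker

noncomputable section

namespace CLH

/-! ### Finite dimensional tensor products and interaction algebras

An operator on a Hilbert space with orthonormal basis indexed by `m` is a matrix over `m`; the
tensor product of two such spaces has its basis indexed by `m × k`. -/

section Algebras

variable {m k : Type} [Fintype m] [Fintype k] [DecidableEq m] [DecidableEq k]

/-- Partial trace over the second tensor factor. -/
def ptrace (A : Matrix (m × k) (m × k) ℂ) : Matrix m m ℂ :=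
  Matrix.of fun i j => ∑ c, A (i, c) (j, c)

/-- The interaction algebra, on the first tensor factor, of a set of operators on `m × k`: the
(unital) algebra generated by all partial traces `tr₂ (O (1 ⊗ B))` with `O` in the set. -/
def interactionAlgebra (S : Set (Matrix (m × k) (m × k) ℂ)) : Subalgebra ℂ (Matrix m m ℂ) :=
  Algebra.adjoin ℂ {X | ∃ O ∈ S, ∃ B : Matrix k k ℂ,
    X = ptrace (O * ((1 : Matrix m m ℂ) ⊗ₖ B))}

/-- The interaction algebra on the second tensor factor. -/
def interactionAlgebraSnd (S : Set (Matrix (m × k) (m × k) ℂ)) : Subalgebra ℂ (Matrix k k ℂ) :=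
  interactionAlgebra ((fun O => O.submatrix Prod.swap Prod.swap) '' S)

/-- Orthogonal projector. -/
def IsProjector (P : Matrix m m ℂ) : Prop := P.IsHermitian ∧ P * P = P

/-- `P` is a projector in the center of the algebra `𝒜`. -/
def IsCentralProjector (𝒜 : Subalgebra ℂ (Matrix m m ℂ)) (P : Matrix m m ℂ) : Prop :=
  IsProjector P ∧ P ∈ 𝒜 ∧ ∀ B ∈ 𝒜, Commute P B

/-- `P` is one of the minimal projectors which generate the center of the algebra `𝒜`. -/
def IsMinimalCentralProjector (𝒜 : Subalgebra ℂ (Matrix m m ℂ)) (P : Matrix m m ℂ) : Prop :=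
  IsCentralProjector 𝒜 P ∧ P ≠ 0 ∧
    ∀ P', IsCentralProjector 𝒜 P' → P' * P = P' → P' = 0 ∨ P' = P

end Algebras

/-! ### The conditions on a four-site problem `1, 2, 3, X` -/

section FourSite

variable {ι₁ ι ι₃ κ : Type} [Fintype ι₁] [Fintype ι] [Fintype ι₃] [Fintype κ]
  [DecidableEq ι₁] [DecidableEq ι] [DecidableEq ι₃] [DecidableEq κ]

/-- The conditions on the pair `Q₁₂ₓ`, `Q₂ₓ₃`; here `ι₁`, `ι`, `κ` index bases of
`ℋ₁`, `ℋ₂ₓ = ℋ₂ ⊗ ℋₓ` and `ℋ₃`: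
there is a minimal projector `P⁰` of the center of the algebra generated on `2X` by the two
interaction algebras, such that all zero energy states of `Q₂ₓ₃` are in the range of `P⁰`; the range
of `P⁰` is (through the isometry `V`) a tensor product `ℋ₂ₓ→₁ ⊗ ℋ₂ₓ→₃` of dimensions `a` and `b`,
on which `Q₁₂ₓ` acts only on the first and `Q₂ₓ₃` only on the second factor (as `R₁`, `R₃`); and
`R₃` has a unique zero energy state `φ` on `ℋ₂ₓ→₃ ⊗ ℋ₃`, whose reduced density matrix
on `ℋ₃` has rank `K`. -/
def UniqueBoundaryState (Q12X : Matrix (ι₁ × ι) (ι₁ × ι) ℂ) (Q2X3 : Matrix (ι × κ) (ι × κ) ℂ)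
    (K : ℕ) : Prop :=
  ∃ P0 : Matrix ι ι ℂ,
    IsMinimalCentralProjector (interactionAlgebraSnd {Q12X} ⊔ interactionAlgebra {Q2X3}) P0 ∧
    (∀ ψ : ι × κ → ℂ, Q2X3 *ᵥ ψ = 0 → (P0 ⊗ₖ (1 : Matrix κ κ ℂ)) *ᵥ ψ = ψ) ∧
    ∃ (a b : ℕ) (V : Matrix ι (Fin a × Fin b) ℂ)
      (R₁ : Matrix (ι₁ × Fin a) (ι₁ × Fin a) ℂ) (R₃ : Matrix (Fin b × κ) (Fin b × κ) ℂ)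
      (φ : Fin b × κ → ℂ),
      Vᴴ * V = 1 ∧ V * Vᴴ = P0 ∧
      Q12X * ((1 : Matrix ι₁ ι₁ ℂ) ⊗ₖ V) = ((1 : Matrix ι₁ ι₁ ℂ) ⊗ₖ V) *
        (R₁ ⊗ₖ (1 : Matrix (Fin b) (Fin b) ℂ)).submatrix
          (Equiv.prodAssoc ι₁ (Fin a) (Fin b)).symm (Equiv.prodAssoc ι₁ (Fin a) (Fin b)).symm ∧
      Q2X3 * (V ⊗ₖ (1 : Matrix κ κ ℂ)) = (V ⊗ₖ (1 : Matrix κ κ ℂ)) *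
        ((1 : Matrix (Fin a) (Fin a) ℂ) ⊗ₖ R₃).submatrix
          (Equiv.prodAssoc (Fin a) (Fin b) κ) (Equiv.prodAssoc (Fin a) (Fin b) κ) ∧
      φ ≠ 0 ∧ R₃ *ᵥ φ = 0 ∧ (∀ ψ, R₃ *ᵥ ψ = 0 → ∃ c : ℂ, ψ = c • φ) ∧
      (Matrix.of fun j j' : κ => ∑ i, φ (i, j) * star (φ (i, j'))).rank = K

/-- The conditions in the case where the interaction algebra of `Q₂ₓ₃` on `3` need not be the full
algebra: `ℋ₃` is (through the unitary `U`) a tensor product `ℋ₃¹ ⊗ ℋ₃²` of dimensions `d` and `d'`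
such that this interaction algebra acts only on `ℋ₃¹`, so that `Q₂ₓ₃` is `Q' ⊗ 1` with `Q'` an
operator on `ℋ₂ₓ ⊗ ℋ₃¹`, and the problem with `3` replaced by `3¹` obeys the conditions above. -/
def ReducedBoundaryState (Q12X : Matrix (ι₁ × ι) (ι₁ × ι) ℂ)
    (Q2X3 : Matrix (ι × ι₃) (ι × ι₃) ℂ) (d K : ℕ) : Prop :=
  ∃ (d' : ℕ) (U : Matrix ι₃ (Fin d × Fin d') ℂ) (Q' : Matrix (ι × Fin d) (ι × Fin d) ℂ),
    Uᴴ * U = 1 ∧ U * Uᴴ = 1 ∧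
    (∀ A ∈ interactionAlgebraSnd {Q2X3}, ∃ A₁ : Matrix (Fin d) (Fin d) ℂ,
      A = U * (A₁ ⊗ₖ (1 : Matrix (Fin d') (Fin d') ℂ)) * Uᴴ) ∧
    Q2X3 = ((1 : Matrix ι ι ℂ) ⊗ₖ U) *
      (Q' ⊗ₖ (1 : Matrix (Fin d') (Fin d') ℂ)).submatrix
        (Equiv.prodAssoc ι (Fin d) (Fin d')).symm (Equiv.prodAssoc ι (Fin d) (Fin d')).symm *
      ((1 : Matrix ι ι ℂ) ⊗ₖ U)ᴴ ∧
    UniqueBoundaryState Q12X Q' K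

end FourSite

/-! ### The square lattice

The lattice has size `L × L` with `L = n + 1`.  A site is a pair (horizontal coordinate, vertical
coordinate), and a plaquette is given by its lower left corner. -/

abbrev Site (n : ℕ) := Fin (n + 1) × Fin (n + 1)

abbrev Plaquette (n : ℕ) := Fin n × Fin n

/-- Basis states of the sites in the region `R`, with `D` states on each site. -/
abbrev RCfg {n : ℕ} (D : ℕ) (R : Finset (Site n)) := {s // s ∈ R} → Fin D

/-- Basis states of the whole lattice. -/
abbrev Cfg (n D : ℕ) := Site n → Fin D

/-- Operators on the Hilbert space of the whole lattice. -/
abbrev Op (n D : ℕ) := Matrix (Cfg n D) (Cfg n D) ℂ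

/-- Basis states of the four sites of a plaquette: `c a b` is the state of the site in the left
(`a = 0`) or right (`a = 1`) column and the lower (`b = 0`) or upper (`b = 1`) row. -/
abbrev PCfg (D : ℕ) := Fin 2 → Fin 2 → Fin D

section Lattice

variable {n D : ℕ}

def corner (z : Plaquette n) (a b : Fin 2) : Site n :=
  (if a = 0 then z.1.castSucc else z.1.succ, if b = 0 then z.2.castSucc else z.2.succ)

/-- The set of the four sites around a plaquette. -/
def plaqSites (z : Plaquette n) : Finset (Site n) :=
  Finset.univ.image fun p : Fin 2 × Fin 2 => corner z p.1 p.2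

/-- The operator on the lattice which acts as `q` on the four sites of `z`, and trivially on
the others. -/
def plaqOp (z : Plaquette n) (q : Matrix (PCfg D) (PCfg D) ℂ) : Op n D :=
  Matrix.of fun σ τ => if ∀ s, s ∉ plaqSites z → σ s = τ s then
    q (fun a b => σ (corner z a b)) (fun a b => τ (corner z a b)) else 0

end Lattice

/-- An instance of 2DCLH: pairwise commuting projectors `Q_Z`, one on each plaquette `Z`. -/
structure Model (n D : ℕ) where
  q : Plaquette n → Matrix (PCfg D) (PCfg D) ℂ
  isProjector : ∀ z, IsProjector (q z)
  commute : ∀ z z', Commute (plaqOp z (q z)) (plaqOp z' (q z'))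

section Regions

variable {n D : ℕ}

/-- The operator on the lattice acting as `B` on the region `R` and trivially elsewhere. -/
def amp (R : Finset (Site n)) (B : Matrix (RCfg D R) (RCfg D R) ℂ) : Op n D :=
  Matrix.of fun σ τ => if ∀ s, s ∉ R → σ s = τ s then
    B (fun s => σ s) (fun s => τ s) else 0

variable [NeZero D]

/-- The configuration with values `p.1` on `R`, `p.2` on `S`, and the basis state `0` elsewhere. -/
def glue (R S : Finset (Site n)) (p : RCfg D R × RCfg D S) : Cfg n D := fun s =>
  if h : s ∈ R then p.1 ⟨s, h⟩ else if h : s ∈ S then p.2 ⟨s, h⟩ else 0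

/-- An operator on the lattice which acts trivially outside of the union of the disjoint regions
`R` and `S`, regarded as an operator on the tensor product of the Hilbert spaces of `R` and `S`. -/
def onPair (R S : Finset (Site n)) (A : Op n D) :
    Matrix (RCfg D R × RCfg D S) (RCfg D R × RCfg D S) ℂ :=
  A.submatrix (glue R S) (glue R S)

/-- Partial trace over all sites in `R`; the result is an operator on the complement of `R`. -/
def traceOut (R : Finset (Site n)) (A : Op n D) : Matrix (RCfg D Rᶜ) (RCfg D Rᶜ) ℂ :=
  ptrace (onPair Rᶜ R A)

/-- The interaction algebra of an algebra of operators on the region `R`. -/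
def interactionAlgebraOn (R : Finset (Site n)) (𝒜 : Subalgebra ℂ (Op n D)) :
    Subalgebra ℂ (Matrix (RCfg D R) (RCfg D R) ℂ) :=
  interactionAlgebra (onPair R Rᶜ '' (𝒜 : Set (Op n D)))

end Regions

/-- The column `C`. -/
def col {n : ℕ} (C : Fin (n + 1)) : Finset (Site n) := Finset.univ.filter fun s => s.1 = C

/-- The column `C - 1`; it is empty for the first column `C`. -/
def prevCol {n : ℕ} (C : Fin (n + 1)) : Finset (Site n) :=
  Finset.univ.filter fun s => s.1.val + 1 = C.val

/-- The column `C + 1`; it is empty for the last column `C`. -/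
def nextCol {n : ℕ} (C : Fin (n + 1)) : Finset (Site n) :=
  Finset.univ.filter fun s => s.1.val = C.val + 1

/-! Grouping of the sites of the columns `C - 1` and `C` for the four-site problem centered
at `i`: sites `1`, `3`, and `2` together with `X`. -/

def below {n : ℕ} (C i : Fin (n + 1)) : Finset (Site n) :=
  (col C).filter fun s => s.2 < i

def above {n : ℕ} (C i : Fin (n + 1)) : Finset (Site n) :=
  (col C).filter fun s => i < s.2

def centerX {n : ℕ} (C i : Fin (n + 1)) : Finset (Site n) := insert (C, i) (prevCol C)

namespace Model

variable {n D : ℕ} (M : Model n D)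

/-- The term `Q_Z` as an operator on the lattice. -/
def term (z : Plaquette n) : Op n D := plaqOp z (M.q z)

/-- The Hamiltonian `H = ∑ Q_Z`. -/
def hamiltonian : Op n D := ∑ z, M.term z

/-- `H` has a zero energy ground state. -/
def HasZeroEnergyState : Prop := ∃ ψ : Cfg n D → ℂ, ψ ≠ 0 ∧ M.hamiltonian *ᵥ ψ = 0

/-- A projector is consistent with `H` if there is a zero energy ground state of `H` in its
range. -/
def Consistent (P : Op n D) : Prop :=
  ∃ ψ : Cfg n D → ℂ, ψ ≠ 0 ∧ M.hamiltonian *ᵥ ψ = 0 ∧ ∃ χ, P *ᵥ χ = ψ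

/-- The plaquettes contained in the set of sites `S`. -/
def plaqIn (S : Finset (Site n)) : Finset (Plaquette n) :=
  Finset.univ.filter fun z => plaqSites z ⊆ S

/-- The term algebra of `S`. -/
def termAlgebra (S : Finset (Site n)) : Subalgebra ℂ (Op n D) :=
  Algebra.adjoin ℂ (M.term '' (plaqIn S : Set (Plaquette n)))

/-- The product of the commuting projectors `P_Z = 1 - Q_Z` with `Z ⊆ S`. -/
def projOn (S : Finset (Site n)) : Op n D :=
  (plaqIn S).noncommProd (fun z => 1 - M.term z) fun z _ z' _ _ =>
    ((Commute.one_left _).sub_left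
      ((Commute.one_right _).sub_right (M.commute z z')))

/-- `P_{C-1,C}` (it is `1` for the first column). -/
def projLeft (C : Fin (n + 1)) : Op n D := M.projOn (prevCol C ∪ col C)

/-- `P_{C,C+1}` (it is `1` for the last column). -/
def projRight (C : Fin (n + 1)) : Op n D := M.projOn (col C ∪ nextCol C)

variable [NeZero D]

/-- The interaction algebra of `C - 1, C` on `C`. -/
def leftAlgebra (C : Fin (n + 1)) : Subalgebra ℂ (Matrix (RCfg D (col C)) (RCfg D (col C)) ℂ) :=
  interactionAlgebraOn (col C) (M.termAlgebra (prevCol C ∪ col C))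

/-- The operator `B` on column `C` is a mask:
`tr_{C-1,C} (O P_{C-1,C} B P_{C,C+1}) = x tr_C (B P_{C,C+1})` for every operator `O` on column
`C - 1`, with a scalar `x` depending on `O`.  As the operators act on the whole lattice here, the
trace over `C - 1` is taken on both sides; on the right, where the operator acts trivially on
column `C - 1`, this is a nonzero factor that is absorbed in `x`. -/
def IsMask (C : Fin (n + 1)) (B : Matrix (RCfg D (col C)) (RCfg D (col C)) ℂ) : Prop :=
  ∀ O : Matrix (RCfg D (prevCol C)) (RCfg D (prevCol C)) ℂ, ∃ x : ℂ,
    traceOut (prevCol C ∪ col C)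
        (amp (prevCol C) O * M.projLeft C * amp (col C) B * M.projRight C) =
      x • traceOut (prevCol C ∪ col C) (amp (col C) B * M.projRight C)

/-- The operator `Q₁₂ₓ` of the four-site problem centered at `i`, for the column `C`. -/
def q12X (C i : Fin (n + 1)) : Matrix (RCfg D (below C i) × RCfg D (centerX C i))
    (RCfg D (below C i) × RCfg D (centerX C i)) ℂ :=
  onPair (below C i) (centerX C i) (∑ z ∈ plaqIn (below C i ∪ centerX C i), M.term z)

/-- The operator `Q₂ₓ₃`, with weights `w`, of the four-site problem centered at `i`. -/
def q2X3 (C i : Fin (n + 1)) (w : Plaquette n → ℝ) :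
    Matrix (RCfg D (centerX C i) × RCfg D (above C i))
      (RCfg D (centerX C i) × RCfg D (above C i)) ℂ :=
  onPair (centerX C i) (above C i)
    (∑ z ∈ plaqIn (centerX C i ∪ above C i), (w z : ℂ) • M.term z)

/-- The weights `w` are positive and generic: every operator which commutes with `Q₂ₓ₃` commutes
with each of its terms separately. -/
def GenericWeights (C i : Fin (n + 1)) (w : Plaquette n → ℝ) : Prop :=
  (∀ z, 0 < w z) ∧ ∀ B, Commute B (M.q2X3 C i w) →
    ∀ z ∈ plaqIn (centerX C i ∪ above C i),
      Commute B (onPair (centerX C i) (above C i) (M.term z))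

/-- For each column `C` and each `i` with `1 ≤ i ≤ L - 2` the four-site problem centered at `i`
obeys the conditions, with a ratio `D_{3¹} / K` of at most `r`. -/
def FourSiteConditions (r : ℝ) : Prop :=
  ∀ C i : Fin (n + 1), 1 ≤ i.val → i.val + 1 ≤ n →
    ∃ (w : Plaquette n → ℝ) (d K : ℕ), M.GenericWeights C i w ∧
      ReducedBoundaryState (M.q12X C i) (M.q2X3 C i w) d K ∧ (d : ℝ) / K ≤ r

end Model

/-! ### Matrix product operators on a column -/

/-- For each site of a column, given by its vertical coordinate, the tensor of a matrix product
operator with bond dimension `χ`: `T y a b s t` is the matrix element between the basis states `s`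
and `t` of the operator on site `y` for the values `a`, `b` of the bonds below and above. -/
abbrev MPO (n D χ : ℕ) := Fin (n + 1) → Fin χ → Fin χ → Matrix (Fin D) (Fin D) ℂ

/-- The operator on column `C` given by a matrix product operator: a sum over all values of
the bonds.  (The two outer bonds only serve to write the end tensors like the others.) -/
def MPO.toOp {n D χ : ℕ} (C : Fin (n + 1)) (T : MPO n D χ) :
    Matrix (RCfg D (col C)) (RCfg D (col C)) ℂ :=
  Matrix.of fun σ τ => ∑ β : Fin (n + 2) → Fin χ, ∏ y : Fin (n + 1),
    T y (β y.castSucc) (β y.succ) (σ ⟨(C, y), by simp [col]⟩) (τ ⟨(C, y), by simp [col]⟩)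

/-! ### A machine model with exact arithmetic

A random access machine with finitely many natural number registers and finitely many
multi-dimensional arrays of complex numbers.  The natural numbers serve as loop counters and
array indices; they can only be added, subtracted and compared.  Exact field operations,
conjugation and a test for zero are available for complex numbers.  All these operations have unit
cost.  The only loops are counted ones, so a program always terminates. -/

/-- Natural number expressions. -/
inductive NExpr where
  | const (c : ℕ)
  | var (i : ℕ)
  | add (e f : NExpr)
  | sub (e f : NExpr)

/-- Complex expressions; `cell A idx` is the entry of the array `A` at the given indices. -/
inductive CExpr where
  | const (c : ℕ)
  | cell (A : ℕ) (idx : List NExpr)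
  | add (e f : CExpr)
  | sub (e f : CExpr)
  | mul (e f : CExpr)
  | inv (e : CExpr)
  | conj (e : CExpr)

/-- Tests. -/
inductive Test where
  | lt (e f : NExpr)
  | isZero (e : CExpr)

/-- Programs; `loop i e p` runs `p` for `i = 0, …, v - 1`, where `v` is the value of `e` at the
start of the loop. -/
inductive Program where
  | skip
  | setN (i : ℕ) (e : NExpr)
  | setC (A : ℕ) (idx : List NExpr) (e : CExpr)
  | seq (p p' : Program)
  | ite (t : Test) (p p' : Program)
  | loop (i : ℕ) (e : NExpr) (p : Program)

/-- Contents of the memory. -/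
structure Memory where
  nat : ℕ → ℕ
  arr : ℕ → List ℕ → ℂ

def NExpr.eval (s : Memory) : NExpr → ℕ
  | .const c => c
  | .var i => s.nat i
  | .add e f => e.eval s + f.eval s
  | .sub e f => e.eval s - f.eval s

/-- The number of steps needed to evaluate an expression. -/
def NExpr.cost : NExpr → ℕ
  | .const _ => 1
  | .var _ => 1
  | .add e f => e.cost + f.cost + 1
  | .sub e f => e.cost + f.cost + 1

def CExpr.eval (s : Memory) : CExpr → ℂ
  | .const c => (c : ℂ)
  | .cell A idx => s.arr A (idx.map (NExpr.eval s))
  | .add e f => e.eval s + f.eval s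
  | .sub e f => e.eval s - f.eval s
  | .mul e f => e.eval s * f.eval s
  | .inv e => (e.eval s)⁻¹
  | .conj e => star (e.eval s)

def CExpr.cost : CExpr → ℕ
  | .const _ => 1
  | .cell _ idx => (idx.map NExpr.cost).sum + 1
  | .add e f => e.cost + f.cost + 1
  | .sub e f => e.cost + f.cost + 1
  | .mul e f => e.cost + f.cost + 1
  | .inv e => e.cost + 1
  | .conj e => e.cost + 1

def Test.holds (s : Memory) : Test → Prop
  | .lt e f => e.eval s < f.eval s
  | .isZero e => e.eval s = 0

def Test.cost : Test → ℕ
  | .lt e f => e.cost + f.cost + 1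
  | .isZero e => e.cost + 1

def Memory.setNat (s : Memory) (i v : ℕ) : Memory :=
  { s with nat := Function.update s.nat i v }

def Memory.setCell (s : Memory) (A : ℕ) (idx : List ℕ) (v : ℂ) : Memory :=
  { s with arr := Function.update s.arr A (Function.update (s.arr A) idx v) }

open Classical in
/-- Run a program; the result is the memory at the end, and the number of steps. -/
def Program.run : Program → Memory → Memory × ℕ
  | .skip, s => (s, 1)
  | .setN i e, s => (s.setNat i (e.eval s), e.cost + 1)
  | .setC A idx e, s =>
      (s.setCell A (idx.map (NExpr.eval s)) (e.eval s), (idx.map NExpr.cost).sum + e.cost + 1)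
  | .seq p p', s => ((p'.run (p.run s).1).1, (p.run s).2 + (p'.run (p.run s).1).2)
  | .ite t p p', s =>
      if t.holds s then ((p.run s).1, t.cost + (p.run s).2)
      else ((p'.run s).1, t.cost + (p'.run s).2)
  | .loop i e p, s =>
      (List.range (e.eval s)).foldl
        (fun r j => ((p.run (r.1.setNat i j)).1, r.2 + (p.run (r.1.setNat i j)).2 + 1))
        (s, e.cost + 1)

/-- A program accepts if it ends with the value `1` in the register `0`. -/
def Program.Accepts (p : Program) (s : Memory) : Prop := (p.run s).1.nat 0 = 1

/-- The number of steps. -/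
def Program.time (p : Program) (s : Memory) : ℕ := (p.run s).2

/-! ### The input of a verifier -/

/-- The matrix elements of the projectors `Q_Z`, listed by the coordinates of `Z` and by the two
basis states of its four sites. -/
def Model.table {n D : ℕ} (M : Model n D) : List ℕ → ℂ
  | [x, y, a, b, c, d, a', b', c', d'] =>
      if h : (x < n ∧ y < n) ∧ (a < D ∧ b < D ∧ c < D ∧ d < D) ∧
          (a' < D ∧ b' < D ∧ c' < D ∧ d' < D) then
        M.q (⟨x, h.1.1⟩, ⟨y, h.1.2⟩)
          ![![⟨a, h.2.1.1⟩, ⟨b, h.2.1.2.1⟩], ![⟨c, h.2.1.2.2.1⟩, ⟨d, h.2.1.2.2.2⟩]]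
          ![![⟨a', h.2.2.1⟩, ⟨b', h.2.2.2.1⟩], ![⟨c', h.2.2.2.2.1⟩, ⟨d', h.2.2.2.2.2⟩]]
      else 0
  | _ => 0

/-- The entries of a family of matrix product operators, one for each column. -/
def mpoTable {n D χ : ℕ} (T : Fin (n + 1) → MPO n D χ) : List ℕ → ℂ
  | [x, y, a, b, s, t] =>
      if h : (x < n + 1 ∧ y < n + 1) ∧ (a < χ ∧ b < χ) ∧ (s < D ∧ t < D) then
        T ⟨x, h.1.1⟩ ⟨y, h.1.2⟩ ⟨a, h.2.1.1⟩ ⟨b, h.2.1.2⟩ ⟨s, h.2.2.1⟩ ⟨t, h.2.2.2⟩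
      else 0
  | _ => 0

/-- The initial memory of a verifier: the size `L`, the dimension `D` and the bond dimension `χ` in
the registers `1, 2, 3`, the instance in array `0` and the witness in array `1`; everything
else is zero. -/
def verifierInput {n D χ : ℕ} (M : Model n D) (T : Fin (n + 1) → MPO n D χ) : Memory where
  nat i := if i = 1 then n + 1 else if i = 2 then D else if i = 3 then χ else 0
  arr A := if A = 0 then M.table else if A = 1 then mpoTable T else fun _ => 0

end CLH

end

open scoped Matrix Kronecker

noncomputable section

namespace CLH

/-! ### Star-closed matrix algebras: support projectors, units of ideals, minimal central
projectors. -/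

section MatrixAlgebras

open scoped ComplexOrder

variable {m : Type} [Fintype m] [DecidableEq m]

/-! The masks are explicit. For a column $C$ let $A_i$ (`upperAlgebra`) be generated by the slices,
over column $C-1$, of the terms between the two columns in the rows from $i$ on, and let $P_{\ge i}$
be the product of the corresponding $P_Z$; $A_0$ is the interaction algebra. The slices of $P_{\ge
i}$ generate a two-sided ideal of $A_i$, and its unit $z_i$ (`exists_supportProjector`) is a central
projector of $A_i$. It fixes $P_{\ge i}$, and it is small: an operator off column $C-1$ which
commutes with the terms and annihilates $P_{\ge i}$ also annihilates $z_i$. The $A_i$ decrease with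
$i$, so the $z_i$ commute. For a minimal central projector $O$ of $A_0$ the mask is $B=O
z_0z_1\cdots z_n$. Every $z_i$ fixes $P_{C-1,C}$, so $B$ and $O$ agree there, and $O-B$ is the part
$O^\perp$.

Bond dimension (`exists_mpo`): cut the column below row $i$. The slices of $O z_0\cdots z_i$ over
the rows below $i$ commute with the terms from row $i$ on and with everything above row $i$ that
commutes with those terms, and they are fixed by $z_i$, hence determined by their action on zero
energy states. Under the four-site conditions these states are $\mathcal H_{2X\to1}\otimes\varphi$,
so a slice acts there as a matrix $\beta$ on the first factor. It is also a combination of the $D^2$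
matrix units of site $2$, tensored with operators on $3$. With $W$ the span of the vectors of
$\varphi$ on the other factor of $2X$, $N$ independent $\beta$ give $N\dim W$ independent vectors in
a space of dimension at most $D^2\dim W$ (`card_le_of_embedSnd`), so $N\le D^2$. A tensor train
construction (`exists_matrixProduct`) turns cut ranks into a matrix product operator of bond
dimension $D^2\le D^2r$.

Mask property (`isMask`): the algebra generated by all operators on $C-1$ and by $A_0$ has the same
center as $A_0$. Below $O$ its central elements are scalars, so the functionals
$W\mapsto\mathrm{tr}(WOX)$, with $X$ in the commutant, are all proportional (`exists_trace_eq_mul`).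

The verifier checks for each pair of adjacent columns that the partial trace of
$B_{x+1}B_xP_{x,x+1}P_{x+1,x+2}$ over both columns is a nonzero multiple of the partial trace of
$B_{x+1}P_{x+1,x+2}$. Proportionality is the equality case of Cauchy-Schwarz, and the inner products
in it are networks contracted row by row, with a number of row states polynomial in $D$ and $\chi$
(`run_innerProgram`, `accepts_verifier_iff`).

Soundness (`hasZeroEnergyState_of_proportional`): chaining the proportionalities from the last
column to the first gives a nonzero trace containing the product of all $P_{C,C+1}$. That product is
therefore nonzero, and its nonzero columns are ground states; nothing else about the witness
matters. Completeness (`proportional_of_masks`): the $O_C$ are chosen one after the other so that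
they fix a common ground state, the mask property gives the proportionality, and the ground state
shows that the factor does not vanish. -/

theorem IsProjector.one_sub {P : Matrix m m ℂ} (h : IsProjector P) : IsProjector (1 - P) := by
  refine ⟨Matrix.isHermitian_one.sub h.1, ?_⟩
  rw [sub_mul, mul_sub, mul_sub, h.2]; simp

omit [DecidableEq m] in
theorem IsProjector.mul {P Q : Matrix m m ℂ} (hP : IsProjector P) (hQ : IsProjector Q)
    (h : Commute P Q) : IsProjector (P * Q) := by
  refine ⟨?_, ?_⟩
  · unfold Matrix.IsHermitian
    rw [Matrix.conjTranspose_mul, hP.1.eq, hQ.1.eq, h.eq]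
  · calc P * Q * (P * Q) = P * (Q * P) * Q := by noncomm_ring
      _ = P * P * (Q * Q) := by rw [← h.eq]; noncomm_ring
      _ = P * Q := by rw [hP.2, hQ.2]

theorem IsProjector.sub_mul_self {P Q : Matrix m m ℂ} (hP : IsProjector P) (hQ : IsProjector Q)
    (h : Commute P Q) : IsProjector (P - P * Q) := by
  have := hP.mul hQ.one_sub ((Commute.one_right P).sub_right h)
  rwa [mul_sub, mul_one] at this

theorem conjTranspose_mem_adjoin {S : Set (Matrix m m ℂ)}
    (hS : ∀ x ∈ S, xᴴ ∈ Algebra.adjoin ℂ S) {x : Matrix m m ℂ}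
    (hx : x ∈ Algebra.adjoin ℂ S) : xᴴ ∈ Algebra.adjoin ℂ S := by
  induction hx using Algebra.adjoin_induction with
  | mem x h => exact hS x h
  | algebraMap r =>
    rw [Algebra.algebraMap_eq_smul_one, Matrix.conjTranspose_smul, Matrix.conjTranspose_one]
    exact Subalgebra.smul_mem _ (Subalgebra.one_mem _) _
  | add x y _ _ hx hy => rw [Matrix.conjTranspose_add]; exact Subalgebra.add_mem _ hx hy
  | mul x y _ _ hx hy => rw [Matrix.conjTranspose_mul]; exact Subalgebra.mul_mem _ hy hx

/-- The elements which commute with `X`. -/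
theorem commute_of_mem_adjoin {S : Set (Matrix m m ℂ)} {X : Matrix m m ℂ}
    (hS : ∀ x ∈ S, Commute X x) {x : Matrix m m ℂ} (hx : x ∈ Algebra.adjoin ℂ S) :
    Commute X x := by
  induction hx using Algebra.adjoin_induction with
  | mem x h => exact hS x h
  | algebraMap r => exact (Algebra.commutes r X).symm
  | add x y _ _ hx hy => exact hx.add_right hy
  | mul x y _ _ hx hy => exact hx.mul_right hy

/-- The support projector of a Hermitian matrix `h` is `h` times a polynomial in `h`. -/
theorem exists_support_projector {h : Matrix m m ℂ} (hh : h.IsHermitian) :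
    ∃ x ∈ Algebra.adjoin ℂ {h}, IsProjector (h * x) ∧ h * (h * x) = h := by
  set 𝒜 := Algebra.adjoin ℂ {h}
  have h_mem : h ∈ 𝒜 := Algebra.subset_adjoin rfl
  have comm : ∀ {x y}, x ∈ 𝒜 → y ∈ 𝒜 → Commute x y := by
    intro x y hx hy
    refine commute_of_mem_adjoin (fun z hz => ?_) hy
    rw [Set.mem_singleton_iff.mp hz]
    exact (commute_of_mem_adjoin (fun w hw => by rw [Set.mem_singleton_iff.mp hw]) hx).symm
  have star_mem : ∀ {x}, x ∈ 𝒜 → xᴴ ∈ 𝒜 := fun hx =>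
    conjTranspose_mem_adjoin (fun y hy => by
      rw [Set.mem_singleton_iff.mp hy, hh.eq]; exact h_mem) hx
  let f : 𝒜 →ₗ[ℂ] 𝒜 := LinearMap.mulLeft ℂ ⟨h, h_mem⟩
  have f_apply : ∀ x : 𝒜, ((f x : 𝒜) : Matrix m m ℂ) = h * x := fun x => rfl
  -- Hermiticity makes the kernels of multiplication by `h` and by `h ^ 2` equal; counting
  -- dimensions, so are the ranges. Hence `h = h ^ 2 * x` has a solution in the algebra generated by
  -- `h`.
  have ker_eq : LinearMap.ker (f ∘ₗ f) = LinearMap.ker f := by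
    ext x
    simp only [LinearMap.mem_ker, LinearMap.comp_apply]
    refine ⟨fun hx => ?_, fun hx => by rw [hx, map_zero]⟩
    have hx' : h * (h * (x : Matrix m m ℂ)) = 0 := by
      rw [← f_apply, ← f_apply, hx]; rfl
    apply Subtype.ext
    rw [f_apply]
    change h * (x : Matrix m m ℂ) = 0
    rw [← Matrix.conjTranspose_mul_self_eq_zero, Matrix.conjTranspose_mul, hh.eq, Matrix.mul_assoc,
      hx', Matrix.mul_zero]
  have range_eq : LinearMap.range (f ∘ₗ f) = LinearMap.range f := by
    apply Submodule.eq_of_le_of_finrank_eq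
    · exact LinearMap.range_comp_le_range f f
    · have h1 := LinearMap.finrank_range_add_finrank_ker (f ∘ₗ f)
      have h2 := LinearMap.finrank_range_add_finrank_ker f
      rw [ker_eq] at h1
      omega
  obtain ⟨⟨x, hx⟩, hx'⟩ : f 1 ∈ LinearMap.range (f ∘ₗ f) := by rw [range_eq]; exact ⟨1, rfl⟩
  have key : h * (h * x) = h := by
    have := congrArg (Subtype.val) hx'
    simpa [f_apply] using this
  refine ⟨x, hx, ?_, key⟩
  set e := h * x with he
  have e_mem : e ∈ 𝒜 := Subalgebra.mul_mem _ h_mem hx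
  have e_idem : e * e = e := by
    calc e * e = (h * x) * (h * x) := rfl
      _ = h * (h * x) * x := by
        rw [Matrix.mul_assoc h x, (comm hx e_mem).eq, Matrix.mul_assoc, Matrix.mul_assoc, Matrix.mul_assoc]
      _ = e := by rw [key]
  have eh : e * h = h := by rw [(comm e_mem h_mem).eq, key]
  -- The adjoint of this identity reads `e * eᴴ = e`, so `e` is Hermitian.
  have e_eq : e * eᴴ = eᴴ := by
    calc e * eᴴ = e * (h * xᴴ) := by
          rw [he, Matrix.conjTranspose_mul, hh.eq, (comm (star_mem hx) h_mem).eq]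
      _ = h * xᴴ := by rw [← Matrix.mul_assoc, eh]
      _ = eᴴ := by rw [he, Matrix.conjTranspose_mul, hh.eq, (comm (star_mem hx) h_mem).eq]
  refine ⟨?_, e_idem⟩
  have := congrArg Matrix.conjTranspose e_eq
  rw [Matrix.conjTranspose_mul, Matrix.conjTranspose_conjTranspose] at this
  exact e_eq.symm.trans this

/-- A space of matrices closed under products and adjoints contains a unit. -/
theorem exists_unit_projector (I : Submodule ℂ (Matrix m m ℂ))
    (h_mul : ∀ x ∈ I, ∀ y ∈ I, x * y ∈ I) (h_star : ∀ x ∈ I, xᴴ ∈ I) :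
    ∃ e ∈ I, IsProjector e ∧ ∀ x ∈ I, x * e = x ∧ e * x = x := by
  let b := Module.finBasis ℂ I
  -- Being a sum of the positive matrices `bᴴ b`, `h` has as kernel the common kernel of the basis.
  -- Its support projector is therefore a right unit, and by taking adjoints also a left unit.
  let h : Matrix m m ℂ := ∑ k, (b k : Matrix m m ℂ)ᴴ * (b k : Matrix m m ℂ)
  have hI : h ∈ I := Submodule.sum_mem _ fun k _ => h_mul _ (h_star _ (b k).2) _ (b k).2
  have hh : h.IsHermitian := by
    unfold Matrix.IsHermitian
    simp only [h, Matrix.conjTranspose_sum, Matrix.conjTranspose_mul,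
      Matrix.conjTranspose_conjTranspose]
  obtain ⟨x, hx, he, hhe⟩ := exists_support_projector hh
  have e_mem : h * x ∈ I := by
    suffices ∀ u ∈ I, u * x ∈ I from this h hI
    clear he hhe
    induction hx using Algebra.adjoin_induction with
    | mem x hx => rw [Set.mem_singleton_iff.mp hx]; exact fun u hu => h_mul u hu h hI
    | algebraMap r =>
      intro u hu
      rw [Algebra.algebraMap_eq_smul_one, mul_smul_comm, mul_one]
      exact I.smul_mem _ hu
    | add x y _ _ hx hy => intro u hu; rw [mul_add]; exact I.add_mem (hx u hu) (hy u hu)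
    | mul x y _ _ hx hy => intro u hu; rw [← mul_assoc]; exact hy _ (hx u hu)
  set e := h * x
  have hzero : ∀ k, (b k : Matrix m m ℂ) * (1 - e) = 0 := by
    have hs : ∑ k, (((b k : Matrix m m ℂ) * (1 - e))ᴴ * ((b k : Matrix m m ℂ) * (1 - e))).trace
        = 0 := by
      rw [← Matrix.trace_sum]
      have : ∑ k, ((b k : Matrix m m ℂ) * (1 - e))ᴴ * ((b k : Matrix m m ℂ) * (1 - e)) =
          (1 - e)ᴴ * (h * (1 - e)) := by
        simp only [h, Finset.mul_sum, Finset.sum_mul, Matrix.conjTranspose_mul, Matrix.mul_assoc]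
      rw [this, mul_sub, mul_one, hhe, sub_self, mul_zero, Matrix.trace_zero]
    rw [Finset.sum_eq_zero_iff_of_nonneg] at hs
    · intro k
      exact Matrix.trace_conjTranspose_mul_self_eq_zero_iff.mp (hs k (Finset.mem_univ _))
    · intro k _
      exact (Matrix.posSemidef_conjTranspose_mul_self _).trace_nonneg
  have right : ∀ y ∈ I, y * e = y := by
    intro y hy
    have : y = ∑ k, b.repr ⟨y, hy⟩ k • (b k : Matrix m m ℂ) := by
      have := congrArg I.subtype (b.sum_repr ⟨y, hy⟩)
      rw [map_sum] at this
      exact this.symm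
    have hb : ∀ k, (b k : Matrix m m ℂ) * e = b k := by
      intro k
      have := hzero k
      rw [mul_sub, mul_one, sub_eq_zero] at this
      exact this.symm
    rw [this, Finset.sum_mul]
    exact Finset.sum_congr rfl fun k _ => by rw [smul_mul_assoc, hb]
  refine ⟨e, e_mem, he, fun y hy => ⟨right y hy, ?_⟩⟩
  have := congrArg Matrix.conjTranspose (right _ (h_star y hy))
  rwa [Matrix.conjTranspose_mul, Matrix.conjTranspose_conjTranspose, he.1.eq] at this

/-- A minimal central projector turns central elements into scalars: Hermitian case. -/
theorem IsMinimalCentralProjector.exists_smul_of_isHermitian {𝒜 : Subalgebra ℂ (Matrix m m ℂ)}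
    {P : Matrix m m ℂ} (hP : IsMinimalCentralProjector 𝒜 P) {w : Matrix m m ℂ} (hw : w ∈ 𝒜)
    (hc : ∀ a ∈ 𝒜, Commute w a) (hh : w.IsHermitian) : ∃ c : ℂ, w * P = c • P := by
  obtain ⟨⟨hPp, hPm, hPc⟩, hP0, hmin⟩ := hP
  have hwP : (w * P).IsHermitian := by
    unfold Matrix.IsHermitian
    rw [Matrix.conjTranspose_mul, hPp.1.eq, hh.eq, (hPc w hw).eq]
  obtain ⟨v, hv⟩ : ∃ v, P *ᵥ v ≠ 0 := by
    by_contra! h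
    exact hP0 (Matrix.ext_of_mulVec_single fun i => by rw [h, Matrix.zero_mulVec])
  let W : Submodule ℂ (m → ℂ) := LinearMap.range P.mulVecLin
  have hmap : ∀ x ∈ W, (w * P).mulVecLin x ∈ W := by
    rintro _ ⟨x, rfl⟩
    refine ⟨w *ᵥ (P *ᵥ x), ?_⟩
    simp only [Matrix.mulVecLin_apply, Matrix.mulVec_mulVec]
    rw [← Matrix.mul_assoc, (hPc w hw).eq, Matrix.mul_assoc w P P, hPp.2]
  let g : Module.End ℂ W := (w * P).mulVecLin.restrict hmap
  have : Nontrivial W := ⟨⟨⟨P *ᵥ v, v, rfl⟩, 0, fun h => hv (congrArg Subtype.val h)⟩⟩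
  obtain ⟨c, hgc⟩ := Module.End.exists_eigenvalue g
  obtain ⟨⟨u, hu⟩, hu1⟩ := hgc.exists_hasEigenvector
  have hu0 : u ≠ 0 := fun h => hu1.2 (Subtype.ext h)
  have hPu : P *ᵥ u = u := by
    obtain ⟨y, rfl⟩ := hu
    simp [Matrix.mulVec_mulVec, hPp.2]
  have hwu : (w * P) *ᵥ u = c • u := congrArg Subtype.val hu1.apply_eq_smul
  set k := w * P - c • P with hk
  have hkm : k ∈ 𝒜 := 𝒜.sub_mem (𝒜.mul_mem hw hPm) (𝒜.smul_mem hPm c)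
  have hkc : ∀ a ∈ 𝒜, Commute k a := fun a ha =>
    ((hc a ha).mul_left (hPc a ha)).sub_left ((hPc a ha).smul_left c)
  have hku : k *ᵥ u = 0 := by
    rw [hk, Matrix.sub_mulVec, hwu, Matrix.smul_mulVec, hPu, sub_self]
  have hkP : k * P = k := by
    rw [hk, sub_mul, Matrix.mul_assoc, hPp.2, smul_mul_assoc, hPp.2]
  -- `kᴴ k` is Hermitian, with support projector a central projector below `P`
  have hks : kᴴ = w * P - star c • P := by
    rw [hk, Matrix.conjTranspose_sub, hwP.eq, Matrix.conjTranspose_smul, hPp.1.eq]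
  have hksm : kᴴ ∈ 𝒜 := by
    rw [hks]; exact 𝒜.sub_mem (𝒜.mul_mem hw hPm) (𝒜.smul_mem hPm _)
  have hksc : ∀ a ∈ 𝒜, Commute kᴴ a := fun a ha => by
    rw [hks]; exact ((hc a ha).mul_left (hPc a ha)).sub_left ((hPc a ha).smul_left _)
  obtain ⟨x, hx, he, hhe⟩ := exists_support_projector (Matrix.isHermitian_conjTranspose_mul_self k)
  have hle : Algebra.adjoin ℂ {kᴴ * k} ≤ 𝒜 :=
    Algebra.adjoin_le (by rw [Set.singleton_subset_iff]; exact 𝒜.mul_mem hksm hkm)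
  have hxc : ∀ a ∈ 𝒜, Commute x a := fun a ha =>
    (commute_of_mem_adjoin (fun y hy => by
      rw [Set.mem_singleton_iff.mp hy]; exact ((hksc a ha).mul_left (hkc a ha)).symm) hx).symm
  set e := kᴴ * k * x with hedef
  have hec : IsCentralProjector 𝒜 e :=
    ⟨he, 𝒜.mul_mem (𝒜.mul_mem hksm hkm) (hle hx),
      fun a ha => ((hksc a ha).mul_left (hkc a ha)).mul_left (hxc a ha)⟩
  have heP : e * P = e := by
    rw [hedef, Matrix.mul_assoc, (hxc P hPm).eq, ← Matrix.mul_assoc, Matrix.mul_assoc kᴴ k P, hkP]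
  have heu : e *ᵥ u = 0 := by
    have : e = x * kᴴ * k := by
      rw [hedef, (((hksc x (hle hx)).mul_left (hkc x (hle hx)))).eq, Matrix.mul_assoc]
    rw [this, ← Matrix.mulVec_mulVec, hku, Matrix.mulVec_zero]
  -- By minimality `e` is `0` or `P`. It annihilates the eigenvector `u`, which `P` fixes, so it is
  -- `0` and `w * P` equals its eigenvalue times `P`.
  rcases hmin e hec heP with h0 | h1
  · rw [h0, Matrix.mul_zero] at hhe
    have : k = 0 := Matrix.conjTranspose_mul_self_eq_zero.mp hhe.symm
    exact ⟨c, sub_eq_zero.mp this⟩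
  · rw [h1, hPu] at heu
    exact absurd heu hu0

/-- Star-closedness keeps the Hermitian and skew-Hermitian parts of `w` in the center, so the
Hermitian case applies to both. -/
theorem IsMinimalCentralProjector.exists_smul {𝒜 : Subalgebra ℂ (Matrix m m ℂ)}
    (h𝒜 : ∀ a ∈ 𝒜, aᴴ ∈ 𝒜)
    {P : Matrix m m ℂ} (hP : IsMinimalCentralProjector 𝒜 P) {w : Matrix m m ℂ} (hw : w ∈ 𝒜)
    (hc : ∀ a ∈ 𝒜, Commute w a) : ∃ c : ℂ, w * P = c • P := by
  have hcs : ∀ a ∈ 𝒜, Commute wᴴ a := fun a ha => by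
    have := (hc _ (h𝒜 a ha)).star_star
    rwa [Matrix.star_eq_conjTranspose, Matrix.star_eq_conjTranspose,
      Matrix.conjTranspose_conjTranspose] at this
  obtain ⟨c, h1⟩ := hP.exists_smul_of_isHermitian (w := w + wᴴ) (𝒜.add_mem hw (h𝒜 w hw))
    (fun a ha => (hc a ha).add_left (hcs a ha)) (Matrix.isHermitian_add_transpose_self w)
  obtain ⟨d, h2⟩ := hP.exists_smul_of_isHermitian (w := Complex.I • (w - wᴴ))
    (𝒜.smul_mem (𝒜.sub_mem hw (h𝒜 w hw)) _)
    (fun a ha => ((hc a ha).sub_left (hcs a ha)).smul_left _) (by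
      unfold Matrix.IsHermitian
      rw [Matrix.conjTranspose_smul, Matrix.conjTranspose_sub, Matrix.conjTranspose_conjTranspose]
      simp [smul_sub, neg_add_eq_sub])
  refine ⟨(1 / 2) * (c - Complex.I * d), ?_⟩
  have : w = (1 / 2 : ℂ) • ((w + wᴴ) - Complex.I • (Complex.I • (w - wᴴ))) := by
    rw [smul_smul, Complex.I_mul_I, neg_one_smul, sub_neg_eq_add, add_add_sub_cancel, ← two_smul ℂ,
      smul_smul]
    norm_num
  rw [this, smul_mul_assoc, sub_mul, h1, smul_mul_assoc, h2, smul_smul, ← sub_smul, smul_smul]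

/-- On a star-closed algebra `𝒟` with a central projector `e` below which all central elements are
scalars, the functionals `W ↦ tr (W e X)`, with `X` in the commutant, are all proportional. -/
theorem exists_trace_eq_mul (𝒟 : Subalgebra ℂ (Matrix m m ℂ)) (h𝒟 : ∀ a ∈ 𝒟, aᴴ ∈ 𝒟)
    {e : Matrix m m ℂ} (he : IsCentralProjector 𝒟 e) (he0 : e ≠ 0)
    (hcen : ∀ w ∈ 𝒟, (∀ a ∈ 𝒟, Commute w a) → ∃ c : ℂ, w * e = c • e)
    {X : Matrix m m ℂ} (hX : ∀ a ∈ 𝒟, Commute X a) {W : Matrix m m ℂ} (hW : W ∈ 𝒟) :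
    (W * e * X).trace = (W * e).trace / e.trace * (e * X).trace := by
  have he_tr : e.trace ≠ 0 := by
    intro h
    rw [← he.1.2] at h
    nth_rewrite 1 [← he.1.1.eq] at h
    exact he0 (Matrix.trace_conjTranspose_mul_self_eq_zero_iff.mp h)
  have eq_zero : ∀ g ∈ 𝒟, (∀ W ∈ 𝒟, (W * g).trace = 0) → g = 0 := fun g hg h =>
    Matrix.trace_conjTranspose_mul_self_eq_zero_iff.mp (h _ (h𝒟 g hg))
  -- The trace form on `𝒟` is nondegenerate, as `tr (gᴴ g) = 0` forces `g = 0`. So every functional,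
  -- in particular `W ↦ tr (W e X)`, is represented by some `g` in `𝒟`.
  let φ : 𝒟 →ₗ[ℂ] Module.Dual ℂ 𝒟 :=
    { toFun := fun g =>
        { toFun := fun W => ((W : Matrix m m ℂ) * g).trace
          map_add' := fun x y => by simp [add_mul]
          map_smul' := fun c x => by simp }
      map_add' := fun x y => by ext W; simp [mul_add]
      map_smul' := fun c x => by ext W; simp }
  have hφ : Function.Injective φ := by
    rw [← LinearMap.ker_eq_bot, LinearMap.ker_eq_bot']
    intro g hg
    apply Subtype.ext
    exact eq_zero g g.2 fun W hW => LinearMap.congr_fun hg ⟨W, hW⟩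
  have hφs : Function.Surjective φ :=
    (LinearMap.injective_iff_surjective_of_finrank_eq_finrank
      (Subspace.dual_finrank_eq (K := ℂ) (V := 𝒟)).symm).mp hφ
  let f : Module.Dual ℂ 𝒟 :=
    { toFun := fun W => ((W : Matrix m m ℂ) * e * X).trace
      map_add' := fun x y => by simp [add_mul]
      map_smul' := fun c x => by simp }
  obtain ⟨⟨g, hg⟩, hgf⟩ := hφs f
  have hgf' : ∀ W ∈ 𝒟, (W * g).trace = (W * e * X).trace := fun W hW =>
    LinearMap.congr_fun hgf ⟨W, hW⟩
  have hem := he.2.1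
  have hec := he.2.2
  -- Cyclicity of the trace and `X a = a X` show that `g a - a g` is orthogonal to `𝒟`. Thus `g` is
  -- central and, being below `e`, a multiple of `e`; the value at `W = 1` fixes the multiple.
  have hgc : ∀ a ∈ 𝒟, Commute g a := by
    intro a ha
    apply sub_eq_zero.mp
    apply eq_zero _ (𝒟.sub_mem (𝒟.mul_mem hg ha) (𝒟.mul_mem ha hg))
    intro W hW
    have h1 : (W * (g * a)).trace = (W * e * X * a).trace := by
      rw [← Matrix.mul_assoc, Matrix.trace_mul_comm, ← Matrix.mul_assoc, hgf' _ (𝒟.mul_mem ha hW),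
        Matrix.mul_assoc, Matrix.mul_assoc, Matrix.trace_mul_comm, Matrix.mul_assoc W e X]
    have h2 : W * e * X * a = W * a * e * X := by
      rw [Matrix.mul_assoc _ X, (hX a ha).eq, ← Matrix.mul_assoc, Matrix.mul_assoc W e,
        (hec a ha).eq, ← Matrix.mul_assoc]
    rw [mul_sub, Matrix.trace_sub, h1, h2, ← hgf' _ (𝒟.mul_mem hW ha), Matrix.mul_assoc, sub_self]
  have hge : g * e = g := by
    apply sub_eq_zero.mp
    apply eq_zero _ (𝒟.sub_mem (𝒟.mul_mem hg hem) hg)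
    intro W hW
    rw [mul_sub, Matrix.trace_sub, (hec g hg).symm.eq, ← Matrix.mul_assoc,
      hgf' _ (𝒟.mul_mem hW hem), hgf' _ hW, Matrix.mul_assoc W e e, he.1.2, sub_self]
  obtain ⟨c, hc⟩ := hcen g hg hgc
  rw [hge] at hc
  have h1 := hgf' 1 𝒟.one_mem
  have h2 := hgf' W hW
  rw [hc] at h1 h2
  rw [Matrix.one_mul, Matrix.one_mul, Matrix.trace_smul] at h1
  rw [mul_smul_comm, Matrix.trace_smul] at h2
  rw [← h1, ← h2, smul_eq_mul, smul_eq_mul]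
  field_simp

/-- A minimal central projector which does not annihilate a given vector. -/
theorem exists_isMinimalCentralProjector (𝒜 : Subalgebra ℂ (Matrix m m ℂ))
    (K : Matrix m m ℂ → Prop) (h0 : K 0) (h1 : ¬ K 1)
    (hK : ∀ P Q, IsCentralProjector 𝒜 P → IsCentralProjector 𝒜 Q → K P → K Q → K (P + Q)) :
    ∃ P, IsMinimalCentralProjector 𝒜 P ∧ ¬ K P := by
  have hone : IsCentralProjector 𝒜 1 :=
    ⟨⟨Matrix.isHermitian_one, mul_one 1⟩, 𝒜.one_mem, fun B _ => Commute.one_left B⟩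
  -- `K` stands for annihilating the vector. A central projector of least rank violating `K` is
  -- minimal: if it split as `P' + (P - P')`, both parts would have smaller rank and satisfy `K`,
  -- and so would their sum.
  obtain ⟨P, ⟨hP, hKP⟩, hmin⟩ := (InvImage.wf (fun P : Matrix m m ℂ => P.rank) Nat.lt_wfRel.wf).has_min
    {P | IsCentralProjector 𝒜 P ∧ ¬ K P} ⟨1, hone, h1⟩
  have rank_lt : ∀ P', IsCentralProjector 𝒜 P' → P' * P = P' → P' ≠ P → P'.rank < P.rank := by
    intro P' hP' hle hne
    have hle' : P * P' = P' := by rw [(hP.2.2 P' hP'.2.1).eq, hle]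
    apply Submodule.finrank_lt_finrank_of_lt
    refine lt_of_le_of_ne ?_ fun h => hne ?_
    · rintro _ ⟨v, rfl⟩
      exact ⟨P' *ᵥ v, by simp [Matrix.mulVec_mulVec, hle']⟩
    · rw [← hle]
      apply Matrix.ext_of_mulVec_single
      intro i
      obtain ⟨v, hv⟩ : P *ᵥ (Pi.single i 1) ∈ LinearMap.range P'.mulVecLin := by
        rw [h]; exact ⟨_, rfl⟩
      rw [← Matrix.mulVec_mulVec, ← hv]
      simp [Matrix.mulVec_mulVec, hP'.1.2]
  refine ⟨P, ⟨hP, fun h => ?_, fun P' hP' hle => ?_⟩, hKP⟩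
  · exact hKP (h ▸ h0)
  · by_contra! hne
    have hsub : IsCentralProjector 𝒜 (P - P') := by
      refine ⟨?_, 𝒜.sub_mem hP.2.1 hP'.2.1, fun B hB => (hP.2.2 B hB).sub_left (hP'.2.2 B hB)⟩
      have := hP.1.sub_mul_self hP'.1 (hP.2.2 P' hP'.2.1)
      rwa [(hP.2.2 P' hP'.2.1).eq, hle] at this
    have hsub_le : (P - P') * P = P - P' := by rw [sub_mul, hP.1.2, hle]
    have k1 : K P' := by
      by_contra hk
      exact hmin P' ⟨hP', hk⟩ (rank_lt P' hP' hle hne.2)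
    have k2 : K (P - P') := by
      by_contra hk
      exact hmin (P - P') ⟨hsub, hk⟩ (rank_lt _ hsub hsub_le fun h => hne.1 (by simpa using h))
    have := hK P' (P - P') hP' hsub k1 k2
    rw [add_sub_cancel] at this
    exact hKP this

end MatrixAlgebras

/-! ### The dimension bound obtained from a four-site problem. -/

section FourSiteDimension

variable {ι₁ ι ι₃ κ α : Type} [Fintype ι₁] [Fintype ι] [Fintype ι₃] [Fintype κ] [Fintype α]
  [DecidableEq ι₁] [DecidableEq ι] [DecidableEq ι₃] [DecidableEq κ]

/-- `V (1 ⊗ ω)` for a vector `ω` on the second factor. -/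
def embedSnd {a b : ℕ} (V : Matrix ι (Fin a × Fin b) ℂ) (ω : Fin b → ℂ) : Matrix ι (Fin a) ℂ :=
  Matrix.of fun x j => ∑ i, V x (j, i) * ω i

omit [Fintype ι] [DecidableEq ι] in
theorem embedSnd_sum {a b : ℕ} (V : Matrix ι (Fin a × Fin b) ℂ) {σ : Type} (s : Finset σ)
    (c : σ → ℂ) (ω : σ → Fin b → ℂ) :
    embedSnd V (∑ k ∈ s, c k • ω k) = ∑ k ∈ s, c k • embedSnd V (ω k) := by
  ext x j
  simp only [embedSnd, Matrix.of_apply, Matrix.sum_apply, Matrix.smul_apply, Finset.sum_apply,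
    Pi.smul_apply, smul_eq_mul, Finset.mul_sum]
  rw [Finset.sum_comm]
  exact Finset.sum_congr rfl fun k _ => Finset.sum_congr rfl fun i _ => by ring

omit [DecidableEq ι] in
-- The isometry recovers the elementary tensor `ω ⊗ β` from its image; linear independence questions
-- can then be settled in coordinates.
theorem embedSnd_coeff {a b : ℕ} {V : Matrix ι (Fin a × Fin b) ℂ} (hV : Vᴴ * V = 1)
    (ω : Fin b → ℂ) (β : Matrix (Fin a) (Fin a) ℂ) (j' j : Fin a) (i : Fin b) :
    ∑ x, star (V x (j', i)) * (embedSnd V ω * β) x j = ω i * β j' j := by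
  have hV' : ∀ p q, ∑ x, star (V x p) * V x q = if p = q then 1 else 0 := by
    intro p q
    have := congrFun (congrFun hV p) q
    rwa [Matrix.mul_apply, Matrix.one_apply] at this
  simp only [embedSnd, Matrix.mul_apply, Matrix.of_apply, Finset.sum_mul, Finset.mul_sum]
  rw [Finset.sum_comm]
  calc ∑ k, ∑ x, ∑ l, star (V x (j', i)) * (V x (k, l) * ω l * β k j)
      = ∑ k, ∑ l, (∑ x, star (V x (j', i)) * V x (k, l)) * (ω l * β k j) := by
        refine Finset.sum_congr rfl fun k _ => ?_
        rw [Finset.sum_comm]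
        refine Finset.sum_congr rfl fun l _ => ?_
        rw [Finset.sum_mul]
        exact Finset.sum_congr rfl fun x _ => by ring
    _ = ω i * β j' j := by
        simp only [hV', Prod.mk.injEq, ite_and, ite_mul, one_mul, zero_mul]
        rw [Finset.sum_eq_single j', Finset.sum_eq_single i]
        · simp
        · intro l _ hl; simp [Ne.symm hl]
        · simp
        · intro k _ hk; simp [Ne.symm hk]
        · simp

omit [DecidableEq ι] [DecidableEq κ] in
/-- A counting bound: operators `b` on the first factor, such that each `V (b ⊗ ω)` with `ω` in a
space `W` is a combination of products of `card α` fixed operators with `V (1 ⊗ ω')`,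
`ω'` in `W`, span a space of dimension at most `card α`. -/
theorem card_le_of_embedSnd {a b N : ℕ} {V : Matrix ι (Fin a × Fin b) ℂ} (hV : Vᴴ * V = 1)
    (E : α → Matrix ι ι ℂ) (φ : κ → Fin b → ℂ) (hφ : ∃ p, φ p ≠ 0)
    (β : Fin N → Matrix (Fin a) (Fin a) ℂ) (hβ : LinearIndependent ℂ β)
    (h : ∀ k p, ∃ c : α → κ → ℂ, embedSnd V (φ p) * β k =
      ∑ e, ∑ p', c e p' • (E e * embedSnd V (φ p'))) :
    N ≤ Fintype.card α := by
  obtain ⟨t, ht, hspan, hli⟩ := exists_linearIndependent ℂ (Set.range φ)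
  have : Finite t := hli.finite
  have : Fintype t := Fintype.ofFinite t
  have : Nonempty t := by
    by_contra he
    rw [Set.not_nonempty_iff_eq_empty'] at he
    obtain ⟨p, hp⟩ := hφ
    rw [he, Submodule.span_empty] at hspan
    have : φ p ∈ Submodule.span ℂ (Set.range φ) := Submodule.subset_span ⟨p, rfl⟩
    rw [← hspan] at this
    exact hp ((Submodule.mem_bot ℂ).mp this)
  -- `t` is a basis of the space `W` spanned by the `φ p`. The `N * dim W` vectors `u` are
  -- independent and lie in the span of the `card α * dim W` vectors `v`; since `t` is nonempty,
  -- `dim W` cancels.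
  let u : Fin N × t → Matrix ι (Fin a) ℂ := fun p => embedSnd V p.2 * β p.1
  let v : α × t → Matrix ι (Fin a) ℂ := fun p => E p.1 * embedSnd V p.2
  have hu : LinearIndependent ℂ u := by
    rw [Fintype.linearIndependent_iff]
    intro g hg
    have h1 : ∀ j' j, ∀ ω : t, ∑ k, g (k, ω) * β k j' j = 0 := by
      intro j' j
      rw [Fintype.linearIndependent_iff] at hli
      apply hli
      ext i
      have h2 : ∑ x, star (V x (j', i)) * (∑ p, g p • u p) x j = 0 := by rw [hg]; simp
      refine Eq.trans ?_ h2
      calc (∑ ω : t, (∑ k, g (k, ω) * β k j' j) • (ω : Fin b → ℂ)) i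
          = ∑ p : Fin N × t, g p * ((p.2 : Fin b → ℂ) i * β p.1 j' j) := by
            rw [Fintype.sum_prod_type_right, Finset.sum_apply]
            refine Finset.sum_congr rfl fun ω _ => ?_
            rw [Pi.smul_apply, smul_eq_mul, Finset.sum_mul]
            exact Finset.sum_congr rfl fun k _ => by ring
        _ = ∑ p : Fin N × t, g p * ∑ x, star (V x (j', i)) * u p x j := by
            refine Finset.sum_congr rfl fun p _ => ?_
            rw [embedSnd_coeff hV]
        _ = _ := by
            simp only [Matrix.sum_apply, Matrix.smul_apply, smul_eq_mul, Finset.mul_sum]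
            rw [Finset.sum_comm]
            exact Finset.sum_congr rfl fun x _ => Finset.sum_congr rfl fun p _ => by ring
    rintro ⟨k, ω⟩
    rw [Fintype.linearIndependent_iff] at hβ
    refine hβ (fun k => g (k, ω)) ?_ k
    ext j' j
    simpa [Matrix.sum_apply] using h1 j' j ω
  have hle : Submodule.span ℂ (Set.range u) ≤ Submodule.span ℂ (Set.range v) := by
    have key : ∀ e, ∀ ω ∈ Submodule.span ℂ (Set.range φ),
        E e * embedSnd V ω ∈ Submodule.span ℂ (Set.range v) := by
      intro e ω hω
      rw [← hspan] at hω
      have hω' : ω ∈ Submodule.span ℂ (Set.range (Subtype.val : t → Fin b → ℂ)) := by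
        rwa [Subtype.range_coe]
      obtain ⟨c, rfl⟩ := (Submodule.mem_span_range_iff_exists_fun ℂ).mp hω'
      rw [embedSnd_sum, Matrix.mul_sum]
      refine Submodule.sum_mem _ fun k _ => ?_
      rw [Matrix.mul_smul]
      exact Submodule.smul_mem _ _ (Submodule.subset_span ⟨(e, k), rfl⟩)
    rw [Submodule.span_le]
    rintro _ ⟨⟨k, ω⟩, rfl⟩
    obtain ⟨p, hp⟩ := ht ω.2
    obtain ⟨c, hc⟩ := h k p
    change embedSnd V ω * β k ∈ _
    rw [← hp, hc]
    exact Submodule.sum_mem _ fun e _ => Submodule.sum_mem _ fun p' _ =>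
      Submodule.smul_mem _ _ (key e _ (Submodule.subset_span ⟨p', rfl⟩))
  have h1 := finrank_span_eq_card hu
  have h2 := Submodule.finrank_mono hle
  have h3 := finrank_range_le_card (R := ℂ) v
  rw [Set.finrank] at h3
  rw [h1, Fintype.card_prod, Fintype.card_fin] at h2
  rw [Fintype.card_prod] at h3
  exact Nat.le_of_mul_le_mul_right (h2.trans h3) Fintype.card_pos

/-- All zero energy states lie in the range of `P0`, where they have the form `V (η ⊗ φ)` with the
unique `φ`. An operator commuting with `Q` preserves them and acts on `η` by a matrix `β B`; `hker`
makes `β` injective. By `hE` the same operator uses only the operators `E e` on `ι`, so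
`card_le_of_embedSnd` bounds the number of independent `β B`. -/
theorem UniqueBoundaryState.finrank_le {Q12X : Matrix (ι₁ × ι) (ι₁ × ι) ℂ}
    {Q : Matrix (ι × κ) (ι × κ) ℂ} {K : ℕ} (h : UniqueBoundaryState Q12X Q K)
    (E : α → Matrix ι ι ℂ) (𝒮 : Submodule ℂ (Matrix (ι × κ) (ι × κ) ℂ))
    (hE : ∀ B ∈ 𝒮, ∃ F : α → Matrix κ κ ℂ, B = ∑ e, E e ⊗ₖ F e)
    (hc : ∀ B ∈ 𝒮, Commute B Q)
    (hker : ∀ B ∈ 𝒮, (∀ ψ, Q *ᵥ ψ = 0 → B *ᵥ ψ = 0) → B = 0) :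
    Module.finrank ℂ 𝒮 ≤ Fintype.card α := by
  obtain ⟨P0, -, hP0, a, b, V, -, R, φ, hV, hVP, -, hQ, hφ, hR, huniq, -⟩ := h
  obtain ⟨⟨i₀, p₀⟩, hφ0⟩ : ∃ x, φ x ≠ 0 := by
    by_contra! hh
    exact hφ (funext hh)
  -- the zero energy states
  let G : Fin a → ι × κ → ℂ := fun j x => embedSnd V (fun i => φ (i, x.2)) x.1 j
  have hV' : ∀ p q, ∑ x, star (V x p) * V x q = if p = q then 1 else 0 := by
    intro p q
    have := congrFun (congrFun hV p) q
    rwa [Matrix.mul_apply, Matrix.one_apply] at this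
  have hG : ∀ j, G j = (V ⊗ₖ (1 : Matrix κ κ ℂ)) *ᵥ
      (fun x => if x.1.1 = j then φ (x.1.2, x.2) else 0) := by
    intro j
    ext ⟨x, p⟩
    simp only [G, embedSnd, Matrix.of_apply, Matrix.mulVec, dotProduct, Fintype.sum_prod_type,
      Matrix.kroneckerMap_apply, Matrix.one_apply, mul_ite, mul_one, mul_zero, ite_mul, zero_mul]
    rw [Finset.sum_eq_single j]
    · simp
    · intro k _ hk; simp [hk]
    · simp
  have hact : ∀ η : (Fin a × Fin b) × κ → ℂ, ∀ j i p,
      (((1 : Matrix (Fin a) (Fin a) ℂ) ⊗ₖ R).submatrix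
          (Equiv.prodAssoc (Fin a) (Fin b) κ) (Equiv.prodAssoc (Fin a) (Fin b) κ) *ᵥ η)
          ((j, i), p) = (R *ᵥ fun y => η ((j, y.1), y.2)) (i, p) := by
    intro η j i p
    simp only [Matrix.mulVec, dotProduct, Fintype.sum_prod_type, Matrix.submatrix_apply,
      Equiv.prodAssoc_apply, Matrix.kroneckerMap_apply, Matrix.one_apply, ite_mul, one_mul,
      zero_mul]
    rw [Finset.sum_eq_single j]
    · simp
    · intro k _ hk; simp [Ne.symm hk]
    · simp
  have hQG : ∀ j, Q *ᵥ G j = 0 := by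
    intro j
    rw [hG, Matrix.mulVec_mulVec, hQ, ← Matrix.mulVec_mulVec]
    suffices h0 : ((1 : Matrix (Fin a) (Fin a) ℂ) ⊗ₖ R).submatrix
          (Equiv.prodAssoc (Fin a) (Fin b) κ) (Equiv.prodAssoc (Fin a) (Fin b) κ) *ᵥ
        (fun x => if x.1.1 = j then φ (x.1.2, x.2) else 0) = 0 by rw [h0, Matrix.mulVec_zero]
    ext ⟨⟨j', i⟩, p⟩
    rw [hact]
    by_cases hj : j' = j
    · simp only [hj, if_true]
      exact congrFun hR (i, p)
    · simp only [hj, if_false]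
      exact congrFun (Matrix.mulVec_zero R) (i, p)
  have hVV : (V ⊗ₖ (1 : Matrix κ κ ℂ))ᴴ * (V ⊗ₖ (1 : Matrix κ κ ℂ)) = 1 := by
    rw [Matrix.conjTranspose_kronecker, ← Matrix.mul_kronecker_mul, hV, Matrix.conjTranspose_one,
      Matrix.mul_one, Matrix.one_kronecker_one]
  have hspan : ∀ ψ, Q *ᵥ ψ = 0 → ∃ c : Fin a → ℂ, ψ = ∑ j, c j • G j := by
    intro ψ hψ
    set η := (V ⊗ₖ (1 : Matrix κ κ ℂ))ᴴ *ᵥ ψ with hη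
    have h1 : (V ⊗ₖ (1 : Matrix κ κ ℂ)) *ᵥ η = ψ := by
      rw [hη, Matrix.mulVec_mulVec, Matrix.conjTranspose_kronecker, ← Matrix.mul_kronecker_mul,
        hVP, Matrix.conjTranspose_one, Matrix.mul_one, hP0 ψ hψ]
    have h2 : ((1 : Matrix (Fin a) (Fin a) ℂ) ⊗ₖ R).submatrix
          (Equiv.prodAssoc (Fin a) (Fin b) κ) (Equiv.prodAssoc (Fin a) (Fin b) κ) *ᵥ η = 0 := by
      have h3 : (V ⊗ₖ (1 : Matrix κ κ ℂ)) *ᵥ (((1 : Matrix (Fin a) (Fin a) ℂ) ⊗ₖ R).submatrix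
          (Equiv.prodAssoc (Fin a) (Fin b) κ) (Equiv.prodAssoc (Fin a) (Fin b) κ) *ᵥ η) = 0 := by
        rw [Matrix.mulVec_mulVec, ← hQ, ← Matrix.mulVec_mulVec, h1, hψ]
      have h4 := congrArg ((V ⊗ₖ (1 : Matrix κ κ ℂ))ᴴ *ᵥ ·) h3
      simpa only [Matrix.mulVec_mulVec, ← Matrix.mul_assoc, hVV, Matrix.one_mul,
        Matrix.mulVec_zero] using h4
    have h5 : ∀ j, ∃ c : ℂ, (fun y : Fin b × κ => η ((j, y.1), y.2)) = c • φ := by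
      intro j
      apply huniq
      ext ⟨i, p⟩
      rw [← hact, h2]; rfl
    choose c hc using h5
    refine ⟨c, ?_⟩
    have h6 : η = ∑ j, c j • fun x : (Fin a × Fin b) × κ =>
        if x.1.1 = j then φ (x.1.2, x.2) else 0 := by
      ext ⟨⟨j, i⟩, p⟩
      have := congrFun (hc j) (i, p)
      simp only [Pi.smul_apply, smul_eq_mul] at this
      simp [Finset.sum_apply, this]
    rw [← h1, h6, Matrix.mulVec_sum]
    exact Finset.sum_congr rfl fun j _ => by rw [Matrix.mulVec_smul, hG]
  -- the operators on the first factor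
  let β : 𝒮 →ₗ[ℂ] Matrix (Fin a) (Fin a) ℂ :=
    { toFun := fun B => Matrix.of fun j' j =>
        (φ (i₀, p₀))⁻¹ * ∑ x, star (V x (j', i₀)) * ((B : Matrix _ _ ℂ) *ᵥ G j) (x, p₀)
      map_add' := fun B C => by
        ext j' j
        simp [Matrix.add_mulVec, mul_add, Finset.sum_add_distrib]
      map_smul' := fun r B => by
        ext j' j
        simp only [Submodule.coe_smul, Matrix.of_apply, Matrix.smul_mulVec, Pi.smul_apply,
          smul_eq_mul, RingHom.id_apply, Matrix.smul_apply, Finset.mul_sum]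
        exact Finset.sum_congr rfl fun x _ => by ring }
  have hβ : ∀ B : 𝒮, ∀ j x p, ((B : Matrix _ _ ℂ) *ᵥ G j) (x, p) =
      (embedSnd V (fun i => φ (i, p)) * β B) x j := by
    intro B j
    obtain ⟨c, hc'⟩ := hspan ((B : Matrix _ _ ℂ) *ᵥ G j) (by
      rw [Matrix.mulVec_mulVec, ← (hc B B.2).eq, ← Matrix.mulVec_mulVec, hQG, Matrix.mulVec_zero])
    have h1 : ∀ x p, ((B : Matrix _ _ ℂ) *ᵥ G j) (x, p) =
        (embedSnd V (fun i => φ (i, p)) * Matrix.of fun j' _ => c j') x j := by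
      intro x p
      rw [hc', Matrix.mul_apply, Finset.sum_apply]
      exact Finset.sum_congr rfl fun k _ => by
        rw [Pi.smul_apply, smul_eq_mul, mul_comm]; rfl
    -- `β` was defined from the single entry `(i₀, p₀)` at which `φ` does not vanish; that entry
    -- already determines all coefficients.
    have h2 : ∀ j', β B j' j = c j' := by
      intro j'
      change (φ (i₀, p₀))⁻¹ * ∑ x, star (V x (j', i₀)) * ((B : Matrix _ _ ℂ) *ᵥ G j) (x, p₀) = _
      simp only [h1]
      rw [embedSnd_coeff hV, Matrix.of_apply, ← mul_assoc, inv_mul_cancel₀ hφ0, one_mul]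
    intro x p
    rw [h1, Matrix.mul_apply, Matrix.mul_apply]
    exact Finset.sum_congr rfl fun k _ => by rw [h2]; rfl
  have hinj : LinearMap.ker β = ⊥ := by
    rw [LinearMap.ker_eq_bot']
    intro B hB
    apply Subtype.ext
    apply hker B B.2
    intro ψ hψ
    obtain ⟨c, rfl⟩ := hspan ψ hψ
    rw [Matrix.mulVec_sum]
    refine Finset.sum_eq_zero fun j _ => ?_
    rw [Matrix.mulVec_smul]
    convert smul_zero (c j)
    ext ⟨x, p⟩
    rw [hβ, hB, Matrix.mul_zero]; rfl
  let bas := Module.finBasis ℂ 𝒮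
  refine card_le_of_embedSnd (κ := κ) hV E (fun p i => φ (i, p)) ⟨p₀, fun h => hφ0 (congrFun h i₀)⟩
    (fun k => β (bas k)) (bas.linearIndependent.map' β hinj) ?_
  intro k p
  obtain ⟨F, hF⟩ := hE (bas k) (bas k).2
  refine ⟨fun e p' => F e p p', ?_⟩
  ext x j
  rw [← hβ, hF]
  simp only [Matrix.mulVec, dotProduct, Matrix.sum_apply, Matrix.kroneckerMap_apply,
    Fintype.sum_prod_type, Matrix.smul_apply, smul_eq_mul, Matrix.mul_apply, Finset.sum_mul,
    Finset.mul_sum]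
  rw [Finset.sum_comm]
  simp_rw [Finset.sum_comm (s := (Finset.univ : Finset ι)) (t := (Finset.univ : Finset α))]
  rw [Finset.sum_comm]
  refine Finset.sum_congr rfl fun e _ => Finset.sum_congr rfl fun p' _ =>
    Finset.sum_congr rfl fun x' _ => ?_
  simp only [G]
  ring

/-- On the factor `ℋ₃²` the operator `Q` acts trivially, so by `hcomm` each `B` in `𝒮` commutes with
all matrix units of this factor. Hence `B` is the same on every copy of `ℋ₃¹`, and compression to
one copy is injective and reduces to the case without `ℋ₃²`. -/
theorem ReducedBoundaryState.finrank_le [Nonempty ι₃] {Q12X : Matrix (ι₁ × ι) (ι₁ × ι) ℂ}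
    {Q : Matrix (ι × ι₃) (ι × ι₃) ℂ} {d K : ℕ} (h : ReducedBoundaryState Q12X Q d K)
    (E : α → Matrix ι ι ℂ) (𝒮 : Submodule ℂ (Matrix (ι × ι₃) (ι × ι₃) ℂ))
    (hE : ∀ B ∈ 𝒮, ∃ F : α → Matrix ι₃ ι₃ ℂ, B = ∑ e, E e ⊗ₖ F e)
    (hc : ∀ B ∈ 𝒮, Commute B Q)
    (hcomm : ∀ Y : Matrix ι₃ ι₃ ℂ, Commute ((1 : Matrix ι ι ℂ) ⊗ₖ Y) Q →
      ∀ B ∈ 𝒮, Commute B ((1 : Matrix ι ι ℂ) ⊗ₖ Y))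
    (hker : ∀ B ∈ 𝒮, (∀ ψ, Q *ᵥ ψ = 0 → B *ᵥ ψ = 0) → B = 0) :
    Module.finrank ℂ 𝒮 ≤ Fintype.card α := by
  obtain ⟨d', U, Q', hU, hU', -, hQ, hbd⟩ := h
  -- the isometries onto the copies of the first factor
  let W : Fin d' → Matrix ι₃ (Fin d) ℂ := fun q => Matrix.of fun u p => U u (p, q)
  have hW : ∀ q q', (W q)ᴴ * W q' = if q = q' then 1 else 0 := by
    intro q q'
    ext p p'
    have := congrFun (congrFun hU (p, q)) (p', q')
    rw [Matrix.mul_apply, Matrix.one_apply] at this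
    rw [Matrix.mul_apply]
    refine this.trans ?_
    by_cases hq : q = q' <;> simp [hq, Matrix.one_apply]
  have hW' : ∑ q, W q * (W q)ᴴ = 1 := by
    ext u u'
    have := congrFun (congrFun hU' u) u'
    rw [Matrix.mul_apply, Fintype.sum_prod_type_right] at this
    rw [Matrix.sum_apply, ← this]
    rfl
  let w : Fin d' → Matrix (ι × ι₃) (ι × Fin d) ℂ := fun q => (1 : Matrix ι ι ℂ) ⊗ₖ W q
  have hwh : ∀ q, (w q)ᴴ = (1 : Matrix ι ι ℂ) ⊗ₖ (W q)ᴴ := fun q => by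
    rw [Matrix.conjTranspose_kronecker, Matrix.conjTranspose_one]
  have hw : ∀ q q', (w q)ᴴ * w q' = if q = q' then 1 else 0 := by
    intro q q'
    rw [hwh, ← Matrix.mul_kronecker_mul, hW, Matrix.one_mul]
    split_ifs
    · exact Matrix.one_kronecker_one
    · exact Matrix.kronecker_zero _
  have hww : ∀ q q', w q * (w q')ᴴ = (1 : Matrix ι ι ℂ) ⊗ₖ (W q * (W q')ᴴ) := by
    intro q q'
    rw [hwh, ← Matrix.mul_kronecker_mul, Matrix.one_mul]
  have hw' : ∑ q, w q * (w q)ᴴ = 1 := by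
    simp only [hww]
    ext ⟨x, u⟩ ⟨x', u'⟩
    have := congrFun (congrFun hW' u) u'
    rw [Matrix.sum_apply] at this
    simp only [Matrix.sum_apply, Matrix.kroneckerMap_apply]
    rw [← Finset.mul_sum, this, ← Matrix.one_kronecker_one, Matrix.kroneckerMap_apply]
  have hQw : Q = ∑ q, w q * Q' * (w q)ᴴ := by
    rw [hQ]
    have hwq : ∀ q x u y p, w q (x, u) (y, p) = if x = y then U u (p, q) else 0 := by
      intro q x u y p
      simp [w, W, Matrix.one_apply]
    ext ⟨x, u⟩ ⟨x', u'⟩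
    simp only [Matrix.sum_apply, Matrix.mul_apply, Matrix.conjTranspose_apply, hwq,
      Fintype.sum_prod_type, Matrix.kroneckerMap_apply, Matrix.submatrix_apply, Matrix.one_apply,
      Equiv.prodAssoc_symm_apply, ite_mul, zero_mul, one_mul, mul_ite, mul_zero, mul_one,
      apply_ite star, star_zero, Finset.sum_ite_irrel, Finset.sum_const_zero, Finset.sum_ite_eq,
      Finset.mem_univ, if_true]
    rw [Finset.sum_comm]
    refine Finset.sum_congr rfl fun q _ => Finset.sum_congr rfl fun p _ => ?_
    congr 1
    rw [Finset.sum_eq_single x (fun y _ hy => by simp [Ne.symm hy]) (by simp)]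
    exact Finset.sum_congr rfl fun p' _ => by simp
  have hQw1 : ∀ q, Q * w q = w q * Q' := by
    intro q
    rw [hQw, Matrix.sum_mul, Finset.sum_eq_single q]
    · rw [Matrix.mul_assoc, hw, if_pos rfl, Matrix.mul_one]
    · intro q' _ hq; rw [Matrix.mul_assoc, hw, if_neg hq, Matrix.mul_zero]
    · simp
  have hQw2 : ∀ q, (w q)ᴴ * Q = Q' * (w q)ᴴ := by
    intro q
    rw [hQw, Matrix.mul_sum, Finset.sum_eq_single q]
    · rw [← Matrix.mul_assoc, ← Matrix.mul_assoc, hw, if_pos rfl, Matrix.one_mul]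
    · intro q' _ hq; rw [← Matrix.mul_assoc, ← Matrix.mul_assoc, hw, if_neg hq.symm, Matrix.zero_mul, Matrix.zero_mul]
    · simp
  -- These are the matrix units of the second factor; they intertwine the copies of `Q'`.
  have hY : ∀ q q', ∀ B ∈ 𝒮, Commute B (w q * (w q')ᴴ) := by
    intro q q'
    rw [hww]
    apply hcomm
    rw [← hww]
    change w q * (w q')ᴴ * Q = Q * (w q * (w q')ᴴ)
    rw [Matrix.mul_assoc, hQw2, ← Matrix.mul_assoc, ← Matrix.mul_assoc, hQw1]
  -- A copy to compress to exists because `ι₃` is nonempty.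
  obtain ⟨q₀⟩ : Nonempty (Fin d') := by
    by_contra hne
    rw [not_nonempty_iff] at hne
    have u := Classical.arbitrary ι₃
    have := congrFun (congrFun hW' u) u
    simp at this
  have hB : ∀ B ∈ 𝒮, B = ∑ q, w q * ((w q₀)ᴴ * B * w q₀) * (w q)ᴴ := by
    intro B hB
    calc B = ∑ q, w q * (w q)ᴴ * B := by rw [← Finset.sum_mul, hw', Matrix.one_mul]
      _ = _ := by
        refine Finset.sum_congr rfl fun q _ => ?_
        have h1 := (hY q q₀ B hB).eq
        calc w q * (w q)ᴴ * B
            = w q * ((w q₀)ᴴ * w q₀) * (w q)ᴴ * B := by rw [hw, if_pos rfl, Matrix.mul_one]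
          _ = w q * (w q₀)ᴴ * (w q₀ * (w q)ᴴ * B) := by simp only [Matrix.mul_assoc]
          _ = w q * (w q₀)ᴴ * (B * (w q₀ * (w q)ᴴ)) := by rw [(hY q₀ q B hB).eq]
          _ = _ := by simp only [Matrix.mul_assoc]
  let f : 𝒮 →ₗ[ℂ] Matrix (ι × Fin d) (ι × Fin d) ℂ :=
    { toFun := fun B => (w q₀)ᴴ * B.1 * w q₀
      map_add' := fun B C => by simp [Matrix.mul_add, Matrix.add_mul]
      map_smul' := fun r B => by simp }
  have hf : Function.Injective f := by
    intro B C hBC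
    apply Subtype.ext
    rw [hB B B.2, hB C C.2]
    have : (w q₀)ᴴ * B.1 * w q₀ = (w q₀)ᴴ * C.1 * w q₀ := hBC
    rw [this]
  rw [← LinearMap.finrank_range_of_inj hf]
  apply hbd.finrank_le E
  · rintro _ ⟨B, rfl⟩
    obtain ⟨F, hF⟩ := hE B B.2
    refine ⟨fun e => (W q₀)ᴴ * F e * W q₀, ?_⟩
    change (w q₀)ᴴ * B.1 * w q₀ = _
    rw [hF, Matrix.mul_sum, Matrix.sum_mul]
    refine Finset.sum_congr rfl fun e _ => ?_
    rw [hwh, ← Matrix.mul_kronecker_mul, ← Matrix.mul_kronecker_mul, Matrix.one_mul, Matrix.mul_one]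
  · rintro _ ⟨B, rfl⟩
    change (w q₀)ᴴ * B.1 * w q₀ * Q' = Q' * ((w q₀)ᴴ * B.1 * w q₀)
    rw [Matrix.mul_assoc, ← hQw1, ← Matrix.mul_assoc, Matrix.mul_assoc _ B.1 Q,
      (hc B B.2).eq, ← Matrix.mul_assoc, hQw2, Matrix.mul_assoc, Matrix.mul_assoc, Matrix.mul_assoc]
  · rintro _ ⟨B, rfl⟩ hψ
    have : B = 0 := by
      apply Subtype.ext
      apply hker B B.2
      intro ψ hQψ
      rw [hB B B.2, Matrix.sum_mulVec]
      refine Finset.sum_eq_zero fun q _ => ?_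
      rw [Matrix.mul_assoc, ← Matrix.mulVec_mulVec, ← Matrix.mulVec_mulVec]
      have := hψ ((w q)ᴴ *ᵥ ψ) (by
        rw [Matrix.mulVec_mulVec, ← hQw2, ← Matrix.mulVec_mulVec, hQψ, Matrix.mulVec_zero])
      change ((w q₀)ᴴ * B.1 * w q₀) *ᵥ _ = 0 at this
      rw [this, Matrix.mulVec_zero]
    rw [this, map_zero]

end FourSiteDimension

/-! ### Sums over paths, and matrix products from bounded cut ranks. -/

section TensorTrain

theorem sum_snoc {I : Type} [Fintype I] {k : ℕ} (f : (Fin (k + 1) → I) → ℂ) :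
    ∑ v, f v = ∑ v : Fin k → I, ∑ b, f (Fin.snoc v b) := by
  rw [Finset.sum_comm, ← Fintype.sum_prod_type', ← (Fin.snocEquiv fun _ => I).sum_comp]
  rfl

/-- The entries of a product of transfer matrices, as a sum over paths. -/
theorem sum_path_backward {I : Type} [Fintype I] (g : ℕ → I → ℂ) (N : ℕ → I → I → ℂ) (k : ℕ)
    (h : ∀ i < k, ∀ a, g i a = ∑ b, N i a b * g (i + 1) b) :
    ∑ a, g 0 a = ∑ β : Fin (k + 1) → I,
      (∏ y : Fin k, N y (β y.castSucc) (β y.succ)) * g k (β (Fin.last k)) := by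
  induction k with
  | zero =>
    rw [sum_snoc]
    simp [Fin.snoc]
  | succ k ih =>
    rw [ih fun i hi => h i (by omega), sum_snoc (k := k + 1)]
    refine Finset.sum_congr rfl fun β _ => ?_
    rw [h k (by omega), Finset.mul_sum]
    refine Finset.sum_congr rfl fun b _ => ?_
    rw [Fin.prod_univ_castSucc]
    simp only [Fin.snoc_castSucc, Fin.succ_castSucc, Fin.snoc_last, Fin.succ_last,
      Fin.val_castSucc, Fin.val_last]
    ring

/-- Here the row vector `Z` is propagated, as the verifier does it. The closing weight `c` is
arbitrary for the sake of the induction; the indicator of `0` is what pins the last bond later. -/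
theorem sum_path_forward {I : Type} [Fintype I] (Z : ℕ → I → ℂ) (w : ℕ → I → I → ℂ)
    (h : ∀ i b, Z (i + 1) b = ∑ a, Z i a * w i a b) (k : ℕ) (c : I → ℂ) :
    ∑ b, Z k b * c b = ∑ β : Fin (k + 1) → I,
      Z 0 (β 0) * (∏ y : Fin k, w y (β y.castSucc) (β y.succ)) * c (β (Fin.last k)) := by
  induction k generalizing c with
  | zero =>
    rw [sum_snoc]
    simp [Fin.snoc]
  | succ k ih =>
    calc ∑ b, Z (k + 1) b * c b = ∑ a, Z k a * ∑ b, w k a b * c b := by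
          simp only [h, Finset.sum_mul, Finset.mul_sum]
          rw [Finset.sum_comm]
          exact Finset.sum_congr rfl fun _ _ => Finset.sum_congr rfl fun _ _ => by ring
      _ = _ := by
        rw [ih, sum_snoc (k := k + 1)]
        refine Finset.sum_congr rfl fun β _ => ?_
        rw [Finset.mul_sum]
        refine Finset.sum_congr rfl fun b _ => ?_
        rw [Fin.prod_univ_castSucc]
        have h0 : (Fin.snoc β b : Fin (k + 2) → I) 0 = β 0 := by
          rw [← Fin.castSucc_zero, Fin.snoc_castSucc]
        simp only [Fin.snoc_castSucc, Fin.succ_castSucc, Fin.snoc_last, Fin.succ_last,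
          Fin.val_castSucc, Fin.val_last, h0]
        ring

/-- The function on configurations obtained by fixing the values at the sites below `i`. -/
def sliceBelow {A : Type} {n : ℕ} (f : (Fin (n + 1) → A) → ℂ) (i : ℕ) (l : Fin (n + 1) → A) :
    (Fin (n + 1) → A) → ℂ :=
  fun σ => f fun y => if y.val < i then l y else σ y

/-- A basis padded by zeros: all bonds then have exactly `χ` values, whatever the rank of the cut.
-/
theorem exists_spanning_family {E : Type} [AddCommGroup E] [Module ℂ E] [FiniteDimensional ℂ E]
    {χ : ℕ} (S : Submodule ℂ E) (h : Module.finrank ℂ S ≤ χ) :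
    ∃ g : Fin χ → E, (∀ a, g a ∈ S) ∧ S ≤ Submodule.span ℂ (Set.range g) := by
  let b := Module.finBasis ℂ S
  refine ⟨fun a => if h : a.val < Module.finrank ℂ S then (b ⟨a, h⟩ : E) else 0, fun a => ?_, ?_⟩
  · dsimp only
    split_ifs
    · exact (b _).2
    · exact S.zero_mem
  · intro x hx
    have : x = ∑ k, b.repr ⟨x, hx⟩ k • (b k : E) := by
      have := congrArg S.subtype (b.sum_repr ⟨x, hx⟩)
      rw [map_sum] at this
      exact this.symm
    rw [this]
    refine Submodule.sum_mem _ fun k _ => Submodule.smul_mem _ _ (Submodule.subset_span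
      ⟨Fin.castLE h k, ?_⟩)
    simp

/-- A function all of whose cuts have rank at most `χ` is a matrix product of bond dimension `χ`;
the last bond only takes the value `0`. -/
theorem exists_matrixProduct {A : Type} [Fintype A] [Nonempty A] {n χ : ℕ} [NeZero χ]
    (f : (Fin (n + 1) → A) → ℂ) (hA : Fintype.card A ≤ χ)
    (hf : ∀ i, 1 ≤ i → i < n →
      Module.finrank ℂ (Submodule.span ℂ (Set.range (sliceBelow f i))) ≤ χ) :
    ∃ N : ℕ → Fin χ → Fin χ → A → ℂ, (∀ a b s, b ≠ 0 → N n a b s = 0) ∧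
      ∀ σ, f σ = ∑ β : Fin (n + 2) → Fin χ, ∏ y : Fin (n + 1),
        N y (β y.castSucc) (β y.succ) (σ y) := by
  classical
  have slice_zero : ∀ l, sliceBelow f 0 l = f := fun l => by
    ext σ; simp [sliceBelow]
  have slice_update : ∀ (i : ℕ) (hi : i < n + 1) l σ s,
      sliceBelow f i l (Function.update σ ⟨i, hi⟩ s) =
        sliceBelow f (i + 1) (Function.update l ⟨i, hi⟩ s) σ := by
    intro i hi l σ s
    unfold sliceBelow
    congr 1
    ext y
    by_cases hy : y.val = i
    · obtain rfl : y = ⟨i, hi⟩ := Fin.ext hy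
      simp
    · have : y ≠ ⟨i, hi⟩ := fun h => hy (by rw [h])
      simp only [Function.update_of_ne this]
      by_cases h : y.val < i
      · rw [if_pos h, if_pos (by omega)]
      · rw [if_neg h, if_neg (by omega)]
  -- The two outer cuts are not covered by `hf`. At `0` the only slice is `f`, placed in one
  -- component so that the family sums to `f`. At `n` a single site is free, and the size of `A`
  -- bounds the rank.
  have base : ∀ i ≤ n, ∃ g : Fin χ → (Fin (n + 1) → A) → ℂ,
      (∀ a, g a ∈ Submodule.span ℂ (Set.range (sliceBelow f i))) ∧
      (∀ l, sliceBelow f i l ∈ Submodule.span ℂ (Set.range g)) ∧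
      (i = 0 → ∑ a, g a = f) := by
    intro i hi
    rcases Nat.eq_zero_or_pos i with rfl | hpos
    · have hfm : f ∈ Submodule.span ℂ (Set.range (sliceBelow f 0)) :=
        Submodule.subset_span ⟨fun _ => Classical.arbitrary A, slice_zero _⟩
      refine ⟨fun a => if a = 0 then f else 0, fun a => ?_, fun l => ?_, fun _ => ?_⟩
      · dsimp only; split_ifs
        · exact hfm
        · exact Submodule.zero_mem _
      · rw [slice_zero]
        exact Submodule.subset_span ⟨0, by simp⟩
      · simp
    · obtain ⟨g, h1, h2⟩ := exists_spanning_family (χ := χ)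
        (Submodule.span ℂ (Set.range (sliceBelow f i))) (by
          rcases hi.lt_or_eq with hlt | rfl
          · exact hf i hpos hlt
          · have hle : Submodule.span ℂ (Set.range (sliceBelow f i)) ≤ Submodule.span ℂ
                (Set.range fun (s : A) (σ : Fin (i + 1) → A) =>
                  if σ (Fin.last i) = s then (1 : ℂ) else 0) := by
              rw [Submodule.span_le]
              rintro _ ⟨l, rfl⟩
              have : sliceBelow f i l = ∑ s : A,
                  f (fun y => if y.val < i then l y else s) • fun σ : Fin (i + 1) → A =>
                    if σ (Fin.last i) = s then (1 : ℂ) else 0 := by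
                ext σ
                simp only [Finset.sum_apply, Pi.smul_apply, smul_eq_mul, mul_ite, mul_one, mul_zero,
                  Finset.sum_ite_eq, Finset.mem_univ, if_true, sliceBelow]
                congr 1
                ext y
                split_ifs with hy
                · rfl
                · congr 1
                  exact Fin.ext (by simp; omega)
              rw [this]
              exact Submodule.sum_mem _ fun s _ =>
                Submodule.smul_mem _ _ (Submodule.subset_span ⟨s, rfl⟩)
            have h3 := finrank_range_le_card (R := ℂ)
              (fun (s : A) (σ : Fin (i + 1) → A) => if σ (Fin.last i) = s then (1 : ℂ) else 0)
            exact (Submodule.finrank_mono hle).trans (h3.trans hA))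
      exact ⟨g, h1, fun l => h2 (Submodule.subset_span ⟨l, rfl⟩), fun h => by omega⟩
  choose! g hg1 hg2 hg3 using base
  -- Behind the last site the family is the indicator of `0`, which forces the last bond to take the
  -- value `0`.
  let G : ℕ → Fin χ → (Fin (n + 1) → A) → ℂ := fun i =>
    if i ≤ n then g i else fun b _ => if b = 0 then 1 else 0
  have hG2 : ∀ i ≤ n + 1, ∀ l, sliceBelow f i l ∈ Submodule.span ℂ (Set.range (G i)) := by
    intro i hi l
    by_cases h : i ≤ n
    · simpa [G, h] using hg2 i h l
    · obtain rfl : i = n + 1 := by omega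
      have : sliceBelow f (n + 1) l = f l • G (n + 1) 0 := by
        ext σ
        simp only [sliceBelow, G, if_neg h, Pi.smul_apply, smul_eq_mul, if_true, mul_one]
        congr 1
        ext y
        rw [if_pos y.isLt]
      rw [this]
      exact Submodule.smul_mem _ _ (Submodule.subset_span ⟨0, rfl⟩)
  -- Fixing the value at site `i` maps the span of the slices at `i` into that at `i + 1`. The
  -- coefficients of this map are the tensor at site `i`.
  have step : ∀ i (hi : i < n + 1) a s, ∃ c : Fin χ → ℂ, ∀ σ,
      G i a (Function.update σ ⟨i, hi⟩ s) = ∑ b, c b * G (i + 1) b σ := by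
    intro i hi a s
    let T : ((Fin (n + 1) → A) → ℂ) →ₗ[ℂ] ((Fin (n + 1) → A) → ℂ) :=
      LinearMap.funLeft ℂ ℂ fun σ => Function.update σ ⟨i, hi⟩ s
    have hT : T (G i a) ∈ Submodule.span ℂ (Set.range (G (i + 1))) := by
      have h1 : G i a ∈ Submodule.span ℂ (Set.range (sliceBelow f i)) := by
        have : i ≤ n := by omega
        simpa [G, this] using hg1 i this a
      have h2 : T (G i a) ∈ (Submodule.span ℂ (Set.range (sliceBelow f i))).map T :=
        Submodule.mem_map_of_mem h1
      rw [Submodule.map_span] at h2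
      refine Submodule.span_le.mpr ?_ h2
      rintro _ ⟨_, ⟨l, rfl⟩, rfl⟩
      have : T (sliceBelow f i l) = sliceBelow f (i + 1) (Function.update l ⟨i, hi⟩ s) := by
        ext σ
        exact slice_update i hi l σ s
      rw [this]
      exact hG2 (i + 1) (by omega) _
    obtain ⟨c, hc⟩ := (Submodule.mem_span_range_iff_exists_fun ℂ).mp hT
    refine ⟨c, fun σ => ?_⟩
    have := congrFun hc σ
    simp only [Finset.sum_apply, Pi.smul_apply, smul_eq_mul] at this
    exact this.symm
  choose c hc using step
  let N : ℕ → Fin χ → Fin χ → A → ℂ := fun i a b s =>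
    if hi : i < n + 1 then (if i = n then (if b = 0 then c i hi a s b else 0) else c i hi a s b)
    else 0
  refine ⟨N, fun a b s hb => ?_, fun σ => ?_⟩
  · simp [N, hb]
  have h0 : f σ = ∑ a, G 0 a σ := by
    have := congrFun (hg3 0 (Nat.zero_le n) rfl) σ
    rw [Finset.sum_apply] at this
    simpa [G] using this.symm
  let s : ℕ → A := fun y => if h : y < n + 1 then σ ⟨y, h⟩ else σ 0
  rw [h0, sum_path_backward (fun i a => G i a σ) (fun i a b => N i a b (s i)) (n + 1)]
  · refine Finset.sum_congr rfl fun β _ => ?_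
    rw [Fin.prod_univ_castSucc, Fin.prod_univ_castSucc]
    simp only [G]
    rw [if_neg (by omega)]
    by_cases hβ : β (Fin.last (n + 1)) = 0
    · rw [if_pos hβ, mul_one]
      congr 1
      · refine Finset.prod_congr rfl fun y _ => ?_
        congr 1
        simp only [s, Fin.val_castSucc]
        rw [dif_pos (by omega)]
        rfl
      · simp [s, Fin.last]
    · rw [if_neg hβ, mul_zero]
      symm
      apply mul_eq_zero_of_right
      simp [N, hβ]
  · intro i hi a
    have h1 := hc i hi a (s i) σ
    have h2 : Function.update σ ⟨i, hi⟩ (s i) = σ := by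
      have : i ≤ n := by omega
      simp [s, this]
    rw [h2] at h1
    rw [h1]
    refine Finset.sum_congr rfl fun b _ => ?_
    simp only [N, dif_pos hi]
    by_cases hn : i = n
    · subst hn
      by_cases hb : b = 0
      · simp [hb]
      · simp [G, hb]
    · simp [hn]

end TensorTrain

/-! ### Operators on regions of the lattice, local algebras, and matrix elements with respect to a
region. -/

section Locality

variable {n D : ℕ}

/-- Splitting configurations into their parts on `R` and off `R` turns `amp` into tensoring with
`1`, so that its algebraic properties become those of the Kronecker product. -/
theorem amp_eq_submatrix (R : Finset (Site n)) (B : Matrix (RCfg D R) (RCfg D R) ℂ) :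
    amp R B = (B ⊗ₖ (1 : Matrix ({s // s ∉ R} → Fin D) ({s // s ∉ R} → Fin D) ℂ)).submatrix
      (Equiv.piEquivPiSubtypeProd (· ∈ R) fun _ => Fin D)
      (Equiv.piEquivPiSubtypeProd (· ∈ R) fun _ => Fin D) := by
  ext σ τ
  simp only [amp, Matrix.of_apply, Matrix.submatrix_apply, Matrix.kroneckerMap_apply,
    Matrix.one_apply, mul_ite, mul_one, mul_zero, Equiv.piEquivPiSubtypeProd_apply]
  congr 1
  simp [funext_iff]

/-- `amp` as a homomorphism of algebras. -/
def ampHom (R : Finset (Site n)) : Matrix (RCfg D R) (RCfg D R) ℂ →ₐ[ℂ] Op n D :=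
  AlgHom.ofLinearMap
    { toFun := amp R
      map_add' := fun A B => by ext σ τ; simp only [amp, Matrix.of_apply, Matrix.add_apply]; split_ifs <;> simp
      map_smul' := fun c A => by ext σ τ; simp only [amp, Matrix.of_apply, Matrix.smul_apply, RingHom.id_apply]; split_ifs <;> simp }
    (by
      change amp R 1 = 1
      rw [amp_eq_submatrix, Matrix.one_kronecker_one, Matrix.submatrix_one_equiv])
    (fun A B => by
      change amp R (A * B) = amp R A * amp R B
      rw [amp_eq_submatrix, amp_eq_submatrix, amp_eq_submatrix, Matrix.submatrix_mul_equiv,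
        ← Matrix.mul_kronecker_mul, Matrix.one_mul])

theorem ampHom_apply (R : Finset (Site n)) (B : Matrix (RCfg D R) (RCfg D R) ℂ) :
    ampHom R B = amp R B := rfl

theorem amp_mul (R : Finset (Site n)) (A B : Matrix (RCfg D R) (RCfg D R) ℂ) :
    amp R (A * B) = amp R A * amp R B := map_mul (ampHom R) A B

theorem amp_one (R : Finset (Site n)) : amp R (1 : Matrix (RCfg D R) (RCfg D R) ℂ) = 1 :=
  map_one (ampHom R)

theorem amp_sub (R : Finset (Site n)) (A B : Matrix (RCfg D R) (RCfg D R) ℂ) :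
    amp R (A - B) = amp R A - amp R B := map_sub (ampHom R) A B

theorem amp_conjTranspose (R : Finset (Site n)) (A : Matrix (RCfg D R) (RCfg D R) ℂ) :
    amp R Aᴴ = (amp R A)ᴴ := by
  rw [amp_eq_submatrix, amp_eq_submatrix, Matrix.conjTranspose_submatrix,
    Matrix.conjTranspose_kronecker, Matrix.conjTranspose_one]

/-- The configuration equal to `c` on `R` and to `σ` elsewhere. -/
def merge (R : Finset (Site n)) (c : RCfg D R) (σ : Cfg n D) : Cfg n D :=
  fun s => if h : s ∈ R then c ⟨s, h⟩ else σ s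

/-- The restriction of a configuration. -/
def restr (R : Finset (Site n)) (σ : Cfg n D) : RCfg D R := fun s => σ s

@[simp]
theorem merge_restr (R : Finset (Site n)) (σ : Cfg n D) : merge R (restr R σ) σ = σ := by
  ext s; simp [merge, restr]

@[simp]
theorem restr_merge (R : Finset (Site n)) (c : RCfg D R) (σ : Cfg n D) :
    restr R (merge R c σ) = c := by
  ext s; simp [merge, restr]

@[simp]
theorem merge_merge (R : Finset (Site n)) (c d : RCfg D R) (σ : Cfg n D) :
    merge R c (merge R d σ) = merge R c σ := by
  ext s; by_cases h : s ∈ R <;> simp [merge, h]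

theorem merge_of_mem {R : Finset (Site n)} (c : RCfg D R) (σ : Cfg n D) {s : Site n} (h : s ∈ R) :
    merge R c σ s = c ⟨s, h⟩ := by simp [merge, h]

theorem merge_of_notMem {R : Finset (Site n)} (c : RCfg D R) (σ : Cfg n D) {s : Site n}
    (h : s ∉ R) : merge R c σ s = σ s := by simp [merge, h]

theorem amp_injective [NeZero D] (R : Finset (Site n)) :
    Function.Injective (amp (D := D) R) := by
  intro A B h
  ext c d
  have := congrFun (congrFun h (merge R c 0)) (merge R d 0)
  have h1 : ∀ s, s ∉ R → merge R c 0 s = merge R d 0 s := fun s hs => by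
    rw [merge_of_notMem _ _ hs, merge_of_notMem _ _ hs]
  have h2 : ∀ c : RCfg D R, (fun s : {s // s ∈ R} => merge R c 0 s) = c := fun c =>
    restr_merge R c 0
  simpa only [amp, Matrix.of_apply, if_pos h1, h2] using this

theorem amp_eq_zero_iff [NeZero D] {R : Finset (Site n)} {B : Matrix (RCfg D R) (RCfg D R) ℂ} :
    amp R B = 0 ↔ B = 0 :=
  ⟨fun h => amp_injective R (h.trans (map_zero (ampHom R)).symm), fun h => by
    rw [h]; exact map_zero (ampHom R)⟩

theorem isProjector_amp {R : Finset (Site n)} {P : Matrix (RCfg D R) (RCfg D R) ℂ}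
    (h : IsProjector P) : IsProjector (amp R P) := by
  refine ⟨?_, by rw [← amp_mul, h.2]⟩
  unfold Matrix.IsHermitian
  rw [← amp_conjTranspose, h.1.eq]

theorem isProjector_of_amp [NeZero D] {R : Finset (Site n)} {P : Matrix (RCfg D R) (RCfg D R) ℂ}
    (h : IsProjector (amp R P)) : IsProjector P := by
  refine ⟨amp_injective R ?_, amp_injective R ?_⟩
  · rw [amp_conjTranspose, h.1.eq]
  · rw [amp_mul, h.2]

/-- The operators which act trivially outside of `R`. -/
def localAlgebra (D : ℕ) (R : Finset (Site n)) : Subalgebra ℂ (Op n D) := (ampHom R).range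

theorem amp_mem (R : Finset (Site n)) (B : Matrix (RCfg D R) (RCfg D R) ℂ) :
    amp R B ∈ localAlgebra D R := ⟨B, rfl⟩

theorem exists_amp {R : Finset (Site n)} {A : Op n D} (h : A ∈ localAlgebra D R) :
    ∃ B, A = amp R B := by
  obtain ⟨B, rfl⟩ := h
  exact ⟨B, rfl⟩

theorem localAlgebra_eq_zero {R : Finset (Site n)} {A : Op n D} (h : A ∈ localAlgebra D R)
    {σ τ : Cfg n D} {s : Site n} (hs : s ∉ R) (hne : σ s ≠ τ s) : A σ τ = 0 := by
  obtain ⟨B, rfl⟩ := h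
  exact if_neg fun hh => hne (hh s hs)

theorem localAlgebra_congr {R : Finset (Site n)} {A : Op n D} (h : A ∈ localAlgebra D R)
    {σ τ σ' τ' : Cfg n D} (h1 : ∀ s, s ∉ R → σ s = τ s) (h2 : ∀ s, s ∉ R → σ' s = τ' s)
    (h3 : ∀ s ∈ R, σ s = σ' s) (h4 : ∀ s ∈ R, τ s = τ' s) : A σ τ = A σ' τ' := by
  obtain ⟨B, rfl⟩ := h
  change (if _ then _ else _) = (if _ then _ else _)
  rw [if_pos h1, if_pos h2]
  congr 1
  · ext s; rw [h3 s s.2]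
  · ext s; rw [h4 s s.2]

/-- Membership is tested entrywise; the operator on `R` is read off from configurations extended by
the basis state `0`, which is why `D` must be nonzero. -/
theorem mem_localAlgebra [NeZero D] {R : Finset (Site n)} {A : Op n D}
    (h0 : ∀ σ τ, ∀ s, s ∉ R → σ s ≠ τ s → A σ τ = 0)
    (h : ∀ σ τ σ' τ' : Cfg n D, (∀ s, s ∉ R → σ s = τ s) → (∀ s, s ∉ R → σ' s = τ' s) →
      (∀ s ∈ R, σ s = σ' s) → (∀ s ∈ R, τ s = τ' s) → A σ τ = A σ' τ') :
    A ∈ localAlgebra D R := by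
  refine ⟨Matrix.of fun c d => A (merge R c 0) (merge R d 0), ?_⟩
  ext σ τ
  change (if _ then _ else _) = _
  split_ifs with hst
  · refine h _ _ _ _ (fun s hs => ?_) hst (fun s hs => ?_) (fun s hs => ?_)
    · rw [merge_of_notMem _ _ hs, merge_of_notMem _ _ hs]
    · rw [merge_of_mem _ _ hs]
    · rw [merge_of_mem _ _ hs]
  · push Not at hst
    obtain ⟨s, hs, hne⟩ := hst
    exact (h0 σ τ s hs hne).symm

theorem localAlgebra_mono [NeZero D] {R S : Finset (Site n)} (h : R ⊆ S) :
    localAlgebra D R ≤ localAlgebra D S := by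
  intro A hA
  refine mem_localAlgebra (fun σ τ s hs hne => localAlgebra_eq_zero hA (fun h' => hs (h h')) hne) ?_
  intro σ τ σ' τ' h1 h2 h3 h4
  by_cases hR : ∀ s, s ∉ R → σ s = τ s
  · refine localAlgebra_congr hA hR (fun s hs => ?_) (fun s hs => h3 s (h hs))
      fun s hs => h4 s (h hs)
    by_cases hS : s ∈ S
    · rw [← h3 s hS, ← h4 s hS, hR s hs]
    · exact h2 s hS
  · push Not at hR
    obtain ⟨s, hs, hne⟩ := hR
    have hS : s ∈ S := by
      by_contra hS
      exact hne (h1 s hS)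
    rw [localAlgebra_eq_zero hA hs hne,
      localAlgebra_eq_zero hA hs (by rw [← h3 s hS, ← h4 s hS]; exact hne)]

/-- Only one intermediate configuration contributes: `σ` overwritten by `τ` on `R`. The symmetry of
the result gives commutation of operators on disjoint regions. -/
theorem amp_mul_amp_apply {R S : Finset (Site n)} (hd : Disjoint R S)
    (A : Matrix (RCfg D R) (RCfg D R) ℂ) (B : Matrix (RCfg D S) (RCfg D S) ℂ) (σ τ : Cfg n D) :
    (amp R A * amp S B) σ τ = if ∀ s, s ∉ R → s ∉ S → σ s = τ s then
      A (restr R σ) (restr R τ) * B (restr S σ) (restr S τ) else 0 := by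
  have hd' : ∀ {s}, s ∈ S → s ∉ R := fun hs hr => Finset.disjoint_left.mp hd hr hs
  rw [Matrix.mul_apply, Finset.sum_eq_single (merge R (restr R τ) σ)]
  · have h1 : amp R A σ (merge R (restr R τ) σ) = A (restr R σ) (restr R τ) := by
      change (if _ then _ else _) = _
      rw [if_pos fun s hs => (merge_of_notMem _ _ hs).symm]
      congr 1
      exact restr_merge R _ _
    have h2 : amp S B (merge R (restr R τ) σ) τ =
        if ∀ s, s ∉ R → s ∉ S → σ s = τ s then B (restr S σ) (restr S τ) else 0 := by
      change (if _ then _ else _) = _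
      have : (∀ s, s ∉ S → merge R (restr R τ) σ s = τ s) ↔
          ∀ s, s ∉ R → s ∉ S → σ s = τ s := by
        refine ⟨fun h s hR hS => ?_, fun h s hS => ?_⟩
        · rw [← h s hS, merge_of_notMem _ _ hR]
        · by_cases hR : s ∈ R
          · rw [merge_of_mem _ _ hR]; rfl
          · rw [merge_of_notMem _ _ hR, h s hR hS]
      rw [if_congr this rfl rfl]
      congr 2
      ext s
      rw [merge_of_notMem _ _ (hd' s.2)]; rfl
    rw [h1, h2, mul_ite, mul_zero]
  · intro ρ _ hρ
    by_contra hne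
    apply hρ
    have h1 : ∀ s, s ∉ R → σ s = ρ s := by
      by_contra h
      exact hne (mul_eq_zero_of_left (if_neg h) _)
    have h2 : ∀ s, s ∉ S → ρ s = τ s := by
      by_contra h
      exact hne (mul_eq_zero_of_right _ (if_neg h))
    ext s
    by_cases hR : s ∈ R
    · rw [merge_of_mem _ _ hR, h2 s fun h => hd' h hR]; rfl
    · rw [merge_of_notMem _ _ hR, h1 s hR]
  · simp

theorem commute_of_disjoint {R S : Finset (Site n)} (hd : Disjoint R S) {A B : Op n D}
    (hA : A ∈ localAlgebra D R) (hB : B ∈ localAlgebra D S) : Commute A B := by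
  obtain ⟨A, rfl⟩ := hA
  obtain ⟨B, rfl⟩ := hB
  change amp R A * amp S B = amp S B * amp R A
  ext σ τ
  rw [amp_mul_amp_apply hd, amp_mul_amp_apply hd.symm]
  refine if_congr ⟨fun h s h1 h2 => h s h2 h1, fun h s h1 h2 => h s h2 h1⟩ (mul_comm _ _) rfl

/-! ### Slices -/

/-- The matrix element, with respect to the factor `R`, of an operator. -/
def slice (R : Finset (Site n)) (c d : RCfg D R) (A : Op n D) : Op n D :=
  Matrix.of fun σ τ => if restr R σ = restr R τ then A (merge R c σ) (merge R d τ) else 0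

theorem amp_single_mul_apply (R : Finset (Site n)) (c d : RCfg D R) (A : Op n D) (σ τ : Cfg n D) :
    (amp R (Matrix.single c d 1) * A) σ τ = if restr R σ = c then A (merge R d σ) τ else 0 := by
  rw [Matrix.mul_apply, Finset.sum_eq_single (merge R d σ)]
  · have : amp R (Matrix.single c d 1) σ (merge R d σ) = if restr R σ = c then 1 else 0 := by
      change (if _ then _ else _) = _
      rw [if_pos fun s hs => (merge_of_notMem _ _ hs).symm]
      change Matrix.single c d 1 (restr R σ) (restr R (merge R d σ)) = _
      rw [restr_merge, Matrix.single_apply]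
      simp [eq_comm]
    rw [this, ite_mul, one_mul, zero_mul]
  · intro ρ _ hρ
    apply mul_eq_zero_of_left
    change (if _ then _ else _) = _
    split_ifs with h
    · change Matrix.single c d 1 (restr R σ) (restr R ρ) = 0
      rw [Matrix.single_apply, if_neg]
      rintro ⟨-, h2⟩
      apply hρ
      ext s
      by_cases hR : s ∈ R
      · rw [merge_of_mem _ _ hR, h2]; rfl
      · rw [merge_of_notMem _ _ hR, h s hR]
    · rfl
  · simp

theorem mul_amp_single_apply (R : Finset (Site n)) (c d : RCfg D R) (A : Op n D) (σ τ : Cfg n D) :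
    (A * amp R (Matrix.single c d 1)) σ τ = if restr R τ = d then A σ (merge R c τ) else 0 := by
  have h := amp_single_mul_apply R d c Aᴴ τ σ
  have h2 : amp R (Matrix.single d c 1) = (amp R (Matrix.single c d (1 : ℂ)))ᴴ := by
    rw [← amp_conjTranspose, Matrix.conjTranspose_single, star_one]
  rw [h2, ← Matrix.conjTranspose_mul] at h
  have h3 := congrArg star h
  rw [Matrix.conjTranspose_apply, star_star] at h3
  rw [h3, apply_ite star, Matrix.conjTranspose_apply, star_star, star_zero]

/-- In this form a slice is a sandwich of `A` between matrix units on `R`, so commutation with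
operators off `R`, products and sums become formal. -/
theorem slice_eq_sum (R : Finset (Site n)) (c d : RCfg D R) (A : Op n D) :
    slice R c d A =
      ∑ e, amp R (Matrix.single e c 1) * A * amp R (Matrix.single d e 1) := by
  ext σ τ
  rw [Matrix.sum_apply]
  simp only [mul_amp_single_apply, amp_single_mul_apply, slice, Matrix.of_apply]
  simp only [Finset.sum_ite_eq, Finset.mem_univ, if_true]

theorem sum_amp_mul_slice (R : Finset (Site n)) (A : Op n D) :
    A = ∑ c, ∑ d, amp R (Matrix.single c d 1) * slice R c d A := by
  ext σ τ
  simp only [Matrix.sum_apply, amp_single_mul_apply, slice, Matrix.of_apply, restr_merge,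
    merge_merge]
  rw [Finset.sum_eq_single (restr R σ) (fun c _ hc => by simp [hc.symm]) (by simp),
    Finset.sum_eq_single (restr R τ) (fun c _ hc => by simp [hc]) (by simp)]
  simp

theorem slice_commute {R : Finset (Site n)} {X A : Op n D}
    (hX : X ∈ localAlgebra D Rᶜ) (h : Commute X A) (c d : RCfg D R) :
    Commute X (slice R c d A) := by
  have hR : ∀ B, Commute X (amp R B) := fun B =>
    commute_of_disjoint (disjoint_compl_left) hX (amp_mem R B)
  rw [slice_eq_sum]
  exact Commute.sum_right _ _ _ fun e _ => ((hR _).mul_right h).mul_right (hR _)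

/-- If `X` commutes with all operators on `R` and with the slices of `A` then it commutes
with `A`. -/
theorem commute_of_slice {R : Finset (Site n)} {X A : Op n D}
    (hX : X ∈ localAlgebra D Rᶜ) (h : ∀ c d, Commute X (slice R c d A)) : Commute X A := by
  rw [sum_amp_mul_slice R A]
  exact Commute.sum_right _ _ _ fun c _ => Commute.sum_right _ _ _ fun d _ =>
    (commute_of_disjoint (disjoint_compl_left) hX (amp_mem R _)).mul_right (h c d)

theorem slice_mul_right {R : Finset (Site n)} {X : Op n D} (hX : X ∈ localAlgebra D Rᶜ)
    (A : Op n D) (c d : RCfg D R) : slice R c d (A * X) = slice R c d A * X := by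
  rw [slice_eq_sum, slice_eq_sum, Finset.sum_mul]
  refine Finset.sum_congr rfl fun e _ => ?_
  have := (commute_of_disjoint (disjoint_compl_left) hX
    (amp_mem R (Matrix.single d e 1))).eq
  simp only [Matrix.mul_assoc, this]

theorem slice_mul_left {R : Finset (Site n)} {X : Op n D} (hX : X ∈ localAlgebra D Rᶜ)
    (A : Op n D) (c d : RCfg D R) : slice R c d (X * A) = X * slice R c d A := by
  rw [slice_eq_sum, slice_eq_sum, Finset.mul_sum]
  refine Finset.sum_congr rfl fun e _ => ?_
  have := (commute_of_disjoint (disjoint_compl_left) hX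
    (amp_mem R (Matrix.single e c 1))).eq
  simp only [← Matrix.mul_assoc, this]

/-- This is matrix multiplication for matrices with operator entries; the resolution of the identity
on `R` is inserted between the factors. -/
theorem slice_mul (R : Finset (Site n)) (A B : Op n D) (c d : RCfg D R) :
    slice R c d (A * B) = ∑ e, slice R c e A * slice R e d B := by
  have h1 : ∑ e : RCfg D R, amp R (Matrix.single e e (1 : ℂ)) = 1 := by
    have := map_sum (ampHom (D := D) R) (fun e => Matrix.single e e (1 : ℂ)) Finset.univ
    rw [Matrix.sum_single_one, map_one] at this
    exact this.symm
  have h2 : ∀ e, slice R c e A * slice R e d B =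
      ∑ f, amp R (Matrix.single f c 1) * A * amp R (Matrix.single e e 1) * B *
        amp R (Matrix.single d f 1) := by
    intro e
    rw [slice_eq_sum, slice_eq_sum, Finset.sum_mul]
    refine Finset.sum_congr rfl fun f _ => ?_
    rw [Finset.mul_sum, Finset.sum_eq_single f]
    · have : amp R (Matrix.single e f (1 : ℂ)) * amp R (Matrix.single f e 1) =
          amp R (Matrix.single e e 1) := by
        rw [← amp_mul, Matrix.single_mul_single_same, mul_one]
      rw [← this]
      simp only [Matrix.mul_assoc]
    · intro g _ hg
      have : amp R (Matrix.single e f (1 : ℂ)) * amp R (Matrix.single g e 1) = 0 := by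
        rw [← amp_mul, Matrix.single_mul_single_of_ne _ _ _ _ hg.symm]
        exact map_zero (ampHom R)
      calc _ = amp R (Matrix.single f c 1) * A * (amp R (Matrix.single e f (1 : ℂ)) *
            amp R (Matrix.single g e 1)) * B * amp R (Matrix.single d g 1) := by
            simp only [Matrix.mul_assoc]
        _ = 0 := by rw [this]; simp
    · simp
  simp only [h2]
  rw [Finset.sum_comm, slice_eq_sum]
  refine Finset.sum_congr rfl fun f _ => ?_
  rw [← Finset.sum_mul, ← Finset.sum_mul, ← Finset.mul_sum, h1, Matrix.mul_one]
  simp only [Matrix.mul_assoc]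

theorem slice_conjTranspose (R : Finset (Site n)) (A : Op n D) (c d : RCfg D R) :
    (slice R c d A)ᴴ = slice R d c Aᴴ := by
  ext σ τ
  simp only [Matrix.conjTranspose_apply, slice, Matrix.of_apply, apply_ite star, star_zero]
  exact if_congr eq_comm rfl rfl

theorem slice_zero (R : Finset (Site n)) (c d : RCfg D R) : slice R c d (0 : Op n D) = 0 := by
  ext σ τ; simp [slice]

theorem slice_add (R : Finset (Site n)) (A B : Op n D) (c d : RCfg D R) :
    slice R c d (A + B) = slice R c d A + slice R c d B := by
  simp only [slice_eq_sum, Matrix.mul_add, Matrix.add_mul, Finset.sum_add_distrib]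

/-- The slices of an operator on the complement. -/
theorem slice_of_mem_compl {R : Finset (Site n)} {A : Op n D} (hA : A ∈ localAlgebra D Rᶜ)
    (c d : RCfg D R) : slice R c d A = if c = d then A else 0 := by
  have h : ∀ B, Commute A (amp R B) := fun B =>
    commute_of_disjoint (disjoint_compl_left) hA (amp_mem R B)
  ext σ τ
  simp only [slice, Matrix.of_apply]
  split_ifs with h1 h2 h2
  · subst h2
    by_cases h3 : ∀ s, s ∉ Rᶜ → σ s = τ s
    · refine localAlgebra_congr hA (fun s hs => ?_) h3 (fun s hs => ?_) fun s hs => ?_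
      · simp only [Finset.mem_compl, not_not] at hs
        rw [merge_of_mem _ _ hs, merge_of_mem _ _ hs]
      · exact merge_of_notMem _ _ (Finset.mem_compl.mp hs)
      · exact merge_of_notMem _ _ (Finset.mem_compl.mp hs)
    · exact absurd (fun s hs => congrFun h1 ⟨s, by simpa using hs⟩) h3
  · obtain ⟨s, hs⟩ := Function.ne_iff.mp h2
    refine localAlgebra_eq_zero hA (s := s) (by simp) ?_
    rw [merge_of_mem _ _ s.2, merge_of_mem _ _ s.2]
    exact hs
  · obtain ⟨s, hs⟩ := Function.ne_iff.mp h1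
    exact (localAlgebra_eq_zero hA (s := s) (by simp) hs).symm
  · rfl

theorem slice_mem [NeZero D] {R S : Finset (Site n)} {A : Op n D} (hA : A ∈ localAlgebra D S)
    (c d : RCfg D R) : slice R c d A ∈ localAlgebra D (S \ R) := by
  refine mem_localAlgebra ?_ ?_
  · intro σ τ s hs hne
    simp only [slice, Matrix.of_apply]
    split_ifs with h
    · have hR : s ∉ R := fun h' => hne (congrFun h ⟨s, h'⟩)
      refine localAlgebra_eq_zero hA (s := s) (fun h' => hs (Finset.mem_sdiff.mpr ⟨h', hR⟩)) ?_
      rw [merge_of_notMem _ _ hR, merge_of_notMem _ _ hR]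
      exact hne
    · rfl
  · intro σ τ σ' τ' h1 h2 h3 h4
    have hR1 : restr R σ = restr R τ := funext fun s => h1 s (by simp)
    have hR2 : restr R σ' = restr R τ' := funext fun s => h2 s (by simp)
    simp only [slice, Matrix.of_apply, if_pos hR1, if_pos hR2]
    by_cases hS : ∀ s, s ∉ S → merge R c σ s = merge R d τ s
    · refine localAlgebra_congr hA hS (fun s hs => ?_) (fun s hs => ?_) fun s hs => ?_
      · by_cases hR : s ∈ R
        · have := hS s hs
          rwa [merge_of_mem _ _ hR, merge_of_mem _ _ hR] at this ⊢
        · rw [merge_of_notMem _ _ hR, merge_of_notMem _ _ hR]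
          exact h2 s fun h => hs (Finset.mem_sdiff.mp h).1
      · by_cases hR : s ∈ R
        · rw [merge_of_mem _ _ hR, merge_of_mem _ _ hR]
        · rw [merge_of_notMem _ _ hR, merge_of_notMem _ _ hR]
          exact h3 s (Finset.mem_sdiff.mpr ⟨hs, hR⟩)
      · by_cases hR : s ∈ R
        · rw [merge_of_mem _ _ hR, merge_of_mem _ _ hR]
        · rw [merge_of_notMem _ _ hR, merge_of_notMem _ _ hR]
          exact h4 s (Finset.mem_sdiff.mpr ⟨hs, hR⟩)
    · push Not at hS
      obtain ⟨s, hs, hne⟩ := hS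
      rw [localAlgebra_eq_zero hA hs hne]
      refine (localAlgebra_eq_zero hA hs ?_).symm
      by_cases hR : s ∈ R
      · rwa [merge_of_mem _ _ hR, merge_of_mem _ _ hR] at hne ⊢
      · have hsS : s ∉ S \ R := fun h => hs (Finset.mem_sdiff.mp h).1
        rw [merge_of_notMem _ _ hR, merge_of_notMem _ _ hR] at hne ⊢
        exact absurd (h1 s hsS) hne

end Locality

/-! ### Operators on a pair of regions, interaction algebras through slices, and partial traces
through traces. -/

section Pairs

variable {n D : ℕ} [NeZero D]

theorem glue_of_mem_left {R S : Finset (Site n)} (p : RCfg D R × RCfg D S) {s : Site n}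
    (h : s ∈ R) : glue R S p s = p.1 ⟨s, h⟩ := by simp [glue, h]

theorem glue_of_mem_right {R S : Finset (Site n)} (hd : Disjoint R S) (p : RCfg D R × RCfg D S)
    {s : Site n} (h : s ∈ S) : glue R S p s = p.2 ⟨s, h⟩ := by
  simp [glue, h, Finset.disjoint_right.mp hd h]

theorem glue_of_notMem {R S : Finset (Site n)} (p : RCfg D R × RCfg D S)
    {s : Site n} (h : s ∉ R ∪ S) : glue R S p s = 0 := by
  rw [Finset.mem_union, not_or] at h
  simp [glue, h.1, h.2]

theorem glue_injective {R S : Finset (Site n)} (hd : Disjoint R S) :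
    Function.Injective (glue (D := D) R S) := by
  intro p q h
  refine Prod.ext (funext fun s => ?_) (funext fun s => ?_)
  · have := congrFun h s
    rwa [glue_of_mem_left _ s.2, glue_of_mem_left _ s.2] at this
  · have := congrFun h s
    rwa [glue_of_mem_right hd _ s.2, glue_of_mem_right hd _ s.2] at this

theorem glue_restr {R S : Finset (Site n)} {σ : Cfg n D} (h : ∀ s, s ∉ R ∪ S → σ s = 0) :
    glue R S (restr R σ, restr S σ) = σ := by
  ext s
  by_cases hR : s ∈ R
  · rw [glue_of_mem_left _ hR]; rfl
  · by_cases hS : s ∈ S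
    · simp [glue, hR, hS, restr]
    · rw [glue_of_notMem _ (by simp [hR, hS]), h s (by simp [hR, hS])]

/-- `glue` extends by `0` outside of `R ∪ S`. Locality of the left factor already excludes
intermediate configurations with other values there, so nothing is needed about `B`. -/
theorem onPair_mul {R S : Finset (Site n)} (hd : Disjoint R S) {A : Op n D}
    (hA : A ∈ localAlgebra D (R ∪ S)) (B : Op n D) :
    onPair R S (A * B) = onPair R S A * onPair R S B := by
  ext p q
  simp only [onPair, Matrix.submatrix_apply, Matrix.mul_apply]
  symm
  refine Fintype.sum_of_injective (glue R S) (glue_injective hd) _ _ (fun ρ hρ => ?_) fun _ => rfl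
  obtain ⟨s, hs, hne⟩ : ∃ s, s ∉ R ∪ S ∧ ρ s ≠ 0 := by
    by_contra! h
    exact hρ ⟨_, glue_restr h⟩
  rw [localAlgebra_eq_zero hA hs, zero_mul]
  rw [glue_of_notMem _ hs]
  exact hne.symm

theorem onPair_eq_zero {R S : Finset (Site n)} (hd : Disjoint R S) {A : Op n D}
    (hA : A ∈ localAlgebra D (R ∪ S)) (h : onPair R S A = 0) : A = 0 := by
  ext σ τ
  by_cases hst : ∀ s, s ∉ R ∪ S → σ s = τ s
  · have := congrFun (congrFun h (restr R σ, restr S σ)) (restr R τ, restr S τ)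
    refine Eq.trans ?_ this
    refine localAlgebra_congr hA hst (fun s hs => ?_) (fun s hs => ?_) fun s hs => ?_
    · rw [glue_of_notMem _ hs, glue_of_notMem _ hs]
    · rcases Finset.mem_union.mp hs with h' | h'
      · rw [glue_of_mem_left _ h']; rfl
      · rw [glue_of_mem_right hd _ h']; rfl
    · rcases Finset.mem_union.mp hs with h' | h'
      · rw [glue_of_mem_left _ h']; rfl
      · rw [glue_of_mem_right hd _ h']; rfl
  · push Not at hst
    obtain ⟨s, hs, hne⟩ := hst
    exact localAlgebra_eq_zero hA hs hne

omit [NeZero D] in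
theorem onPair_sub [NeZero D] (R S : Finset (Site n)) (A B : Op n D) :
    onPair R S (A - B) = onPair R S A - onPair R S B := rfl

theorem onPair_amp_right {R S : Finset (Site n)} (hd : Disjoint R S)
    (Y : Matrix (RCfg D S) (RCfg D S) ℂ) :
    onPair R S (amp S Y) = (1 : Matrix (RCfg D R) (RCfg D R) ℂ) ⊗ₖ Y := by
  ext p q
  rw [Matrix.kroneckerMap_apply, Matrix.one_apply, ite_mul, one_mul, zero_mul]
  change (if _ then _ else _) = _
  have h1 : (∀ s, s ∉ S → glue R S p s = glue R S q s) ↔ p.1 = q.1 := by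
    refine ⟨fun h => funext fun s => ?_, fun h s hs => ?_⟩
    · have := h s (Finset.disjoint_left.mp hd s.2)
      rwa [glue_of_mem_left _ s.2, glue_of_mem_left _ s.2] at this
    · by_cases hR : s ∈ R
      · rw [glue_of_mem_left _ hR, glue_of_mem_left _ hR, h]
      · rw [glue_of_notMem _ (by simp [hR, hs]), glue_of_notMem _ (by simp [hR, hs])]
  rw [if_congr h1 rfl rfl]
  congr 2 <;> ext s <;> rw [glue_of_mem_right hd _ s.2]

theorem commute_onPair {R S : Finset (Site n)} (hd : Disjoint R S) {A B : Op n D}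
    (hA : A ∈ localAlgebra D (R ∪ S)) (hB : B ∈ localAlgebra D (R ∪ S)) :
    Commute (onPair R S A) (onPair R S B) ↔ Commute A B := by
  refine ⟨fun h => ?_, fun h => ?_⟩
  · apply sub_eq_zero.mp
    refine onPair_eq_zero hd (sub_mem (mul_mem hA hB) (mul_mem hB hA)) ?_
    rw [onPair_sub, onPair_mul hd hA, onPair_mul hd hB, h.eq, sub_self]
  · change _ = _
    rw [← onPair_mul hd hA, ← onPair_mul hd hB, h.eq]

theorem glue_compl (R : Finset (Site n)) (c : RCfg D R) (d : RCfg D Rᶜ) (σ : Cfg n D)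
    (h : restr R σ = c) : glue R Rᶜ (c, d) = merge Rᶜ d σ := by
  subst h
  ext s
  by_cases hR : s ∈ R
  · rw [glue_of_mem_left _ hR, merge_of_notMem _ _ (by simpa using hR)]; rfl
  · have hR' : s ∈ Rᶜ := by simpa using hR
    rw [merge_of_mem _ _ hR']
    simp [glue, hR]

/-- The generators of an interaction algebra, as operators on the whole lattice. -/
theorem amp_ptrace_onPair (R : Finset (Site n)) (W : Op n D)
    (B : Matrix (RCfg D Rᶜ) (RCfg D Rᶜ) ℂ) :
    amp R (ptrace (onPair R Rᶜ W * ((1 : Matrix (RCfg D R) (RCfg D R) ℂ) ⊗ₖ B))) =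
      ∑ c, ∑ d, B d c • slice Rᶜ c d W := by
  ext σ τ
  simp only [Matrix.sum_apply, Matrix.smul_apply, smul_eq_mul, slice, Matrix.of_apply]
  change (if _ then _ else _) = _
  have h1 : (∀ s, s ∉ R → σ s = τ s) ↔ restr Rᶜ σ = restr Rᶜ τ := by
    refine ⟨fun h => funext fun s => h s (Finset.mem_compl.mp s.2), fun h s hs =>
      congrFun h ⟨s, Finset.mem_compl.mpr hs⟩⟩
  rw [if_congr h1 rfl rfl]
  split_ifs with h
  · simp only [ptrace, Matrix.of_apply, Matrix.mul_apply, Fintype.sum_prod_type,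
      Matrix.kroneckerMap_apply, Matrix.one_apply, ite_mul, one_mul, zero_mul, mul_ite, mul_zero]
    refine Finset.sum_congr rfl fun c _ => ?_
    rw [Finset.sum_comm]
    refine Finset.sum_congr rfl fun d _ => ?_
    rw [Finset.sum_ite_eq' Finset.univ, if_pos (Finset.mem_univ _), mul_comm]
    congr 1
    exact congrArg₂ W (glue_compl R _ c σ rfl) (glue_compl R _ d τ rfl)
  · simp

/-- A partial trace against `B` is a combination of slices over the complement of `R`, and a matrix
unit for `B` isolates one slice. So the slices generate the same algebra. -/
theorem map_interactionAlgebraOn (R : Finset (Site n)) (𝒜 : Subalgebra ℂ (Op n D)) :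
    (interactionAlgebraOn R 𝒜).map (ampHom R) =
      Algebra.adjoin ℂ {x | ∃ W ∈ 𝒜, ∃ c d, x = slice Rᶜ c d W} := by
  unfold interactionAlgebraOn interactionAlgebra
  rw [AlgHom.map_adjoin]
  apply le_antisymm
  · apply Algebra.adjoin_le
    rintro _ ⟨_, ⟨_, ⟨W, hW, rfl⟩, B, rfl⟩, rfl⟩
    rw [ampHom_apply, amp_ptrace_onPair]
    refine sum_mem fun c _ => sum_mem fun d _ => Subalgebra.smul_mem _ ?_ _
    exact Algebra.subset_adjoin ⟨W, hW, c, d, rfl⟩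
  · apply Algebra.adjoin_le
    rintro _ ⟨W, hW, c, d, rfl⟩
    apply Algebra.subset_adjoin
    refine ⟨ptrace (onPair R Rᶜ W *
      ((1 : Matrix (RCfg D R) (RCfg D R) ℂ) ⊗ₖ Matrix.single d c 1)),
      ⟨_, ⟨W, hW, rfl⟩, Matrix.single d c 1, rfl⟩, ?_⟩
    rw [ampHom_apply, amp_ptrace_onPair]
    simp only [Matrix.single_apply, ite_smul, one_smul, zero_smul, ite_and]
    rw [Finset.sum_eq_single c (fun c' _ hc => by simp [hc.symm]) (by simp),
      Finset.sum_eq_single d (fun d' _ hd => by simp [hd.symm]) (by simp)]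
    simp

omit [NeZero D] in
/-- Slices with respect to a larger factor on which the operator acts trivially. -/
theorem slice_of_subset {R Q S : Finset (Site n)} (hQS : Q ⊆ S) {W : Op n D}
    (hW : W ∈ localAlgebra D (Q ∪ R)) (hS : Disjoint S R) (c d : RCfg D S) :
    slice S c d W = if ∀ s : {s // s ∈ S}, s.1 ∉ Q → c s = d s then
      slice Q (fun s => c ⟨s, hQS s.2⟩) (fun s => d ⟨s, hQS s.2⟩) W else 0 := by
  split_ifs with hcd
  · ext σ τ
    simp only [slice, Matrix.of_apply]
    by_cases hQ : restr Q σ = restr Q τ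
    · rw [if_pos hQ]
      by_cases hst : ∀ s, s ∉ Q ∪ R → σ s = τ s
      · have : restr S σ = restr S τ := by
          ext s
          by_cases hs : s.1 ∈ Q
          · exact congrArg _ (congrFun hQ ⟨s, hs⟩)
          · have : s.1 ∉ R := Finset.disjoint_left.mp hS s.2
            exact congrArg _ (hst s (by simp [hs, this]))
        rw [if_pos this]
        refine localAlgebra_congr hW (fun s hs => ?_) (fun s hs => ?_) (fun s hs => ?_)
          fun s hs => ?_
        · have hs' : s ∉ Q := fun h => hs (Finset.mem_union_left _ h)
          by_cases h : s ∈ S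
          · rw [merge_of_mem _ _ h, merge_of_mem _ _ h]
            exact hcd ⟨s, h⟩ hs'
          · rw [merge_of_notMem _ _ h, merge_of_notMem _ _ h]
            exact hst s hs
        · have hs' : s ∉ Q := fun h => hs (Finset.mem_union_left _ h)
          rw [merge_of_notMem _ _ hs', merge_of_notMem _ _ hs']
          exact hst s hs
        · by_cases hs' : s ∈ Q
          · rw [merge_of_mem _ _ hs', merge_of_mem _ _ (hQS hs')]
          · have h2 : s ∉ S := by
              rcases Finset.mem_union.mp hs with h | h
              · exact absurd h hs'
              · exact Finset.disjoint_right.mp hS h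
            rw [merge_of_notMem _ _ hs', merge_of_notMem _ _ h2]
        · by_cases hs' : s ∈ Q
          · rw [merge_of_mem _ _ hs', merge_of_mem _ _ (hQS hs')]
          · have h2 : s ∉ S := by
              rcases Finset.mem_union.mp hs with h | h
              · exact absurd h hs'
              · exact Finset.disjoint_right.mp hS h
            rw [merge_of_notMem _ _ hs', merge_of_notMem _ _ h2]
      · push Not at hst
        obtain ⟨s, hs, hne⟩ := hst
        have hs' : s ∉ Q := fun h => hs (Finset.mem_union_left _ h)
        rw [localAlgebra_eq_zero hW hs (σ := merge Q _ σ)]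
        · by_cases h : s ∈ S
          · rw [if_neg]
            exact fun h' => hne (congrFun h' ⟨s, h⟩)
          · split_ifs
            · refine localAlgebra_eq_zero hW hs ?_
              rwa [merge_of_notMem _ _ h, merge_of_notMem _ _ h]
            · rfl
        · rwa [merge_of_notMem _ _ hs', merge_of_notMem _ _ hs']
    · rw [if_neg hQ, if_neg]
      exact fun h => hQ (funext fun s => congrFun h ⟨s, hQS s.2⟩)
  · push Not at hcd
    obtain ⟨s, hs, hne⟩ := hcd
    ext σ τ
    simp only [slice, Matrix.of_apply]
    split_ifs
    · refine localAlgebra_eq_zero hW (s := s.1) ?_ ?_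
      · have : s.1 ∉ R := Finset.disjoint_left.mp hS s.2
        simp [hs, this]
      · rw [merge_of_mem _ _ s.2, merge_of_mem _ _ s.2]
        exact hne
    · rfl

omit [NeZero D] in
-- By the product rule for slices it is enough to control the slices of generators.
theorem slice_mem_of_mem_adjoin (R : Finset (Site n)) (𝒜 : Subalgebra ℂ (Op n D))
    {S : Set (Op n D)} (hS : ∀ W ∈ S, ∀ c d, slice R c d W ∈ 𝒜) {W : Op n D}
    (hW : W ∈ Algebra.adjoin ℂ S) : ∀ c d, slice R c d W ∈ 𝒜 := by
  induction hW using Algebra.adjoin_induction with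
  | mem x h => exact hS x h
  | algebraMap r =>
    intro c d
    rw [slice_of_mem_compl (algebraMap_mem _ r)]
    split_ifs
    · exact algebraMap_mem _ r
    · exact zero_mem _
  | add x y _ _ hx hy => intro c d; rw [slice_add]; exact add_mem (hx c d) (hy c d)
  | mul x y _ _ hx hy =>
    intro c d
    rw [slice_mul]
    exact sum_mem fun e _ => mul_mem (hx c e) (hy e d)

theorem traceOut_apply_eq_trace (R : Finset (Site n)) (A : Op n D) (i j : RCfg D Rᶜ) :
    traceOut R A i j = (A * amp Rᶜ (Matrix.single j i 1)).trace := by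
  simp only [Matrix.trace, Matrix.diag, mul_amp_single_apply]
  rw [← (Equiv.piEquivPiSubtypeProd (· ∈ R) fun _ => Fin D).symm.sum_comp,
    Fintype.sum_prod_type]
  simp only [traceOut, ptrace, Matrix.of_apply, onPair, Matrix.submatrix_apply]
  refine Finset.sum_congr rfl fun c _ => ?_
  rw [Finset.sum_eq_single (fun s : {s // s ∉ R} => i ⟨s.1, Finset.mem_compl.mpr s.2⟩)]
  · have h1 : ∀ i : RCfg D Rᶜ, glue Rᶜ R (i, c) =
        (Equiv.piEquivPiSubtypeProd (· ∈ R) fun _ => Fin D).symm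
          (c, fun s => i ⟨s.1, Finset.mem_compl.mpr s.2⟩) := by
      intro i
      ext s
      by_cases hs : s ∈ R
      · rw [glue_of_mem_right disjoint_compl_left _ hs]; simp [Equiv.piEquivPiSubtypeProd, hs]
      · rw [glue_of_mem_left _ (by simpa using hs)]; simp [Equiv.piEquivPiSubtypeProd, hs]
    rw [if_pos]
    · rw [h1 i, h1 j]
      congr 1
      ext s
      by_cases hs : s ∈ Rᶜ
      · rw [merge_of_mem _ _ hs]
        simp [Equiv.piEquivPiSubtypeProd, Finset.mem_compl.mp hs]
      · rw [merge_of_notMem _ _ hs]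
        have : s ∈ R := by simpa using hs
        simp [Equiv.piEquivPiSubtypeProd, this]
    · ext s
      simp [restr, Equiv.piEquivPiSubtypeProd, Finset.mem_compl.mp s.2]
  · intro d _ hd
    rw [if_neg]
    intro h
    apply hd
    ext s
    have := congrFun h ⟨s.1, Finset.mem_compl.mpr s.2⟩
    simp only [restr, Equiv.piEquivPiSubtypeProd, Equiv.coe_fn_symm_mk, dif_neg s.2] at this
    rw [this]
  · simp

theorem trace_mul_amp (R : Finset (Site n)) (A : Op n D) (E : Matrix (RCfg D Rᶜ) (RCfg D Rᶜ) ℂ) :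
    (A * amp Rᶜ E).trace = (traceOut R A * E).trace := by
  have h1 : amp Rᶜ E = ∑ i, ∑ j, E i j • amp Rᶜ (Matrix.single i j 1) := by
    conv_lhs => rw [Matrix.matrix_eq_sum_single E, ← ampHom_apply]
    simp only [map_sum]
    refine Finset.sum_congr rfl fun i _ => Finset.sum_congr rfl fun j _ => ?_
    rw [← ampHom_apply, ← map_smul, Matrix.smul_single, smul_eq_mul, mul_one]
  rw [h1]
  simp only [Matrix.mul_sum, Matrix.trace_sum, Matrix.mul_smul, Matrix.trace_smul, smul_eq_mul,
    ← traceOut_apply_eq_trace]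
  rw [Finset.sum_comm]
  simp only [Matrix.trace, Matrix.diag, Matrix.mul_apply, mul_comm]

/-- The entries of a partial trace are traces against matrix units on the complement. Proportional
partial traces can therefore be proved by testing full traces, for which cyclicity is available. -/
theorem traceOut_eq_smul {R : Finset (Site n)} {A B : Op n D} {x : ℂ}
    (h : ∀ E : Matrix (RCfg D Rᶜ) (RCfg D Rᶜ) ℂ,
      (A * amp Rᶜ E).trace = x * (B * amp Rᶜ E).trace) :
    traceOut R A = x • traceOut R B := by
  ext i j
  rw [Matrix.smul_apply, traceOut_apply_eq_trace, traceOut_apply_eq_trace, h, smul_eq_mul]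

end Pairs

/-! ### The terms of the Hamiltonian and products of the $P_Z$. -/

section Plaquettes

variable {n D : ℕ}

theorem corner_mem (z : Plaquette n) (a b : Fin 2) : corner z a b ∈ plaqSites z :=
  Finset.mem_image_of_mem (fun p : Fin 2 × Fin 2 => corner z p.1 p.2) (Finset.mem_univ (a, b))

theorem exists_corner {z : Plaquette n} {s : Site n} (h : s ∈ plaqSites z) :
    ∃ a b, s = corner z a b := by
  obtain ⟨p, -, rfl⟩ := Finset.mem_image.mp h
  exact ⟨p.1, p.2, rfl⟩

theorem plaqOp_mem [NeZero D] (z : Plaquette n) (q : Matrix (PCfg D) (PCfg D) ℂ) :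
    plaqOp z q ∈ localAlgebra D (plaqSites z) := by
  refine mem_localAlgebra (fun σ τ s hs hne => if_neg fun h => hne (h s hs)) ?_
  intro σ τ σ' τ' h1 h2 h3 h4
  change (if _ then _ else _) = (if _ then _ else _)
  rw [if_pos h1, if_pos h2]
  congr 1
  · funext a b; exact h3 _ (corner_mem z a b)
  · funext a b; exact h4 _ (corner_mem z a b)

theorem corner_injective (z : Plaquette n) {a b a' b' : Fin 2} (h : corner z a b = corner z a' b') :
    a = a' ∧ b = b' := by
  have h1 : ∀ (i : Fin n) (a a' : Fin 2), (if a = 0 then i.castSucc else i.succ) =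
      (if a' = 0 then i.castSucc else i.succ) → a = a' := by
    intro i a a' h
    have h' := congrArg Fin.val h
    fin_cases a <;> fin_cases a' <;> simp at h' ⊢
  exact ⟨h1 _ _ _ (congrArg Prod.fst h), h1 _ _ _ (congrArg Prod.snd h)⟩

open Classical in
/-- The configuration with values `c` on the plaquette `z` and `σ` elsewhere. -/
def plaqMerge (z : Plaquette n) (σ : Cfg n D) (c : PCfg D) : Cfg n D := fun s =>
  if h : ∃ p : Fin 2 × Fin 2, s = corner z p.1 p.2 then c h.choose.1 h.choose.2 else σ s

theorem plaqMerge_corner (z : Plaquette n) (σ : Cfg n D) (c : PCfg D) (a b : Fin 2) :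
    plaqMerge z σ c (corner z a b) = c a b := by
  have h : ∃ p : Fin 2 × Fin 2, corner z a b = corner z p.1 p.2 := ⟨(a, b), rfl⟩
  unfold plaqMerge
  rw [dif_pos h]
  obtain ⟨h1, h2⟩ := corner_injective z h.choose_spec
  exact congrArg₂ c h1.symm h2.symm

theorem plaqMerge_of_notMem (z : Plaquette n) (σ : Cfg n D) (c : PCfg D) {s : Site n}
    (hs : s ∉ plaqSites z) : plaqMerge z σ c s = σ s := by
  unfold plaqMerge
  rw [dif_neg]
  rintro ⟨p, rfl⟩
  exact hs (corner_mem z _ _)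

/-- Intermediate configurations in a product of plaquette operators differ from `σ` only at the four
corners, so the sum runs over `PCfg`. -/
theorem sum_plaq (z : Plaquette n) (σ : Cfg n D) (f : Cfg n D → ℂ)
    (hf : ∀ ρ, f ρ ≠ 0 → ∀ s, s ∉ plaqSites z → σ s = ρ s) :
    ∑ ρ, f ρ = ∑ c : PCfg D, f (plaqMerge z σ c) := by
  symm
  refine Fintype.sum_of_injective _ ?_ _ _ ?_ fun _ => rfl
  · intro c d hcd
    funext a b
    rw [← plaqMerge_corner z σ c, ← plaqMerge_corner z σ d, hcd]
  · intro ρ hρ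
    by_contra hne
    apply hρ
    refine ⟨fun a b => ρ (corner z a b), ?_⟩
    funext s
    by_cases h : s ∈ plaqSites z
    · obtain ⟨a, b, rfl⟩ := exists_corner h
      exact plaqMerge_corner z σ _ a b
    · rw [plaqMerge_of_notMem z σ _ h]
      exact hf ρ hne s h

theorem plaqOp_mul (z : Plaquette n) (p q : Matrix (PCfg D) (PCfg D) ℂ) :
    plaqOp z (p * q) = plaqOp z p * plaqOp z q := by
  ext σ τ
  rw [Matrix.mul_apply, sum_plaq z σ]
  · simp only [plaqOp, Matrix.of_apply]
    split_ifs with hst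
    · rw [Matrix.mul_apply]
      refine Finset.sum_congr rfl fun c _ => ?_
      rw [if_pos fun s hs => (plaqMerge_of_notMem z σ c hs).symm,
        if_pos fun s hs => (plaqMerge_of_notMem z σ c hs).trans (hst s hs)]
      simp only [plaqMerge_corner]
    · symm
      refine Finset.sum_eq_zero fun c _ => mul_eq_zero_of_right _ (if_neg fun h => hst ?_)
      intro s hs
      rw [← h s hs, plaqMerge_of_notMem z σ c hs]
  · intro ρ hρ s hs
    by_contra hne
    exact hρ (mul_eq_zero_of_left (if_neg fun h => hne (h s hs)) _)

theorem plaqOp_conjTranspose (z : Plaquette n) (q : Matrix (PCfg D) (PCfg D) ℂ) :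
    (plaqOp z q)ᴴ = plaqOp z qᴴ := by
  ext σ τ
  simp only [plaqOp, Matrix.conjTranspose_apply, Matrix.of_apply, apply_ite star, star_zero]
  exact if_congr ⟨fun h s hs => (h s hs).symm, fun h s hs => (h s hs).symm⟩ rfl rfl

namespace Model

variable (M : Model n D)

theorem isProjector_term (z : Plaquette n) : IsProjector (M.term z) := by
  refine ⟨?_, ?_⟩
  · unfold Matrix.IsHermitian term
    rw [plaqOp_conjTranspose, (M.isProjector z).1.eq]
  · unfold term
    rw [← plaqOp_mul, (M.isProjector z).2]

theorem term_mem [NeZero D] {z : Plaquette n} {S : Finset (Site n)} (h : z ∈ plaqIn S) :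
    M.term z ∈ localAlgebra D S :=
  localAlgebra_mono (Finset.mem_filter.mp h).2 (plaqOp_mem z _)

theorem plaqIn_mono {S S' : Finset (Site n)} (h : S ⊆ S') : plaqIn S ⊆ plaqIn S' := by
  intro z hz
  rw [plaqIn, Finset.mem_filter] at hz ⊢
  exact ⟨hz.1, hz.2.trans h⟩

theorem commute_projOn {S : Finset (Site n)} {X : Op n D}
    (h : ∀ z ∈ plaqIn S, Commute X (M.term z)) : Commute X (M.projOn S) :=
  Finset.noncommProd_commute _ _ _ _ fun z hz => (Commute.one_right X).sub_right (h z hz)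

theorem projOn_mem [NeZero D] (S : Finset (Site n)) : M.projOn S ∈ localAlgebra D S :=
  Finset.noncommProd_induction _ _ _ (· ∈ localAlgebra D S) (fun _ _ => mul_mem) (one_mem _)
    fun _ hz => sub_mem (one_mem _) (M.term_mem hz)

/-- Together with `term_mul_projOn` this characterizes `projOn` as the projector onto the common
kernel of the terms, so that the order of its factors never has to be handled. -/
theorem projOn_mul_of_forall {S : Finset (Site n)} {X : Op n D}
    (h : ∀ z ∈ plaqIn S, M.term z * X = 0) : M.projOn S * X = X :=
  Finset.noncommProd_induction _ _ _ (fun P => P * X = X)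
    (fun a b ha hb => by rw [Matrix.mul_assoc, hb, ha]) (Matrix.one_mul X)
    fun z hz => by rw [Matrix.sub_mul, h z hz, Matrix.one_mul, sub_zero]

theorem projOn_mulVec_of_forall {S : Finset (Site n)} {ψ : Cfg n D → ℂ}
    (h : ∀ z ∈ plaqIn S, M.term z *ᵥ ψ = 0) : M.projOn S *ᵥ ψ = ψ :=
  Finset.noncommProd_induction _ _ _ (fun P => P *ᵥ ψ = ψ)
    (fun a b ha hb => by rw [← Matrix.mulVec_mulVec, hb, ha]) (Matrix.one_mulVec ψ)
    fun z hz => by rw [Matrix.sub_mulVec, h z hz, Matrix.one_mulVec, sub_zero]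

theorem term_mul_projOn {S : Finset (Site n)} {z : Plaquette n} (hz : z ∈ plaqIn S) :
    M.term z * M.projOn S = 0 := by
  have h : (1 - M.term z) * _ = M.projOn S :=
    Finset.mul_noncommProd_erase (plaqIn S) hz (fun z => 1 - M.term z) _
  rw [← h, ← Matrix.mul_assoc, Matrix.mul_sub, (M.isProjector_term z).2, Matrix.mul_one, sub_self,
    Matrix.zero_mul]

theorem isProjector_projOn (S : Finset (Site n)) : IsProjector (M.projOn S) := by
  refine ⟨?_, M.projOn_mul_of_forall fun z hz => M.term_mul_projOn hz⟩
  have h1 : ∀ z ∈ plaqIn S, (M.projOn S)ᴴ * M.term z = 0 := fun z hz => by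
    have := congrArg Matrix.conjTranspose (M.term_mul_projOn hz)
    rwa [Matrix.conjTranspose_mul, (M.isProjector_term z).1.eq, Matrix.conjTranspose_zero] at this
  -- The adjoint annihilates every term from the left and thus absorbs each factor `1 - M.term z`.
  -- The left side is Hermitian, so `projOn` equals its own adjoint.
  have h2 : (M.projOn S)ᴴ * M.projOn S = (M.projOn S)ᴴ :=
    Finset.noncommProd_induction _ _ _ (fun P => (M.projOn S)ᴴ * P = (M.projOn S)ᴴ)
      (fun a b ha hb => by rw [← Matrix.mul_assoc, ha, hb]) (Matrix.mul_one _)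
      fun z hz => by rw [Matrix.mul_sub, h1 z hz, Matrix.mul_one, sub_zero]
  have h3 := congrArg Matrix.conjTranspose h2
  rw [Matrix.conjTranspose_mul, Matrix.conjTranspose_conjTranspose, h2] at h3
  exact h3

theorem projOn_mul_projOn {S S' : Finset (Site n)} (h : S ⊆ S') :
    M.projOn S * M.projOn S' = M.projOn S' :=
  M.projOn_mul_of_forall fun _ hz => M.term_mul_projOn (plaqIn_mono h hz)

end Model

end Plaquettes

/-! ### The interaction algebras of a column from a given row on, and their support projectors. -/

section Columns

variable {n D : ℕ}

theorem mem_col {C : Fin (n + 1)} {s : Site n} : s ∈ col C ↔ s.1 = C := by simp [col]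

theorem mem_prevCol {C : Fin (n + 1)} {s : Site n} : s ∈ prevCol C ↔ s.1.val + 1 = C.val := by
  simp [prevCol]

theorem mem_nextCol {C : Fin (n + 1)} {s : Site n} : s ∈ nextCol C ↔ s.1.val = C.val + 1 := by
  simp [nextCol]

/-- The sites of the column `C` from the row `i` on. -/
def upperCol (C : Fin (n + 1)) (i : ℕ) : Finset (Site n) := (col C).filter fun s => i ≤ s.2.val

/-- The column `C - 1` together with the sites of the column `C` from the row `i` on. -/
def upperRegion (C : Fin (n + 1)) (i : ℕ) : Finset (Site n) := prevCol C ∪ upperCol C i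

theorem mem_upperCol {C : Fin (n + 1)} {i : ℕ} {s : Site n} :
    s ∈ upperCol C i ↔ s.1 = C ∧ i ≤ s.2.val := by simp [upperCol, mem_col]

theorem upperCol_zero (C : Fin (n + 1)) : upperCol C 0 = col C := by ext; simp [upperCol]

theorem upperRegion_zero (C : Fin (n + 1)) : upperRegion C 0 = prevCol C ∪ col C := by
  rw [upperRegion, upperCol_zero]

theorem upperCol_mono (C : Fin (n + 1)) {i j : ℕ} (h : i ≤ j) : upperCol C j ⊆ upperCol C i := by
  intro s hs
  rw [mem_upperCol] at hs ⊢
  exact ⟨hs.1, h.trans hs.2⟩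

theorem upperRegion_mono (C : Fin (n + 1)) {i j : ℕ} (h : i ≤ j) :
    upperRegion C j ⊆ upperRegion C i :=
  Finset.union_subset_union_right (upperCol_mono C h)

theorem disjoint_prevCol_col (C : Fin (n + 1)) : Disjoint (prevCol C) (col C) := by
  rw [Finset.disjoint_left]
  intro s h1 h2
  rw [mem_prevCol] at h1
  rw [mem_col] at h2
  rw [h2] at h1
  omega

theorem upperCol_subset_compl (C : Fin (n + 1)) (i : ℕ) : upperCol C i ⊆ (prevCol C)ᶜ := by
  intro s hs
  rw [Finset.mem_compl]
  intro h
  exact Finset.disjoint_left.mp (disjoint_prevCol_col C) h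
    (Finset.mem_filter.mp hs).1

theorem upperRegion_sdiff (C : Fin (n + 1)) (i : ℕ) :
    upperRegion C i \ prevCol C ⊆ upperCol C i := by
  intro s hs
  rw [upperRegion, Finset.mem_sdiff, Finset.mem_union] at hs
  tauto

namespace Model

variable (M : Model n D)

/-- The interaction algebra on the column `C` of the terms to its left, from the row `i` on, as an
algebra of operators on the lattice. -/
def upperAlgebra (C : Fin (n + 1)) (i : ℕ) : Subalgebra ℂ (Op n D) :=
  Algebra.adjoin ℂ {x | ∃ z ∈ plaqIn (upperRegion C i), ∃ c d, x = slice (prevCol C) c d (M.term z)}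

theorem slice_term_mem {C : Fin (n + 1)} {i : ℕ} {z : Plaquette n}
    (hz : z ∈ plaqIn (upperRegion C i)) (c d : RCfg D (prevCol C)) :
    slice (prevCol C) c d (M.term z) ∈ M.upperAlgebra C i :=
  Algebra.subset_adjoin ⟨z, hz, c, d, rfl⟩

theorem upperAlgebra_mono (C : Fin (n + 1)) {i j : ℕ} (h : i ≤ j) :
    M.upperAlgebra C j ≤ M.upperAlgebra C i := by
  apply Algebra.adjoin_mono
  rintro _ ⟨z, hz, c, d, rfl⟩
  exact ⟨z, plaqIn_mono (upperRegion_mono C h) hz, c, d, rfl⟩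

theorem conjTranspose_mem_upperAlgebra {C : Fin (n + 1)} {i : ℕ} {a : Op n D}
    (ha : a ∈ M.upperAlgebra C i) : aᴴ ∈ M.upperAlgebra C i := by
  refine conjTranspose_mem_adjoin ?_ ha
  rintro _ ⟨z, hz, c, d, rfl⟩
  rw [slice_conjTranspose, (M.isProjector_term z).1.eq]
  exact M.slice_term_mem hz d c

theorem upperAlgebra_le [NeZero D] (C : Fin (n + 1)) (i : ℕ) :
    M.upperAlgebra C i ≤ localAlgebra D (upperCol C i) := by
  apply Algebra.adjoin_le
  rintro _ ⟨z, hz, c, d, rfl⟩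
  exact localAlgebra_mono (upperRegion_sdiff C i) (slice_mem (M.term_mem hz) c d)

theorem upperAlgebra_le_compl [NeZero D] (C : Fin (n + 1)) (i : ℕ) :
    M.upperAlgebra C i ≤ localAlgebra D (prevCol C)ᶜ :=
  (M.upperAlgebra_le C i).trans (localAlgebra_mono (upperCol_subset_compl C i))

/-- For operators off the column `C - 1`, commuting with the terms and commuting with their slices
are the same; the converse is `commute_term_of_commute`. -/
theorem commute_upperAlgebra {C : Fin (n + 1)} {i : ℕ} {X : Op n D}
    (hX : X ∈ localAlgebra D (prevCol C)ᶜ)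
    (h : ∀ z ∈ plaqIn (upperRegion C i), Commute X (M.term z)) {a : Op n D}
    (ha : a ∈ M.upperAlgebra C i) : Commute X a := by
  refine commute_of_mem_adjoin ?_ ha
  rintro _ ⟨z, hz, c, d, rfl⟩
  exact slice_commute hX (h z hz) c d

theorem commute_term_of_commute {C : Fin (n + 1)} {i : ℕ} {X : Op n D}
    (hX : X ∈ localAlgebra D (prevCol C)ᶜ) (h : ∀ a ∈ M.upperAlgebra C i, Commute X a)
    {z : Plaquette n} (hz : z ∈ plaqIn (upperRegion C i)) : Commute X (M.term z) :=
  commute_of_slice hX fun c d => h _ (M.slice_term_mem hz c d)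

/-- The projector is a polynomial in the terms, and slicing stays in the algebra generated by the
slices of the terms. -/
theorem slice_projOn_mem (C : Fin (n + 1)) (i : ℕ) (c d : RCfg D (prevCol C)) :
    slice (prevCol C) c d (M.projOn (upperRegion C i)) ∈ M.upperAlgebra C i := by
  have h : M.projOn (upperRegion C i) ∈
      Algebra.adjoin ℂ (M.term '' (plaqIn (upperRegion C i) : Set (Plaquette n))) :=
    Finset.noncommProd_induction _ _ _ (· ∈ Algebra.adjoin ℂ _) (fun _ _ => mul_mem) (one_mem _)
      fun z hz => sub_mem (one_mem _) (Algebra.subset_adjoin ⟨z, hz, rfl⟩)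
  refine slice_mem_of_mem_adjoin _ _ ?_ h c d
  rintro _ ⟨z, hz, rfl⟩ c d
  exact M.slice_term_mem hz c d

/-- The smallest central projector of the interaction algebra, from the row `i` on, which fixes all
states with zero energy for the terms there. -/
theorem exists_supportProjector [NeZero D] (C : Fin (n + 1)) (i : ℕ) :
    ∃ z ∈ M.upperAlgebra C i, IsProjector z ∧ (∀ a ∈ M.upperAlgebra C i, Commute z a) ∧
      z * M.projOn (upperRegion C i) = M.projOn (upperRegion C i) ∧
      ∀ B ∈ localAlgebra D (prevCol C)ᶜ,
        (∀ p ∈ plaqIn (upperRegion C i), Commute B (M.term p)) →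
        B * M.projOn (upperRegion C i) = 0 → B * z = 0 := by
  set 𝒜 := M.upperAlgebra C i with h𝒜
  set P := M.projOn (upperRegion C i) with hP
  -- The span of `S` is the two-sided ideal generated by the slices of `P`. It is closed under
  -- adjoints, so it has a unit, which is the projector looked for.
  let S : Set (Op n D) := {x | ∃ a ∈ 𝒜, ∃ b ∈ 𝒜, ∃ c d, x = a * slice (prevCol C) c d P * b}
  have hs : ∀ c d, slice (prevCol C) c d P ∈ 𝒜 := M.slice_projOn_mem C i
  have hS𝒜 : ∀ x ∈ Submodule.span ℂ S, x ∈ 𝒜 := by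
    intro x hx
    have : Submodule.span ℂ S ≤ Subalgebra.toSubmodule 𝒜 := by
      rw [Submodule.span_le]
      rintro _ ⟨a, ha, b, hb, c, d, rfl⟩
      exact 𝒜.mul_mem (𝒜.mul_mem ha (hs c d)) hb
    exact this hx
  have hleft : ∀ y ∈ 𝒜, ∀ x ∈ Submodule.span ℂ S, y * x ∈ Submodule.span ℂ S := by
    intro y hy x hx
    induction hx using Submodule.span_induction with
    | mem x h =>
      obtain ⟨a, ha, b, hb, c, d, rfl⟩ := h
      exact Submodule.subset_span ⟨y * a, mul_mem hy ha, b, hb, c, d, by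
        simp only [Matrix.mul_assoc]⟩
    | zero => rw [Matrix.mul_zero]; exact zero_mem _
    | add x x' _ _ h h' => rw [Matrix.mul_add]; exact add_mem h h'
    | smul r x _ h => rw [Matrix.mul_smul]; exact Submodule.smul_mem _ r h
  have hright : ∀ y ∈ 𝒜, ∀ x ∈ Submodule.span ℂ S, x * y ∈ Submodule.span ℂ S := by
    intro y hy x hx
    induction hx using Submodule.span_induction with
    | mem x h =>
      obtain ⟨a, ha, b, hb, c, d, rfl⟩ := h
      exact Submodule.subset_span ⟨a, ha, b * y, mul_mem hb hy, c, d, by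
        simp only [Matrix.mul_assoc]⟩
    | zero => rw [Matrix.zero_mul]; exact zero_mem _
    | add x x' _ _ h h' => rw [Matrix.add_mul]; exact add_mem h h'
    | smul r x _ h => rw [Matrix.smul_mul]; exact Submodule.smul_mem _ r h
  have hstar : ∀ x ∈ Submodule.span ℂ S, xᴴ ∈ Submodule.span ℂ S := by
    intro x hx
    induction hx using Submodule.span_induction with
    | mem x h =>
      obtain ⟨a, ha, b, hb, c, d, rfl⟩ := h
      refine Submodule.subset_span ⟨bᴴ, M.conjTranspose_mem_upperAlgebra hb, aᴴ,
        M.conjTranspose_mem_upperAlgebra ha, d, c, ?_⟩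
      rw [Matrix.conjTranspose_mul, Matrix.conjTranspose_mul, slice_conjTranspose,
        (M.isProjector_projOn _).1.eq, Matrix.mul_assoc]
    | zero => rw [Matrix.conjTranspose_zero]; exact zero_mem _
    | add x x' _ _ h h' => rw [Matrix.conjTranspose_add]; exact add_mem h h'
    | smul r x _ h => rw [Matrix.conjTranspose_smul]; exact Submodule.smul_mem _ _ h
  obtain ⟨z, hz, hzp, hunit⟩ := exists_unit_projector (Submodule.span ℂ S)
    (fun x hx y hy => hleft x (hS𝒜 x hx) y hy) hstar
  -- The unit of a two-sided ideal is central: `z a` and `a z` both lie in the ideal, and both equal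
  -- `z a z`.
  have hzc : ∀ a ∈ 𝒜, Commute z a := by
    intro a ha
    have h1 := (hunit _ (hleft a ha z hz)).2
    have h2 := (hunit _ (hright a ha z hz)).1
    change z * a = a * z
    rw [← h1, ← h2, Matrix.mul_assoc]
  refine ⟨z, hS𝒜 z hz, hzp, hzc, ?_, ?_⟩
  · have hzl := M.upperAlgebra_le_compl C i (hS𝒜 z hz)
    have h1 : ∀ c d, z * slice (prevCol C) c d P = slice (prevCol C) c d P := fun c d =>
      (hunit _ (Submodule.subset_span ⟨1, one_mem _, 1, one_mem _, c, d, by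
        rw [Matrix.one_mul, Matrix.mul_one]⟩)).2
    conv_rhs => rw [sum_amp_mul_slice (prevCol C) P]
    rw [sum_amp_mul_slice (prevCol C) P, Finset.mul_sum]
    refine Finset.sum_congr rfl fun c _ => ?_
    rw [Finset.mul_sum]
    refine Finset.sum_congr rfl fun d _ => ?_
    rw [← Matrix.mul_assoc, (commute_of_disjoint disjoint_compl_left hzl (amp_mem _ _)).eq,
      Matrix.mul_assoc]
    congr 1
    convert h1 c d using 2; rw [← sum_amp_mul_slice (prevCol C) P]
  · intro B hB hBc hBP
    have hBs : ∀ c d, B * slice (prevCol C) c d P = 0 := fun c d => by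
      rw [← slice_mul_left hB, hBP, slice_zero]
    -- `B` annihilates the slices of `P` and commutes with the algebra, so it annihilates the whole
    -- ideal, including the unit.
    have : ∀ x ∈ Submodule.span ℂ S, B * x = 0 := by
      intro x hx
      induction hx using Submodule.span_induction with
      | mem x h =>
        obtain ⟨a, ha, b, hb, c, d, rfl⟩ := h
        rw [← Matrix.mul_assoc, ← Matrix.mul_assoc, (M.commute_upperAlgebra hB hBc ha).eq,
          Matrix.mul_assoc a, hBs, Matrix.mul_zero, Matrix.zero_mul]
      | zero => exact Matrix.mul_zero _
      | add x x' _ _ h h' => rw [Matrix.mul_add, h, h', add_zero]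
      | smul r x _ h => rw [Matrix.mul_smul, h, smul_zero]
    exact this z hz

/-- The interaction algebra on a column, as an algebra of operators on the lattice. -/
theorem map_leftAlgebra [NeZero D] (C : Fin (n + 1)) :
    (M.leftAlgebra C).map (ampHom (col C)) = M.upperAlgebra C 0 := by
  have hsub : prevCol C ⊆ (col C)ᶜ := fun s hs => Finset.mem_compl.mpr
    (Finset.disjoint_left.mp (disjoint_prevCol_col C) hs)
  have hloc : ∀ W ∈ M.termAlgebra (prevCol C ∪ col C), W ∈ localAlgebra D (prevCol C ∪ col C) := by
    intro W hW
    refine (Algebra.adjoin_le ?_ :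
      M.termAlgebra (prevCol C ∪ col C) ≤ localAlgebra D (prevCol C ∪ col C)) hW
    rintro _ ⟨z, hz, rfl⟩
    exact M.term_mem hz
  rw [leftAlgebra, map_interactionAlgebraOn]
  apply le_antisymm
  · apply Algebra.adjoin_le
    rintro _ ⟨W, hW, c, d, rfl⟩
    rw [slice_of_subset hsub (hloc W hW) disjoint_compl_left]
    split_ifs
    · refine slice_mem_of_mem_adjoin _ _ ?_ hW _ _
      rintro _ ⟨z, hz, rfl⟩ c d
      rw [← upperRegion_zero] at hz
      exact M.slice_term_mem hz c d
    · exact zero_mem _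
  · apply Algebra.adjoin_le
    rintro _ ⟨z, hz, c, d, rfl⟩
    apply Algebra.subset_adjoin
    rw [upperRegion_zero] at hz
    have hzt : M.term z ∈ M.termAlgebra (prevCol C ∪ col C) :=
      Algebra.subset_adjoin ⟨z, hz, rfl⟩
    refine ⟨M.term z, hzt, fun s => merge (prevCol C) c 0 s, fun s => merge (prevCol C) d 0 s, ?_⟩
    rw [slice_of_subset hsub (hloc _ hzt) disjoint_compl_left, if_pos]
    · congr 1
      · ext s; rw [merge_of_mem _ _ s.2]
      · ext s; rw [merge_of_mem _ _ s.2]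
    · intro s hs
      rw [merge_of_notMem _ _ hs, merge_of_notMem _ _ hs]

theorem amp_mem_upperAlgebra [NeZero D] {C : Fin (n + 1)}
    {B : Matrix (RCfg D (col C)) (RCfg D (col C)) ℂ} :
    amp (col C) B ∈ M.upperAlgebra C 0 ↔ B ∈ M.leftAlgebra C := by
  rw [← M.map_leftAlgebra C]
  refine ⟨?_, fun h => ⟨B, h, rfl⟩⟩
  rintro ⟨B', hB', h⟩
  rwa [← amp_injective (col C) h]

theorem exists_of_mem_upperAlgebra [NeZero D] {C : Fin (n + 1)} {A : Op n D}
    (hA : A ∈ M.upperAlgebra C 0) : ∃ B ∈ M.leftAlgebra C, A = amp (col C) B := by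
  rw [← M.map_leftAlgebra C] at hA
  obtain ⟨B, hB, h⟩ := hA
  exact ⟨B, hB, h.symm⟩

theorem commute_leftAlgebra [NeZero D] {C : Fin (n + 1)}
    {O : Matrix (RCfg D (col C)) (RCfg D (col C)) ℂ} (hO : ∀ B ∈ M.leftAlgebra C, Commute O B)
    {a : Op n D} (ha : a ∈ M.upperAlgebra C 0) : Commute (amp (col C) O) a := by
  obtain ⟨B, hB, rfl⟩ := M.exists_of_mem_upperAlgebra ha
  change amp (col C) O * amp (col C) B = amp (col C) B * amp (col C) O
  rw [← amp_mul, ← amp_mul, (hO B hB).eq]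

theorem conjTranspose_mem_leftAlgebra [NeZero D] {C : Fin (n + 1)}
    {a : Matrix (RCfg D (col C)) (RCfg D (col C)) ℂ} (ha : a ∈ M.leftAlgebra C) :
    aᴴ ∈ M.leftAlgebra C := by
  rw [← M.amp_mem_upperAlgebra] at ha ⊢
  rw [amp_conjTranspose]
  exact M.conjTranspose_mem_upperAlgebra ha

/-- The algebra generated by the operators on the column `C - 1` and by the interaction algebra
on the column `C`. -/
def pairAlgebra (C : Fin (n + 1)) : Subalgebra ℂ (Op n D) where
  carrier := {W | ∀ c d, slice (prevCol C) c d W ∈ M.upperAlgebra C 0}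
  mul_mem' := fun {a b} ha hb c d => by
    rw [slice_mul]
    exact sum_mem fun e _ => mul_mem (ha c e) (hb e d)
  add_mem' := fun {a b} ha hb c d => by
    rw [slice_add]
    exact add_mem (ha c d) (hb c d)
  algebraMap_mem' := fun r c d => by
    rw [slice_of_mem_compl (algebraMap_mem _ r)]
    split_ifs
    · exact algebraMap_mem _ r
    · exact zero_mem _

theorem upperAlgebra_le_pairAlgebra [NeZero D] (C : Fin (n + 1)) :
    M.upperAlgebra C 0 ≤ M.pairAlgebra C := by
  intro a ha c d
  rw [slice_of_mem_compl (M.upperAlgebra_le_compl C 0 ha)]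
  split_ifs
  · exact ha
  · exact zero_mem _

theorem amp_prevCol_mem_pairAlgebra (C : Fin (n + 1))
    (E : Matrix (RCfg D (prevCol C)) (RCfg D (prevCol C)) ℂ) :
    amp (prevCol C) E ∈ M.pairAlgebra C := by
  intro c d
  have : slice (prevCol C) c d (amp (prevCol C) E) = E c d • 1 := by
    ext σ τ
    simp only [slice, Matrix.of_apply, Matrix.smul_apply, Matrix.one_apply, smul_eq_mul, mul_ite,
      mul_one, mul_zero, amp]
    split_ifs with h1 h2 h3 h3 h3
    · congr 1
      · exact restr_merge _ c σ
      · exact restr_merge _ d τ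
    · exfalso
      apply h3
      rw [← merge_restr (prevCol C) σ, ← merge_restr (prevCol C) τ, h1]
      ext s
      by_cases hs : s ∈ prevCol C
      · rw [merge_of_mem _ _ hs, merge_of_mem _ _ hs]
      · have := h2 s hs
        rw [merge_of_notMem _ _ hs, merge_of_notMem _ _ hs] at this ⊢
        exact congrArg _ this
    · exfalso
      apply h2
      intro s hs
      rw [merge_of_notMem _ _ hs, merge_of_notMem _ _ hs, h3]
    · rfl
    · exact absurd (congrArg _ h3) h1
    · rfl
  rw [this]
  exact Subalgebra.smul_mem _ (one_mem _) _

theorem projLeft_mem_pairAlgebra (C : Fin (n + 1)) : M.projLeft C ∈ M.pairAlgebra C := by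
  intro c d
  rw [projLeft, ← upperRegion_zero]
  exact M.slice_projOn_mem C 0 c d

theorem conjTranspose_mem_pairAlgebra {C : Fin (n + 1)} {W : Op n D} (hW : W ∈ M.pairAlgebra C) :
    Wᴴ ∈ M.pairAlgebra C := by
  intro c d
  rw [← slice_conjTranspose]
  exact M.conjTranspose_mem_upperAlgebra (hW d c)

theorem commute_pairAlgebra {C : Fin (n + 1)} {X : Op n D}
    (hX : X ∈ localAlgebra D (prevCol C)ᶜ) (h : ∀ a ∈ M.upperAlgebra C 0, Commute X a)
    {W : Op n D} (hW : W ∈ M.pairAlgebra C) : Commute X W :=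
  commute_of_slice hX fun c d => h _ (hW c d)

/-- Proportionality of the traces against operators which commute with the interaction algebra of a
column, below a minimal central projector. -/
theorem trace_pairAlgebra [NeZero D] {C : Fin (n + 1)}
    {O : Matrix (RCfg D (col C)) (RCfg D (col C)) ℂ}
    (hO : IsMinimalCentralProjector (M.leftAlgebra C) O) {W : Op n D} (hW : W ∈ M.pairAlgebra C)
    {X : Op n D} (hX : X ∈ localAlgebra D (prevCol C)ᶜ)
    (hXc : ∀ a ∈ M.upperAlgebra C 0, Commute X a) :
    (W * amp (col C) O * X).trace =
      (W * amp (col C) O).trace / (amp (col C) O).trace * (amp (col C) O * X).trace := by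
  have hOm : amp (col C) O ∈ M.upperAlgebra C 0 := M.amp_mem_upperAlgebra.mpr hO.1.2.1
  have hOc : ∀ a ∈ M.upperAlgebra C 0, Commute (amp (col C) O) a := fun a ha =>
    M.commute_leftAlgebra hO.1.2.2 ha
  refine exists_trace_eq_mul (M.pairAlgebra C) (fun a ha => M.conjTranspose_mem_pairAlgebra ha)
    ⟨isProjector_amp hO.1.1, M.upperAlgebra_le_pairAlgebra C hOm, fun B hB =>
      M.commute_pairAlgebra (M.upperAlgebra_le_compl C 0 hOm) hOc hB⟩
    (fun h => hO.2.1 (amp_eq_zero_iff.mp h)) ?_ (fun a ha => M.commute_pairAlgebra hX hXc ha) hW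
  intro w hw hwc
  -- A central element commutes with the matrix units on column `C - 1` and so equals each of its
  -- diagonal slices. It therefore lies in the interaction algebra on `C`, to whose center the
  -- minimality of `O` applies.
  have hslice : ∀ c, slice (prevCol C) c c w = w := by
    intro c
    have h1 : ∑ e : RCfg D (prevCol C), amp (prevCol C) (Matrix.single e e (1 : ℂ)) = 1 := by
      have := map_sum (ampHom (D := D) (prevCol C)) (fun e => Matrix.single e e (1 : ℂ)) Finset.univ
      rw [Matrix.sum_single_one, map_one] at this
      exact this.symm
    rw [slice_eq_sum]
    calc _ = ∑ e : RCfg D (prevCol C), w * amp (prevCol C) (Matrix.single e e (1 : ℂ)) := by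
          refine Finset.sum_congr rfl fun e _ => ?_
          rw [← (hwc _ (M.amp_prevCol_mem_pairAlgebra C _)).eq, Matrix.mul_assoc, ← amp_mul,
            Matrix.single_mul_single_same, mul_one]
      _ = w := by rw [← Finset.mul_sum, h1, Matrix.mul_one]
  have hwm : w ∈ M.upperAlgebra C 0 := by
    rw [← hslice fun _ => 0]
    exact hw _ _
  obtain ⟨v, hv, rfl⟩ := M.exists_of_mem_upperAlgebra hwm
  obtain ⟨c, hc⟩ := hO.exists_smul (fun a ha => M.conjTranspose_mem_leftAlgebra ha) hv (by
    intro a ha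
    apply amp_injective (col C)
    rw [amp_mul, amp_mul]
    exact hwc _ (M.upperAlgebra_le_pairAlgebra C (M.amp_mem_upperAlgebra.mpr ha)))
  refine ⟨c, ?_⟩
  rw [← amp_mul, hc]
  exact map_smul (ampHom (col C)) c O

end Model

end Columns

/-! ### Products of support projectors, and their matrix product form. -/

section Rank

variable {n D : ℕ}

theorem centerX_union_above (C i : Fin (n + 1)) : centerX C i ∪ above C i = upperRegion C i.val := by
  ext s
  obtain ⟨x, y⟩ := s
  simp only [centerX, above, upperRegion, Finset.mem_union, Finset.mem_insert, Finset.mem_filter,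
    mem_upperCol, mem_col, Prod.mk.injEq]
  have h1 : i.val ≤ y.val ↔ y = i ∨ i < y := by
    rw [Fin.lt_def, Fin.ext_iff]; omega
  rw [h1]
  tauto

theorem disjoint_centerX_above (C i : Fin (n + 1)) : Disjoint (centerX C i) (above C i) := by
  rw [Finset.disjoint_left]
  intro s h1 h2
  rw [centerX, Finset.mem_insert] at h1
  rw [above, Finset.mem_filter] at h2
  rcases h1 with rfl | h1
  · exact lt_irrefl _ h2.2
  · exact Finset.disjoint_left.mp (disjoint_prevCol_col C) h1 h2.1

theorem corner_snd_val (z : Plaquette n) (a b : Fin 2) :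
    (corner z a b).2.val = z.2.val + b.val := by
  fin_cases b <;> simp [corner]

theorem corner_fst_val (z : Plaquette n) (a b : Fin 2) :
    (corner z a b).1.val = z.1.val + a.val := by
  fin_cases a <;> simp [corner]

theorem mem_centerX_self (C i : Fin (n + 1)) : (C, i) ∈ centerX C i := Finset.mem_insert_self _ _

theorem mem_centerX_of_mem {C i : Fin (n + 1)} {s : Site n} (h : s ∈ prevCol C) :
    s ∈ centerX C i := Finset.mem_insert_of_mem h

/-- The matrix unit on the center site, times the identity on the column `C - 1`. -/
def centerUnit {D : ℕ} (C i : Fin (n + 1)) (e : Fin D × Fin D) :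
    Matrix (RCfg D (centerX C i)) (RCfg D (centerX C i)) ℂ :=
  Matrix.of fun c d => if (c ⟨(C, i), mem_centerX_self C i⟩ = e.1 ∧
    d ⟨(C, i), mem_centerX_self C i⟩ = e.2) ∧ ∀ s (hs : s ∈ prevCol C),
      c ⟨s, mem_centerX_of_mem hs⟩ = d ⟨s, mem_centerX_of_mem hs⟩ then (1 : ℂ) else 0

namespace Model

/-- A plaquette that leaves the rows above `i - 1` of the column `C` does not reach the rows
above `i`. -/
theorem disjoint_plaqSites_above {C i : Fin (n + 1)} {z : Plaquette n}
    (hz : z ∈ plaqIn (prevCol C ∪ col C)) (hz' : z ∉ plaqIn (upperRegion C i.val)) :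
    Disjoint (plaqSites z) (above C i) := by
  have hz := (Finset.mem_filter.mp hz).2
  have : ∃ s ∈ plaqSites z, s ∉ upperRegion C i.val := by
    by_contra! h
    exact hz' (Finset.mem_filter.mpr ⟨Finset.mem_univ _, h⟩)
  obtain ⟨s, hs, hs'⟩ := this
  have hrow : s.2.val < i.val := by
    by_contra! h
    apply hs'
    have := hz hs
    rw [Finset.mem_union] at this
    rw [upperRegion, Finset.mem_union, mem_upperCol]
    rcases this with h1 | h1
    · exact Or.inl h1
    · exact Or.inr ⟨mem_col.mp h1, h⟩
  rw [Finset.disjoint_left]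
  intro t ht ht'
  have h2 := (Finset.mem_filter.mp ht').2
  obtain ⟨a, b, rfl⟩ := exists_corner hs
  obtain ⟨a', b', rfl⟩ := exists_corner ht
  rw [Fin.lt_def, corner_snd_val] at h2
  rw [corner_snd_val] at hrow
  have := b'.isLt
  omega

variable (M : Model n D) [NeZero D]

/-- The projector of `exists_supportProjector`. -/
def supportProj (C : Fin (n + 1)) (i : ℕ) : Op n D := (M.exists_supportProjector C i).choose

theorem supportProj_mem (C : Fin (n + 1)) (i : ℕ) : M.supportProj C i ∈ M.upperAlgebra C i :=
  (M.exists_supportProjector C i).choose_spec.1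

theorem isProjector_supportProj (C : Fin (n + 1)) (i : ℕ) : IsProjector (M.supportProj C i) :=
  (M.exists_supportProjector C i).choose_spec.2.1

theorem supportProj_commute {C : Fin (n + 1)} {i : ℕ} {a : Op n D} (ha : a ∈ M.upperAlgebra C i) :
    Commute (M.supportProj C i) a :=
  (M.exists_supportProjector C i).choose_spec.2.2.1 a ha

theorem supportProj_mul_projOn (C : Fin (n + 1)) (i : ℕ) :
    M.supportProj C i * M.projOn (upperRegion C i) = M.projOn (upperRegion C i) :=
  (M.exists_supportProjector C i).choose_spec.2.2.2.1

theorem mul_supportProj_eq_zero {C : Fin (n + 1)} {i : ℕ} {B : Op n D}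
    (hB : B ∈ localAlgebra D (prevCol C)ᶜ)
    (hc : ∀ p ∈ plaqIn (upperRegion C i), Commute B (M.term p))
    (h : B * M.projOn (upperRegion C i) = 0) : B * M.supportProj C i = 0 :=
  (M.exists_supportProjector C i).choose_spec.2.2.2.2 B hB hc h

/-- The product of the support projectors from the rows below `k` on. -/
def supportProd (C : Fin (n + 1)) : ℕ → Op n D
  | 0 => 1
  | k + 1 => supportProd C k * M.supportProj C k

theorem supportProd_mem (C : Fin (n + 1)) (k : ℕ) : M.supportProd C k ∈ M.upperAlgebra C 0 := by
  induction k with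
  | zero => exact one_mem _
  | succ k ih => exact mul_mem ih (M.upperAlgebra_mono C (Nat.zero_le k) (M.supportProj_mem C k))

/-- The factor for row `j` is central in the algebra from row `j` on, which contains the algebra
from row `i` on when `j ≤ i`. In particular the factors commute with each other. -/
theorem supportProd_commute {C : Fin (n + 1)} {k i : ℕ} (h : k ≤ i + 1) {a : Op n D}
    (ha : a ∈ M.upperAlgebra C i) : Commute (M.supportProd C k) a := by
  induction k with
  | zero => exact Commute.one_left a
  | succ k ih =>
    exact (ih (by omega)).mul_left
      (M.supportProj_commute (M.upperAlgebra_mono C (by omega) ha))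

theorem isProjector_supportProd (C : Fin (n + 1)) (k : ℕ) : IsProjector (M.supportProd C k) := by
  induction k with
  | zero => exact ⟨Matrix.isHermitian_one, Matrix.mul_one 1⟩
  | succ k ih =>
    exact ih.mul (M.isProjector_supportProj C k)
      (M.supportProd_commute (Nat.le_succ k) (M.supportProj_mem C k))

/-- Each factor fixes the projector of the rows it belongs to, and this projector is absorbed by the
full `projLeft`. -/
theorem supportProd_mul_projLeft (C : Fin (n + 1)) (k : ℕ) :
    M.supportProd C k * M.projLeft C = M.projLeft C := by
  induction k with
  | zero => exact Matrix.one_mul _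
  | succ k ih =>
    have h : M.projOn (upperRegion C k) * M.projLeft C = M.projLeft C := by
      apply M.projOn_mul_projOn
      rw [← upperRegion_zero]
      exact upperRegion_mono C (Nat.zero_le k)
    rw [supportProd, Matrix.mul_assoc, ← h, ← Matrix.mul_assoc (M.supportProj C k),
      M.supportProj_mul_projOn, h, ih]

/-- The factors from `i` on act only on the rows from `i` on. For a cut below row `i` this splits
off the factors with index greater than `i`, which act by multiplication with a fixed operator. -/
theorem exists_supportProd_eq_mul (C : Fin (n + 1)) {i k : ℕ} (h : i ≤ k) :
    ∃ a ∈ M.upperAlgebra C i, M.supportProd C k = M.supportProd C i * a := by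
  induction k, h using Nat.le_induction with
  | base => exact ⟨1, one_mem _, (Matrix.mul_one _).symm⟩
  | succ k h ih =>
    obtain ⟨a, ha, h'⟩ := ih
    exact ⟨a * M.supportProj C k, mul_mem ha (M.upperAlgebra_mono C h (M.supportProj_mem C k)), by
      rw [supportProd, h', Matrix.mul_assoc]⟩

/-- The operators on the rows from `i` on that the cut below the row `i` can produce. -/
def cutSpace (C i : Fin (n + 1)) : Submodule ℂ (Op n D) where
  carrier := {B | B ∈ localAlgebra D (upperCol C i) ∧
    (∀ z ∈ plaqIn (upperRegion C i), Commute B (M.term z)) ∧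
    (∀ Y ∈ localAlgebra D (above C i), (∀ z ∈ plaqIn (upperRegion C i), Commute Y (M.term z)) →
      Commute B Y) ∧
    B * M.supportProj C i = B}
  add_mem' := fun {a b} ha hb => ⟨add_mem ha.1 hb.1, fun z hz => (ha.2.1 z hz).add_left (hb.2.1 z hz),
    fun Y hY h => (ha.2.2.1 Y hY h).add_left (hb.2.2.1 Y hY h), by
      rw [Matrix.add_mul, ha.2.2.2, hb.2.2.2]⟩
  zero_mem' := ⟨zero_mem _, fun _ _ => Commute.zero_left _, fun _ _ _ => Commute.zero_left _,
    Matrix.zero_mul _⟩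
  smul_mem' := fun r b hb => ⟨Subalgebra.smul_mem _ hb.1 r, fun z hz => (hb.2.1 z hz).smul_left r,
    fun Y hY h => (hb.2.2.1 Y hY h).smul_left r, by rw [Matrix.smul_mul, hb.2.2.2]⟩

/-- `B` acts trivially on the column `C - 1`, so on the center region only the `D ^ 2` matrix units
of the site `(C, i)` occur. This is the source of the bound `D ^ 2`. -/
theorem exists_sum_kronecker {C i : Fin (n + 1)} {B : Op n D}
    (hB : B ∈ localAlgebra D (upperCol C i)) :
    ∃ F : Fin D × Fin D → Matrix (RCfg D (above C i)) (RCfg D (above C i)) ℂ,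
      onPair (centerX C i) (above C i) B = ∑ e : Fin D × Fin D,
        centerUnit C i e ⊗ₖ F e := by
  let v : Fin D → RCfg D (centerX C i) := fun a s => if s.1 = (C, i) then a else 0
  have hd := disjoint_centerX_above C i
  refine ⟨fun e => Matrix.of fun y y' => B (glue (centerX C i) (above C i) (v e.1, y))
    (glue (centerX C i) (above C i) (v e.2, y')), ?_⟩
  ext ⟨c, y⟩ ⟨d, y'⟩
  unfold centerUnit
  rw [Matrix.sum_apply, Finset.sum_eq_single (c ⟨(C, i), mem_centerX_self C i⟩,
    d ⟨(C, i), mem_centerX_self C i⟩)]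
  · simp only [Matrix.kroneckerMap_apply, Matrix.of_apply, true_and, ite_mul, one_mul,
      zero_mul, onPair, Matrix.submatrix_apply, and_self]
    have hmem : ∀ s, s ∈ centerX C i → s ≠ (C, i) → s ∈ prevCol C := fun s hs hne =>
      (Finset.mem_insert.mp hs).resolve_left hne
    have hup : ∀ s, s ∈ upperCol C i → s = (C, i) ∨ s ∈ above C i := by
      intro s hs
      rw [mem_upperCol] at hs
      rcases hs.2.eq_or_lt with h | h
      · exact Or.inl (Prod.ext hs.1 (Fin.ext h.symm))
      · exact Or.inr (Finset.mem_filter.mpr ⟨mem_col.mpr hs.1, h⟩)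
    have hprev : ∀ s, s ∈ prevCol C → s ∉ upperCol C i := fun s hs h =>
      Finset.mem_compl.mp (upperCol_subset_compl C i h) hs
    split_ifs with h
    · have hl : ∀ p : RCfg D (above C i), ∀ e e' : RCfg D (centerX C i),
        e ⟨(C, i), mem_centerX_self C i⟩ = e' ⟨(C, i), mem_centerX_self C i⟩ →
        ∀ s ∈ upperCol C i, glue (centerX C i) (above C i) (e, p) s =
          glue (centerX C i) (above C i) (e', p) s := by
        intro p e e' he s hs
        rcases hup s hs with rfl | h'
        · rw [glue_of_mem_left _ (mem_centerX_self C i),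
            glue_of_mem_left _ (mem_centerX_self C i)]
          exact he
        · rw [glue_of_mem_right hd _ h', glue_of_mem_right hd _ h']
      have hout : ∀ e e' : RCfg D (centerX C i), (∀ s (hs : s ∈ prevCol C),
          e ⟨s, mem_centerX_of_mem hs⟩ = e' ⟨s, mem_centerX_of_mem hs⟩) →
          ∀ s, s ∉ upperCol C i → glue (centerX C i) (above C i) (e, y) s =
          glue (centerX C i) (above C i) (e', y') s := by
        intro e e' he s hs
        by_cases h1 : s ∈ prevCol C
        · rw [glue_of_mem_left _ (mem_centerX_of_mem h1),
            glue_of_mem_left _ (mem_centerX_of_mem h1)]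
          exact he s h1
        · have : s ∉ centerX C i ∪ above C i := by
            rw [centerX_union_above, upperRegion, Finset.mem_union]
            tauto
          rw [glue_of_notMem _ this, glue_of_notMem _ this]
      refine localAlgebra_congr hB (hout _ _ h) (hout _ _ ?_) (hl _ _ _ ?_) (hl _ _ _ ?_)
      · intro s hs
        have : s ≠ (C, i) := by
          rintro rfl
          exact hprev _ hs (mem_upperCol.mpr ⟨rfl, le_rfl⟩)
        simp only [v]
        rw [if_neg this, if_neg this]
      · simp [v]
      · simp [v]
    · push Not at h
      obtain ⟨s, hs, hne⟩ := h
      refine localAlgebra_eq_zero hB (hprev s hs) ?_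
      rw [glue_of_mem_left _ (mem_centerX_of_mem hs),
        glue_of_mem_left _ (mem_centerX_of_mem hs)]
      exact hne
  · rintro ⟨a, b⟩ - hne
    rw [Matrix.kroneckerMap_apply, Matrix.of_apply, if_neg, zero_mul]
    rintro ⟨⟨rfl, rfl⟩, -⟩
    exact hne rfl
  · exact fun h => absurd (Finset.mem_univ _) h

/-- Under the conditions on the four-site problem the space of a cut has dimension at most `D²`. -/
theorem finrank_cutSpace_le {C i : Fin (n + 1)} {w : Plaquette n → ℝ} {d K : ℕ}
    (hw : M.GenericWeights C i w)
    (h : ReducedBoundaryState (M.q12X C i) (M.q2X3 C i w) d K) :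
    Module.finrank ℂ (M.cutSpace C i) ≤ D ^ 2 := by
  have hd := disjoint_centerX_above C i
  have hU := centerX_union_above C i
  let f : Op n D →ₗ[ℂ] Matrix (RCfg D (centerX C i) × RCfg D (above C i))
      (RCfg D (centerX C i) × RCfg D (above C i)) ℂ :=
    { toFun := onPair (centerX C i) (above C i)
      map_add' := fun _ _ => rfl
      map_smul' := fun _ _ => rfl }
  have hloc : ∀ B ∈ M.cutSpace C i, B ∈ localAlgebra D (centerX C i ∪ above C i) := fun B hB => by
    rw [hU]
    exact localAlgebra_mono Finset.subset_union_right hB.1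
  have hterm : ∀ z ∈ plaqIn (centerX C i ∪ above C i),
      M.term z ∈ localAlgebra D (centerX C i ∪ above C i) := fun z hz => M.term_mem hz
  have hinj : Function.Injective (f.domRestrict (M.cutSpace C i)) := by
    rw [← LinearMap.ker_eq_bot, LinearMap.ker_eq_bot']
    intro B hB
    exact Subtype.ext (onPair_eq_zero hd (hloc B.1 B.2) hB)
  rw [← LinearMap.finrank_range_of_inj hinj, LinearMap.range_domRestrict]
  have hQ : M.q2X3 C i w = onPair (centerX C i) (above C i)
    (∑ z ∈ plaqIn (centerX C i ∪ above C i), (w z : ℂ) • M.term z) := rfl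
  have hsum : ∑ z ∈ plaqIn (centerX C i ∪ above C i), (w z : ℂ) • M.term z ∈
      localAlgebra D (centerX C i ∪ above C i) :=
    sum_mem fun z hz => Subalgebra.smul_mem _ (hterm z hz) _
  refine (h.finrank_le (centerUnit C i) ((M.cutSpace C i).map f) ?_ ?_ ?_ ?_).trans ?_
  · rintro _ ⟨B, hB, rfl⟩
    exact exists_sum_kronecker hB.1
  · rintro _ ⟨B, hB, rfl⟩
    rw [hQ]
    refine (commute_onPair hd (hloc B hB) hsum).mpr (Commute.sum_right _ _ _ fun z hz => ?_)
    rw [hU] at hz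
    exact (hB.2.1 z hz).smul_right _
  -- Genericity of the weights is used here: commuting with the weighted sum implies commuting with
  -- each term, which is the form of the condition in `cutSpace`.
  · rintro Y hY _ ⟨B, hB, rfl⟩
    rw [← onPair_amp_right hd] at hY ⊢
    have hYl : amp (above C i) Y ∈ localAlgebra D (centerX C i ∪ above C i) :=
      localAlgebra_mono Finset.subset_union_right (amp_mem _ _)
    refine (commute_onPair hd (hloc B hB) hYl).mpr (hB.2.2.1 _ (amp_mem _ _) fun z hz => ?_)
    rw [← hU] at hz
    exact (commute_onPair hd hYl (hterm z hz)).mp (hw.2 _ hY z hz)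
  -- The columns of `projOn` are zero energy states. So `B` annihilates `projOn`, hence
  -- `supportProj`, and `B` is its own product with `supportProj`.
  · rintro _ ⟨B, hB, rfl⟩ hker
    have hPz : (∑ z ∈ plaqIn (centerX C i ∪ above C i), (w z : ℂ) • M.term z) *
        M.projOn (centerX C i ∪ above C i) = 0 := by
      rw [Finset.sum_mul]
      refine Finset.sum_eq_zero fun z hz => ?_
      rw [Matrix.smul_mul, M.term_mul_projOn hz, smul_zero]
    have h1 : onPair (centerX C i) (above C i) B *
        onPair (centerX C i) (above C i) (M.projOn (centerX C i ∪ above C i)) = 0 := by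
      ext p q
      have := hker (fun r => onPair (centerX C i) (above C i)
        (M.projOn (centerX C i ∪ above C i)) r q) ?_
      · exact congrFun this p
      · have h2 := congrArg (onPair (centerX C i) (above C i)) hPz
        rw [onPair_mul hd hsum] at h2
        ext r
        exact congrFun (congrFun h2 r) q
    rw [← onPair_mul hd (hloc B hB)] at h1
    have h3 := onPair_eq_zero hd (mul_mem (hloc B hB) (M.projOn_mem _)) h1
    rw [hU] at h3
    have h4 := M.mul_supportProj_eq_zero
      (localAlgebra_mono (upperCol_subset_compl C i) hB.1) hB.2.1 h3
    rw [hB.2.2.2] at h4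
    rw [h4, map_zero]
  · rw [Fintype.card_prod, Fintype.card_fin, pow_two]

/-- The slices over the rows below `i` of the product of an operator in the center of the
interaction algebra and of the support projectors. -/
theorem slice_mem_cutSpace {C i : Fin (n + 1)} {O : Op n D} (hO : O ∈ M.upperAlgebra C 0)
    (hOc : ∀ a ∈ M.upperAlgebra C 0, Commute O a) (c d : RCfg D (below C i)) :
    slice (below C i) c d (O * M.supportProd C (i.val + 1)) ∈ M.cutSpace C i := by
  have hT : O * M.supportProd C (i.val + 1) ∈ M.upperAlgebra C 0 :=
    mul_mem hO (M.supportProd_mem C _)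
  have hbelow : upperRegion C i ⊆ (below C i)ᶜ := by
    intro s hs
    rw [Finset.mem_compl, below, Finset.mem_filter]
    rintro ⟨h1, h2⟩
    rw [upperRegion, Finset.mem_union] at hs
    rcases hs with hs | hs
    · exact Finset.disjoint_left.mp (disjoint_prevCol_col C) hs h1
    · exact absurd (mem_upperCol.mp hs).2 (not_le.mpr h2)
  have hcol : upperCol C i ⊆ (below C i)ᶜ := Finset.subset_union_right.trans hbelow
  have habove : above C i ⊆ (below C i)ᶜ := by
    refine subset_trans ?_ hbelow
    rw [← centerX_union_above]
    exact Finset.subset_union_right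
  refine ⟨?_, ?_, ?_, ?_⟩
  · have h1 := M.upperAlgebra_le C 0 hT
    refine localAlgebra_mono ?_ (slice_mem h1 c d)
    intro s hs
    rw [Finset.mem_sdiff, upperCol_zero] at hs
    rw [mem_upperCol]
    refine ⟨mem_col.mp hs.1, ?_⟩
    by_contra! h
    exact hs.2 (Finset.mem_filter.mpr ⟨hs.1, h⟩)
  · intro z hz
    have hTc : ∀ a ∈ M.upperAlgebra C i, Commute (O * M.supportProd C (i.val + 1)) a :=
      fun a ha => (hOc a (M.upperAlgebra_mono C (Nat.zero_le _) ha)).mul_left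
        (M.supportProd_commute le_rfl ha)
    have hl := M.upperAlgebra_le_compl C 0 hT
    exact (slice_commute (localAlgebra_mono hbelow (M.term_mem hz))
      (M.commute_term_of_commute hl hTc hz).symm c d).symm
  -- The terms that are not in the region from row `i` on do not reach above row `i`, so `Y`
  -- commutes with all terms between the columns, hence with the interaction algebra, and hence with
  -- the slice.
  · intro Y hY hYc
    have hYp : Y ∈ localAlgebra D (prevCol C)ᶜ := by
      refine localAlgebra_mono ?_ hY
      intro s hs
      rw [Finset.mem_compl]
      exact fun h => Finset.disjoint_left.mp (disjoint_prevCol_col C) h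
        (Finset.mem_filter.mp hs).1
    refine (slice_commute (localAlgebra_mono habove hY) (M.commute_upperAlgebra hYp ?_ hT) c d).symm
    intro z hz
    rw [upperRegion_zero] at hz
    by_cases hz' : z ∈ plaqIn (upperRegion C i)
    · exact hYc z hz'
    · exact commute_of_disjoint (disjoint_plaqSites_above hz hz').symm hY (plaqOp_mem z _)
  · rw [supportProd, ← Matrix.mul_assoc]
    have h1 : M.supportProj C i ∈ localAlgebra D (below C i)ᶜ :=
      localAlgebra_mono hcol (M.upperAlgebra_le C i (M.supportProj_mem C i))
    rw [slice_mul_right h1, Matrix.mul_assoc, (M.isProjector_supportProj C i).2]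

end Model

/-- The configuration with values `v` on the column `C`, and `0` elsewhere. -/
def colCfg [NeZero D] (C : Fin (n + 1)) (v : Fin (n + 1) → Fin D) : Cfg n D :=
  fun s => if s.1 = C then v s.2 else 0

namespace Model

variable (M : Model n D) [NeZero D]

/-- The product of an operator in the center of the interaction algebra and of the support
projectors is a matrix product operator of bond dimension `D²`. -/
theorem exists_mpo {r : ℝ} (hcond : M.FourSiteConditions r) (C : Fin (n + 1))
    {O B : Matrix (RCfg D (col C)) (RCfg D (col C)) ℂ} (hO : O ∈ M.leftAlgebra C)
    (hOc : ∀ a ∈ M.leftAlgebra C, Commute O a)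
    (hB : amp (col C) B = amp (col C) O * M.supportProd C (n + 1)) :
    ∃ T : MPO n D (D ^ 2), (∀ a b, b.val ≠ 0 → T (Fin.last n) a b = 0) ∧ T.toOp C = B := by
  -- The operator as a function of pairs of row values; a tensor train for this function is a matrix
  -- product operator.
  let f : (Fin (n + 1) → Fin D × Fin D) → ℂ := fun σ =>
    amp (col C) B (colCfg C fun y => (σ y).1) (colCfg C fun y => (σ y).2)
  have hOm := M.amp_mem_upperAlgebra.mpr hO
  have hOc' : ∀ a ∈ M.upperAlgebra C 0, Commute (amp (col C) O) a := fun a ha =>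
    M.commute_leftAlgebra hOc ha
  obtain ⟨N, hN, hf⟩ := exists_matrixProduct (χ := D ^ 2) f
    (by rw [Fintype.card_prod, Fintype.card_fin, pow_two]) (by
      intro i hi1 hin
      obtain ⟨w, d, K, hw, hR, -⟩ := hcond C ⟨i, by omega⟩ hi1 hin
      -- The factors up to index `i` give elements of `cutSpace`. The remaining ones, collected in
      -- `Z`, act above row `i` and commute with slicing, so every slice of `f` is the image of an
      -- element of `cutSpace` under the linear map `g`.
      obtain ⟨Z, hZ, hZe⟩ := M.exists_supportProd_eq_mul C (i := i + 1) (k := n + 1) (by omega)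
      let g : Op n D →ₗ[ℂ] (Fin (n + 1) → Fin D × Fin D) → ℂ :=
        { toFun := fun A σ =>
            (A * Z) (colCfg C fun y => if y.val < i then 0 else (σ y).1)
              (colCfg C fun y => if y.val < i then 0 else (σ y).2)
          map_add' := fun A A' => by
            ext σ; rw [Matrix.add_mul, Matrix.add_apply]; rfl
          map_smul' := fun c A => by
            ext σ; rw [Matrix.smul_mul, Matrix.smul_apply]; rfl }
      refine le_trans ?_ ((Submodule.finrank_map_le g _).trans (M.finrank_cutSpace_le hw hR))
      apply Submodule.finrank_mono
      rw [Submodule.span_le]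
      rintro _ ⟨l, rfl⟩
      refine ⟨_, M.slice_mem_cutSpace hOm hOc' (fun s => (l s.1.2).1) (fun s => (l s.1.2).2), ?_⟩
      have hZl : Z ∈ localAlgebra D (below C (⟨i, by omega⟩ : Fin (n + 1)))ᶜ := by
        refine localAlgebra_mono ?_ (M.upperAlgebra_le C (i + 1) hZ)
        intro s hs
        rw [Finset.mem_compl, below, Finset.mem_filter]
        rintro ⟨-, h2⟩
        have := (mem_upperCol.mp hs).2
        rw [Fin.lt_def] at h2
        change s.2.val < i at h2
        omega
      ext σ
      have key : ∀ c d, slice (below C (⟨i, by omega⟩ : Fin (n + 1))) c d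
          (amp (col C) O * M.supportProd C (i + 1)) * Z = slice _ c d (amp (col C) B) := by
        intro c d
        rw [← slice_mul_right hZl, Matrix.mul_assoc, ← hZe, ← hB]
      refine (congrFun (congrFun (key _ _) _) _).trans ?_
      have hbm : ∀ s : Site n, s ∈ below C (⟨i, by omega⟩ : Fin (n + 1)) ↔
          s.1 = C ∧ s.2.val < i := by
        intro s
        rw [below, Finset.mem_filter, mem_col, Fin.lt_def]
      have hm : ∀ p : Fin D × Fin D → Fin D, merge (below C (⟨i, by omega⟩ : Fin (n + 1)))
          (fun s => p (l s.1.2)) (colCfg C fun y => if y.val < i then 0 else p (σ y)) =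
          colCfg C fun y => p (if y.val < i then l y else σ y) := by
        intro p
        ext s
        by_cases hs : s ∈ below C (⟨i, by omega⟩ : Fin (n + 1))
        · rw [merge_of_mem _ _ hs]
          rw [hbm] at hs
          simp only [colCfg]
          rw [if_pos hs.1, if_pos hs.2]
        · rw [merge_of_notMem _ _ hs]
          rw [hbm] at hs
          simp only [colCfg]
          by_cases h1 : s.1 = C
          · have h2 : ¬ s.2.val < i := fun h => hs ⟨h1, h⟩
            rw [if_pos h1, if_pos h1, if_neg h2, if_neg h2]
          · rw [if_neg h1, if_neg h1]
      change (if _ then _ else _) = _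
      rw [if_pos]
      · rw [hm Prod.fst, hm Prod.snd]
        rfl
      · ext s
        have hs := (hbm _).mp s.2
        simp only [restr, colCfg]
        rw [if_pos hs.1, if_pos hs.1, if_pos hs.2, if_pos hs.2])
  refine ⟨fun y a b => Matrix.of fun s t => N y a b (s, t), fun a b hb => ?_, ?_⟩
  · ext s t
    exact hN a b (s, t) fun h => hb (by rw [h]; rfl)
  · ext σ τ
    refine (hf fun y => (σ ⟨(C, y), by simp [col]⟩, τ ⟨(C, y), by simp [col]⟩)).symm.trans ?_
    change (if _ then _ else _) = _
    rw [if_pos]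
    · have : ∀ σ : RCfg D (col C), (fun s : {s // s ∈ col C} => colCfg C
          (fun y => σ ⟨(C, y), by simp [col]⟩) s.1) = σ := by
        intro σ
        ext ⟨⟨x, y⟩, hs⟩
        obtain rfl := mem_col.mp hs
        simp [colCfg]
      exact congrArg₂ B (this σ) (this τ)
    · intro s hs
      rw [mem_col] at hs
      simp only [colCfg]
      rw [if_neg hs, if_neg hs]

end Model

end Rank

/-! ### The masks, their properties, and projectors consistent with a ground state. -/

section Masks

variable {n D : ℕ}

open scoped ComplexOrder in
theorem IsProjector.trace_ne_zero {m : Type} [Fintype m] {P : Matrix m m ℂ} (h : IsProjector P)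
    (h0 : P ≠ 0) : P.trace ≠ 0 := by
  intro ht
  apply h0
  have : (Pᴴ * P).trace = 0 := by rw [h.1.eq, h.2, ht]
  exact Matrix.trace_conjTranspose_mul_self_eq_zero_iff.mp this

theorem fst_val_of_mem_plaqSites {z : Plaquette n} {s : Site n} (h : s ∈ plaqSites z) :
    s.1.val = z.1.val ∨ s.1.val = z.1.val + 1 := by
  obtain ⟨a, b, rfl⟩ := exists_corner h
  rw [corner_fst_val]
  have := a.isLt
  omega

theorem mem_plaqIn_of_fst {C : Fin (n + 1)} {z : Plaquette n} (h : z.1.val + 1 = C.val) :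
    z ∈ Model.plaqIn (prevCol C ∪ col C) := by
  refine Finset.mem_filter.mpr ⟨Finset.mem_univ _, fun s hs => ?_⟩
  rw [Finset.mem_union, mem_prevCol, mem_col, Fin.ext_iff]
  have := fst_val_of_mem_plaqSites hs
  omega

theorem mem_plaqIn_right_of_fst {C : Fin (n + 1)} {z : Plaquette n} (h : z.1.val = C.val) :
    z ∈ Model.plaqIn (col C ∪ nextCol C) := by
  refine Finset.mem_filter.mpr ⟨Finset.mem_univ _, fun s hs => ?_⟩
  rw [Finset.mem_union, mem_nextCol, mem_col, Fin.ext_iff]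
  have := fst_val_of_mem_plaqSites hs
  omega

theorem fst_of_mem_plaqIn_right {C : Fin (n + 1)} {z : Plaquette n}
    (h : z ∈ Model.plaqIn (col C ∪ nextCol C)) : z.1.val = C.val := by
  have h1 := (Finset.mem_filter.mp h).2 (corner_mem z 0 0)
  have h2 := (Finset.mem_filter.mp h).2 (corner_mem z 1 0)
  rw [Finset.mem_union, mem_nextCol, mem_col, Fin.ext_iff, corner_fst_val] at h1 h2
  simp only [Fin.val_zero, Fin.val_one] at h1 h2
  omega

namespace Model

variable (M : Model n D) [NeZero D]

/-- A term between `C - 2` and `C - 1` is disjoint from the column `C`. The other admitted terms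
avoid the column `C - 1` and commute with all terms, hence with their slices. -/
theorem commute_term_of_mem_upperAlgebra {C : Fin (n + 1)} {a : Op n D}
    (ha : a ∈ M.upperAlgebra C 0) {z : Plaquette n} (hz : z.1.val + 1 ≠ C.val) :
    Commute a (M.term z) := by
  by_cases h : z.1.val + 2 = C.val
  · refine commute_of_disjoint (S := plaqSites z) ?_ (M.upperAlgebra_le C 0 ha) (plaqOp_mem z _)
    rw [upperCol_zero, Finset.disjoint_left]
    intro s hs hs'
    rw [mem_col, Fin.ext_iff] at hs
    have := fst_val_of_mem_plaqSites hs'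
    omega
  · refine (M.commute_upperAlgebra (localAlgebra_mono ?_ (plaqOp_mem z _))
      (fun p _ => M.commute z p) ha).symm
    intro s hs
    rw [Finset.mem_compl, mem_prevCol]
    have := fst_val_of_mem_plaqSites hs
    omega

/-- For the terms between `C - 1` and `C` membership in the algebra does not suffice; there the
centrality of `O` is needed. -/
theorem commute_term_amp {C : Fin (n + 1)} {O : Matrix (RCfg D (col C)) (RCfg D (col C)) ℂ}
    (hO : IsCentralProjector (M.leftAlgebra C) O) (z : Plaquette n) :
    Commute (amp (col C) O) (M.term z) := by
  have hOm := M.amp_mem_upperAlgebra.mpr hO.2.1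
  by_cases hz : z.1.val + 1 = C.val
  · refine M.commute_term_of_commute (i := 0) (M.upperAlgebra_le_compl C 0 hOm)
      (fun a ha => M.commute_leftAlgebra hO.2.2 ha) ?_
    rw [upperRegion_zero]
    exact mem_plaqIn_of_fst hz
  · exact M.commute_term_of_mem_upperAlgebra hOm hz

section Column

variable {C : Fin (n + 1)} {O B : Matrix (RCfg D (col C)) (RCfg D (col C)) ℂ}

theorem mem_leftAlgebra_of_eq_mul (hO : IsCentralProjector (M.leftAlgebra C) O)
    (hB : amp (col C) B = amp (col C) O * M.supportProd C (n + 1)) :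
    amp (col C) B ∈ M.upperAlgebra C 0 := by
  rw [hB]
  exact mul_mem (M.amp_mem_upperAlgebra.mpr hO.2.1) (M.supportProd_mem C _)

theorem exists_eq_mul_supportProd (hO : IsCentralProjector (M.leftAlgebra C) O) :
    ∃ B, amp (col C) B = amp (col C) O * M.supportProd C (n + 1) := by
  obtain ⟨B, -, hB⟩ := M.exists_of_mem_upperAlgebra
    (mul_mem (M.amp_mem_upperAlgebra.mpr hO.2.1) (M.supportProd_mem C (n + 1)))
  exact ⟨B, hB.symm⟩

theorem commute_supportProd (hO : IsCentralProjector (M.leftAlgebra C) O) :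
    Commute (amp (col C) O) (M.supportProd C (n + 1)) :=
  M.commute_leftAlgebra hO.2.2 (M.supportProd_mem C _)

theorem isProjector_mask (hO : IsCentralProjector (M.leftAlgebra C) O)
    (hB : amp (col C) B = amp (col C) O * M.supportProd C (n + 1)) : IsProjector B := by
  apply isProjector_of_amp
  rw [hB]
  exact (isProjector_amp hO.1).mul (M.isProjector_supportProd C _) (M.commute_supportProd hO)

theorem isProjector_sub_mask (hO : IsCentralProjector (M.leftAlgebra C) O)
    (hB : amp (col C) B = amp (col C) O * M.supportProd C (n + 1)) : IsProjector (O - B) := by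
  apply isProjector_of_amp
  rw [amp_sub, hB]
  exact (isProjector_amp hO.1).sub_mul_self (M.isProjector_supportProd C _)
    (M.commute_supportProd hO)

theorem amp_mul_projLeft
    (hB : amp (col C) B = amp (col C) O * M.supportProd C (n + 1)) :
    amp (col C) B * M.projLeft C = amp (col C) O * M.projLeft C := by
  rw [hB, Matrix.mul_assoc, M.supportProd_mul_projLeft]

theorem projLeft_mul_amp (hO : IsCentralProjector (M.leftAlgebra C) O)
    (hB : amp (col C) B = amp (col C) O * M.supportProd C (n + 1)) :
    M.projLeft C * amp (col C) B = M.projLeft C * amp (col C) O := by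
  have h := congrArg Matrix.conjTranspose (M.amp_mul_projLeft hB)
  rwa [Matrix.conjTranspose_mul, Matrix.conjTranspose_mul,
    (isProjector_amp (M.isProjector_mask hO hB)).1.eq, (isProjector_amp hO.1).1.eq,
    show (M.projLeft C)ᴴ = M.projLeft C from (M.isProjector_projOn _).1.eq] at h

theorem sub_mul_projLeft
    (hB : amp (col C) B = amp (col C) O * M.supportProd C (n + 1)) :
    amp (col C) (O - B) * M.projLeft C = 0 := by
  rw [amp_sub, Matrix.sub_mul, M.amp_mul_projLeft hB, sub_self]

theorem projLeft_mul_sub (hO : IsCentralProjector (M.leftAlgebra C) O)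
    (hB : amp (col C) B = amp (col C) O * M.supportProd C (n + 1)) :
    M.projLeft C * amp (col C) (O - B) = 0 := by
  rw [amp_sub, Matrix.mul_sub, M.projLeft_mul_amp hO hB, sub_self]

/-- Multiplied with `projLeft` from either side the mask may be replaced by `O`, which commutes with
each term. -/
theorem commute_projLeft (hO : IsCentralProjector (M.leftAlgebra C) O)
    (hB : amp (col C) B = amp (col C) O * M.supportProd C (n + 1)) :
    Commute (amp (col C) B) (M.projLeft C) := by
  change _ * _ = _ * _
  rw [M.amp_mul_projLeft hB, M.projLeft_mul_amp hO hB]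
  exact M.commute_projOn fun z _ => M.commute_term_amp hO z

theorem commute_projRight (hO : IsCentralProjector (M.leftAlgebra C) O)
    (hB : amp (col C) B = amp (col C) O * M.supportProd C (n + 1)) (C' : Fin (n + 1)) :
    Commute (amp (col C) B) (M.projRight C') := by
  by_cases h : C'.val + 1 = C.val
  · have : M.projRight C' = M.projLeft C := by
      have h1 : prevCol C = col C' := by
        ext s; rw [mem_prevCol, mem_col, Fin.ext_iff]; omega
      have h2 : nextCol C' = col C := by
        ext s; rw [mem_nextCol, mem_col, Fin.ext_iff]; omega
      rw [projRight, projLeft, h1, h2]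
    rw [this]
    exact M.commute_projLeft hO hB
  · refine M.commute_projOn fun z hz => ?_
    refine M.commute_term_of_mem_upperAlgebra (M.mem_leftAlgebra_of_eq_mul hO hB) ?_
    rw [fst_of_mem_plaqIn_right hz]
    exact h

theorem amp_mul_self_left (hO : IsCentralProjector (M.leftAlgebra C) O)
    (hB : amp (col C) B = amp (col C) O * M.supportProd C (n + 1)) :
    amp (col C) B * amp (col C) O = amp (col C) B := by
  rw [hB, Matrix.mul_assoc, ← (M.commute_supportProd hO).eq, ← Matrix.mul_assoc,
    (isProjector_amp hO.1).2]

/-- Both sides are traces `tr (W O X)` with the same `X` in the commutant and with `W` in the pair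
algebra, since `B = B O`. By `trace_pairAlgebra` they are proportional, with a ratio independent of
`X`. -/
theorem isMask (hO : IsMinimalCentralProjector (M.leftAlgebra C) O)
    (hB : amp (col C) B = amp (col C) O * M.supportProd C (n + 1)) : M.IsMask C B := by
  intro O'
  have hBm := M.mem_leftAlgebra_of_eq_mul hO.1 hB
  have hBO := M.amp_mul_self_left hO.1 hB
  refine ⟨(amp (prevCol C) O' * M.projLeft C * amp (col C) B).trace / (amp (col C) B).trace,
    traceOut_eq_smul fun E => ?_⟩
  set X := M.projRight C * amp (prevCol C ∪ col C)ᶜ E with hX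
  have hXl : X ∈ localAlgebra D (prevCol C)ᶜ := by
    refine mul_mem (localAlgebra_mono ?_ (M.projOn_mem _)) (localAlgebra_mono ?_ (amp_mem _ _))
    · intro s hs
      rw [Finset.mem_union, mem_nextCol, mem_col, Fin.ext_iff] at hs
      rw [Finset.mem_compl, mem_prevCol]
      omega
    · exact Finset.compl_subset_compl.mpr Finset.subset_union_left
  have hXc : ∀ a ∈ M.upperAlgebra C 0, Commute X a := fun a ha => by
    refine M.commute_upperAlgebra hXl (fun z hz => ?_) ha
    rw [upperRegion_zero] at hz
    refine (Commute.mul_left ?_ ?_)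
    · exact (M.commute_projOn fun p _ => M.commute z p).symm
    · exact commute_of_disjoint disjoint_compl_left (amp_mem _ _) (M.term_mem hz)
  have h1 : amp (prevCol C) O' * M.projLeft C * amp (col C) B ∈ M.pairAlgebra C :=
    mul_mem (mul_mem (M.amp_prevCol_mem_pairAlgebra C O') (M.projLeft_mem_pairAlgebra C))
      (M.upperAlgebra_le_pairAlgebra C hBm)
  have e1 := M.trace_pairAlgebra hO h1 hXl hXc
  have e2 := M.trace_pairAlgebra hO (M.upperAlgebra_le_pairAlgebra C hBm) hXl hXc
  rw [Matrix.mul_assoc _ (amp (col C) B) (amp (col C) O), hBO] at e1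
  rw [hBO] at e2
  rw [Matrix.mul_assoc _ (M.projRight C), Matrix.mul_assoc _ (M.projRight C), ← hX, e1, e2]
  -- For `B = 0` both sides vanish; otherwise the trace of the projector `B` may be cancelled.
  by_cases h0 : B = 0
  · rw [amp_eq_zero_iff.mpr h0]; simp
  · have h2 := (isProjector_amp (M.isProjector_mask hO.1 hB)).trace_ne_zero
      (fun h => h0 (amp_eq_zero_iff.mp h))
    field_simp

theorem amp_mulVec_eq
    (hB : amp (col C) B = amp (col C) O * M.supportProd C (n + 1)) {φ : Cfg n D → ℂ}
    (hφ : ∀ z, M.term z *ᵥ φ = 0) (hOφ : amp (col C) O *ᵥ φ = φ) : amp (col C) B *ᵥ φ = φ := by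
  have h : M.projLeft C *ᵥ φ = φ := M.projOn_mulVec_of_forall fun z _ => hφ z
  rw [← h, Matrix.mulVec_mulVec, M.amp_mul_projLeft hB, ← Matrix.mulVec_mulVec, h, hOφ]

end Column

omit [NeZero D] in
-- The energy is the sum of the squared norms of the vectors `M.term z *ᵥ φ`.
theorem term_mulVec_eq_zero {φ : Cfg n D → ℂ} (h : M.hamiltonian *ᵥ φ = 0) (z : Plaquette n) :
    M.term z *ᵥ φ = 0 := by
  have h1 : ∀ z, star φ ⬝ᵥ (M.term z *ᵥ φ) = star (M.term z *ᵥ φ) ⬝ᵥ (M.term z *ᵥ φ) := by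
    intro z
    rw [Matrix.star_mulVec, (M.isProjector_term z).1.eq, ← Matrix.dotProduct_mulVec,
      Matrix.mulVec_mulVec, (M.isProjector_term z).2]
  have h2 : ∑ z, star (M.term z *ᵥ φ) ⬝ᵥ (M.term z *ᵥ φ) = 0 := by
    rw [← Finset.sum_congr rfl fun z _ => h1 z, ← dotProduct_sum, ← Matrix.sum_mulVec]
    change star φ ⬝ᵥ (M.hamiltonian *ᵥ φ) = 0
    rw [h, dotProduct_zero]
  have h3 : ∀ v : Cfg n D → ℂ, star v ⬝ᵥ v = ((∑ i, ‖v i‖ ^ 2 : ℝ) : ℂ) := by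
    intro v
    simp only [dotProduct, Pi.star_apply]
    push_cast
    refine Finset.sum_congr rfl fun i _ => ?_
    exact Complex.conj_mul' (v i)
  simp only [h3] at h2
  rw [← Complex.ofReal_sum, Complex.ofReal_eq_zero] at h2
  have h4 := (Finset.sum_eq_zero_iff_of_nonneg fun z _ =>
    Finset.sum_nonneg fun i _ => sq_nonneg ‖(M.term z *ᵥ φ) i‖).mp h2 z (Finset.mem_univ z)
  have h5 := (Finset.sum_eq_zero_iff_of_nonneg fun i _ => sq_nonneg _).mp h4
  ext i
  have := h5 i (Finset.mem_univ i)
  simpa using this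

/-- Minimal projectors of the centers of the interaction algebras that are consistent with a common
ground state. -/
theorem exists_minimalProjectors (h : M.HasZeroEnergyState) :
    ∃ (O : ∀ C : Fin (n + 1), Matrix (RCfg D (col C)) (RCfg D (col C)) ℂ) (φ : Cfg n D → ℂ),
      φ ≠ 0 ∧ M.hamiltonian *ᵥ φ = 0 ∧ ∀ C,
        IsMinimalCentralProjector (M.leftAlgebra C) (O C) ∧ amp (col C) (O C) *ᵥ φ = φ := by
  obtain ⟨ψ, hψ, hH⟩ := h
  -- The columns are treated one after the other. The new projector commutes with all terms and with
  -- the projectors on other columns, so zero energy and the earlier conditions survive its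
  -- application to the state.
  have key : ∀ k ≤ n + 1, ∃ (O : ∀ C : Fin (n + 1), Matrix (RCfg D (col C)) (RCfg D (col C)) ℂ)
      (φ : Cfg n D → ℂ), φ ≠ 0 ∧ M.hamiltonian *ᵥ φ = 0 ∧ ∀ C, C.val < k →
        IsMinimalCentralProjector (M.leftAlgebra C) (O C) ∧ amp (col C) (O C) *ᵥ φ = φ := by
    intro k
    induction k with
    | zero => exact fun _ => ⟨fun _ => 0, ψ, hψ, hH, fun C hC => absurd hC (Nat.not_lt_zero _)⟩
    | succ k ih =>
      intro hk
      obtain ⟨O, φ, hφ, hHφ, hO⟩ := ih (by omega)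
      let E : Fin (n + 1) := ⟨k, hk⟩
      obtain ⟨P, hP, hPφ⟩ := exists_isMinimalCentralProjector (M.leftAlgebra E)
        (fun P => amp (col E) P *ᵥ φ = 0)
        (by rw [show amp (col E) (0 : Matrix (RCfg D (col E)) (RCfg D (col E)) ℂ) = 0 from
          amp_eq_zero_iff.mpr rfl, Matrix.zero_mulVec])
        (by rw [amp_one, Matrix.one_mulVec]; exact hφ)
        (by
          intro P Q _ _ h1 h2
          have := map_add (ampHom (col E)) P Q
          change amp (col E) (P + Q) = amp (col E) P + amp (col E) Q at this
          change amp (col E) (P + Q) *ᵥ φ = 0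
          rw [this, Matrix.add_mulVec, h1, h2, add_zero])
      refine ⟨Function.update O E P, amp (col E) P *ᵥ φ, hPφ, ?_, ?_⟩
      · rw [Matrix.mulVec_mulVec]
        have : Commute (amp (col E) P) M.hamiltonian :=
          Commute.sum_right _ _ _ fun z _ => M.commute_term_amp hP.1 z
        rw [← this.eq, ← Matrix.mulVec_mulVec, hHφ, Matrix.mulVec_zero]
      · intro C hC
        by_cases hCE : C = E
        · subst hCE
          rw [Function.update_self]
          refine ⟨hP, ?_⟩
          rw [Matrix.mulVec_mulVec, (isProjector_amp hP.1.1).2]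
        · rw [Function.update_of_ne hCE]
          have hlt : C.val < k := by
            have : C.val ≠ k := fun h => hCE (Fin.ext h)
            omega
          obtain ⟨h1, h2⟩ := hO C hlt
          refine ⟨h1, ?_⟩
          have hd : Disjoint (col C) (col E) := by
            rw [Finset.disjoint_left]
            intro s hs hs'
            rw [mem_col] at hs hs'
            exact hCE (hs.symm.trans hs')
          rw [Matrix.mulVec_mulVec, (commute_of_disjoint hd (amp_mem _ _) (amp_mem _ _)).eq,
            ← Matrix.mulVec_mulVec, h2]
  obtain ⟨O, φ, h1, h2, h3⟩ := key (n + 1) le_rfl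
  exact ⟨O, φ, h1, h2, fun C => h3 C C.isLt⟩

end Model

end Masks

/-! ### Path sums with a fixed last state. -/

/-- The extension of a finite sequence by `0`. -/
def extendZero {I : Type} [Zero I] {k : ℕ} (v : Fin k → I) : ℕ → I :=
  fun y => if h : y < k then v ⟨y, h⟩ else 0

theorem extendZero_of_lt {I : Type} [Zero I] {k : ℕ} (v : Fin k → I) {y : ℕ} (h : y < k) :
    extendZero v y = v ⟨y, h⟩ := dif_pos h

theorem extendZero_of_le {I : Type} [Zero I] {k : ℕ} (v : Fin k → I) {y : ℕ} (h : k ≤ y) :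
    extendZero v y = 0 := dif_neg (not_lt.mpr h)

theorem extendZero_coe {I : Type} [Zero I] {k : ℕ} (v : Fin k → I) (y : Fin k) :
    extendZero v y = v y := extendZero_of_lt v y.isLt

/-- The sum over paths of length `L` which end in `0`, for the initial weight `g` and the transfer
weights `w`. -/
def pathSum {I : Type} [Fintype I] [Zero I] (L : ℕ) (g : I → ℂ) (w : ℕ → I → I → ℂ) : ℂ :=
  ∑ β : Fin L → I, g (extendZero β 0) *
    ∏ y : Fin L, w y (extendZero β y) (extendZero β (y + 1))

/-- This links a row by row recursion, as in `rowTransfer` or in a run of the verifier, with the sum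
over paths. Extension by `0` supplies the fixed end point. -/
theorem eq_pathSum {I : Type} [Fintype I] [Zero I] {g : I → ℂ} {w : ℕ → I → I → ℂ}
    {Z : ℕ → I → ℂ} (h0 : ∀ a, Z 0 a = g a)
    (h : ∀ y b, Z (y + 1) b = ∑ a, Z y a * w y a b) (L : ℕ) :
    Z L 0 = pathSum L g w := by
  classical
  have h1 := sum_path_forward Z w h L (fun b => if b = 0 then 1 else 0)
  simp only [mul_ite, mul_one, mul_zero, Finset.sum_ite_eq', Finset.mem_univ, if_true] at h1
  rw [h1, sum_snoc]
  refine Finset.sum_congr rfl fun v _ => ?_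
  rw [Finset.sum_eq_single 0 (fun b _ hb => by rw [if_neg]; rwa [Fin.snoc_last])
    (fun h => absurd (Finset.mem_univ _) h), if_pos (Fin.snoc_last (α := fun _ => I) _ _)]
  have h2 : ∀ j : Fin (L + 1), (Fin.snoc v 0 : Fin (L + 1) → I) j = extendZero v j := by
    intro j
    refine Fin.lastCases ?_ (fun i => ?_) j
    · rw [Fin.snoc_last (α := fun _ => I), extendZero_of_le v (by simp)]
    · rw [Fin.snoc_castSucc (α := fun _ => I)]
      exact (extendZero_coe v i).symm
  simp only [h2, h0]
  rfl

/-! ### Matrix elements of $P_{C,C+1}$ as path sums along the rows. -/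

section Strips

variable {n D : ℕ} [NeZero D] (M : Model n D)

/-- The values of a configuration on a column, extended by `0`. -/
def colVal (x : ℕ) (σ : Cfg n D) : ℕ → Fin D :=
  fun y => if h : x < n + 1 ∧ y < n + 1 then σ (⟨x, h.1⟩, ⟨y, h.2⟩) else 0

theorem colVal_coe (x y : Fin (n + 1)) (σ : Cfg n D) : colVal x.val σ y.val = σ (x, y) :=
  dif_pos ⟨x.isLt, y.isLt⟩

theorem colVal_of_le {x y : ℕ} (σ : Cfg n D) (h : n + 1 ≤ y) : colVal x σ y = 0 :=
  dif_neg fun h' => by omega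

/-- The values on the two columns `x` and `x + 1`. -/
def pairVal (x : ℕ) (σ : Cfg n D) : ℕ → Fin D × Fin D := fun y => (colVal x σ y, colVal (x + 1) σ y)

namespace Model

omit [NeZero D] in
/-- The matrix elements of `P_Z = 1 - Q_Z` between states of the lower and upper pairs of sites. -/
def gate (x y : ℕ) (a b c d : Fin D × Fin D) : ℂ :=
  (if a = c ∧ b = d then 1 else 0) - M.table [x, y, a.1, b.1, a.2, b.2, c.1, d.1, c.2, d.2]

omit [NeZero D] in
-- `table` vanishes off the lattice, so the gates there are trivial. Strips can therefore have `n +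
-- 1` steps, and a strip at the last column is the identity.
theorem gate_of_le {x y : ℕ} (h : n ≤ x ∨ n ≤ y) (a b c d : Fin D × Fin D) :
    M.gate x y a b c d = if a = c ∧ b = d then 1 else 0 := by
  rw [gate, table, dif_neg (fun h' => by have := h'.1; omega), sub_zero]

/-- Transfer along the rows of the product of the `P_Z` between two columns. -/
def rowTransfer (x : ℕ) (b k : ℕ → Fin D × Fin D) : ℕ → Fin D × Fin D → ℂ
  | 0, a => if a = b 0 then 1 else 0
  | y + 1, a' => ∑ a, rowTransfer x b k y a * M.gate x y a (b (y + 1)) (k y) a'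

/-- The matrix elements of the product of the `P_Z` between the columns `x` and `x + 1`. -/
def strip (x : ℕ) (b k : ℕ → Fin D × Fin D) : ℂ :=
  pathSum (n + 1) (fun a => if a = b 0 then 1 else 0)
    fun y a a' => M.gate x y a (b (y + 1)) (k y) a'

theorem rowTransfer_eq_strip (x : ℕ) (b k : ℕ → Fin D × Fin D) :
    M.rowTransfer x b k (n + 1) 0 = M.strip x b k :=
  eq_pathSum (fun _ => rfl) (fun _ _ => rfl) (n + 1)

omit [NeZero D] in
theorem rowTransfer_congr {x : ℕ} {b b' k k' : ℕ → Fin D × Fin D} {y : ℕ}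
    (hb : ∀ j ≤ y, b j = b' j) (hk : ∀ j < y, k j = k' j) (a : Fin D × Fin D) :
    M.rowTransfer x b k y a = M.rowTransfer x b' k' y a := by
  induction y generalizing a with
  | zero => simp only [rowTransfer, hb 0 le_rfl]
  | succ y ih =>
    simp only [rowTransfer]
    refine Finset.sum_congr rfl fun c _ => ?_
    rw [ih (fun j hj => hb j (by omega)) (fun j hj => hk j (by omega)), hb (y + 1) le_rfl,
      hk y (Nat.lt_succ_self y)]

omit [NeZero D] in
theorem rowTransfer_of_le {x : ℕ} (h : n ≤ x) (b k : ℕ → Fin D × Fin D) (y : ℕ)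
    (a : Fin D × Fin D) :
    M.rowTransfer x b k y a = if (∀ j < y, b j = k j) ∧ a = b y then 1 else 0 := by
  induction y generalizing a with
  | zero => simp [rowTransfer]
  | succ y ih =>
    simp only [rowTransfer, ih, M.gate_of_le (Or.inl h)]
    rw [Finset.sum_eq_single (k y)]
    · simp only [Nat.lt_succ_iff_lt_or_eq, or_imp, forall_and, forall_eq, true_and]
      by_cases h1 : ∀ j < y, b j = k j
      · by_cases h2 : b y = k y
        · by_cases h3 : b (y + 1) = a
          · simp [h2, h3]
          · have : ¬ a = b (y + 1) := fun h => h3 h.symm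
            simp [h3, this]
        · have : ¬ k y = b y := fun h => h2 h.symm
          simp [h2, this]
      · simp [h1]
    · intro c _ hc
      simp [hc]
    · exact fun h => absurd (Finset.mem_univ _) h

theorem strip_of_le {x : ℕ} (h : n ≤ x) {b k : ℕ → Fin D × Fin D} (hb : b (n + 1) = 0) :
    M.strip x b k = if ∀ j < n + 1, b j = k j then 1 else 0 := by
  rw [← M.rowTransfer_eq_strip, M.rowTransfer_of_le h]
  simp [hb]

/-- The extra step at row `n` is an identity gate; together with `b (n + 1) = 0` it selects the
final state `k n`. -/
theorem strip_eq_rowTransfer (x : ℕ) {b k : ℕ → Fin D × Fin D} (hb : b (n + 1) = 0) :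
    M.strip x b k = M.rowTransfer x b k n (k n) := by
  rw [← M.rowTransfer_eq_strip, rowTransfer, Finset.sum_eq_single (k n)]
  · rw [M.gate_of_le (Or.inr le_rfl), hb]; simp
  · intro c _ hc
    rw [M.gate_of_le (Or.inr le_rfl)]
    simp [hc]
  · exact fun h => absurd (Finset.mem_univ _) h

theorem one_sub_term_apply (z : Plaquette n) (ρ τ : Cfg n D) :
    (1 - M.term z) ρ τ = if ∀ s, s ∉ plaqSites z → ρ s = τ s then
      M.gate z.1 z.2 (pairVal z.1 ρ z.2) (pairVal z.1 ρ (z.2 + 1))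
        (pairVal z.1 τ z.2) (pairVal z.1 τ (z.2 + 1)) else 0 := by
  have hv : ∀ (σ : Cfg n D) (a b : Fin 2), colVal (z.1.val + a.val) σ (z.2.val + b.val) =
      σ (corner z a b) := by
    intro σ a b
    have := colVal_coe (corner z a b).1 (corner z a b).2 σ
    rwa [corner_fst_val, corner_snd_val] at this
  have h00 := fun σ => hv σ 0 0
  have h01 := fun σ => hv σ 0 1
  have h10 := fun σ => hv σ 1 0
  have h11 := fun σ => hv σ 1 1
  simp only [Fin.val_zero, Fin.val_one, add_zero] at h00 h01 h10 h11
  simp only [pairVal, h00, h01, h10, h11]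
  rw [Matrix.sub_apply, Matrix.one_apply, term]
  simp only [plaqOp, Matrix.of_apply]
  split_ifs with h1 h2 h2
  · subst h1
    rw [gate, if_pos ⟨rfl, rfl⟩, table]
    simp only [Fin.is_lt, and_self, dif_pos]
    congr 2 <;> ext a b <;> fin_cases a <;> fin_cases b <;> rfl
  · exact absurd (fun s _ => congrFun h1 s) h2
  · rw [gate, if_neg, table]
    · simp only [Fin.is_lt, and_self, dif_pos]
      congr 2 <;> ext a b <;> fin_cases a <;> fin_cases b <;> rfl
    · rintro ⟨h3, h4⟩
      rw [Prod.mk.injEq] at h3 h4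
      apply h1
      ext s
      by_cases hs : s ∈ plaqSites z
      · obtain ⟨a, b, rfl⟩ := exists_corner hs
        congr 1
        fin_cases a <;> fin_cases b
        · exact h3.1
        · exact h4.1
        · exact h3.2
        · exact h4.2
      · rw [h2 s hs]
  · ring

omit [NeZero D] in
/-- The product of the `P_Z` between the columns `x` and `x + 1`, over the first `k` rows. -/
def stripProd (x : Fin n) : ℕ → Op n D
  | 0 => 1
  | k + 1 => stripProd x k * if h : k < n then 1 - M.term (x, ⟨k, h⟩) else 1

theorem mem_plaqSites_iff {z : Plaquette n} {s : Site n} : s ∈ plaqSites z ↔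
    (s.1.val = z.1.val ∨ s.1.val = z.1.val + 1) ∧ (s.2.val = z.2.val ∨ s.2.val = z.2.val + 1) := by
  constructor
  · intro h
    refine ⟨fst_val_of_mem_plaqSites h, ?_⟩
    obtain ⟨a, b, rfl⟩ := exists_corner h
    rw [corner_snd_val]
    have := b.isLt
    omega
  · rintro ⟨h1, h2⟩
    have : s = corner z (if s.1.val = z.1.val then 0 else 1)
        (if s.2.val = z.2.val then 0 else 1) := by
      refine Prod.ext (Fin.ext ?_) (Fin.ext ?_)
      · rw [corner_fst_val]
        split_ifs with h
        · simpa using h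
        · simpa using h1.resolve_left h
      · rw [corner_snd_val]
        split_ifs with h
        · simpa using h
        · simpa using h2.resolve_left h
    rw [this]
    exact corner_mem z _ _

theorem stripProd_apply (x : Fin n) {k : ℕ} (hk : k ≤ n) (σ τ : Cfg n D) :
    M.stripProd x k σ τ = if ∀ s : Site n,
        ¬ ((s.1.val = x.val ∨ s.1.val = x.val + 1) ∧ s.2.val ≤ k) → σ s = τ s then
      M.rowTransfer x (pairVal x σ) (pairVal x τ) k (pairVal x τ k) else 0 := by
  induction k generalizing τ with
  | zero =>
    rw [stripProd, Matrix.one_apply, rowTransfer]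
    have hx : x.val < n + 1 := by omega
    have hx' : x.val + 1 < n + 1 := by omega
    have hp : pairVal x τ 0 = pairVal x σ 0 ↔ τ (⟨x, hx⟩, 0) = σ (⟨x, hx⟩, 0) ∧
        τ (⟨x + 1, hx'⟩, 0) = σ (⟨x + 1, hx'⟩, 0) := by
      simp [pairVal, colVal, hx, hx']
    simp only [hp]
    by_cases h : σ = τ
    · subst h; simp
    · rw [if_neg h]
      symm
      split_ifs with h1 h2
      · exfalso
        apply h
        ext s
        by_cases hs : (s.1.val = x.val ∨ s.1.val = x.val + 1) ∧ s.2.val ≤ 0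
        · obtain ⟨a, b⟩ := s
          have hb : b = 0 := Fin.ext (by simpa using hs.2)
          subst hb
          rcases hs.1 with ha | ha
          · have : a = ⟨x, hx⟩ := Fin.ext ha
            rw [this, h2.1]
          · have : a = ⟨x + 1, hx'⟩ := Fin.ext ha
            rw [this, h2.2]
        · rw [h1 s hs]
      · rfl
      · rfl
  | succ k ih =>
    have hk' : k < n := by omega
    have ih := ih hk'.le
    -- The only intermediate configurations which contribute: the two sites of row `k` are free, row
    -- `k + 1` of the two columns still has the values of `σ`, and everything else already has those
    -- of `τ`.
    let ρ : Fin D × Fin D → Cfg n D := fun a s =>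
      if s.2.val = k ∧ s.1.val = x.val then a.1 else
      if s.2.val = k ∧ s.1.val = x.val + 1 then a.2 else
      if s.2.val = k + 1 ∧ (s.1.val = x.val ∨ s.1.val = x.val + 1) then σ s else τ s
    have hρk : ∀ a, pairVal x (ρ a) k = a := by
      intro a
      have h1 : x.val < n + 1 := by omega
      have h2 : x.val + 1 < n + 1 := by omega
      have h3 : k < n + 1 := by omega
      simp [pairVal, colVal, h1, h2, h3, ρ]
    have hρk1 : ∀ a, pairVal x (ρ a) (k + 1) = pairVal x σ (k + 1) := by
      intro a
      have h1 : x.val < n + 1 := by omega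
      have h2 : x.val + 1 < n + 1 := by omega
      have h3 : k + 1 < n + 1 := by omega
      simp [pairVal, colVal, h1, h2, h3, ρ]
    have hρlt : ∀ a, ∀ j < k, pairVal x (ρ a) j = pairVal x τ j := by
      intro a j hj
      have h1 : j ≠ k := by omega
      have h2 : j ≠ k + 1 := by omega
      simp [pairVal, colVal, ρ, h1, h2]
    rw [stripProd, dif_pos hk', Matrix.mul_apply]
    have hsum : ∑ a, M.stripProd x k σ (ρ a) * (1 - M.term (x, ⟨k, hk'⟩)) (ρ a) τ =
        ∑ μ, M.stripProd x k σ μ * (1 - M.term (x, ⟨k, hk'⟩)) μ τ := by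
      refine Fintype.sum_of_injective ρ ?_ _ _ ?_ fun _ => rfl
      · intro a b hab
        rw [← hρk a, ← hρk b, hab]
      · intro μ hμ
        by_contra hne
        apply hμ
        have hne1 := left_ne_zero_of_mul hne
        have hne2 := right_ne_zero_of_mul hne
        rw [ih] at hne1
        rw [M.one_sub_term_apply] at hne2
        have h1 := (ite_ne_right_iff.mp hne1).1
        have h2 := (ite_ne_right_iff.mp hne2).1
        refine ⟨pairVal x μ k, ?_⟩
        ext s
        simp only [ρ]
        split_ifs with c1 c2 c3
        · have : s = (⟨x, by omega⟩, ⟨k, by omega⟩) := Prod.ext (Fin.ext c1.2) (Fin.ext c1.1)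
          rw [this]
          congr 1
          exact dif_pos ⟨by omega, by omega⟩
        · have : s = (⟨x + 1, by omega⟩, ⟨k, by omega⟩) := Prod.ext (Fin.ext c2.2) (Fin.ext c2.1)
          rw [this]
          congr 1
          exact dif_pos ⟨by omega, by omega⟩
        · rw [h1 s (by omega)]
        · rw [h2 s]
          rw [mem_plaqSites_iff]
          push Not at c1 c2 c3 ⊢
          simp only
          rintro (h | h) <;> refine ⟨fun h' => ?_, fun h' => ?_⟩
          · exact c1 h' h
          · exact (c3 h').1 h
          · exact c2 h' h
          · exact (c3 h').2 h
    rw [← hsum]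
    have hcond : ∀ a, (∀ s : Site n,
        ¬ ((s.1.val = x.val ∨ s.1.val = x.val + 1) ∧ s.2.val ≤ k) → σ s = ρ a s) ↔
        ∀ s : Site n, ¬ ((s.1.val = x.val ∨ s.1.val = x.val + 1) ∧ s.2.val ≤ k + 1) →
          σ s = τ s := by
      intro a
      constructor
      · intro h s hs
        have := h s (by omega)
        simp only [ρ] at this
        rwa [if_neg (by omega), if_neg (by omega), if_neg (by omega)] at this
      · intro h s hs
        simp only [ρ]
        rw [if_neg (by omega), if_neg (by omega)]
        split_ifs with c
        · rfl
        · exact h s (by omega)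
    have hplaq : ∀ a, ∀ s, s ∉ plaqSites ((x, ⟨k, hk'⟩) : Plaquette n) → ρ a s = τ s := by
      intro a s hs
      rw [mem_plaqSites_iff] at hs
      simp only at hs
      simp only [ρ]
      rw [if_neg (by omega), if_neg (by omega), if_neg (by omega)]
    simp only [ih, M.one_sub_term_apply, hcond]
    split_ifs with hst
    · rw [rowTransfer]
      refine Finset.sum_congr rfl fun a _ => ?_
      rw [if_pos (hplaq a), hρk, hρk1]
      congr 1
      exact M.rowTransfer_congr (fun _ _ => rfl) (hρlt a) a
    · simp

omit [NeZero D] in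
theorem commute_stripProd (x : Fin n) (k : ℕ) (z : Plaquette n) :
    Commute (M.term z) (M.stripProd x k) := by
  induction k with
  | zero => exact Commute.one_right _
  | succ k ih =>
    refine ih.mul_right ?_
    split_ifs
    · exact (Commute.one_right _).sub_right (M.commute _ _)
    · exact Commute.one_right _

omit [NeZero D] in
-- Each of the two commuting products absorbs the other, so no reordering of the factors is needed.
theorem stripProd_eq (x : Fin n) : M.stripProd x n = M.projRight x.castSucc := by
  have h1 : M.projRight x.castSucc * M.stripProd x n = M.stripProd x n := by
    refine M.projOn_mul_of_forall fun z hz => ?_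
    have hx : z.1 = x := Fin.ext (fst_of_mem_plaqIn_right hz)
    have key : ∀ k, z.2.val < k → M.term z * M.stripProd x k = 0 := by
      intro k hk
      induction k with
      | zero => omega
      | succ k ih =>
        rw [stripProd]
        by_cases hz' : z.2.val < k
        · rw [← Matrix.mul_assoc, ih hz', Matrix.zero_mul]
        · have hkn : k < n := by omega
          have : z = (x, ⟨k, hkn⟩) := Prod.ext hx (Fin.ext (by simp only; omega))
          rw [← Matrix.mul_assoc, (M.commute_stripProd x k z).eq, Matrix.mul_assoc, dif_pos hkn,
            ← this, Matrix.mul_sub, (M.isProjector_term z).2, Matrix.mul_one, sub_self,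
            Matrix.mul_zero]
    exact key n z.2.isLt
  have h2 : ∀ k, M.stripProd x k * M.projRight x.castSucc = M.projRight x.castSucc := by
    intro k
    induction k with
    | zero => exact Matrix.one_mul _
    | succ k ih =>
      rw [stripProd, Matrix.mul_assoc]
      split_ifs with hk
      · rw [Matrix.sub_mul, projRight, M.term_mul_projOn (mem_plaqIn_right_of_fst rfl), sub_zero,
          Matrix.one_mul]
        exact ih
      · rw [Matrix.one_mul, ih]
  have h3 : Commute (M.stripProd x n) (M.projRight x.castSucc) :=
    M.commute_projOn fun z _ => (M.commute_stripProd x n z).symm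
  rw [← h2 n, h3.eq, h1]

/-- The matrix elements of `P_{C,C+1}`. -/
theorem projRight_apply (C : Fin (n + 1)) (σ τ : Cfg n D) :
    M.projRight C σ τ = if ∀ s, s ∉ col C → s ∉ nextCol C → σ s = τ s then
      M.strip C (pairVal C σ) (pairVal C τ) else 0 := by
  have hb : ∀ ρ : Cfg n D, pairVal C.val ρ (n + 1) = 0 := fun ρ => by
    rw [pairVal, colVal_of_le _ le_rfl, colVal_of_le _ le_rfl]; rfl
  refine Fin.lastCases ?_ (fun x => ?_) C
  · have h1 : M.projRight (Fin.last n) = 1 := by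
      have : Model.plaqIn (col (Fin.last n) ∪ nextCol (Fin.last n)) = ∅ := by
        rw [Finset.eq_empty_iff_forall_notMem]
        intro z hz
        have := fst_of_mem_plaqIn_right hz
        have h := z.1.isLt
        rw [Fin.val_last] at this
        omega
      rw [projRight, projOn]
      simp only [this, Finset.noncommProd_empty]
    rw [h1, Matrix.one_apply, M.strip_of_le (by simp) (by
      rw [pairVal, colVal_of_le _ le_rfl, colVal_of_le _ le_rfl]; rfl)]
    by_cases h : σ = τ
    · subst h; simp
    · rw [if_neg h]
      symm
      split_ifs with h2 h3
      · exfalso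
        apply h
        ext s
        by_cases hs : s ∈ col (Fin.last n)
        · obtain ⟨a, b⟩ := s
          obtain rfl := mem_col.mp hs
          have := congrArg Prod.fst (h3 b.val b.isLt)
          simp only [pairVal, colVal_coe] at this
          rw [this]
        · rw [h2 s hs]
          rw [mem_nextCol, Fin.val_last]
          have := s.1.isLt
          omega
      · rfl
      · rfl
  · rw [← M.stripProd_eq, M.stripProd_apply x le_rfl, M.strip_eq_rowTransfer _ (by
      rw [pairVal, colVal_of_le _ le_rfl, colVal_of_le _ le_rfl]; rfl)]
    refine if_congr ?_ rfl rfl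
    refine forall_congr' fun s => ?_
    rw [mem_col, mem_nextCol, Fin.ext_iff, Fin.val_castSucc]
    have := s.2.isLt
    have hx : x.castSucc.val = x.val := rfl
    exact ⟨fun h h1 h2 => h (by omega), fun h h1 => h (by omega) (by omega)⟩

end Model

end Strips

/-! ### Partial traces over one and over two columns in coordinates. -/

section Contraction

variable {n D : ℕ} [NeZero D] (M : Model n D)

/-- A sequence of values as a configuration of the column `C`. -/
def colFun (C : Fin (n + 1)) (v : Fin (n + 1) → Fin D) : RCfg D (col C) := fun s => v s.1.2

omit [NeZero D] in
/-- The configuration with values `v` on the column `C`, and equal to `u` elsewhere. -/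
def setCol (C : Fin (n + 1)) (v : Fin (n + 1) → Fin D) (u : Cfg n D) : Cfg n D :=
  fun s => if s.1 = C then v s.2 else u s

omit [NeZero D] in
theorem setCol_of_mem {C : Fin (n + 1)} (v : Fin (n + 1) → Fin D) (u : Cfg n D) {s : Site n}
    (h : s ∈ col C) : setCol C v u s = v s.2 := if_pos (mem_col.mp h)

omit [NeZero D] in
theorem setCol_of_notMem {C : Fin (n + 1)} (v : Fin (n + 1) → Fin D) (u : Cfg n D) {s : Site n}
    (h : s ∉ col C) : setCol C v u s = u s := if_neg fun h' => h (mem_col.mpr h')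

/-- The values of a configuration on a column, or `0` outside of the lattice. -/
def colVec (x : ℕ) (u : Cfg n D) : Fin (n + 1) → Fin D := fun y => colVal x u y

theorem extendZero_colVec (x : ℕ) (u : Cfg n D) : extendZero (colVec x u) = colVal x u := by
  ext y
  by_cases h : y < n + 1
  · rw [extendZero_of_lt _ h]; rfl
  · rw [extendZero_of_le _ (not_lt.mp h), colVal_of_le _ (not_lt.mp h)]

theorem colVec_coe (C y : Fin (n + 1)) (u : Cfg n D) : colVec C.val u y = u (C, y) :=
  colVal_coe C y u

theorem colVec_setCol_self (C : Fin (n + 1)) (v : Fin (n + 1) → Fin D) (u : Cfg n D) :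
    colVec C.val (setCol C v u) = v := by
  ext y
  rw [colVec_coe]
  exact congrArg Fin.val (setCol_of_mem v u (mem_col.mpr rfl))

theorem colVec_setCol_of_ne {C : Fin (n + 1)} {x : ℕ} (h : x ≠ C.val)
    (v : Fin (n + 1) → Fin D) (u : Cfg n D) : colVec x (setCol C v u) = colVec x u := by
  ext y
  unfold colVec colVal
  split_ifs with hx
  · rw [setCol_of_notMem]
    rw [mem_col]
    exact fun h' => h (congrArg Fin.val h')
  · rfl

theorem colFun_colVec (C : Fin (n + 1)) (u : Cfg n D) :
    colFun C (colVec C.val u) = restr (col C) u := by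
  ext ⟨⟨x, y⟩, hs⟩
  obtain rfl := mem_col.mp hs
  simp only [colFun, colVec_coe]
  rfl

theorem setCol_colVec_of_forall {C : Fin (n + 1)} {u u' : Cfg n D}
    (h : ∀ s, s ∉ col C → u s = u' s) : setCol C (colVec C.val u') u = u' := by
  ext s
  by_cases hs : s ∈ col C
  · rw [setCol_of_mem _ _ hs, colVec_coe, ← mem_col.mp hs]
  · rw [setCol_of_notMem _ _ hs, h s hs]

/-- Two sequences of values as a sequence of pairs, extended by `0`. -/
def pairExtend (v w : Fin (n + 1) → Fin D) : ℕ → Fin D × Fin D :=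
  fun y => (extendZero v y, extendZero w y)

theorem pairVal_eq (x : ℕ) (u : Cfg n D) :
    pairVal x u = pairExtend (colVec x u) (colVec (x + 1) u) := by
  ext y <;> simp only [pairVal, pairExtend, extendZero_colVec]

theorem amp_col_mul_apply (C : Fin (n + 1)) (B : Matrix (RCfg D (col C)) (RCfg D (col C)) ℂ)
    (A : Op n D) (u u' : Cfg n D) :
    (amp (col C) B * A) u u' =
      ∑ w, B (colFun C (colVec C.val u)) (colFun C w) * A (setCol C w u) u' := by
  rw [Matrix.mul_apply]
  symm
  refine Fintype.sum_of_injective (fun w => setCol C w u) ?_ _ _ ?_ ?_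
  · intro w w' h
    have := congrArg (colVec C.val) h
    simpa only [colVec_setCol_self] using this
  · intro ρ hρ
    have : amp (col C) B u ρ = 0 := if_neg fun h => hρ ⟨colVec C.val ρ, setCol_colVec_of_forall h⟩
    rw [this, zero_mul]
  · intro w
    congr 1
    symm
    change (if _ then _ else _) = _
    rw [if_pos fun s hs => (setCol_of_notMem _ _ hs).symm, colFun_colVec]
    congr 1
    ext s
    exact congrArg Fin.val (setCol_of_mem _ _ s.2)

namespace Model

/-- The partial trace of `B P_{x,x+1}` over the column `x`. -/
def halfTrace (b : (Fin (n + 1) → Fin D) → (Fin (n + 1) → Fin D) → ℂ) (x : ℕ)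
    (s t : Fin (n + 1) → Fin D) : ℂ :=
  ∑ σ, ∑ ν, b σ ν * M.strip x (pairExtend ν s) (pairExtend σ t)

/-- The partial trace of `B' B P_{x,x+1} P_{x+1,x+2}` over the columns `x`, `x + 1`. -/
def doubleTrace (b b' : (Fin (n + 1) → Fin D) → (Fin (n + 1) → Fin D) → ℂ) (x : ℕ)
    (s t : Fin (n + 1) → Fin D) : ℂ :=
  ∑ σ, ∑ ν, ∑ μ, b' σ ν * M.halfTrace b x ν μ * M.strip (x + 1) (pairExtend μ s) (pairExtend σ t)

theorem strip_pairExtend_of_le {x : ℕ} (h : n ≤ x) (ν s σ t : Fin (n + 1) → Fin D) :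
    M.strip x (pairExtend ν s) (pairExtend σ t) = if ν = σ ∧ s = t then 1 else 0 := by
  rw [M.strip_of_le h (by
    rw [pairExtend, extendZero_of_le _ le_rfl, extendZero_of_le _ le_rfl]; rfl)]
  refine if_congr ?_ rfl rfl
  constructor
  · intro h
    refine ⟨funext fun y => ?_, funext fun y => ?_⟩
    · have := congrArg Prod.fst (h y y.isLt)
      simpa only [pairExtend, extendZero_coe] using this
    · have := congrArg Prod.snd (h y y.isLt)
      simpa only [pairExtend, extendZero_coe] using this
  · rintro ⟨rfl, rfl⟩ j _
    rfl

/-- To the right of the last column there is nothing: the strip is the identity and the partial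
trace a scalar multiple of it. -/
theorem halfTrace_of_le {x : ℕ} (h : n ≤ x)
    (b : (Fin (n + 1) → Fin D) → (Fin (n + 1) → Fin D) → ℂ) (s t : Fin (n + 1) → Fin D) :
    M.halfTrace b x s t = if s = t then M.halfTrace b x 0 0 else 0 := by
  simp only [halfTrace, M.strip_pairExtend_of_le h]
  split_ifs with hst <;> simp [hst]

theorem doubleTrace_of_le {x : ℕ} (h : n ≤ x + 1)
    (b b' : (Fin (n + 1) → Fin D) → (Fin (n + 1) → Fin D) → ℂ) (s t : Fin (n + 1) → Fin D) :
    M.doubleTrace b b' x s t = if s = t then M.doubleTrace b b' x 0 0 else 0 := by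
  simp only [doubleTrace, M.strip_pairExtend_of_le h]
  split_ifs with hst <;> simp [hst]

/-- The second factor does not touch column `x` and the first does not touch column `x + 2`, so only
the values `μ` of the shared column `x + 1` are summed over. -/
theorem projRight_mul_projRight_apply (x : Fin n) (u u' : Cfg n D) :
    (M.projRight x.castSucc * M.projRight x.succ) u u' =
      if ∀ s, s ∉ col x.castSucc → s ∉ col x.succ → s ∉ nextCol x.succ → u s = u' s then
        ∑ μ, M.strip x.val (pairExtend (colVec x.val u) (colVec (x.val + 1) u))
            (pairExtend (colVec x.val u') μ) *
          M.strip (x.val + 1) (pairExtend μ (colVec (x.val + 2) u))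
            (pairExtend (colVec (x.val + 1) u') (colVec (x.val + 2) u')) else 0 := by
  have hnext : nextCol x.castSucc = col x.succ := by
    ext s; rw [mem_nextCol, mem_col, Fin.ext_iff]; simp
  have hne : ∀ s : Site n, s ∈ col x.castSucc → s ∉ col x.succ := by
    intro s h1 h2
    rw [mem_col, Fin.ext_iff] at h1 h2
    rw [h1] at h2
    simp at h2
  have hne2 : ∀ s : Site n, s ∈ col x.castSucc → s ∉ nextCol x.succ := by
    intro s h1 h2
    rw [mem_col, Fin.ext_iff] at h1
    rw [mem_nextCol, h1, Fin.val_castSucc, Fin.val_succ] at h2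
    omega
  let ρ : (Fin (n + 1) → Fin D) → Cfg n D := fun μ =>
    setCol x.succ μ (setCol x.castSucc (colVec x.castSucc.val u') u)
  have c0 : ∀ μ, colVec x.val (ρ μ) = colVec x.val u' := fun μ =>
    (colVec_setCol_of_ne (by simp) _ _).trans (colVec_setCol_self x.castSucc _ _)
  have c1 : ∀ μ, colVec (x.val + 1) (ρ μ) = μ := fun μ => colVec_setCol_self x.succ _ _
  have c2 : ∀ μ, colVec (x.val + 2) (ρ μ) = colVec (x.val + 2) u := fun μ =>
    (colVec_setCol_of_ne (by simp) _ _).trans (colVec_setCol_of_ne (by simp) _ _)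
  have hsum : ∑ μ, M.projRight x.castSucc u (ρ μ) * M.projRight x.succ (ρ μ) u' =
      (M.projRight x.castSucc * M.projRight x.succ) u u' := by
    rw [Matrix.mul_apply]
    refine Fintype.sum_of_injective ρ ?_ _ _ ?_ fun _ => rfl
    · intro μ μ' h
      rw [← c1 μ, ← c1 μ', h]
    · intro τ hτ
      by_contra hne0
      apply hτ
      have h1 := left_ne_zero_of_mul hne0
      have h2 := right_ne_zero_of_mul hne0
      rw [M.projRight_apply] at h1 h2
      have h1 := (ite_ne_right_iff.mp h1).1
      have h2 := (ite_ne_right_iff.mp h2).1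
      refine ⟨colVec x.succ.val τ, ?_⟩
      ext s
      change Fin.val (setCol x.succ _ (setCol x.castSucc _ u) s) = _
      by_cases hs : s ∈ col x.succ
      · rw [setCol_of_mem _ _ hs, colVec_coe, ← mem_col.mp hs]
      · rw [setCol_of_notMem _ _ hs]
        by_cases hs' : s ∈ col x.castSucc
        · rw [setCol_of_mem _ _ hs', colVec_coe, ← mem_col.mp hs']
          exact congrArg Fin.val (h2 s hs (hne2 s hs')).symm
        · rw [setCol_of_notMem _ _ hs']
          exact congrArg Fin.val (h1 s hs' (by rwa [hnext]))
  rw [← hsum]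
  have h1 : ∀ μ, M.projRight x.castSucc u (ρ μ) =
      M.strip x.val (pairExtend (colVec x.val u) (colVec (x.val + 1) u))
            (pairExtend (colVec x.val u') μ) := by
    intro μ
    rw [M.projRight_apply, if_pos, pairVal_eq, pairVal_eq]
    · change M.strip x.val _ (pairExtend (colVec x.val (ρ μ)) (colVec (x.val + 1) (ρ μ))) = _
      rw [c0, c1]
      rfl
    · intro s hs hs'
      rw [hnext] at hs'
      exact ((setCol_of_notMem _ _ hs').trans (setCol_of_notMem _ _ hs)).symm
  have h2 : ∀ μ, M.projRight x.succ (ρ μ) u' =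
      if ∀ s, s ∉ col x.castSucc → s ∉ col x.succ → s ∉ nextCol x.succ → u s = u' s then
      M.strip (x.val + 1) (pairExtend μ (colVec (x.val + 2) u))
            (pairExtend (colVec (x.val + 1) u') (colVec (x.val + 2) u')) else 0 := by
    intro μ
    rw [M.projRight_apply, pairVal_eq, pairVal_eq]
    refine if_congr ?_ ?_ rfl
    · refine forall_congr' fun s => ?_
      by_cases hs : s ∈ col x.castSucc
      · simp only [hs, not_true_eq_false, false_imp_iff, iff_true]
        intro h3 h4
        refine (setCol_of_notMem _ _ h3).trans ((setCol_of_mem _ _ hs).trans ?_)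
        rw [colVec_coe, ← mem_col.mp hs]
      · simp only [hs, not_false_eq_true, true_imp_iff]
        refine forall_congr' fun h3 => ?_
        have : ρ μ s = u s := (setCol_of_notMem _ _ h3).trans (setCol_of_notMem _ _ hs)
        rw [this]
    · change M.strip (x.val + 1) (pairExtend (colVec (x.val + 1) (ρ μ))
        (colVec (x.val + 2) (ρ μ))) _ = _
      rw [c1, c2]
      rfl
  simp only [h1, h2]
  split_ifs
  · rfl
  · simp

end Model

/-- Configurations of two neighbouring columns. -/
def pairColEquiv (x : Fin n) : RCfg D (prevCol x.succ ∪ col x.succ) ≃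
    (Fin (n + 1) → Fin D) × (Fin (n + 1) → Fin D) where
  toFun c := (fun y => c ⟨(x.castSucc, y), Finset.mem_union_left _ (mem_prevCol.mpr rfl)⟩,
    fun y => c ⟨(x.succ, y), Finset.mem_union_right _ (mem_col.mpr rfl)⟩)
  invFun p s := if s.1.1 = x.castSucc then p.1 s.1.2 else p.2 s.1.2
  left_inv c := by
    funext ⟨⟨a, b⟩, hs⟩
    change (if a = x.castSucc then _ else _) = _
    split_ifs with h
    · subst h
      rfl
    · rw [Finset.mem_union, mem_prevCol, mem_col] at hs
      rcases hs with hs | hs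
      · exact absurd (Fin.ext (by simpa using hs)) h
      · obtain rfl : a = x.succ := hs
        rfl
  right_inv p := by
    have : ¬ (x.succ = x.castSucc) := fun h => by simpa using congrArg Fin.val h
    ext y <;> simp [this]

theorem glue_pairColEquiv (x : Fin n) (i : RCfg D (prevCol x.succ ∪ col x.succ)ᶜ)
    (p : (Fin (n + 1) → Fin D) × (Fin (n + 1) → Fin D)) :
    glue (prevCol x.succ ∪ col x.succ)ᶜ (prevCol x.succ ∪ col x.succ)
      (i, (pairColEquiv x).symm p) =
    setCol x.castSucc p.1 (setCol x.succ p.2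
      (glue (prevCol x.succ ∪ col x.succ)ᶜ (prevCol x.succ ∪ col x.succ) (i, 0))) := by
  ext s
  have hprev : s ∈ prevCol x.succ ↔ s ∈ col x.castSucc := by
    rw [mem_prevCol, mem_col, Fin.ext_iff]; simp
  by_cases hs : s ∈ prevCol x.succ ∪ col x.succ
  · rw [glue_of_mem_right disjoint_compl_left _ hs]
    by_cases h1 : s ∈ col x.castSucc
    · rw [setCol_of_mem _ _ h1]
      change Fin.val (if _ then _ else _) = _
      rw [if_pos (mem_col.mp h1)]
    · rw [setCol_of_notMem _ _ h1, setCol_of_mem]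
      · change Fin.val (if _ then _ else _) = _
        rw [if_neg fun h => h1 (mem_col.mpr h)]
      · rw [Finset.mem_union, hprev] at hs
        exact hs.resolve_left h1
  · have h1 : s ∉ col x.castSucc := fun h => hs (Finset.mem_union_left _ (hprev.mpr h))
    have h2 : s ∉ col x.succ := fun h => hs (Finset.mem_union_right _ h)
    rw [setCol_of_notMem _ _ h1, setCol_of_notMem _ _ h2,
      glue_of_mem_left _ (Finset.mem_compl.mpr hs), glue_of_mem_left _ (Finset.mem_compl.mpr hs)]

/-- The extension by `0` of a configuration of the complement of two columns. -/
def outer (x : Fin n) (i : RCfg D (prevCol x.succ ∪ col x.succ)ᶜ) : Cfg n D :=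
  glue (prevCol x.succ ∪ col x.succ)ᶜ (prevCol x.succ ∪ col x.succ) (i, 0)

theorem traceOut_apply (x : Fin n) (A : Op n D)
    (i j : RCfg D (prevCol x.succ ∪ col x.succ)ᶜ) :
    traceOut (prevCol x.succ ∪ col x.succ) A i j = ∑ v, ∑ w,
      A (setCol x.castSucc v (setCol x.succ w (outer x i)))
        (setCol x.castSucc v (setCol x.succ w (outer x j))) := by
  change ∑ c, A (glue _ _ (i, c)) (glue _ _ (j, c)) = _
  rw [← (pairColEquiv x).symm.sum_comp, Fintype.sum_prod_type]
  simp only [glue_pairColEquiv]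
  rfl

namespace Model

theorem colVec_outer (x : Fin n) (i : RCfg D (prevCol x.succ ∪ col x.succ)ᶜ)
    (v w : Fin (n + 1) → Fin D) :
    colVec (x.val + 2) (setCol x.castSucc v (setCol x.succ w (outer x i))) =
      colVec (x.val + 2) (outer x i) := by
  rw [colVec_setCol_of_ne (by simp), colVec_setCol_of_ne (by simp)]

theorem forall_outer_iff (x : Fin n) (i j : RCfg D (prevCol x.succ ∪ col x.succ)ᶜ)
    (v w v' w' : Fin (n + 1) → Fin D) :
    (∀ s, s ∉ col x.castSucc → s ∉ col x.succ → s ∉ nextCol x.succ →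
      setCol x.castSucc v (setCol x.succ w (outer x i)) s =
        setCol x.castSucc v' (setCol x.succ w' (outer x j)) s) ↔
    ∀ s, s ∉ col x.castSucc → s ∉ col x.succ → s ∉ nextCol x.succ → outer x i s = outer x j s := by
  refine forall_congr' fun s => forall_congr' fun h1 => forall_congr' fun h2 => ?_
  rw [setCol_of_notMem _ _ h1, setCol_of_notMem _ _ h1, setCol_of_notMem _ _ h2,
    setCol_of_notMem _ _ h2]

/-- The factor is the dimension of column `x`, which is traced out although the operator acts
trivially on it. -/
theorem traceOut_halfTrace (x : Fin n)
    (B : Matrix (RCfg D (col x.succ)) (RCfg D (col x.succ)) ℂ)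
    (i j : RCfg D (prevCol x.succ ∪ col x.succ)ᶜ) :
    traceOut (prevCol x.succ ∪ col x.succ) (amp (col x.succ) B * M.projRight x.succ) i j =
      if ∀ s, s ∉ col x.castSucc → s ∉ col x.succ → s ∉ nextCol x.succ →
        outer x i s = outer x j s then
        (Fintype.card (Fin (n + 1) → Fin D) : ℂ) *
        M.halfTrace (fun σ ν => B (colFun x.succ σ) (colFun x.succ ν)) (x.val + 1)
          (colVec (x.val + 2) (outer x i)) (colVec (x.val + 2) (outer x j)) else 0 := by
  have hne : x.succ.val ≠ x.castSucc.val := by simp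
  have hne2 : x.val + 2 ≠ x.succ.val := by simp
  have hne3 : ∀ s : Site n, s ∈ col x.castSucc → s ∉ col x.succ := by
    intro s h1 h2
    rw [mem_col, Fin.ext_iff] at h1 h2
    rw [h1] at h2
    simp at h2
  have key : ∀ v w ν, M.projRight x.succ
      (setCol x.succ ν (setCol x.castSucc v (setCol x.succ w (outer x i))))
      (setCol x.castSucc v (setCol x.succ w (outer x j))) =
      if ∀ s, s ∉ col x.castSucc → s ∉ col x.succ → s ∉ nextCol x.succ →
        outer x i s = outer x j s then
        M.strip (x.val + 1) (pairExtend ν (colVec (x.val + 2) (outer x i)))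
          (pairExtend w (colVec (x.val + 2) (outer x j))) else 0 := by
    intro v w ν
    rw [M.projRight_apply]
    refine if_congr ?_ ?_ rfl
    · rw [← forall_outer_iff x i j v w v w]
      refine forall_congr' fun s => ?_
      by_cases h1 : s ∈ col x.castSucc
      · simp only [h1, not_true_eq_false, false_imp_iff, iff_true]
        intro h2 _
        rw [setCol_of_notMem _ _ h2, setCol_of_mem _ _ h1, setCol_of_mem _ _ h1]
      · simp only [h1, not_false_eq_true, true_imp_iff]
        refine forall_congr' fun h2 => ?_
        rw [setCol_of_notMem _ _ h2]
    · rw [pairVal_eq, pairVal_eq, colVec_setCol_self, colVec_setCol_of_ne hne, colVec_setCol_self]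
      change M.strip (x.val + 1) (pairExtend ν (colVec (x.val + 2) _))
        (pairExtend w (colVec (x.val + 2) _)) = _
      rw [colVec_setCol_of_ne hne2, colVec_outer, colVec_outer]
  rw [traceOut_apply]
  simp only [amp_col_mul_apply, key, colVec_setCol_of_ne hne, colVec_setCol_self]
  split_ifs
  · rw [Finset.sum_const, nsmul_eq_mul]
    rfl
  · simp

theorem traceOut_doubleTrace (x : Fin n)
    (B : Matrix (RCfg D (col x.castSucc)) (RCfg D (col x.castSucc)) ℂ)
    (B' : Matrix (RCfg D (col x.succ)) (RCfg D (col x.succ)) ℂ)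
    (i j : RCfg D (prevCol x.succ ∪ col x.succ)ᶜ) :
    traceOut (prevCol x.succ ∪ col x.succ) (amp (col x.succ) B' * (amp (col x.castSucc) B *
      (M.projRight x.castSucc * M.projRight x.succ))) i j =
      if ∀ s, s ∉ col x.castSucc → s ∉ col x.succ → s ∉ nextCol x.succ →
        outer x i s = outer x j s then
        M.doubleTrace (fun σ ν => B (colFun x.castSucc σ) (colFun x.castSucc ν))
          (fun σ ν => B' (colFun x.succ σ) (colFun x.succ ν)) x.val
          (colVec (x.val + 2) (outer x i)) (colVec (x.val + 2) (outer x j)) else 0 := by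
  have hne : x.succ.val ≠ x.castSucc.val := by simp
  have key : ∀ v w ν ν', (M.projRight x.castSucc * M.projRight x.succ)
      (setCol x.castSucc ν' (setCol x.succ ν (setCol x.castSucc v (setCol x.succ w (outer x i)))))
      (setCol x.castSucc v (setCol x.succ w (outer x j))) =
      if ∀ s, s ∉ col x.castSucc → s ∉ col x.succ → s ∉ nextCol x.succ →
        outer x i s = outer x j s then
        ∑ μ, M.strip x.val (pairExtend ν' ν) (pairExtend v μ) *
          M.strip (x.val + 1) (pairExtend μ (colVec (x.val + 2) (outer x i)))
          (pairExtend w (colVec (x.val + 2) (outer x j))) else 0 := by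
    intro v w ν ν'
    rw [M.projRight_mul_projRight_apply]
    refine if_congr ?_ ?_ rfl
    · refine Iff.trans ?_ (forall_outer_iff x i j v w v w)
      refine forall_congr' fun s => forall_congr' fun h1 => forall_congr' fun h2 => ?_
      rw [setCol_of_notMem _ _ h1, setCol_of_notMem _ _ h2]
    · have e1 : ∀ a b : Cfg n D, ∀ v, colVec x.val (setCol x.castSucc v a) = v :=
        fun a b v => colVec_setCol_self x.castSucc v a
      have e2 : ∀ a v, colVec (D := D) (x.val + 1) (setCol x.succ v a) = v :=
        fun a v => colVec_setCol_self x.succ v a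
      have e3 : ∀ (a : Cfg n D) v, colVec (x.val + 1) (setCol x.castSucc v a) =
          colVec (x.val + 1) a :=
        fun a v => colVec_setCol_of_ne (by simp) v a
      have e4 : ∀ (a : Cfg n D) v, colVec (x.val + 2) (setCol x.castSucc v a) =
          colVec (x.val + 2) a :=
        fun a v => colVec_setCol_of_ne (by simp) v a
      have e5 : ∀ (a : Cfg n D) v, colVec (x.val + 2) (setCol x.succ v a) =
          colVec (x.val + 2) a :=
        fun a v => colVec_setCol_of_ne (by simp) v a
      simp only [e1 _ (outer x i), e2, e3, e4, e5]
  rw [traceOut_apply]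
  have e1 : ∀ (a : Cfg n D) v, colVec x.castSucc.val (setCol x.castSucc v a) = v :=
    fun a v => colVec_setCol_self x.castSucc v a
  have e2 : ∀ (a : Cfg n D) v, colVec x.castSucc.val (setCol x.succ v a) =
      colVec x.castSucc.val a :=
    fun a v => colVec_setCol_of_ne (by simp) v a
  simp only [amp_col_mul_apply, key, colVec_setCol_of_ne hne, colVec_setCol_self, e1, e2]
  split_ifs
  · simp only [doubleTrace, halfTrace]
    rw [Finset.sum_comm]
    refine Finset.sum_congr rfl fun w _ => ?_
    rw [Finset.sum_comm]
    refine Finset.sum_congr rfl fun ν _ => ?_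
    simp only [Finset.mul_sum, Finset.sum_mul]
    rw [Finset.sum_congr rfl fun v _ => Finset.sum_comm, Finset.sum_comm]
    refine Finset.sum_congr rfl fun μ _ => Finset.sum_congr rfl fun v _ =>
      Finset.sum_congr rfl fun ν' _ => ?_
    ring
  · simp

/-- Proportional contractions, in terms of traces. -/
theorem trace_eq_of_doubleTrace {x : Fin n} {c : ℂ}
    {B : Matrix (RCfg D (col x.castSucc)) (RCfg D (col x.castSucc)) ℂ}
    {B' : Matrix (RCfg D (col x.succ)) (RCfg D (col x.succ)) ℂ}
    (h : ∀ s t, M.doubleTrace (fun σ ν => B (colFun x.castSucc σ) (colFun x.castSucc ν))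
          (fun σ ν => B' (colFun x.succ σ) (colFun x.succ ν)) x.val s t =
        c * M.halfTrace (fun σ ν => B' (colFun x.succ σ) (colFun x.succ ν)) (x.val + 1) s t)
    {E : Op n D} (hE : E ∈ localAlgebra D (prevCol x.succ ∪ col x.succ)ᶜ) :
    (amp (col x.succ) B' * (amp (col x.castSucc) B *
      (M.projRight x.castSucc * M.projRight x.succ)) * E).trace =
    c / (Fintype.card (Fin (n + 1) → Fin D) : ℂ) *
      (amp (col x.succ) B' * M.projRight x.succ * E).trace := by
  obtain ⟨E, rfl⟩ := exists_amp hE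
  rw [trace_mul_amp, trace_mul_amp, ← smul_eq_mul (c / _), ← Matrix.trace_smul, ← Matrix.smul_mul]
  congr 2
  ext i j
  rw [M.traceOut_doubleTrace, Matrix.smul_apply, M.traceOut_halfTrace, smul_eq_mul]
  split_ifs
  · have : (Fintype.card (Fin (n + 1) → Fin D) : ℂ) ≠ 0 := Nat.cast_ne_zero.mpr Fintype.card_ne_zero
    rw [h]
    field_simp
  · rw [mul_zero]

theorem doubleTrace_eq_of_traceOut {x : Fin n} {c : ℂ}
    {B : Matrix (RCfg D (col x.castSucc)) (RCfg D (col x.castSucc)) ℂ}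
    {B' : Matrix (RCfg D (col x.succ)) (RCfg D (col x.succ)) ℂ}
    (h : traceOut (prevCol x.succ ∪ col x.succ) (amp (col x.succ) B' * (amp (col x.castSucc) B *
      (M.projRight x.castSucc * M.projRight x.succ))) =
      c • traceOut (prevCol x.succ ∪ col x.succ) (amp (col x.succ) B' * M.projRight x.succ))
    (s t : Fin (n + 1) → Fin D) :
    M.doubleTrace (fun σ ν => B (colFun x.castSucc σ) (colFun x.castSucc ν))
          (fun σ ν => B' (colFun x.succ σ) (colFun x.succ ν)) x.val s t =
        c * Fintype.card (Fin (n + 1) → Fin D) *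
        M.halfTrace (fun σ ν => B' (colFun x.succ σ) (colFun x.succ ν)) (x.val + 1) s t := by
  have key : ∀ i j, (∀ s, s ∉ col x.castSucc → s ∉ col x.succ → s ∉ nextCol x.succ →
        outer x i s = outer x j s) →
      M.doubleTrace (fun σ ν => B (colFun x.castSucc σ) (colFun x.castSucc ν))
          (fun σ ν => B' (colFun x.succ σ) (colFun x.succ ν)) x.val
          (colVec (x.val + 2) (outer x i)) (colVec (x.val + 2) (outer x j)) =
        c * Fintype.card (Fin (n + 1) → Fin D) *
        M.halfTrace (fun σ ν => B' (colFun x.succ σ) (colFun x.succ ν)) (x.val + 1)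
          (colVec (x.val + 2) (outer x i)) (colVec (x.val + 2) (outer x j)) := by
    intro i j hij
    have := congrFun (congrFun h i) j
    rw [M.traceOut_doubleTrace, Matrix.smul_apply, M.traceOut_halfTrace, smul_eq_mul, if_pos hij,
      if_pos hij] at this
    rw [this]
    ring
  -- If the column `x + 2` exists, all `s`, `t` are realized by configurations of the complement.
  -- Otherwise both functions are multiples of the Kronecker delta, and one comparison suffices.
  by_cases hx : x.val + 2 < n + 1
  · let C : Fin (n + 1) := ⟨x.val + 2, hx⟩
    let i : (Fin (n + 1) → Fin D) → RCfg D (prevCol x.succ ∪ col x.succ)ᶜ := fun s p =>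
      setCol C s 0 p
    have hCm : ∀ y, ((C, y) : Site n) ∈ (prevCol x.succ ∪ col x.succ)ᶜ := by
      intro y
      rw [Finset.mem_compl, Finset.mem_union, mem_prevCol, mem_col, Fin.ext_iff]
      simp [C]
    have hi : ∀ s, colVec (x.val + 2) (outer x (i s)) = s := by
      intro s
      ext y
      rw [show x.val + 2 = C.val from rfl, colVec_coe, outer, glue_of_mem_left _ (hCm y)]
      exact congrArg Fin.val (setCol_of_mem _ _ (mem_col.mpr rfl))
    have hi' : ∀ s p, p ∉ nextCol x.succ → outer x (i s) p = 0 := by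
      intro s p hp
      unfold outer
      by_cases hp' : p ∈ (prevCol x.succ ∪ col x.succ)ᶜ
      · rw [glue_of_mem_left _ hp']
        refine setCol_of_notMem _ _ ?_
        rw [mem_col, Fin.ext_iff]
        rw [mem_nextCol] at hp
        simpa [C] using hp
      · rw [glue_of_mem_right disjoint_compl_left _ (by rwa [Finset.mem_compl, not_not] at hp')]
        rfl
    have := key (i s) (i t) fun p _ _ hp => by rw [hi' s p hp, hi' t p hp]
    rwa [hi, hi] at this
  · have hn : n ≤ x.val + 1 := by omega
    have hz : ∀ u : Cfg n D, colVec (x.val + 2) u = 0 := by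
      intro u
      ext y
      exact congrArg Fin.val (dif_neg fun h => hx h.1)
    have := key 0 0 fun _ _ _ _ => rfl
    rw [hz] at this
    rw [M.doubleTrace_of_le hn, M.halfTrace_of_le hn]
    split_ifs
    · exact this
    · rw [mul_zero]

end Model

end Contraction

/-! ### Sums over boxes of lists -/

/-- The sum over all lists whose entries are below those of the given list. -/
def boxSum : List ℕ → (List ℕ → ℂ) → ℂ
  | [], f => f []
  | b :: bs, f => ∑ i ∈ Finset.range b, boxSum bs fun l => f (i :: l)

theorem boxSum_append (bs cs : List ℕ) (f : List ℕ → ℂ) :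
    boxSum (bs ++ cs) f = boxSum bs fun l => boxSum cs fun l' => f (l ++ l') := by
  induction bs generalizing f with
  | nil => rfl
  | cons b bs ih => simp only [List.cons_append, boxSum, ih]

/-- `enc` enumerates the lists whose entries are below those of `bs`. -/
structure Coding (I : Type) [Fintype I] (bs : List ℕ) (enc : I → List ℕ) : Prop where
  length : ∀ i, (enc i).length = bs.length
  injective : Function.Injective enc
  sum : ∀ f, boxSum bs f = ∑ i, f (enc i)

theorem Coding.fin (d : ℕ) : Coding (Fin d) [d] fun i => [i.val] where
  length _ := rfl
  injective i j h := Fin.ext (by simpa using h)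
  sum f := by
    simp only [boxSum]
    exact Finset.sum_range fun i => f [i]

theorem Coding.prod {I J : Type} [Fintype I] [Fintype J] {bs cs : List ℕ} {enc : I → List ℕ}
    {enc' : J → List ℕ} (h : Coding I bs enc) (h' : Coding J cs enc') :
    Coding (I × J) (bs ++ cs) fun p => enc p.1 ++ enc' p.2 where
  length p := by rw [List.length_append, List.length_append, h.length, h'.length]
  injective p q hpq := by
    have := List.append_inj hpq (by rw [h.length, h.length])
    exact Prod.ext (h.injective this.1) (h'.injective this.2)
  sum f := by
    rw [boxSum_append, h.sum, Fintype.sum_prod_type]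
    exact Finset.sum_congr rfl fun i _ => h'.sum _

/-! ### Loops -/

theorem Memory.setNat_nat_of_ne (s : Memory) {i j : ℕ} (v : ℕ) (h : j ≠ i) :
    (s.setNat i v).nat j = s.nat j := Function.update_of_ne h _ _

theorem Memory.setNat_nat_self (s : Memory) (i v : ℕ) :
    (s.setNat i v).nat i = v := Function.update_self _ _ _

/-- `P j` is the invariant before iteration `j`. The number of iterations is fixed at the start, so
the body may change the registers in the upper limit. -/
theorem Program.loop_induction {i : ℕ} {e : NExpr} {p : Program} (P : ℕ → Memory → Prop)
    {s : Memory} (h0 : P 0 s)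
    (h : ∀ j < e.eval s, ∀ t, P j t → P (j + 1) (p.run (t.setNat i j)).1) :
    P (e.eval s) ((Program.loop i e p).run s).1 := by
  have key : ∀ k ≤ e.eval s, P k ((List.range k).foldl
      (fun r j => ((p.run (r.1.setNat i j)).1, r.2 + (p.run (r.1.setNat i j)).2 + 1))
        (s, e.cost + 1)).1 := by
    intro k
    induction k with
    | zero => exact fun _ => h0
    | succ k ih =>
      intro hk
      rw [List.range_succ, List.foldl_append]
      exact h k hk _ (ih (by omega))
  exact key _ le_rfl

/-- Nested loops over the given registers, with upper limits from the given registers. -/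
def nest : List (ℕ × ℕ) → Program → Program
  | [], p => p
  | v :: vs, p => .loop v.1 (.var v.2) (nest vs p)

/-- The values of the registers inside of nested loops. -/
def assign : List (ℕ × ℕ) → List ℕ → (ℕ → ℕ) → ℕ → ℕ
  | v :: vs, a :: l, ν => assign vs l (Function.update ν v.1 a)
  | _, _, ν => ν

theorem assign_append (vs ws : List (ℕ × ℕ)) (l l' : List ℕ) (ν : ℕ → ℕ)
    (h : l.length = vs.length) : assign (vs ++ ws) (l ++ l') ν = assign ws l' (assign vs l ν) := by
  induction vs generalizing l ν with
  | nil =>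
    rw [List.length_nil, List.length_eq_zero_iff] at h
    subst h
    rw [List.nil_append, List.nil_append, assign.eq_def [] []]
  | cons v vs ih =>
    match l, h with
    | a :: l, h => exact ih l _ (by simpa using h)

/-- The memory agrees with `s₀`, except for the loop registers and for the cells `W` of
array `3`. -/
def AgreesOff (s₀ : Memory) (W : Set (List ℕ)) (s : Memory) : Prop :=
  (∀ i < 10, s.nat i = s₀.nat i) ∧ ∀ A k, (A ≠ 3 ∨ k ∉ W) → s.arr A k = s₀.arr A k

/-- The effect of the program is to add `G` to array `3`; it also changes registers in `mod`. -/
def Adds (s₀ : Memory) (W : Set (List ℕ)) (mod : Set ℕ) (p : Program)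
    (G : (ℕ → ℕ) → List ℕ → ℂ) : Prop :=
  ∀ s, AgreesOff s₀ W s → (∀ i ∉ mod, (p.run s).1.nat i = s.nat i) ∧
    ∀ A k, (p.run s).1.arr A k = s.arr A k + if A = 3 then G s.nat k else 0

theorem AgreesOff.setNat {s₀ s : Memory} {W : Set (List ℕ)} (h : AgreesOff s₀ W s) {i : ℕ}
    (hi : 10 ≤ i) (v : ℕ) : AgreesOff s₀ W (s.setNat i v) :=
  ⟨fun j hj => (s.setNat_nat_of_ne v (by omega)).trans (h.1 j hj), h.2⟩

theorem Adds.agreesOff {s₀ : Memory} {W : Set (List ℕ)} {mod : Set ℕ} {p : Program}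
    {G : (ℕ → ℕ) → List ℕ → ℂ} (hp : Adds s₀ W mod p G) (hmod : ∀ i ∈ mod, 10 ≤ i)
    (hG : ∀ ν : ℕ → ℕ, (∀ i < 10, ν i = s₀.nat i) → ∀ k, k ∉ W → G ν k = 0)
    {s : Memory} (h : AgreesOff s₀ W s) :
    AgreesOff s₀ W (p.run s).1 := by
  obtain ⟨h1, h2⟩ := hp s h
  refine ⟨fun i hi => (h1 i fun h' => ?_).trans (h.1 i hi), fun A k hk => ?_⟩
  · have := hmod i h'
    omega
  · rw [h2, h.2 A k hk]
    split_ifs with hA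
    · rw [hG _ h.1 _ (hk.resolve_left (not_not.mpr hA)), add_zero]
    · rw [add_zero]

/-- Contributions of the iterations add up because `G` does not see the registers that earlier
iterations changed. Loop registers are at least `10` and upper limits are below `10`, so the limits
stay constant. -/
theorem Adds.loop {s₀ : Memory} {W : Set (List ℕ)} {mod : Set ℕ} {p : Program}
    {G : (ℕ → ℕ) → List ℕ → ℂ} (hp : Adds s₀ W mod p G) (hmod : ∀ i ∈ mod, 10 ≤ i)
    (hG : ∀ ν : ℕ → ℕ, (∀ i < 10, ν i = s₀.nat i) → ∀ k, k ∉ W → G ν k = 0)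
    (hG' : ∀ ν ν', (∀ j ∉ mod, ν j = ν' j) → G ν = G ν')
    {i r : ℕ} (hi : 10 ≤ i) (hr : r < 10) :
    Adds s₀ W (insert i mod) (.loop i (.var r) p)
      fun ν k => ∑ j ∈ Finset.range (s₀.nat r), G (Function.update ν i j) k := by
  intro s hs
  have hv : (NExpr.var r).eval s = s₀.nat r := hs.1 r hr
  rw [← hv]
  refine (Program.loop_induction (fun j t => AgreesOff s₀ W t ∧
    (∀ i' ∉ insert i mod, t.nat i' = s.nat i') ∧ ∀ A k, t.arr A k = s.arr A k +
      if A = 3 then ∑ j ∈ Finset.range j, G (Function.update s.nat i j) k else 0) ?_ ?_).2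
  · exact ⟨hs, fun _ _ => rfl, fun A k => by simp⟩
  · rintro j - t ⟨h1, h2, h3⟩
    have h4 := h1.setNat hi j
    obtain ⟨h5, h6⟩ := hp _ h4
    refine ⟨hp.agreesOff hmod hG h4, fun i' hi' => ?_, fun A k => ?_⟩
    · rw [Set.mem_insert_iff, not_or] at hi'
      rw [h5 i' hi'.2, t.setNat_nat_of_ne _ hi'.1]
      exact h2 i' fun h => (Set.mem_insert_iff.mp h).elim hi'.1 hi'.2
    · rw [h6]
      change t.arr A k + _ = _
      rw [h3]
      split_ifs with hA
      · rw [Finset.sum_range_succ, add_assoc]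
        congr 2
        refine congrFun (hG' _ _ fun j' hj' => ?_) k
        by_cases hji : j' = i
        · subst hji
          rw [t.setNat_nat_self, Function.update_self]
        · rw [t.setNat_nat_of_ne _ hji, Function.update_of_ne hji]
          exact h2 j' fun h => (Set.mem_insert_iff.mp h).elim hji hj'
      · simp

theorem Adds.nest {s₀ : Memory} {W : Set (List ℕ)} {p : Program}
    {G : (ℕ → ℕ) → List ℕ → ℂ} (hp : Adds s₀ W ∅ p G)
    (hG : ∀ ν : ℕ → ℕ, (∀ i < 10, ν i = s₀.nat i) → ∀ k, k ∉ W → G ν k = 0) (vs : List (ℕ × ℕ))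
    (hvs : ∀ v ∈ vs, 10 ≤ v.1 ∧ v.2 < 10) :
    Adds s₀ W {i | ∃ v ∈ vs, v.1 = i} (nest vs p)
      fun ν k => boxSum (vs.map fun v => s₀.nat v.2) fun l => G (assign vs l ν) k := by
  -- The induction also needs that the accumulated sum vanishes off `W` and does not depend on the
  -- loop registers, the two hypotheses of `Adds.loop`.
  suffices h : Adds s₀ W {i | ∃ v ∈ vs, v.1 = i} (CLH.nest vs p)
      (fun ν k => boxSum (vs.map fun v => s₀.nat v.2) fun l => G (assign vs l ν) k) ∧
      (∀ ν : ℕ → ℕ, (∀ i < 10, ν i = s₀.nat i) → ∀ k, k ∉ W →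
        boxSum (vs.map fun v => s₀.nat v.2) (fun l => G (assign vs l ν) k) = 0) ∧
      ∀ ν ν', (∀ j, (∀ v ∈ vs, v.1 ≠ j) → ν j = ν' j) → ∀ k,
        boxSum (vs.map fun v => s₀.nat v.2) (fun l => G (assign vs l ν) k) =
        boxSum (vs.map fun v => s₀.nat v.2) (fun l => G (assign vs l ν') k) from h.1
  induction vs with
  | nil =>
    refine ⟨?_, fun ν hν k hk => hG _ hν _ hk, fun ν ν' h k => ?_⟩
    · simpa [CLH.nest, boxSum, assign] using hp
    · have : ν = ν' := funext fun j => h j (by simp)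
      rw [this]
  | cons v vs ih =>
    obtain ⟨h1, h2, h3⟩ := ih fun v hv => hvs v (List.mem_cons_of_mem _ hv)
    have hv := hvs v List.mem_cons_self
    refine ⟨?_, ?_, ?_⟩
    · have := h1.loop (by
        rintro i ⟨v, hv, rfl⟩
        exact (hvs v (List.mem_cons_of_mem _ hv)).1) h2
        (fun ν ν' h => funext fun k => h3 ν ν' (fun j hj => h j (by
          rintro ⟨v, hv, rfl⟩
          exact hj v hv rfl)) k) hv.1 hv.2
      intro s hs
      obtain ⟨h4, h5⟩ := this s hs
      refine ⟨fun i hi => h4 i fun h' => hi ?_, h5⟩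
      rcases h' with rfl | ⟨w, hw, rfl⟩
      · exact ⟨v, List.mem_cons_self, rfl⟩
      · exact ⟨w, List.mem_cons_of_mem _ hw, rfl⟩
    · intro ν hν k hk
      refine Finset.sum_eq_zero fun j _ => h2 _ (fun i hi => ?_) k hk
      rw [Function.update_of_ne (by omega)]
      exact hν i hi
    · intro ν ν' h k
      refine Finset.sum_congr rfl fun j _ => h3 _ _ (fun i hi => ?_) k
      by_cases hiv : i = v.1
      · subst hiv; rw [Function.update_self, Function.update_self]
      · rw [Function.update_of_ne hiv, Function.update_of_ne hiv]
        refine h i fun w hw => ?_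
        rcases List.mem_cons.mp hw with rfl | hw
        · exact fun h => hiv h.symm
        · exact hi w hw

/-- Add the value of `e` to a cell of array `3`. -/
def scatter (idx : List NExpr) (e : CExpr) : Program :=
  .setC 3 idx (.add (.cell 3 idx) e)

theorem NExpr.eval_congr {s s' : Memory} (h : s.nat = s'.nat) (e : NExpr) :
    e.eval s = e.eval s' := by
  induction e with
  | const c => rfl
  | var i => exact congrFun h i
  | add e f he hf => exact congrArg₂ (· + ·) he hf
  | sub e f he hf => exact congrArg₂ (· - ·) he hf

/-- By `he` the added value does not depend on the cells in `W` that are being written, so repeated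
execution is a sum. -/
theorem adds_scatter {s₀ : Memory} {W : Set (List ℕ)} {idx : List NExpr} {e : CExpr}
    (he : ∀ s, AgreesOff s₀ W s → e.eval s = e.eval ⟨s.nat, s₀.arr⟩) :
    Adds s₀ W ∅ (scatter idx e) fun ν k =>
      if idx.map (NExpr.eval ⟨ν, s₀.arr⟩) = k then e.eval ⟨ν, s₀.arr⟩ else 0 := by
  intro s hs
  have hidx : idx.map (NExpr.eval ⟨s.nat, s₀.arr⟩) = idx.map (NExpr.eval s) :=
    List.map_congr_left fun f _ =>
      NExpr.eval_congr (s := ⟨s.nat, s₀.arr⟩) (s' := s) rfl f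
  refine ⟨fun i _ => rfl, fun A k => ?_⟩
  beta_reduce
  rw [hidx, ← he s hs]
  change Function.update s.arr 3 (Function.update (s.arr 3) (idx.map (NExpr.eval s))
    (s.arr 3 (idx.map (NExpr.eval s)) + e.eval s)) A k = _
  by_cases hA : A = 3
  · subst hA
    rw [Function.update_self, if_pos rfl]
    by_cases hk : idx.map (NExpr.eval s) = k
    · rw [if_pos hk, hk, Function.update_self]
    · rw [if_neg hk, Function.update_of_ne (Ne.symm hk), add_zero]
  · rw [Function.update_of_ne hA, if_neg hA, add_zero]

theorem run_nest_scatter {s₀ : Memory} (W : Set (List ℕ)) {vs : List (ℕ × ℕ)}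
    {idx : List NExpr} {e : CExpr} (hvs : ∀ v ∈ vs, 10 ≤ v.1 ∧ v.2 < 10)
    (he : ∀ s, AgreesOff s₀ W s → e.eval s = e.eval ⟨s.nat, s₀.arr⟩)
    (hidx : ∀ ν : ℕ → ℕ, (∀ i < 10, ν i = s₀.nat i) → idx.map (NExpr.eval ⟨ν, s₀.arr⟩) ∈ W)
    {J : Type} [Fintype J] {enc : J → List ℕ} (hJ : Coding J (vs.map fun v => s₀.nat v.2) enc) :
    (∀ i < 10, ((nest vs (scatter idx e)).run s₀).1.nat i = s₀.nat i) ∧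
    (∀ A ≠ 3, ((nest vs (scatter idx e)).run s₀).1.arr A = s₀.arr A) ∧
    ∀ k, ((nest vs (scatter idx e)).run s₀).1.arr 3 k = s₀.arr 3 k +
      ∑ j, if idx.map (NExpr.eval ⟨assign vs (enc j) s₀.nat, s₀.arr⟩) = k then
        e.eval ⟨assign vs (enc j) s₀.nat, s₀.arr⟩ else 0 := by
  obtain ⟨h1, h2⟩ := (adds_scatter he).nest
    (fun ν hν k hk => if_neg fun h => hk (by rw [← h]; exact hidx ν hν))
    vs hvs s₀ ⟨fun _ _ => rfl, fun _ _ _ => rfl⟩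
  refine ⟨fun i hi => h1 i ?_, fun A hA => ?_, fun k => ?_⟩
  · rintro ⟨v, hv, rfl⟩
    have := (hvs v hv).1
    omega
  · ext k
    rw [h2, if_neg hA, add_zero]
  · rw [h2, if_pos rfl]
    beta_reduce
    rw [hJ.sum]

/-! ### Evaluation of a network -/

/-- Loop registers `a, a + 2, …` with the registers of their upper limits. -/
def vars (a : ℕ) : List ℕ → List (ℕ × ℕ)
  | [] => []
  | t :: ts => (a, t) :: vars (a + 2) ts

/-- The loop registers as index expressions. -/
def index (a : ℕ) (ts : List ℕ) : List NExpr := (vars a ts).map fun v => .var v.1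

theorem length_vars (a : ℕ) (ts : List ℕ) : (vars a ts).length = ts.length := by
  induction ts generalizing a with
  | nil => rfl
  | cons t ts ih => exact congrArg (· + 1) (ih (a + 2))

theorem map_vars (a : ℕ) (ts : List ℕ) (f : ℕ → ℕ) : (vars a ts).map (fun v => f v.2) =
    ts.map f := by
  induction ts generalizing a with
  | nil => rfl
  | cons t ts ih => exact congrArg (f t :: ·) (ih (a + 2))

theorem le_of_mem_vars {a : ℕ} {ts : List ℕ} {v : ℕ × ℕ} (h : v ∈ vars a ts) :
    a ≤ v.1 ∧ v.2 ∈ ts := by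
  induction ts generalizing a with
  | nil => exact absurd h List.not_mem_nil
  | cons t ts ih =>
    rcases List.mem_cons.mp h with rfl | h
    · exact ⟨le_rfl, List.mem_cons_self⟩
    · have := ih h
      exact ⟨by omega, List.mem_cons_of_mem _ this.2⟩

theorem mod_two_of_mem_vars {a : ℕ} {ts : List ℕ} {v : ℕ × ℕ} (h : v ∈ vars a ts) :
    v.1 % 2 = a % 2 := by
  induction ts generalizing a with
  | nil => exact absurd h List.not_mem_nil
  | cons t ts ih =>
    rcases List.mem_cons.mp h with rfl | h
    · rfl
    · have := ih h
      omega

/-- Registers advance in steps of two, so families starting at `10` and at `11` are kept apart by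
parity. -/
theorem assign_of_ne {a : ℕ} {ts l : List ℕ} (ν : ℕ → ℕ) {m : ℕ} (h : m < a ∨ m % 2 ≠ a % 2) :
    assign (vars a ts) l ν m = ν m := by
  induction ts generalizing a l ν with
  | nil => rfl
  | cons t ts ih =>
    match l with
    | [] => rfl
    | x :: l =>
      change assign (vars (a + 2) ts) l _ m = _
      rw [ih _ (by omega), Function.update_of_ne]
      rintro rfl
      omega

theorem assign_vars {a : ℕ} {ts l : List ℕ} (ν : ℕ → ℕ) (h : l.length = ts.length) {j : ℕ}
    (hj : j < l.length) : assign (vars a ts) l ν (a + 2 * j) = l.getD j 0 := by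
  induction ts generalizing a l ν j with
  | nil =>
    rw [h] at hj
    exact absurd hj (Nat.not_lt_zero _)
  | cons t ts ih =>
    match l, h with
    | x :: l, h =>
      change assign (vars (a + 2) ts) l _ _ = _
      match j with
      | 0 => rw [assign_of_ne _ (Or.inl (by omega)), mul_zero, add_zero, Function.update_self]; rfl
      | j + 1 =>
        have := ih (a := a + 2) (Function.update ν a x) (by simpa using h) (j := j)
          (by simpa using hj)
        rw [show a + 2 * (j + 1) = a + 2 + 2 * j by ring, this]
        rfl

theorem map_index_assign {a : ℕ} {ts l : List ℕ} (ν : ℕ → ℕ) (arr : ℕ → List ℕ → ℂ)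
    (h : l.length = ts.length) :
    (index a ts).map (NExpr.eval ⟨assign (vars a ts) l ν, arr⟩) = l := by
  induction ts generalizing a l ν with
  | nil => exact (List.length_eq_zero_iff.mp h).symm
  | cons t ts ih =>
    match l, h with
    | x :: l, h =>
      refine congrArg₂ List.cons ?_ (ih _ (by simpa using h))
      change assign (vars (a + 2) ts) l _ a = _
      rw [assign_of_ne _ (Or.inl (by omega)), Function.update_self]

/-- The program which evaluates the network with initial weight `ini` and transfer weight `w`, with
states given by the loop registers of types `ts`; the current state is in the registers
`10, 12, …`, the next one in the registers `11, 13, …`, and the step in the register `4`. -/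
def evalNet (id : ℕ) (ts : List ℕ) (ini w : CExpr) : Program :=
  .seq (nest (vars 10 ts) (scatter ([.const id, .var 5, .const 0] ++ index 10 ts) ini))
    (.loop 4 (.var 1) (nest (vars 11 ts ++ vars 10 ts)
      (scatter ([.const id, .var 5, .add (.var 4) (.const 1)] ++ index 11 ts)
        (.mul (.cell 3 ([.const id, .var 5, .var 4] ++ index 10 ts)) w))))

/-- The result of `evalNet`. -/
def netResult (id : ℕ) (ts : List ℕ) : CExpr :=
  .cell 3 ([.const id, .var 5, .var 1] ++ ts.map fun _ => .const 0)

/-- The registers and arrays that weights can depend on agree. -/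
def SameInput (s s₀ : Memory) : Prop :=
  (∀ i < 10, i ≠ 4 → s.nat i = s₀.nat i) ∧ ∀ A, A ≠ 3 → s.arr A = s₀.arr A

/-- The cells of array `3` are indexed by network, column, step and state. Reading layer `y` while
writing layer `y + 1` causes no interference, and since the column is part of the index all cells
start out as zero. -/
theorem run_evalNet {I : Type} [Fintype I] [Zero I] {ts : List ℕ} {enc : I → List ℕ} {s₀ : Memory}
    (hts : ∀ t ∈ ts, t < 4) (hI : Coding I (ts.map s₀.nat) enc) (h0 : enc 0 = ts.map fun _ => 0)
    {id : ℕ} {ini w : CExpr} {g : I → ℂ} {W : ℕ → I → I → ℂ}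
    (hz : ∀ k, s₀.arr 3 (id :: s₀.nat 5 :: k) = 0)
    (hini : ∀ s, SameInput s s₀ → ∀ i,
      (∀ j < ts.length, s.nat (10 + 2 * j) = (enc i).getD j 0) → ini.eval s = g i)
    (hini' : ∀ s s', s.nat = s'.nat → (∀ A ≠ 3, s.arr A = s'.arr A) → ini.eval s = ini.eval s')
    (hw : ∀ s, SameInput s s₀ → ∀ i i',
      (∀ j < ts.length, s.nat (10 + 2 * j) = (enc i).getD j 0) →
      (∀ j < ts.length, s.nat (11 + 2 * j) = (enc i').getD j 0) → w.eval s = W (s.nat 4) i i')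
    (hw' : ∀ s s', s.nat = s'.nat → (∀ A ≠ 3, s.arr A = s'.arr A) → w.eval s = w.eval s') :
    SameInput ((evalNet id ts ini w).run s₀).1 s₀ ∧
    (∀ k, (∀ k', k ≠ id :: s₀.nat 5 :: k') →
      ((evalNet id ts ini w).run s₀).1.arr 3 k = s₀.arr 3 k) ∧
    (netResult id ts).eval ((evalNet id ts ini w).run s₀).1 = pathSum (s₀.nat 1) g W := by
  classical
  set x := s₀.nat 5 with hx
  have hlen : ∀ i, (enc i).length = ts.length := fun i => by rw [hI.length, List.length_map]
  have hvs : ∀ a, 10 ≤ a → ∀ v ∈ vars a ts, 10 ≤ v.1 ∧ v.2 < 10 := fun a ha v hv => by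
    have := le_of_mem_vars hv
    have := hts _ this.2
    omega
  let Z : ℕ → I → ℂ := fun y => Nat.rec g (fun y z b => ∑ a, z a * W y a b) y
  -- The invariant after `y` steps: the input is intact, other networks are untouched, later layers
  -- are zero, and layer `y` holds the vector `Z y`.
  let P : ℕ → Memory → Prop := fun y s => SameInput s s₀ ∧
    (∀ k, (∀ k', k ≠ id :: x :: k') → s.arr 3 k = s₀.arr 3 k) ∧
    (∀ j k, y < j → s.arr 3 (id :: x :: j :: k) = 0) ∧
    ∀ i, s.arr 3 (id :: x :: y :: enc i) = Z y i
  have hfirst : P 0 ((nest (vars 10 ts) (scatter ([.const id, .var 5, .const 0] ++ index 10 ts)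
      ini)).run s₀).1 := by
    have hcod : Coding I ((vars 10 ts).map fun v => s₀.nat v.2) enc := by rwa [map_vars]
    obtain ⟨h1, h2, h3⟩ := run_nest_scatter (s₀ := s₀) {k | ∃ k', k = id :: x :: 0 :: k'}
      (vs := vars 10 ts) (idx := [.const id, .var 5, .const 0] ++ index 10 ts) (e := ini)
      (hvs 10 le_rfl) (fun s hs => hini' _ _ rfl fun A hA => funext fun k => hs.2 A k (Or.inl hA))
      (fun ν hν => ⟨(index 10 ts).map (NExpr.eval ⟨ν, s₀.arr⟩), by
        rw [List.map_append, hx, ← hν 5 (by omega)]; rfl⟩) hcod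
    have hidx : ∀ i, (([.const id, .var 5, .const 0] ++ index 10 ts : List NExpr)).map
        (NExpr.eval ⟨assign (vars 10 ts) (enc i) s₀.nat, s₀.arr⟩) = id :: x :: 0 :: enc i := by
      intro i
      rw [List.map_append, map_index_assign _ _ (hlen i)]
      change id :: assign (vars 10 ts) (enc i) s₀.nat 5 :: 0 :: enc i = _
      rw [assign_of_ne _ (Or.inl (by omega))]
    have hval : ∀ i, ini.eval ⟨assign (vars 10 ts) (enc i) s₀.nat, s₀.arr⟩ = g i := by
      intro i
      refine hini ⟨assign (vars 10 ts) (enc i) s₀.nat, s₀.arr⟩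
        ⟨fun m hm _ => assign_of_ne _ (Or.inl hm), fun _ _ => rfl⟩ i fun j hj => ?_
      exact assign_vars _ (hlen i) (by rwa [hlen])
    simp only [hidx, hval] at h3
    refine ⟨⟨fun i hi _ => h1 i hi, h2⟩, fun k hk => ?_, fun j k hj => ?_, fun i => ?_⟩
    · rw [h3, Finset.sum_eq_zero, add_zero]
      exact fun i _ => if_neg fun h => hk _ h.symm
    · rw [h3, Finset.sum_eq_zero, add_zero, hz]
      refine fun i _ => if_neg fun h => ?_
      simp only [List.cons.injEq] at h
      omega
    · rw [h3, hz, zero_add]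
      simp only [List.cons.injEq, true_and, hI.injective.eq_iff, Finset.sum_ite_eq',
        Finset.mem_univ, if_true]
      rfl
  have hstep : ∀ y t, P y t → P (y + 1) ((nest (vars 11 ts ++ vars 10 ts)
      (scatter ([.const id, .var 5, .add (.var 4) (.const 1)] ++ index 11 ts)
        (.mul (.cell 3 ([.const id, .var 5, .var 4] ++ index 10 ts)) w))).run
        (t.setNat 4 y)).1 := by
    rintro y t ⟨p1, p2, p3, p4⟩
    set s := t.setNat 4 y with hs
    have hs4 : s.nat 4 = y := t.setNat_nat_self 4 y
    have hsi : SameInput s s₀ := ⟨fun i hi hi4 => by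
      rw [hs, t.setNat_nat_of_ne _ hi4]; exact p1.1 i hi hi4, p1.2⟩
    have hsx : s.nat 5 = x := hsi.1 5 (by omega) (by omega)
    have hbs : (ts.map fun t => s.nat t) = ts.map s₀.nat := List.map_congr_left fun t ht => by
      by_cases h4 : t = 4
      · exact absurd (hts t ht) (by omega)
      · exact hsi.1 t ((hts t ht).trans (by omega)) h4
    have hcod : Coding (I × I) ((vars 11 ts ++ vars 10 ts).map fun v => s.nat v.2)
        (fun p => enc p.1 ++ enc p.2) := by
      rw [List.map_append, map_vars, map_vars, hbs]
      exact hI.prod hI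
    obtain ⟨h1, h2, h3⟩ := run_nest_scatter (s₀ := s) {k | ∃ k', k = id :: x :: (y + 1) :: k'}
      (vs := vars 11 ts ++ vars 10 ts)
      (idx := [.const id, .var 5, .add (.var 4) (.const 1)] ++ index 11 ts)
      (e := .mul (.cell 3 ([.const id, .var 5, .var 4] ++ index 10 ts)) w)
      (fun v hv => (List.mem_append.mp hv).elim (hvs 11 (by omega) v) (hvs 10 le_rfl v))
      (fun u hu => by
        refine congrArg₂ (· * ·) ?_
          (hw' _ _ rfl fun A hA => funext fun k => hu.2 A k (Or.inl hA))
        have e1 : ([.const id, .var 5, .var 4] ++ index 10 ts : List NExpr).map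
            (NExpr.eval ⟨u.nat, s.arr⟩) =
            ([.const id, .var 5, .var 4] ++ index 10 ts : List NExpr).map (NExpr.eval u) :=
          List.map_congr_left fun f _ => NExpr.eval_congr (s := ⟨u.nat, s.arr⟩) (s' := u) rfl f
        change u.arr 3 _ = s.arr 3 _
        rw [e1]
        refine hu.2 3 _ (Or.inr ?_)
        rintro ⟨k', hk'⟩
        rw [List.map_append] at hk'
        change id :: u.nat 5 :: u.nat 4 :: _ = _ at hk'
        simp only [List.cons.injEq] at hk'
        rw [hu.1 4 (by omega), hs4] at hk'
        omega)
      (fun ν hν => ⟨(index 11 ts).map (NExpr.eval ⟨ν, s.arr⟩), by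
        rw [List.map_append, ← hsx, ← hs4, ← hν 5 (by omega), ← hν 4 (by omega)]; rfl⟩) hcod
    let ν : I × I → ℕ → ℕ := fun p =>
      assign (vars 11 ts ++ vars 10 ts) (enc p.1 ++ enc p.2) s.nat
    have hν : ∀ p, ν p = assign (vars 10 ts) (enc p.2) (assign (vars 11 ts) (enc p.1) s.nat) :=
      fun p => assign_append _ _ _ _ _ (by rw [hlen, length_vars])
    have hνlow : ∀ p m, m < 10 → ν p m = s.nat m := fun p m hm => by
      rw [hν, assign_of_ne _ (Or.inl hm), assign_of_ne _ (Or.inl (by omega))]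
    have hcur : ∀ p, ∀ j < ts.length, ν p (10 + 2 * j) = (enc p.2).getD j 0 := fun p j hj => by
      rw [hν]
      exact assign_vars _ (hlen _) (by rwa [hlen])
    have hnext : ∀ p, ∀ j < ts.length, ν p (11 + 2 * j) = (enc p.1).getD j 0 := fun p j hj => by
      rw [hν, assign_of_ne _ (Or.inr (by omega))]
      exact assign_vars _ (hlen _) (by rwa [hlen])
    have hidx : ∀ p, ([.const id, .var 5, .add (.var 4) (.const 1)] ++ index 11 ts :
        List NExpr).map (NExpr.eval ⟨ν p, s.arr⟩) = id :: x :: (y + 1) :: enc p.1 := by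
      intro p
      have e1 : (index 11 ts).map (NExpr.eval ⟨ν p, s.arr⟩) = enc p.1 := by
        rw [← map_index_assign (a := 11) s.nat s.arr (hlen p.1)]
        refine List.map_congr_left fun f hf => ?_
        obtain ⟨v, hv, rfl⟩ := List.mem_map.mp hf
        change ν p v.1 = assign _ _ _ v.1
        rw [hν]
        refine assign_of_ne _ (Or.inr ?_)
        rw [mod_two_of_mem_vars hv]
        omega
      rw [List.map_append, e1]
      change id :: ν p 5 :: (ν p 4 + 1) :: enc p.1 = _
      rw [hνlow p 5 (by omega), hνlow p 4 (by omega), hsx, hs4]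
    have hval : ∀ p, (CExpr.mul (.cell 3 ([.const id, .var 5, .var 4] ++ index 10 ts)) w).eval
        ⟨ν p, s.arr⟩ = Z y p.2 * W y p.2 p.1 := by
      intro p
      have e1 : ([.const id, .var 5, .var 4] ++ index 10 ts : List NExpr).map
          (NExpr.eval ⟨ν p, s.arr⟩) = id :: x :: y :: enc p.2 := by
        rw [List.map_append, hν, map_index_assign _ _ (hlen p.2), ← hν]
        change id :: ν p 5 :: ν p 4 :: enc p.2 = _
        rw [hνlow p 5 (by omega), hνlow p 4 (by omega), hsx, hs4]
      refine congrArg₂ (· * ·) ?_ ?_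
      · change s.arr 3 _ = _
        rw [e1]
        exact p4 p.2
      · have := hw ⟨ν p, s.arr⟩ ⟨fun i hi hi4 => (hνlow p i hi).trans (hsi.1 i hi hi4), hsi.2⟩
          p.2 p.1 (hcur p) (hnext p)
        rw [this]
        change W (ν p 4) _ _ = _
        rw [hνlow p 4 (by omega), hs4]
    simp only [show ∀ p : I × I, assign (vars 11 ts ++ vars 10 ts) (enc p.1 ++ enc p.2) s.nat =
      ν p from fun _ => rfl, hidx, hval] at h3
    refine ⟨⟨fun i hi hi4 => (h1 i hi).trans (hsi.1 i hi hi4), fun A hA =>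
      (h2 A hA).trans (hsi.2 A hA)⟩, fun k hk => ?_, fun j k hj => ?_, fun i => ?_⟩
    · rw [h3, Finset.sum_eq_zero, add_zero]
      · exact p2 k hk
      · exact fun i _ => if_neg fun h => hk _ h.symm
    · rw [h3, Finset.sum_eq_zero, add_zero]
      · exact p3 j k (by omega)
      · refine fun i _ => if_neg fun h => ?_
        simp only [List.cons.injEq] at h
        omega
    · rw [h3]
      have e1 : s.arr 3 (id :: x :: (y + 1) :: enc i) = 0 := p3 (y + 1) _ (Nat.lt_succ_self y)
      rw [e1, zero_add, Fintype.sum_prod_type]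
      simp only [List.cons.injEq, true_and, hI.injective.eq_iff]
      rw [Finset.sum_eq_single i]
      · simp only [if_true]
        rfl
      · intro q _ hq
        simp [hq]
      · exact fun h => absurd (Finset.mem_univ _) h
  have hall : P (s₀.nat 1) ((evalNet id ts ini w).run s₀).1 := by
    have hv : (NExpr.var 1).eval ((nest (vars 10 ts)
        (scatter ([.const id, .var 5, .const 0] ++ index 10 ts) ini)).run s₀).1 = s₀.nat 1 :=
      hfirst.1.1 1 (by omega) (by omega)
    rw [← hv]
    exact Program.loop_induction (e := .var 1) P hfirst fun j _ t ht => hstep j t ht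
  obtain ⟨q1, q2, -, q4⟩ := hall
  refine ⟨q1, q2, ?_⟩
  have e1 : ([.const id, .var 5, .var 1] ++ ts.map fun _ => .const 0 : List NExpr).map
      (NExpr.eval ((evalNet id ts ini w).run s₀).1) = id :: x :: s₀.nat 1 :: enc 0 := by
    rw [List.map_append, List.map_map, h0]
    change id :: ((evalNet id ts ini w).run s₀).1.nat 5 :: ((evalNet id ts ini w).run s₀).1.nat 1 ::
      (ts.map fun _ => 0) = _
    rw [q1.1 5 (by omega) (by omega), q1.1 1 (by omega) (by omega)]
  change ((evalNet id ts ini w).run s₀).1.arr 3 _ = _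
  rw [e1, q4 0]
  exact eq_pathSum (fun _ => rfl) (fun _ _ => rfl) _

/-! ### Running times -/

/-- The size of the input. -/
def Memory.size (s : Memory) : ℕ := s.nat 1 + s.nat 2 + s.nat 3

/-- The program never changes the registers `1, 2, 3`, and the number of iterations of its loops is
bounded by the size of the input. -/
def Program.Bounded : Program → Prop
  | .skip => True
  | .setN i _ => i < 1 ∨ 3 < i
  | .setC _ _ _ => True
  | .seq p p' => p.Bounded ∧ p'.Bounded
  | .ite _ p p' => p.Bounded ∧ p'.Bounded
  | .loop i e p => (i < 1 ∨ 3 < i) ∧ (∀ s, e.eval s ≤ s.size) ∧ p.Bounded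

/-- A bound for the running time in terms of the size of the input. -/
def Program.timePoly : Program → Polynomial ℕ
  | .skip => 1
  | .setN _ e => Polynomial.C (e.cost + 1)
  | .setC _ idx e => Polynomial.C ((idx.map NExpr.cost).sum + e.cost + 1)
  | .seq p p' => p.timePoly + p'.timePoly
  | .ite t p p' => Polynomial.C t.cost + p.timePoly + p'.timePoly
  | .loop _ e p => Polynomial.C (e.cost + 1) + Polynomial.X * (p.timePoly + 1)

theorem Memory.setNat_size (s : Memory) {i : ℕ} (hi : i < 1 ∨ 3 < i) (v : ℕ) :
    (s.setNat i v).size = s.size := by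
  unfold size
  rw [s.setNat_nat_of_ne v (by omega), s.setNat_nat_of_ne v (by omega),
    s.setNat_nat_of_ne v (by omega)]

/-- The registers `1, 2, 3` are never written, so the size is constant during the run and bounds the
iterations of every loop. -/
theorem Program.run_le {p : Program} (hp : p.Bounded) (s : Memory) :
    (p.run s).1.size = s.size ∧ (p.run s).2 ≤ p.timePoly.eval s.size := by
  induction p generalizing s with
  | skip => exact ⟨rfl, by simp [run, timePoly]⟩
  | setN i e => exact ⟨s.setNat_size hp _, le_of_eq (Polynomial.eval_C (x := s.size)).symm⟩
  | setC A idx e => exact ⟨rfl, le_of_eq (Polynomial.eval_C (x := s.size)).symm⟩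
  | seq p p' ih ih' =>
    have h1 := ih hp.1 s
    have h2 := ih' hp.2 (p.run s).1
    rw [h1.1] at h2
    refine ⟨h2.1, ?_⟩
    simp only [run, timePoly, Polynomial.eval_add]
    exact add_le_add h1.2 h2.2
  | ite t p p' ih ih' =>
    have h1 := ih hp.1 s
    have h2 := ih' hp.2 s
    simp only [run, timePoly, Polynomial.eval_add, Polynomial.eval_C]
    split_ifs
    · exact ⟨h1.1, by have := h1.2; simp only; omega⟩
    · exact ⟨h2.1, by have := h2.2; simp only; omega⟩
  | loop i e p ih =>
    have key : ∀ k : ℕ, ((List.range k).foldl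
        (fun r j => ((p.run (r.1.setNat i j)).1, r.2 + (p.run (r.1.setNat i j)).2 + 1))
        (s, e.cost + 1)).1.size = s.size ∧ ((List.range k).foldl
        (fun r j => ((p.run (r.1.setNat i j)).1, r.2 + (p.run (r.1.setNat i j)).2 + 1))
        (s, e.cost + 1)).2 ≤ e.cost + 1 + k * (p.timePoly.eval s.size + 1) := by
      intro k
      induction k with
      | zero => exact ⟨rfl, by simp⟩
      | succ k ihk =>
        rw [List.range_succ, List.foldl_append]
        simp only [List.foldl_cons, List.foldl_nil]
        obtain ⟨h1, h2⟩ := ihk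
        obtain ⟨h3, h4⟩ := ih hp.2.2 (((List.range k).foldl
          (fun r j => ((p.run (r.1.setNat i j)).1, r.2 + (p.run (r.1.setNat i j)).2 + 1))
          (s, e.cost + 1)).1.setNat i k)
        rw [Memory.setNat_size _ hp.1, h1] at h3 h4
        refine ⟨h3, ?_⟩
        rw [Nat.succ_mul]
        omega
    obtain ⟨h1, h2⟩ := key (e.eval s)
    refine ⟨h1, h2.trans ?_⟩
    simp only [timePoly, Polynomial.eval_add, Polynomial.eval_mul, Polynomial.eval_X,
      Polynomial.eval_C, Polynomial.eval_one]
    exact Nat.add_le_add_left (Nat.mul_le_mul_right _ (hp.2.1 s)) _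

theorem var_le_size {r : ℕ} (h : 1 ≤ r ∧ r ≤ 3) (s : Memory) : (NExpr.var r).eval s ≤ s.size := by
  obtain ⟨h1, h2⟩ := h
  change s.nat r ≤ s.nat 1 + s.nat 2 + s.nat 3
  interval_cases r <;> omega

theorem bounded_nest {vs : List (ℕ × ℕ)} {p : Program} (hp : p.Bounded)
    (hvs : ∀ v ∈ vs, 3 < v.1 ∧ 1 ≤ v.2 ∧ v.2 ≤ 3) : (nest vs p).Bounded := by
  induction vs with
  | nil => exact hp
  | cons v vs ih =>
    have hv := hvs v List.mem_cons_self
    exact ⟨Or.inr hv.1, fun s => var_le_size hv.2 s,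
      ih fun w hw => hvs w (List.mem_cons_of_mem _ hw)⟩

theorem bounded_evalNet (id : ℕ) {ts : List ℕ} (ini w : CExpr) (hts : ∀ t ∈ ts, 1 ≤ t ∧ t ≤ 3) :
    (evalNet id ts ini w).Bounded := by
  have hvs : ∀ a, 10 ≤ a → ∀ v ∈ vars a ts, 3 < v.1 ∧ 1 ≤ v.2 ∧ v.2 ≤ 3 := fun a ha v hv => by
    have := le_of_mem_vars hv
    have := hts _ this.2
    omega
  refine ⟨bounded_nest trivial (hvs 10 le_rfl), Or.inr (by omega),
    fun s => var_le_size ⟨le_rfl, by omega⟩ s, bounded_nest trivial fun v hv => ?_⟩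
  exact (List.mem_append.mp hv).elim (hvs 11 (by omega) v) (hvs 10 le_rfl v)

/-! ### Path sums over products -/

theorem extendZero_prod {I J : Type} [Zero I] [Zero J] {k : ℕ} (v : Fin k → I) (w : Fin k → J)
    (y : ℕ) : extendZero (fun y => (v y, w y)) y = (extendZero v y, extendZero w y) := by
  unfold extendZero
  split_ifs <;> rfl

theorem sum_arrow_prod {I J : Type} [Fintype I] [Fintype J] {k : ℕ} (f : (Fin k → I × J) → ℂ) :
    ∑ v, f v = ∑ v : Fin k → I, ∑ w : Fin k → J, f fun y => (v y, w y) := by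
  rw [← Fintype.sum_prod_type', ← (Equiv.arrowProdEquivProdArrow (Fin k) (fun _ => I)
    fun _ => J).symm.sum_comp]
  rfl

/-- Two networks depending on the same outer variables, with the second conjugated, form one network
whose row states also contain the outer values. Inner products thus become path sums. -/
theorem pathSum_mul_star {S I J : Type} [Fintype S] [Zero S] [Fintype I] [Zero I] [Fintype J]
    [Zero J] (L : ℕ) (g : S → I → ℂ) (g' : S → J → ℂ) (w : ℕ → S → S → I → I → ℂ)
    (w' : ℕ → S → S → J → J → ℂ) :
    pathSum L (fun p : S × I × J => g p.1 p.2.1 * star (g' p.1 p.2.2))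
      (fun y p p' => w y p.1 p'.1 p.2.1 p'.2.1 * star (w' y p.1 p'.1 p.2.2 p'.2.2)) =
    ∑ v : Fin L → S,
      pathSum L (g (extendZero v 0)) (fun y => w y (extendZero v y) (extendZero v (y + 1))) *
      star (pathSum L (g' (extendZero v 0))
        fun y => w' y (extendZero v y) (extendZero v (y + 1))) := by
  unfold pathSum
  rw [sum_arrow_prod]
  refine Finset.sum_congr rfl fun v _ => ?_
  rw [sum_arrow_prod, star_sum, Finset.sum_mul_sum]
  refine Finset.sum_congr rfl fun a _ => Finset.sum_congr rfl fun b _ => ?_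
  simp only [extendZero_prod, Finset.prod_mul_distrib, star_mul', star_prod]
  ring

/-! ### Partial traces of matrix product operators as path sums. -/

section Networks

variable {n D χ : ℕ} [NeZero D] [NeZero χ] (M : Model n D) (T : Fin (n + 1) → MPO n D χ)

/-- The states of a row of a column: the bond of the matrix product operator, the two values on the
column, and the values on two columns between two plaquettes. -/
abbrev Block (D χ : ℕ) := Fin χ × Fin D × Fin D × Fin D × Fin D

/-- The matrix elements of the matrix product operator on column `x`, with the last bond fixed. -/
def mpoVal (x : ℕ) (σ ν : Fin (n + 1) → Fin D) : ℂ :=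
  pathSum (n + 1) (fun _ : Fin χ => 1)
    fun y a a' => mpoTable T [x, y, a.val, a'.val, (extendZero σ y).val, (extendZero ν y).val]

omit [NeZero D] [NeZero χ] in
/-- The initial weight of a block. -/
def blockIni (a : Block D χ) (b s : Fin D) : ℂ :=
  (if a.2.2.2.1 = b then 1 else 0) * (if a.2.2.2.2 = s then 1 else 0)

omit [NeZero D] [NeZero χ] in
/-- The transfer weight of a block. -/
def blockStep (x y : ℕ) (a a' : Block D χ) (b' s' t : Fin D) : ℂ :=
  mpoTable T [x, y, a.1, a'.1, a.2.1, a.2.2.1] *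
    M.gate x y a.2.2.2 (b', s') (a.2.1, t) a'.2.2.2

/-- The weight `h` and the bra values `br` may depend on the row states only through the values `ν`.
This covers a first column (`br` the identity) and a second one, where `br` is the constant
intermediate value `μ` and `h` is the contraction of the first column. -/
theorem sum_block (x : ℕ) (h : (Fin (n + 1) → Fin D) → ℂ)
    (br : (Fin (n + 1) → Fin D) → Fin (n + 1) → Fin D) (s t : Fin (n + 1) → Fin D) :
    ∑ a : Fin (n + 1) → Block D χ, h (fun y => (a y).2.2.1) *
      (blockIni (extendZero a 0) (extendZero (br fun y => (a y).2.2.1) 0) (extendZero s 0) *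
        ∏ y : Fin (n + 1), blockStep M T x y (extendZero a y) (extendZero a (y + 1))
          (extendZero (br fun y => (a y).2.2.1) (y + 1)) (extendZero s (y + 1))
          (extendZero t y)) =
    ∑ σ, ∑ ν, h ν * (mpoVal T x σ ν * M.strip x (pairExtend (br ν) s) (pairExtend σ t)) := by
  rw [sum_arrow_prod, Finset.sum_comm, sum_arrow_prod]
  refine Finset.sum_congr rfl fun σ _ => ?_
  rw [sum_arrow_prod]
  refine Finset.sum_congr rfl fun ν _ => ?_
  simp only [mpoVal, Model.strip, pathSum]
  rw [Finset.sum_mul_sum, Finset.mul_sum, Finset.sum_comm]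
  refine Finset.sum_congr rfl fun β _ => ?_
  rw [Finset.mul_sum]
  refine Finset.sum_congr rfl fun m _ => ?_
  simp only [extendZero_prod, blockStep, blockIni, Finset.prod_mul_distrib, pairExtend,
    Prod.ext_iff, ite_and, one_mul, mul_ite, ite_mul, zero_mul, mul_zero, mul_one]
  split_ifs <;> ring

theorem pathSum_block (x : ℕ) (s t : Fin (n + 1) → Fin D) :
    pathSum (n + 1) (fun a : Block D χ => blockIni a a.2.2.1 (extendZero s 0))
      (fun y a a' => blockStep M T x y a a' a'.2.2.1 (extendZero s (y + 1)) (extendZero t y)) =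
    M.halfTrace (mpoVal T x) x s t := by
  have h := sum_block M T x (fun _ => 1) id s t
  have e : ∀ (a : Fin (n + 1) → Block D χ) y, (extendZero a y).2.2.1 =
      extendZero (fun y => (a y).2.2.1) y := fun a y => by
    unfold extendZero; split_ifs <;> rfl
  simp only [one_mul, id] at h
  simp only [pathSum, e, h]
  rfl

/-- For fixed states of the second block and fixed `μ`, the sum over the first block is a
`halfTrace`; it then serves as the weight `h` in `sum_block`. -/
theorem pathSum_doubleBlock (x : ℕ) (s t : Fin (n + 1) → Fin D) :
    pathSum (n + 1)
      (fun p : Block D χ × Block D χ × Fin D => blockIni p.1 p.1.2.2.1 p.2.1.2.2.1 *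
        blockIni p.2.1 p.2.2 (extendZero s 0))
      (fun y p p' => blockStep M T x y p.1 p'.1 p'.1.2.2.1 p'.2.1.2.2.1 p.2.2 *
        blockStep M T (x + 1) y p.2.1 p'.2.1 p'.2.2 (extendZero s (y + 1)) (extendZero t y)) =
    M.doubleTrace (mpoVal T x) (mpoVal T (x + 1)) x s t := by
  have e : ∀ (a : Fin (n + 1) → Block D χ) y, (extendZero a y).2.2.1 =
      extendZero (fun y => (a y).2.2.1) y := fun a y => by
    unfold extendZero; split_ifs <;> rfl
  unfold pathSum
  rw [sum_arrow_prod, Finset.sum_comm, sum_arrow_prod, Finset.sum_comm]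
  have h1 : ∀ (μ : Fin (n + 1) → Fin D) (a : Fin (n + 1) → Block D χ),
      ∑ b : Fin (n + 1) → Block D χ,
        (blockIni (extendZero (fun y => (b y, a y, μ y)) 0).1
          (extendZero (fun y => (b y, a y, μ y)) 0).1.2.2.1
          (extendZero (fun y => (b y, a y, μ y)) 0).2.1.2.2.1 *
        blockIni (extendZero (fun y => (b y, a y, μ y)) 0).2.1
          (extendZero (fun y => (b y, a y, μ y)) 0).2.2 (extendZero s 0)) *
        ∏ y : Fin (n + 1), (blockStep M T x y (extendZero (fun y => (b y, a y, μ y)) y).1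
          (extendZero (fun y => (b y, a y, μ y)) (y + 1)).1
          (extendZero (fun y => (b y, a y, μ y)) (y + 1)).1.2.2.1
          (extendZero (fun y => (b y, a y, μ y)) (y + 1)).2.1.2.2.1
          (extendZero (fun y => (b y, a y, μ y)) y).2.2 *
        blockStep M T (x + 1) y (extendZero (fun y => (b y, a y, μ y)) y).2.1
          (extendZero (fun y => (b y, a y, μ y)) (y + 1)).2.1
          (extendZero (fun y => (b y, a y, μ y)) (y + 1)).2.2
          (extendZero s (y + 1)) (extendZero t y)) =
      M.halfTrace (mpoVal T x) x (fun y => (a y).2.2.1) μ *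
        (blockIni (extendZero a 0) (extendZero μ 0) (extendZero s 0) *
        ∏ y : Fin (n + 1), blockStep M T (x + 1) y (extendZero a y) (extendZero a (y + 1))
          (extendZero μ (y + 1)) (extendZero s (y + 1)) (extendZero t y)) := by
    intro μ a
    rw [← pathSum_block, pathSum, Finset.sum_mul]
    refine Finset.sum_congr rfl fun b _ => ?_
    simp only [extendZero_prod, Finset.prod_mul_distrib, e]
    ring
  simp only [h1]
  have h2 : ∀ μ : Fin (n + 1) → Fin D, _ := fun μ =>
    sum_block M T (x + 1) (fun ν => M.halfTrace (mpoVal T x) x ν μ) (fun _ => μ) s t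
  simp only [h2, Model.doubleTrace]
  rw [Finset.sum_comm]
  refine Finset.sum_congr rfl fun σ _ => ?_
  rw [Finset.sum_comm]
  refine Finset.sum_congr rfl fun ν _ => Finset.sum_congr rfl fun μ _ => ?_
  ring

end Networks

/-! ### The programs -/

def curVar (j : ℕ) : NExpr := .var (10 + 2 * j)

def nextVar (j : ℕ) : NExpr := .var (11 + 2 * j)

/-- The Kronecker delta, from array `2`. -/
def deltaExpr (a b : NExpr) : CExpr := .cell 2 [a, b]

/-- Arguments are positions of loop registers: `o` is the first of the five positions of a block,
and `b`, `s` are those of the values to be matched. -/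
def blockIniExpr (o b s : ℕ) : CExpr :=
  .mul (deltaExpr (curVar (o + 3)) (curVar b)) (deltaExpr (curVar (o + 4)) (curVar s))

def blockStepExpr (o : ℕ) (x : NExpr) (b s t : ℕ) : CExpr :=
  .mul (.cell 1 [x, .var 4, curVar o, nextVar o, curVar (o + 1), curVar (o + 2)])
    (.sub (.mul (.mul (deltaExpr (curVar (o + 3)) (curVar (o + 1)))
        (deltaExpr (curVar (o + 4)) (curVar t)))
      (.mul (deltaExpr (nextVar b) (nextVar (o + 3))) (deltaExpr (nextVar s) (nextVar (o + 4)))))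
      (.cell 0 [x, .var 4, curVar (o + 3), nextVar b, curVar (o + 4), nextVar s,
        curVar (o + 1), nextVar (o + 3), curVar t, nextVar (o + 4)]))

/-! ### Values of the expressions for blocks. -/

section Evaluation

variable {n D χ : ℕ} (M : Model n D) (T : Fin (n + 1) → MPO n D χ)

/-- The arrays hold the input and the Kronecker delta, and the register `5` holds `x`. -/
structure Loaded (x : ℕ) (s : Memory) : Prop where
  nat : s.nat 5 = x
  table : s.arr 0 = M.table
  mpo : s.arr 1 = mpoTable T
  delta : ∀ a b : Fin D, s.arr 2 [a.val, b.val] = if a = b then 1 else 0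

/-- The registers `a + 2 o, a + 2 (o + 1), …` hold the list `l`. -/
def Holds (s : Memory) (a o : ℕ) (l : List ℕ) : Prop :=
  ∀ j < l.length, s.nat (a + 2 * (o + j)) = l.getD j 0

theorem Holds.left {s : Memory} {a o : ℕ} {l l' : List ℕ} (h : Holds s a o (l ++ l')) :
    Holds s a o l := fun j hj => by
  rw [h j (by rw [List.length_append]; omega), List.getD_append _ _ _ _ hj]

theorem Holds.right {s : Memory} {a o : ℕ} {l l' : List ℕ} (h : Holds s a o (l ++ l')) :
    Holds s a (o + l.length) l' := fun j hj => by
  rw [add_assoc, h _ (by rw [List.length_append]; omega),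
    List.getD_append_right _ _ _ _ (by omega), Nat.add_sub_cancel_left]

def codeBlock (a : Block D χ) : List ℕ :=
  [a.1.val, a.2.1.val, a.2.2.1.val, a.2.2.2.1.val, a.2.2.2.2.val]

def codeDouble (p : Block D χ × Block D χ × Fin D) : List ℕ :=
  codeBlock p.1 ++ (codeBlock p.2.1 ++ [p.2.2.val])

def codePair (p : Fin D × Fin D) : List ℕ := [p.1.val, p.2.val]

theorem coding_block : Coding (Block D χ) [χ, D, D, D, D] codeBlock :=
  (Coding.fin χ).prod ((Coding.fin D).prod ((Coding.fin D).prod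
    ((Coding.fin D).prod (Coding.fin D))))

theorem coding_double : Coding (Block D χ × Block D χ × Fin D)
    ([χ, D, D, D, D] ++ ([χ, D, D, D, D] ++ [D])) codeDouble :=
  coding_block.prod (coding_block.prod (Coding.fin D))

theorem coding_pair : Coding (Fin D × Fin D) [D, D] codePair :=
  (Coding.fin D).prod (Coding.fin D)

variable {M T} {x : ℕ} {s : Memory}

theorem eval_blockIniExpr (h : Loaded M T x s) {o b u : ℕ} {a : Block D χ} {b' u' : Fin D}
    (ha : Holds s 10 o (codeBlock a)) (hb : s.nat (10 + 2 * b) = b'.val)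
    (hu : s.nat (10 + 2 * u) = u'.val) :
    (blockIniExpr o b u).eval s = blockIni a b' u' := by
  have h3 : s.nat (10 + 2 * (o + 3)) = a.2.2.2.1.val := ha 3 (by simp [codeBlock])
  have h4 : s.nat (10 + 2 * (o + 4)) = a.2.2.2.2.val := ha 4 (by simp [codeBlock])
  simp only [blockIniExpr, deltaExpr, CExpr.eval, List.map_cons, List.map_nil, curVar, NExpr.eval,
    h3, h4, hb, hu, h.delta]
  rfl

theorem eval_blockStepExpr (h : Loaded M T x s) {o b u t x' : ℕ} {xe : NExpr}
    (hx : xe.eval s = x') {a a' : Block D χ} {b' u' t' : Fin D}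
    (ha : Holds s 10 o (codeBlock a)) (ha' : Holds s 11 o (codeBlock a'))
    (hb : s.nat (11 + 2 * b) = b'.val) (hu : s.nat (11 + 2 * u) = u'.val)
    (ht : s.nat (10 + 2 * t) = t'.val) :
    (blockStepExpr o xe b u t).eval s = blockStep M T x' (s.nat 4) a a' b' u' t' := by
  have h0 : s.nat (10 + 2 * o) = a.1.val := ha 0 (by simp [codeBlock])
  have h1 : s.nat (10 + 2 * (o + 1)) = a.2.1.val := ha 1 (by simp [codeBlock])
  have h2 : s.nat (10 + 2 * (o + 2)) = a.2.2.1.val := ha 2 (by simp [codeBlock])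
  have h3 : s.nat (10 + 2 * (o + 3)) = a.2.2.2.1.val := ha 3 (by simp [codeBlock])
  have h4 : s.nat (10 + 2 * (o + 4)) = a.2.2.2.2.val := ha 4 (by simp [codeBlock])
  have h0' : s.nat (11 + 2 * o) = a'.1.val := ha' 0 (by simp [codeBlock])
  have h3' : s.nat (11 + 2 * (o + 3)) = a'.2.2.2.1.val := ha' 3 (by simp [codeBlock])
  have h4' : s.nat (11 + 2 * (o + 4)) = a'.2.2.2.2.val := ha' 4 (by simp [codeBlock])
  simp only [blockStepExpr, deltaExpr, CExpr.eval, List.map_cons, List.map_nil, curVar, nextVar,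
    NExpr.eval, h0, h1, h2, h3, h4, h0', h3', h4', hb, hu, ht, h.delta, hx, h.table, h.mpo,
    blockStep, Model.gate]
  congr 2
  simp only [Prod.ext_iff, ite_and, mul_ite, mul_one, mul_zero]
  split_ifs <;> rfl

theorem blockIniExpr_congr {s s' : Memory} (h : s.nat = s'.nat) (h' : ∀ A ≠ 3, s.arr A = s'.arr A)
    (o b u : ℕ) : (blockIniExpr o b u).eval s = (blockIniExpr o b u).eval s' := by
  simp only [blockIniExpr, deltaExpr, CExpr.eval, List.map_cons, List.map_nil, curVar, NExpr.eval,
    h, h' 2 (by omega)]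

theorem blockStepExpr_congr {s s' : Memory} (h : s.nat = s'.nat)
    (h' : ∀ A ≠ 3, s.arr A = s'.arr A) (o : ℕ) (xe : NExpr) (b u t : ℕ) :
    (blockStepExpr o xe b u t).eval s = (blockStepExpr o xe b u t).eval s' := by
  simp only [blockStepExpr, deltaExpr, CExpr.eval, List.map_cons, List.map_nil, curVar, nextVar,
    NExpr.eval, h, h' 0 (by omega), h' 1 (by omega), h' 2 (by omega), NExpr.eval_congr h xe]

end Evaluation

/-! ### Networks which compute partial traces -/

/-- A network given by the types of its registers, and by its initial and transfer weights, when
the registers start at a given offset. -/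
structure Network where
  types : List ℕ
  ini : ℕ → CExpr
  step : ℕ → CExpr

/-- The network of the partial trace over one column. -/
def halfNetwork (x : NExpr) : Network where
  types := [3, 2, 2, 2, 2]
  ini o := blockIniExpr o (o + 2) 0
  step o := blockStepExpr o x (o + 2) 0 1

/-- The network of the partial trace over two columns. -/
def doubleNetwork : Network where
  types := [3, 2, 2, 2, 2] ++ ([3, 2, 2, 2, 2] ++ [2])
  ini o := .mul (blockIniExpr o (o + 2) (o + 5 + 2)) (blockIniExpr (o + 5) (o + 5 + 5) 0)
  step o := .mul (blockStepExpr o (.var 5) (o + 2) (o + 5 + 2) (o + 5 + 5))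
    (blockStepExpr (o + 5) (.add (.var 5) (.const 1)) (o + 5 + 5) 0 1)

section

variable {n D χ : ℕ}

/-- The network computes the function `F` of the states of two columns. -/
structure Network.Computes [NeZero D] (N : Network) (M : Model n D) (T : Fin (n + 1) → MPO n D χ) (x : ℕ)
    {I : Type} [Fintype I] [Zero I] (enc : I → List ℕ) (g : Fin D × Fin D → I → ℂ)
    (w : ℕ → Fin D × Fin D → Fin D × Fin D → I → I → ℂ)
    (F : (Fin (n + 1) → Fin D) → (Fin (n + 1) → Fin D) → ℂ) : Prop where
  types : ∀ t ∈ N.types, 2 ≤ t ∧ t ≤ 3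
  coding : ∀ s : Memory, s.nat 2 = D → s.nat 3 = χ → Coding I (N.types.map s.nat) enc
  enc_zero : enc 0 = N.types.map fun _ => 0
  ini : ∀ {s : Memory}, Loaded M T x s → ∀ {o : ℕ} {a : I} {p : Fin D × Fin D},
    Holds s 10 o (enc a) → Holds s 10 0 (codePair p) → (N.ini o).eval s = g p a
  step : ∀ {s : Memory}, Loaded M T x s → ∀ {o : ℕ} {a a' : I} {p p' : Fin D × Fin D},
    Holds s 10 o (enc a) → Holds s 10 0 (codePair p) → Holds s 11 o (enc a') →
    Holds s 11 0 (codePair p') → (N.step o).eval s = w (s.nat 4) p p' a a'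
  ini_congr : ∀ {s s' : Memory}, s.nat = s'.nat → (∀ A ≠ 3, s.arr A = s'.arr A) → ∀ o,
    (N.ini o).eval s = (N.ini o).eval s'
  step_congr : ∀ {s s' : Memory}, s.nat = s'.nat → (∀ A ≠ 3, s.arr A = s'.arr A) → ∀ o,
    (N.step o).eval s = (N.step o).eval s'
  sum : ∀ v : Fin (n + 1) → Fin D × Fin D, pathSum (n + 1) (g (extendZero v 0))
    (fun y => w y (extendZero v y) (extendZero v (y + 1))) = F (fun y => (v y).1) fun y => (v y).2

theorem extendZero_fst {I J : Type} [Zero I] [Zero J] {k : ℕ} (v : Fin k → I × J) (y : ℕ) :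
    (extendZero v y).1 = extendZero (fun y => (v y).1) y := by
  unfold extendZero
  split_ifs <;> rfl

theorem extendZero_snd {I J : Type} [Zero I] [Zero J] {k : ℕ} (v : Fin k → I × J) (y : ℕ) :
    (extendZero v y).2 = extendZero (fun y => (v y).2) y := by
  unfold extendZero
  split_ifs <;> rfl

theorem Holds.pair {s : Memory} {a : ℕ} {p : Fin D × Fin D} (h : Holds s a 0 (codePair p)) :
    s.nat a = p.1.val ∧ s.nat (a + 2) = p.2.val :=
  ⟨h 0 (by simp [codePair]), h 1 (by simp [codePair])⟩

variable [NeZero D] [NeZero χ] (M : Model n D) (T : Fin (n + 1) → MPO n D χ)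

/-- The positions `0` and `1` hold the outer values on the neighbouring column, and the bra value is
position `o + 2` of the block itself. -/
theorem computes_halfNetwork {x x' : ℕ} {xe : NExpr}
    (hxe : ∀ s : Memory, s.nat 5 = x → xe.eval s = x') :
    (halfNetwork xe).Computes M T x codeBlock (fun p a => blockIni a a.2.2.1 p.1)
      (fun y p p' a a' => blockStep M T x' y a a' a'.2.2.1 p'.1 p.2)
      (M.halfTrace (mpoVal T x') x') where
  types := by simp [halfNetwork]
  coding s h2 h3 := by
    simp only [halfNetwork, List.map_cons, List.map_nil, h2, h3]
    exact coding_block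
  enc_zero := rfl
  ini h _ _ _ ha hp := eval_blockIniExpr h ha (ha 2 (by simp [codeBlock])) hp.pair.1
  step {s} h _ _ _ _ _ ha hp ha' hp' := eval_blockStepExpr h (hxe s h.nat) ha ha'
    (ha' 2 (by simp [codeBlock])) hp'.pair.1 hp.pair.2
  ini_congr h h' o := blockIniExpr_congr h h' _ _ _
  step_congr h h' o := blockStepExpr_congr h h' _ _ _ _ _
  sum v := by
    simp only [extendZero_fst, extendZero_snd]
    exact pathSum_block M T x' _ _

theorem computes_doubleNetwork (x : ℕ) :
    doubleNetwork.Computes M T x codeDouble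
      (fun p a => blockIni a.1 a.1.2.2.1 a.2.1.2.2.1 * blockIni a.2.1 a.2.2 p.1)
      (fun y p p' a a' => blockStep M T x y a.1 a'.1 a'.1.2.2.1 a'.2.1.2.2.1 a.2.2 *
        blockStep M T (x + 1) y a.2.1 a'.2.1 a'.2.2 p'.1 p.2)
      (M.doubleTrace (mpoVal T x) (mpoVal T (x + 1)) x) where
  types := by simp [doubleNetwork]
  coding s h2 h3 := by
    simp only [doubleNetwork, List.map_append, List.map_cons, List.map_nil, h2, h3]
    exact coding_double
  enc_zero := rfl
  ini h _ _ _ ha hp := by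
    have h1 := ha.left
    have h2 := ha.right.left
    have h3 := ha.right.right
    exact congrArg₂ (· * ·)
      (eval_blockIniExpr h h1 (h1 2 (by simp [codeBlock])) (h2 2 (by simp [codeBlock])))
      (eval_blockIniExpr h h2 (h3 0 (by simp)) hp.pair.1)
  step {s} h _ _ _ _ _ ha hp ha' hp' := by
    have h1 := ha.left
    have h2 := ha.right.left
    have h3 := ha.right.right
    have h1' := ha'.left
    have h2' := ha'.right.left
    have h3' := ha'.right.right
    exact congrArg₂ (· * ·)
      (eval_blockStepExpr h (show (NExpr.var 5).eval s = x from h.nat) h1 h1' (h1' 2 (by simp [codeBlock]))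
        (h2' 2 (by simp [codeBlock])) (h3 0 (by simp)))
      (eval_blockStepExpr h (congrArg (· + 1) h.nat) h2 h2' (h3' 0 (by simp)) hp'.pair.1 hp.pair.2)
  ini_congr h h' o := congrArg₂ (· * ·) (blockIniExpr_congr h h' _ _ _)
    (blockIniExpr_congr h h' _ _ _)
  step_congr h h' o := congrArg₂ (· * ·) (blockStepExpr_congr h h' _ _ _ _ _)
    (blockStepExpr_congr h h' _ _ _ _ _)
  sum v := by
    simp only [extendZero_fst, extendZero_snd]
    exact pathSum_doubleBlock M T x _ _

end

/-! ### Inner products -/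

def pairTypes (N N' : Network) : List ℕ := [2, 2] ++ (N.types ++ N'.types)

/-- The program which computes the inner product of two functions given by networks. -/
def innerProgram (id : ℕ) (N N' : Network) : Program :=
  evalNet id (pairTypes N N')
    (.mul (N.ini 2) (.conj (N'.ini (2 + N.types.length))))
    (.mul (N.step 2) (.conj (N'.step (2 + N.types.length))))

def innerResult (id : ℕ) (N N' : Network) : CExpr := netResult id (pairTypes N N')

/-- The inner product of two functions on pairs. -/
def innerSum {X Y : Type} [Fintype X] [Fintype Y] (F G : X → Y → ℂ) : ℂ :=
  ∑ s, ∑ t, F s t * star (G s t)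

/-- The memory during the run of the verifier: the input, the Kronecker delta, and the
register `5`. -/
structure Ready {n D χ : ℕ} (M : Model n D) (T : Fin (n + 1) → MPO n D χ) (x : ℕ) (s : Memory) :
    Prop extends Loaded M T x s where
  size : s.nat 1 = n + 1
  dim : s.nat 2 = D
  bond : s.nat 3 = χ

theorem Ready.congr {n D χ : ℕ} {M : Model n D} {T : Fin (n + 1) → MPO n D χ} {x : ℕ}
    {s s₀ : Memory} (h : Ready M T x s₀) (hn : ∀ i < 10, i ≠ 0 → i ≠ 4 → s.nat i = s₀.nat i)
    (ha : ∀ A ≠ 3, s.arr A = s₀.arr A) : Ready M T x s where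
  nat := (hn 5 (by omega) (by omega) (by omega)).trans h.nat
  table := (ha 0 (by omega)).trans h.table
  mpo := (ha 1 (by omega)).trans h.mpo
  delta a b := by rw [ha 2 (by omega)]; exact h.delta a b
  size := (hn 1 (by omega) (by omega) (by omega)).trans h.size
  dim := (hn 2 (by omega) (by omega) (by omega)).trans h.dim
  bond := (hn 3 (by omega) (by omega) (by omega)).trans h.bond

theorem Ready.of_sameInput {n D χ : ℕ} {M : Model n D} {T : Fin (n + 1) → MPO n D χ} {x : ℕ}
    {s s₀ : Memory} (h : Ready M T x s₀) (hs : SameInput s s₀) : Ready M T x s :=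
  h.congr (fun i hi _ => hs.1 i hi) hs.2

section

variable {n D χ : ℕ} [NeZero D] {M : Model n D} {T : Fin (n + 1) → MPO n D χ}
  {x : ℕ} {I J : Type} [Fintype I] [Zero I] [Fintype J] [Zero J] {N N' : Network}
  {enc : I → List ℕ} {enc' : J → List ℕ} {g : Fin D × Fin D → I → ℂ}
  {g' : Fin D × Fin D → J → ℂ} {w : ℕ → Fin D × Fin D → Fin D × Fin D → I → I → ℂ}
  {w' : ℕ → Fin D × Fin D → Fin D × Fin D → J → J → ℂ}
  {F F' : (Fin (n + 1) → Fin D) → (Fin (n + 1) → Fin D) → ℂ}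

/-- The outer pair occupies the first two positions and is shared by both networks, whose own states
follow; `pathSum_mul_star` identifies the result. -/
theorem run_innerProgram (h : N.Computes M T x enc g w F) (h' : N'.Computes M T x enc' g' w' F')
    {s₀ : Memory} (hs : Ready M T x s₀) {id : ℕ} (hz : ∀ k, s₀.arr 3 (id :: x :: k) = 0) :
    SameInput ((innerProgram id N N').run s₀).1 s₀ ∧
    (∀ k, (∀ k', k ≠ id :: x :: k') →
      ((innerProgram id N N').run s₀).1.arr 3 k = s₀.arr 3 k) ∧
    (innerResult id N N').eval ((innerProgram id N N').run s₀).1 = innerSum F F' := by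
  have hlen : ∀ a, (enc a).length = N.types.length := fun a => by
    rw [(h.coding s₀ hs.dim hs.bond).length, List.length_map]
  have hlen' : ∀ a, (enc' a).length = N'.types.length := fun a => by
    rw [(h'.coding s₀ hs.dim hs.bond).length, List.length_map]
  let e : (Fin D × Fin D) × I × J → List ℕ := fun p => codePair p.1 ++ (enc p.2.1 ++ enc' p.2.2)
  have he : ∀ p, (e p).length = (pairTypes N N').length := fun p => by
    simp [e, codePair, pairTypes, hlen, hlen']
  have hcod : Coding ((Fin D × Fin D) × I × J) ((pairTypes N N').map s₀.nat) e := by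
    rw [pairTypes, List.map_append, List.map_append]
    simp only [List.map_cons, List.map_nil, hs.dim]
    exact coding_pair.prod ((h.coding s₀ hs.dim hs.bond).prod (h'.coding s₀ hs.dim hs.bond))
  have hholds : ∀ (s : Memory) a p, (∀ j < (pairTypes N N').length,
      s.nat (a + 2 * j) = (e p).getD j 0) → Holds s a 0 (codePair p.1) ∧
      Holds s a 2 (enc p.2.1) ∧ Holds s a (2 + N.types.length) (enc' p.2.2) := by
    intro s a p hp
    have h0 : Holds s a 0 (e p) := fun j hj => by
      rw [zero_add]
      exact hp j (by rwa [he] at hj)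
    have h1 := h0.right.right
    rw [hlen] at h1
    exact ⟨h0.left, h0.right.left, h1⟩
  have key := run_evalNet (s₀ := s₀) (ts := pairTypes N N') (enc := e) (id := id)
    (ini := .mul (N.ini 2) (.conj (N'.ini (2 + N.types.length))))
    (w := .mul (N.step 2) (.conj (N'.step (2 + N.types.length))))
    (g := fun p => g p.1 p.2.1 * star (g' p.1 p.2.2))
    (W := fun y p p' => w y p.1 p'.1 p.2.1 p'.2.1 * star (w' y p.1 p'.1 p.2.2 p'.2.2))
    (fun t ht => by
      rcases List.mem_append.mp ht with ht | ht
      · simp at ht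
        omega
      · rcases List.mem_append.mp ht with ht | ht
        · have := h.types t ht
          omega
        · have := h'.types t ht
          omega)
    hcod (by
      change codePair 0 ++ (enc 0 ++ enc' 0) = _
      rw [h.enc_zero, h'.enc_zero, pairTypes, List.map_append, List.map_append]
      rfl)
    (fun k => by rw [hs.nat]; exact hz k)
    (fun s hss p hp => by
      obtain ⟨h1, h2, h3⟩ := hholds s 10 p hp
      have hl := (hs.of_sameInput hss).toLoaded
      exact congrArg₂ (· * ·) (h.ini hl h2 h1) (congrArg star (h'.ini hl h3 h1)))
    (fun s s' hn ha => congrArg₂ (· * ·) (h.ini_congr hn ha _)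
      (congrArg star (h'.ini_congr hn ha _)))
    (fun s hss p p' hp hp' => by
      obtain ⟨h1, h2, h3⟩ := hholds s 10 p hp
      obtain ⟨h1', h2', h3'⟩ := hholds s 11 p' hp'
      have hl := (hs.of_sameInput hss).toLoaded
      exact congrArg₂ (· * ·) (h.step hl h2 h1 h2' h1') (congrArg star (h'.step hl h3 h1 h3' h1')))
    (fun s s' hn ha => congrArg₂ (· * ·) (h.step_congr hn ha _)
      (congrArg star (h'.step_congr hn ha _)))
  rw [hs.nat] at key
  refine ⟨key.1, key.2.1, key.2.2.trans ?_⟩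
  rw [hs.size, pathSum_mul_star]
  simp only [h.sum, h'.sum]
  rw [sum_arrow_prod]
  rfl

end

/-! ### The verifier -/

/-- The network of the partial trace over the column `x + 1`, with `x` in the register `5`. -/
def nextNetwork : Network := halfNetwork (.add (.var 5) (.const 1))

/-- Clear the register `0` unless the inner products satisfy the equality case of the Cauchy-Schwarz
inequality. -/
def compareProgram (e f g : CExpr) : Program :=
  .ite (.isZero f) (.setN 0 (.const 0))
    (.ite (.isZero (.sub (.mul f (.conj f)) (.mul e g))) .skip (.setN 0 (.const 0)))

/-- The test for two adjacent columns. -/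
def checkColumns : Program :=
  .seq (innerProgram 0 doubleNetwork doubleNetwork)
    (.seq (innerProgram 1 doubleNetwork nextNetwork)
      (.seq (innerProgram 2 nextNetwork nextNetwork)
        (compareProgram (innerResult 0 doubleNetwork doubleNetwork)
          (innerResult 1 doubleNetwork nextNetwork) (innerResult 2 nextNetwork nextNetwork))))

/-- The verifier: it checks, for all pairs of adjacent columns, that the partial trace over two
columns is a nonzero multiple of the partial trace over one column. -/
def verifier : Program :=
  .ite (.lt (.const 0) (.var 3))
    (.seq (.setN 0 (.const 1))
      (.seq (.loop 4 (.var 2) (.setC 2 [.var 4, .var 4] (.const 1)))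
        (.loop 5 (.sub (.var 1) (.const 1)) checkColumns)))
    .skip

/-- The functions `F` and `G` are nonzero and proportional. -/
def Proportional {X Y : Type} [Fintype X] [Fintype Y] (F G : X → Y → ℂ) : Prop :=
  innerSum F G ≠ 0 ∧ innerSum F G * star (innerSum F G) = innerSum F F * innerSum G G

section

variable {n D χ : ℕ} [NeZero D] [NeZero χ] (M : Model n D) (T : Fin (n + 1) → MPO n D χ)

/-- The test of the verifier for the columns `x`, `x + 1`. -/
def PassesCheck (x : ℕ) : Prop :=
  Proportional (M.doubleTrace (mpoVal T x) (mpoVal T (x + 1)) x)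
    (M.halfTrace (mpoVal T (x + 1)) (x + 1))

variable {M T}

theorem innerResult_eval_congr {s s' : Memory} {id x : ℕ} {N N' : Network} (h : s.nat 5 = x)
    (h' : s'.nat 5 = x) (h1 : s.nat 1 = s'.nat 1)
    (ha : ∀ k, s.arr 3 (id :: x :: k) = s'.arr 3 (id :: x :: k)) :
    (innerResult id N N').eval s = (innerResult id N N').eval s' := by
  have e : ∀ s : Memory, ([.const id, .var 5, .var 1] ++
      (pairTypes N N').map fun _ => .const 0 : List NExpr).map (NExpr.eval s) =
      id :: s.nat 5 :: s.nat 1 :: (pairTypes N N').map fun _ => 0 := fun s => by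
    rw [List.map_append, List.map_map]
    rfl
  change s.arr 3 _ = s'.arr 3 _
  rw [e, e, h, h', h1, ha]

theorem run_compareProgram (e f g : CExpr) (s : Memory) :
    ((compareProgram e f g).run s).1.arr = s.arr ∧
    (∀ i ≠ 0, ((compareProgram e f g).run s).1.nat i = s.nat i) ∧
    (((compareProgram e f g).run s).1.nat 0 = 1 ↔ s.nat 0 = 1 ∧ f.eval s ≠ 0 ∧
      f.eval s * star (f.eval s) = e.eval s * g.eval s) := by
  have hne : ∀ {p : Prop}, ¬ p → ((s.setNat 0 0).nat 0 = 1 ↔ s.nat 0 = 1 ∧ p) := fun hp =>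
    iff_of_false (by rw [s.setNat_nat_self]; exact zero_ne_one) fun h => hp h.2
  rw [compareProgram, Program.run]
  split_ifs with p1
  · exact ⟨rfl, fun i hi => s.setNat_nat_of_ne _ hi, hne fun h => h.1 p1⟩
  · rw [Program.run]
    split_ifs with p2
    · exact ⟨rfl, fun _ _ => rfl, ⟨fun h => ⟨h, p1, sub_eq_zero.mp p2⟩, fun h => h.1⟩⟩
    · exact ⟨rfl, fun i hi => s.setNat_nat_of_ne _ hi, hne fun h => p2 (sub_eq_zero.mpr h.2)⟩

/-- The three inner products use the first indices `0`, `1`, `2` of array `3`, so the earlier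
results are still there at the comparison. -/
theorem run_checkColumns {x : ℕ} {s : Memory} (hs : Ready M T x s)
    (hz : ∀ id k, s.arr 3 (id :: x :: k) = 0) :
    Ready M T x (checkColumns.run s).1 ∧
    (∀ x' > x, ∀ id k, (checkColumns.run s).1.arr 3 (id :: x' :: k) =
      s.arr 3 (id :: x' :: k)) ∧
    ((checkColumns.run s).1.nat 0 = 1 ↔ s.nat 0 = 1 ∧ PassesCheck M T x) := by
  have hF := computes_doubleNetwork M T x
  have hG : nextNetwork.Computes M T x _ _ _ _ := computes_halfNetwork M T (x := x) (x' := x + 1)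
    (xe := .add (.var 5) (.const 1)) fun s h => congrArg (· + 1) h
  obtain ⟨a1, a2, a3⟩ := run_innerProgram hF hF hs (hz 0)
  have hrun : (checkColumns.run s).1 = ((compareProgram (innerResult 0 doubleNetwork doubleNetwork)
      (innerResult 1 doubleNetwork nextNetwork) (innerResult 2 nextNetwork nextNetwork)).run
      ((innerProgram 2 nextNetwork nextNetwork).run
      ((innerProgram 1 doubleNetwork nextNetwork).run
      ((innerProgram 0 doubleNetwork doubleNetwork).run s).1).1).1).1 := by
    rw [checkColumns, Program.run, Program.run, Program.run]
  rw [hrun]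
  clear hrun
  generalize ((innerProgram 0 doubleNetwork doubleNetwork).run s).1 = s1 at *
  have r1 := hs.of_sameInput a1
  obtain ⟨b1, b2, b3⟩ := run_innerProgram hF hG r1 (id := 1) fun k => by
    rw [a2 _ (by simp), hz]
  generalize ((innerProgram 1 doubleNetwork nextNetwork).run s1).1 = s2 at *
  have r2 := r1.of_sameInput b1
  obtain ⟨c1, c2, c3⟩ := run_innerProgram hG hG r2 (id := 2) fun k => by
    rw [b2 _ (by simp), a2 _ (by simp), hz]
  generalize ((innerProgram 2 nextNetwork nextNetwork).run s2).1 = s3 at *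
  have r3 := r2.of_sameInput c1
  have e0 := (innerResult_eval_congr (id := 0) (N := doubleNetwork) (N' := doubleNetwork) r3.nat
    r1.nat (r3.size.trans r1.size.symm) fun k => by
      rw [c2 _ (by simp), b2 _ (by simp)]).trans a3
  have e1 := (innerResult_eval_congr (id := 1) (N := doubleNetwork) (N' := nextNetwork) r3.nat
    r2.nat (r3.size.trans r2.size.symm) fun k => by
      rw [c2 _ (by simp)]).trans b3
  obtain ⟨d1, d2, d3⟩ := run_compareProgram (innerResult 0 doubleNetwork doubleNetwork)
    (innerResult 1 doubleNetwork nextNetwork) (innerResult 2 nextNetwork nextNetwork) s3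
  refine ⟨r3.congr (fun i _ hi _ => d2 i hi) fun _ _ => congrFun d1 _, fun x' hx' id k => ?_, ?_⟩
  · have hne : ∀ id' k', id :: x' :: k ≠ id' :: x :: k' := fun id' k' h => by
      simp only [List.cons.injEq] at h
      omega
    rw [d1, c2 _ (hne 2), b2 _ (hne 1), a2 _ (hne 0)]
  · rw [d3, e0, e1, c3, c1.1 0 (by omega) (by omega), b1.1 0 (by omega) (by omega),
      a1.1 0 (by omega) (by omega)]
    rfl

theorem accepts_verifier_iff :
    verifier.Accepts (verifierInput M T) ↔ ∀ x < n, PassesCheck M T x := by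
  set s0 := (verifierInput M T).setNat 0 1 with hs0
  have hχ : (Test.lt (.const 0) (.var 3)).holds (verifierInput M T) := NeZero.pos χ
  have hrun : (verifier.run (verifierInput M T)).1 =
      ((Program.loop 5 (.sub (.var 1) (.const 1)) checkColumns).run
        ((Program.loop 4 (.var 2) (.setC 2 [.var 4, .var 4] (.const 1))).run s0).1).1 := by
    rw [verifier, Program.run, if_pos hχ]
    rfl
  have hdim : (NExpr.var 2).eval s0 = D := rfl
  -- The first loop fills array `2` with the Kronecker delta: only diagonal entries are written, the
  -- others keep their initial `0`.
  have h1 := Program.loop_induction (i := 4) (e := .var 2)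
    (p := .setC 2 [.var 4, .var 4] (.const 1)) (s := s0)
    (fun k t => (∀ i < 4, t.nat i = s0.nat i) ∧ (∀ A ≠ 2, t.arr A = s0.arr A) ∧
      ∀ a b, t.arr 2 [a, b] = if a = b ∧ a < k then 1 else 0)
    ⟨fun _ _ => rfl, fun _ _ => rfl, fun a b => by simp [hs0, verifierInput, Memory.setNat]⟩
    (by
      rintro j - t ⟨h1, h2, h3⟩
      refine ⟨fun i hi => (t.setNat_nat_of_ne j (by omega)).trans (h1 i hi), fun A hA => ?_,
        fun a b => ?_⟩
      · exact (Function.update_of_ne hA _ _).trans (h2 A hA)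
      · have e : (Program.run (.setC 2 [.var 4, .var 4] (.const 1)) (t.setNat 4 j)).1.arr 2 =
            Function.update (t.arr 2) [j, j] 1 := by
          simp [Program.run, Memory.setCell, CExpr.eval, NExpr.eval, Memory.setNat]
        rw [e]
        by_cases h : a = j ∧ b = j
        · obtain ⟨rfl, rfl⟩ := h
          rw [Function.update_self, if_pos ⟨rfl, Nat.lt_succ_self _⟩]
        · rw [Function.update_of_ne (by simpa using h), h3]
          refine if_congr ?_ rfl rfl
          omega)
  rw [hdim] at h1
  set s1 := ((Program.loop 4 (.var 2) (.setC 2 [.var 4, .var 4] (.const 1))).run s0).1 with hs1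
  obtain ⟨i1, i2, i3⟩ := h1
  have hlen : (NExpr.sub (.var 1) (.const 1)).eval s1 = n := by
    change s1.nat 1 - 1 = n
    rw [i1 1 (by omega)]
    rfl
  -- Before the test for column `k` the input is intact, the cells for columns from `k` on are still
  -- zero, and register `0` records whether all earlier tests succeeded.
  have h2 := Program.loop_induction (i := 5) (e := .sub (.var 1) (.const 1))
    (p := checkColumns) (s := s1)
    (fun k t => (∀ x, Ready M T x (t.setNat 5 x)) ∧
      (∀ x' ≥ k, ∀ id l, t.arr 3 (id :: x' :: l) = 0) ∧
      (t.nat 0 = 1 ↔ ∀ x < k, PassesCheck M T x))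
    ⟨fun x =>
      { nat := s1.setNat_nat_self 5 x
        table := i2 0 (by omega)
        mpo := i2 1 (by omega)
        delta := fun a b => by
          change s1.arr 2 _ = _
          rw [i3]
          refine if_congr ?_ rfl rfl
          rw [Fin.ext_iff]
          exact ⟨fun h => h.1, fun h => ⟨h, a.isLt⟩⟩
        size := (s1.setNat_nat_of_ne x (by omega)).trans (i1 1 (by omega))
        dim := (s1.setNat_nat_of_ne x (by omega)).trans (i1 2 (by omega))
        bond := (s1.setNat_nat_of_ne x (by omega)).trans (i1 3 (by omega)) },
      fun x' _ id l => by rw [i2 3 (by omega)]; rfl,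
      iff_of_true ((i1 0 (by omega)).trans ((verifierInput M T).setNat_nat_self 0 1))
        fun x hx => absurd hx (Nat.not_lt_zero x)⟩
    (by
      rintro j - t ⟨h1, h2, h3⟩
      obtain ⟨c1, c2, c3⟩ := run_checkColumns (h1 j) fun id k => h2 j le_rfl id k
      refine ⟨fun x => ?_, fun x' hx' id l => ?_, ?_⟩
      · set u := (checkColumns.run (t.setNat 5 j)).1
        exact
          { nat := u.setNat_nat_self 5 x
            table := c1.table
            mpo := c1.mpo
            delta := c1.delta
            size := (u.setNat_nat_of_ne x (by omega)).trans c1.size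
            dim := (u.setNat_nat_of_ne x (by omega)).trans c1.dim
            bond := (u.setNat_nat_of_ne x (by omega)).trans c1.bond }
      · exact (c2 x' hx' id l).trans (h2 x' (by omega) id l)
      · rw [c3, t.setNat_nat_of_ne j (by omega), h3, Nat.forall_lt_succ_right])
  rw [hlen] at h2
  rw [Program.Accepts, hrun]
  exact h2.2.2

/-- For `χ = 0` the program skips everything and register `0` keeps its initial value `0`. The
evaluation of networks needs a bond value `0` to end in. -/
theorem pos_of_accepts_verifier {n D χ : ℕ} {M : Model n D} {T : Fin (n + 1) → MPO n D χ}
    (h : verifier.Accepts (verifierInput M T)) : 0 < χ := by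
  by_contra hχ
  rw [Program.Accepts, verifier, Program.run, if_neg (show ¬ (Test.lt (.const 0) (.var 3)).holds
    (verifierInput M T) from hχ)] at h
  exact zero_ne_one h

end

theorem bounded_innerProgram (id : ℕ) {N N' : Network} (h : ∀ t ∈ N.types, 2 ≤ t ∧ t ≤ 3)
    (h' : ∀ t ∈ N'.types, 2 ≤ t ∧ t ≤ 3) : (innerProgram id N N').Bounded := by
  refine bounded_evalNet id _ _ fun t ht => ?_
  rcases List.mem_append.mp ht with ht | ht
  · simp at ht
    omega
  · rcases List.mem_append.mp ht with ht | ht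
    · have := h t ht
      omega
    · have := h' t ht
      omega

theorem bounded_verifier : verifier.Bounded := by
  have h : ∀ t ∈ doubleNetwork.types, 2 ≤ t ∧ t ≤ 3 := by simp [doubleNetwork]
  have h' : ∀ t ∈ nextNetwork.types, 2 ≤ t ∧ t ≤ 3 := by simp [nextNetwork, halfNetwork]
  refine ⟨⟨Or.inl (by omega), ⟨Or.inr (by omega), fun s => var_le_size (by omega) s, trivial⟩,
    Or.inr (by omega), fun s => ?_, bounded_innerProgram 0 h h, bounded_innerProgram 1 h h',
    bounded_innerProgram 2 h' h', Or.inl (by omega), trivial, Or.inl (by omega)⟩, trivial⟩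
  change s.nat 1 - 1 ≤ s.nat 1 + s.nat 2 + s.nat 3
  omega

/-! ### The equality case of the Cauchy-Schwarz inequality -/

section InnerSum

variable {X Y : Type} [Fintype X] [Fintype Y] {F G : X → Y → ℂ}

theorem innerSum_self_eq_zero (h : innerSum F F = 0) (s : X) (t : Y) : F s t = 0 := by
  have e : innerSum F F = ((∑ s, ∑ t, Complex.normSq (F s t) : ℝ) : ℂ) := by
    simp only [innerSum, Complex.ofReal_sum, ← Complex.mul_conj]
    rfl
  rw [e, Complex.ofReal_eq_zero, Finset.sum_eq_zero_iff_of_nonneg fun s _ =>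
    Finset.sum_nonneg fun t _ => Complex.normSq_nonneg _] at h
  have h' := h s (Finset.mem_univ _)
  rw [Finset.sum_eq_zero_iff_of_nonneg fun t _ => Complex.normSq_nonneg _] at h'
  exact Complex.normSq_eq_zero.mp (h' t (Finset.mem_univ _))

theorem star_innerSum (F G : X → Y → ℂ) : star (innerSum F G) = innerSum G F := by
  simp only [innerSum, star_sum, star_mul', star_star]
  exact Finset.sum_congr rfl fun s _ => Finset.sum_congr rfl fun t _ => mul_comm _ _

theorem innerSum_mul_left (c : ℂ) (F G : X → Y → ℂ) :
    innerSum (fun s t => c * F s t) G = c * innerSum F G := by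
  simp only [innerSum, Finset.mul_sum, mul_assoc]

theorem innerSum_mul_right (c : ℂ) (F G : X → Y → ℂ) :
    innerSum F (fun s t => c * G s t) = star c * innerSum F G := by
  rw [← star_innerSum, innerSum_mul_left, star_mul', star_innerSum]

theorem innerSum_sub_left (F F' G : X → Y → ℂ) :
    innerSum (fun s t => F s t - F' s t) G = innerSum F G - innerSum F' G := by
  simp only [innerSum, sub_mul, Finset.sum_sub_distrib]

theorem innerSum_sub_right (F G G' : X → Y → ℂ) :
    innerSum F (fun s t => G s t - G' s t) = innerSum F G - innerSum F G' := by
  rw [← star_innerSum, innerSum_sub_left, star_sub, star_innerSum, star_innerSum]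

/-- With `c = ⟨F, G⟩ / ⟨G, G⟩` the squared norm of `F - c G` vanishes, which is the equality case.
The condition `⟨F, G⟩ ≠ 0` makes the denominator and `c` nonzero. -/
theorem Proportional.exists_eq_mul (h : Proportional F G) :
    ∃ c ≠ 0, ∀ s t, F s t = c * G s t := by
  obtain ⟨h0, h1⟩ := h
  have hG : innerSum G G ≠ 0 := fun hG => h0 <| by
    rw [hG, mul_zero, mul_eq_zero, star_eq_zero, or_self] at h1
    exact h1
  have hGs : star (innerSum G G) = innerSum G G := star_innerSum G G
  refine ⟨innerSum F G / innerSum G G, div_ne_zero h0 hG, fun s t => sub_eq_zero.mp <|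
    innerSum_self_eq_zero (F := fun s t => F s t - innerSum F G / innerSum G G * G s t) ?_ s t⟩
  rw [innerSum_sub_left, innerSum_sub_right, innerSum_sub_right, innerSum_mul_left,
    innerSum_mul_right, innerSum_mul_left, innerSum_mul_right, star_div₀, hGs,
    ← star_innerSum F G]
  field_simp
  rw [← h1]
  ring

theorem proportional_of_eq_mul {c : ℂ} (h : ∀ s t, F s t = c * G s t)
    (h0 : ∃ s t, F s t ≠ 0) : Proportional F G := by
  obtain ⟨s, t, hst⟩ := h0
  obtain rfl : F = fun s t => c * G s t := funext fun s => funext fun t => h s t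
  refine ⟨?_, ?_⟩
  · rw [innerSum_mul_left]
    exact mul_ne_zero (left_ne_zero_of_mul hst) fun hG =>
      right_ne_zero_of_mul hst (innerSum_self_eq_zero hG s t)
  · rw [innerSum_mul_left, innerSum_mul_left, innerSum_mul_right, star_mul', star_innerSum]
    ring

end InnerSum

/-! ### Operators on a column -/

section Columns

variable {n D : ℕ}

/-- The operator on the column `C` with the given matrix elements. -/
def colOp (C : Fin (n + 1)) (b : (Fin (n + 1) → Fin D) → (Fin (n + 1) → Fin D) → ℂ) :
    Matrix (RCfg D (col C)) (RCfg D (col C)) ℂ :=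
  Matrix.of fun σ ν => b (fun y => σ ⟨(C, y), mem_col.mpr rfl⟩) fun y => ν ⟨(C, y), mem_col.mpr rfl⟩

variable [NeZero D]

/-- The verifier fixes the last bond to `0` where `toOp` sums over it; the two agree if the last
tensor vanishes at other values. -/
theorem toOp_eq_colOp {χ : ℕ} [NeZero χ] (T : Fin (n + 1) → MPO n D χ) (C : Fin (n + 1))
    (hT : ∀ a b, b.val ≠ 0 → T C (Fin.last n) a b = 0) :
    (T C).toOp C = colOp C (mpoVal T C) := by
  ext σ ν
  change ∑ β : Fin (n + 2) → Fin χ, _ = mpoVal T C _ _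
  rw [sum_snoc, mpoVal, pathSum]
  refine Finset.sum_congr rfl fun v _ => ?_
  rw [Finset.sum_eq_single 0]
  · rw [one_mul]
    refine Finset.prod_congr rfl fun y _ => ?_
    have h1 : (Fin.snoc v 0 : Fin (n + 2) → Fin χ) y.castSucc = extendZero v y := by
      rw [Fin.snoc_castSucc, extendZero_coe]
    have h2 : (Fin.snoc v 0 : Fin (n + 2) → Fin χ) y.succ = extendZero v (y + 1) := by
      by_cases hy : y.val + 1 < n + 1
      · rw [extendZero_of_lt _ hy]
        exact Fin.snoc_castSucc (α := fun _ => Fin χ) (i := ⟨y + 1, hy⟩) ..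
      · rw [extendZero_of_le _ (not_lt.mp hy)]
        obtain rfl : y = Fin.last n := Fin.ext (by have := y.isLt; simp; omega)
        exact Fin.snoc_last ..
    rw [h1, h2, extendZero_coe, extendZero_coe (fun y => σ ⟨(C, y), mem_col.mpr rfl⟩),
      extendZero_coe (fun y => ν ⟨(C, y), mem_col.mpr rfl⟩)]
    simp only [mpoTable]
    rw [dif_pos ⟨⟨C.isLt, y.isLt⟩, ⟨Fin.isLt _, Fin.isLt _⟩, Fin.isLt _, Fin.isLt _⟩]
  · intro b _ hb
    refine Finset.prod_eq_zero (Finset.mem_univ (Fin.last n)) ?_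
    have h : (Fin.snoc v b : Fin (n + 2) → Fin χ) (Fin.last n).succ = b := Fin.snoc_last ..
    rw [h, hT _ _ fun h => hb (Fin.ext h)]
    rfl
  · exact fun h => absurd (Finset.mem_univ _) h

theorem trace_eq_sum_traceOut (R : Finset (Site n)) (A : Op n D) :
    A.trace = ∑ i, traceOut R A i i := by
  have h := trace_mul_amp R A 1
  rwa [amp_one, Matrix.mul_one, Matrix.mul_one] at h

/-- The sites of the columns after `C`. -/
def later (C : Fin (n + 1)) : Finset (Site n) := Finset.univ.filter fun s => C < s.1

omit [NeZero D] in
theorem mem_later {C : Fin (n + 1)} {s : Site n} : s ∈ later C ↔ C.val < s.1.val := by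
  rw [later, Finset.mem_filter, Fin.lt_def]
  exact and_iff_right (Finset.mem_univ _)

namespace Model

variable (M : Model n D)

omit [NeZero D] in
theorem projRight_last : M.projRight (Fin.last n) = 1 := by
  refine Eq.trans (Matrix.mul_one _).symm (M.projOn_mul_of_forall fun z hz => ?_)
  have h := fst_of_mem_plaqIn_right hz
  have := z.1.isLt
  rw [Fin.val_last] at h
  omega

variable (B : ∀ C : Fin (n + 1), Matrix (RCfg D (col C)) (RCfg D (col C)) ℂ)

/-- The partial trace over the columns `x` and `x + 1`. -/
abbrev twoColumns (x : Fin n) : (Fin (n + 1) → Fin D) → (Fin (n + 1) → Fin D) → ℂ :=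
  M.doubleTrace (fun σ ν => B x.castSucc (colFun x.castSucc σ) (colFun x.castSucc ν))
    (fun σ ν => B x.succ (colFun x.succ σ) (colFun x.succ ν)) x

/-- The partial trace over the column `x + 1`. -/
abbrev oneColumn (x : Fin n) : (Fin (n + 1) → Fin D) → (Fin (n + 1) → Fin D) → ℂ :=
  M.halfTrace (fun σ ν => B x.succ (colFun x.succ σ) (colFun x.succ ν)) (x + 1)

variable {B}

/-- Descending induction: `E` collects the strip projectors and `W` the column operators to the
right of `C`. Cyclicity moves the operator of column `x + 1` to the front, and proportionality then
removes column `x` at the price of a nonzero factor. -/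
theorem exists_tail
    (h : ∀ x : Fin n, ∃ c ≠ 0, ∀ s t, M.twoColumns B x s t = c * M.oneColumn B x s t)
    (hlast : (amp (col (Fin.last n)) (B (Fin.last n))).trace ≠ 0) (C : Fin (n + 1)) :
    ∃ E W : Op n D, E ∈ localAlgebra D (later C) ∧ W ∈ localAlgebra D (later C) ∧
      (∀ z : Plaquette n, C.val < z.1.val → M.term z * E = 0) ∧
      (amp (col C) (B C) * M.projRight C * (E * W)).trace ≠ 0 := by
  induction C using Fin.reverseInduction with
  | last =>
    refine ⟨1, 1, one_mem _, one_mem _, fun z hz => ?_, ?_⟩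
    · have := z.1.isLt
      rw [Fin.val_last] at hz
      omega
    · rwa [projRight_last, Matrix.mul_one, Matrix.mul_one, Matrix.mul_one]
  | cast x ih =>
    obtain ⟨E, W, hE, hW, hz, htr⟩ := ih
    obtain ⟨c, hc, hx⟩ := h x
    have hmono : later x.succ ⊆ later x.castSucc := fun s hs => by
      rw [mem_later, Fin.val_succ] at hs
      rw [mem_later, Fin.val_castSucc]
      omega
    have hcol : col x.succ ⊆ later x.castSucc := fun s hs => by
      rw [mem_col, Fin.ext_iff, Fin.val_succ] at hs
      rw [mem_later, Fin.val_castSucc]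
      omega
    have hnext : col x.succ ∪ nextCol x.succ ⊆ later x.castSucc := by
      refine Finset.union_subset hcol fun s hs => ?_
      rw [mem_nextCol, Fin.val_succ] at hs
      rw [mem_later, Fin.val_castSucc]
      omega
    have hout : later x.succ ⊆ (prevCol x.succ ∪ col x.succ)ᶜ := fun s hs => by
      rw [mem_later, Fin.val_succ] at hs
      rw [Finset.mem_compl, Finset.mem_union, mem_prevCol, mem_col, Fin.ext_iff, Fin.val_succ]
      omega
    refine ⟨M.projRight x.succ * E, W * amp (col x.succ) (B x.succ),
      mul_mem (localAlgebra_mono hnext (M.projOn_mem _)) (localAlgebra_mono hmono hE),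
      mul_mem (localAlgebra_mono hmono hW) (localAlgebra_mono hcol (amp_mem _ _)),
      fun z hxz => ?_, ?_⟩
    · by_cases hzx : z.1.val = x.succ.val
      · rw [← Matrix.mul_assoc, projRight, M.term_mul_projOn (mem_plaqIn_right_of_fst hzx),
          Matrix.zero_mul]
      · have hcomm : Commute (M.term z) (M.projRight x.succ) :=
          M.commute_projOn fun z' _ => M.commute z z'
        rw [← Matrix.mul_assoc, hcomm.eq, Matrix.mul_assoc, hz z (by
          rw [Fin.val_castSucc] at hxz
          rw [Fin.val_succ] at hzx ⊢
          omega), Matrix.mul_zero]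
    · have key := M.trace_eq_of_doubleTrace hx
        (localAlgebra_mono hout (mul_mem hE hW))
      have e : (amp (col x.castSucc) (B x.castSucc) * M.projRight x.castSucc *
          (M.projRight x.succ * E * (W * amp (col x.succ) (B x.succ)))).trace =
          (amp (col x.succ) (B x.succ) * (amp (col x.castSucc) (B x.castSucc) *
            (M.projRight x.castSucc * M.projRight x.succ)) * (E * W)).trace := by
        rw [← Matrix.mul_assoc _ W, ← Matrix.mul_assoc, Matrix.trace_mul_comm]
        simp only [Matrix.mul_assoc]
      rw [e, key]
      exact mul_ne_zero (div_ne_zero hc (Nat.cast_ne_zero.mpr Fintype.card_ne_zero)) htr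

/-- At the last column `oneColumn` is a scalar times the Kronecker delta, and this scalar is nonzero
as soon as some entry is. This starts the induction in `exists_tail`. -/
theorem trace_last_ne_zero {x : Fin n} (hx : x.succ = Fin.last n)
    (h : ∃ s t, M.oneColumn B x s t ≠ 0) :
    (amp (col (Fin.last n)) (B (Fin.last n))).trace ≠ 0 := by
  have hle : n ≤ x.val + 1 := by
    have := congrArg Fin.val hx
    rw [Fin.val_succ, Fin.val_last] at this
    omega
  obtain ⟨s, t, hst⟩ := h
  rw [oneColumn, M.halfTrace_of_le hle] at hst
  have h0 := (ite_ne_right_iff.mp hst).2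
  have hP : M.projRight x.succ = 1 := by rw [hx, projRight_last]
  have key : (amp (col x.succ) (B x.succ) * M.projRight x.succ).trace ≠ 0 := by
    have hd : ∀ u, M.oneColumn B x u u = M.oneColumn B x 0 0 := fun u => by
      rw [oneColumn, M.halfTrace_of_le hle, if_pos rfl]
    rw [trace_eq_sum_traceOut (prevCol x.succ ∪ col x.succ),
      Finset.sum_congr rfl fun i _ => (M.traceOut_halfTrace x (B x.succ) i i).trans
        ((if_pos fun _ _ _ _ => rfl).trans (congrArg _ (hd _))), Finset.sum_const, nsmul_eq_mul]
    exact mul_ne_zero (Nat.cast_ne_zero.mpr (Finset.card_ne_zero.mpr Finset.univ_nonempty))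
      (mul_ne_zero (Nat.cast_ne_zero.mpr Fintype.card_ne_zero) h0)
  rw [hP, Matrix.mul_one] at key
  rwa [hx] at key

omit [NeZero D] in
theorem hasZeroEnergyState_of_ne_zero {A : Op n D} (hA : A ≠ 0) (h : ∀ z, M.term z * A = 0) :
    M.HasZeroEnergyState := by
  obtain ⟨σ, τ, hστ⟩ : ∃ σ τ, A σ τ ≠ 0 := by
    by_contra hne
    push Not at hne
    exact hA (Matrix.ext hne)
  refine ⟨fun ρ => A ρ τ, fun h0 => hστ (congrFun h0 σ), ?_⟩
  have hH : M.hamiltonian * A = 0 := by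
    rw [hamiltonian, Matrix.sum_mul]
    exact Finset.sum_eq_zero fun z _ => h z
  ext ρ
  exact congrFun (congrFun hH ρ) τ

/-- A nonzero trace contains the product of all strip projectors as a factor, so this product is
nonzero, while every term annihilates it. With a single column there are no terms at all. -/
theorem hasZeroEnergyState_of_proportional
    (h : ∀ x : Fin n, Proportional (M.twoColumns B x) (M.oneColumn B x)) :
    M.HasZeroEnergyState := by
  obtain rfl | ⟨m, rfl⟩ : n = 0 ∨ ∃ m, n = m + 1 := by
    cases n with
    | zero => exact Or.inl rfl
    | succ m => exact Or.inr ⟨m, rfl⟩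
  · exact M.hasZeroEnergyState_of_ne_zero one_ne_zero fun z => z.1.elim0
  · have hlast := M.trace_last_ne_zero (B := B) (x := Fin.last m) rfl (by
      by_contra hne
      push Not at hne
      refine (h (Fin.last m)).1 ?_
      simp only [innerSum, hne, star_zero, mul_zero, Finset.sum_const_zero])
    obtain ⟨E, W, -, -, hz, htr⟩ := M.exists_tail (fun x => (h x).exists_eq_mul) hlast 0
    refine M.hasZeroEnergyState_of_ne_zero (A := M.projRight 0 * E) (fun h0 => htr ?_) fun z => ?_
    · rw [← Matrix.mul_assoc, Matrix.mul_assoc _ _ E, h0, Matrix.mul_zero, Matrix.zero_mul,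
        Matrix.trace_zero]
    · by_cases hz0 : z.1.val = 0
      · rw [← Matrix.mul_assoc, projRight, M.term_mul_projOn (mem_plaqIn_right_of_fst hz0),
          Matrix.zero_mul]
      · have hcomm : Commute (M.term z) (M.projRight 0) :=
          M.commute_projOn fun z' _ => M.commute z z'
        rw [← Matrix.mul_assoc, hcomm.eq, Matrix.mul_assoc, hz z (Nat.pos_of_ne_zero hz0),
          Matrix.mul_zero]

/-- The verifier's test for the columns `x`, `x + 1` succeeds for masks. -/
theorem proportional_of_masks {O : ∀ C : Fin (n + 1), Matrix (RCfg D (col C)) (RCfg D (col C)) ℂ}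
    (hO : ∀ C, IsMinimalCentralProjector (M.leftAlgebra C) (O C))
    (hB : ∀ C, amp (col C) (B C) = amp (col C) (O C) * M.supportProd C (n + 1))
    {φ : Cfg n D → ℂ} (hφ0 : φ ≠ 0) (hφ : ∀ z, M.term z *ᵥ φ = 0)
    (hBφ : ∀ C, amp (col C) (B C) *ᵥ φ = φ) (x : Fin n) :
    Proportional (M.twoColumns B x) (M.oneColumn B x) := by
  have hprev : prevCol x.succ = col x.castSucc := by
    ext s
    rw [mem_prevCol, mem_col, Fin.ext_iff, Fin.val_succ, Fin.val_castSucc]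
    omega
  have hleft : M.projLeft x.succ = M.projRight x.castSucc := by
    have : nextCol x.castSucc = col x.succ := by
      ext s
      rw [mem_nextCol, mem_col, Fin.ext_iff, Fin.val_succ, Fin.val_castSucc]
    rw [projLeft, projRight, hprev, this]
  have hdisj : Disjoint (col x.succ) (col x.castSucc) := by
    rw [Finset.disjoint_left]
    intro s h1 h2
    rw [mem_col, Fin.ext_iff, Fin.val_succ] at h1
    rw [mem_col, Fin.ext_iff, Fin.val_castSucc] at h2
    omega
  have c1 : Commute (amp (col x.succ) (B x.succ)) (amp (col x.castSucc) (B x.castSucc)) :=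
    commute_of_disjoint hdisj (amp_mem _ _) (amp_mem _ _)
  have c2 : ∀ C C', Commute (amp (col C) (B C)) (M.projRight C') := fun C C' =>
    M.commute_projRight (hO C).1 (hB C) C'
  have c3 : Commute (M.projRight x.castSucc) (M.projRight x.succ) :=
    M.commute_projOn fun z _ => (M.commute_projOn fun z' _ => M.commute z z').symm
  obtain ⟨O', hO'⟩ := exists_amp (R := prevCol x.succ)
    (A := amp (col x.castSucc) (B x.castSucc)) (by rw [hprev]; exact amp_mem _ _)
  obtain ⟨c, hc⟩ := M.isMask (hO x.succ) (hB x.succ) O'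
  have e : amp (col x.succ) (B x.succ) * (amp (col x.castSucc) (B x.castSucc) *
      (M.projRight x.castSucc * M.projRight x.succ)) = amp (prevCol x.succ) O' *
      M.projLeft x.succ * amp (col x.succ) (B x.succ) * M.projRight x.succ := by
    rw [← hO', hleft, ← Matrix.mul_assoc, c1.eq, Matrix.mul_assoc, ← Matrix.mul_assoc (amp _ _)
      (M.projRight _), (c2 _ _).eq]
    simp only [Matrix.mul_assoc]
  rw [← e] at hc
  refine proportional_of_eq_mul (M.doubleTrace_eq_of_traceOut hc) ?_
  by_contra hne
  push Not at hne
  -- If the two-column contraction vanished, so would the trace of a product of commuting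
  -- projectors; but this product fixes the ground state.
  have h0 := M.trace_eq_of_doubleTrace (x := x) (c := 0) (B := B x.castSucc) (B' := B x.succ)
    (fun s t => by rw [zero_mul]; exact hne s t) (one_mem _)
  rw [zero_div, zero_mul, Matrix.mul_one] at h0
  refine IsProjector.trace_ne_zero ?_ ?_ h0
  · have p1 : ∀ C, IsProjector (amp (col C) (B C)) := fun C =>
      isProjector_amp (M.isProjector_mask (hO C).1 (hB C))
    exact (p1 _).mul ((p1 _).mul ((M.isProjector_projOn _).mul (M.isProjector_projOn _) c3)
      ((c2 _ _).mul_right (c2 _ _))) (c1.mul_right ((c2 _ _).mul_right (c2 _ _)))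
  · intro hzero
    have hP : ∀ C, M.projRight C *ᵥ φ = φ := fun C => M.projOn_mulVec_of_forall fun z _ => hφ z
    have := congrArg (· *ᵥ φ) hzero
    simp only [← Matrix.mulVec_mulVec, hP, hBφ, Matrix.zero_mulVec] at this
    exact hφ0 this

end Model

end Columns

/-! ### Running time, soundness and completeness of the verifier. -/

theorem eval_le_eval (P : Polynomial ℕ) {a b : ℕ} (h : a ≤ b) : P.eval a ≤ P.eval b := by
  rw [Polynomial.eval_eq_sum_range, Polynomial.eval_eq_sum_range]
  exact Finset.sum_le_sum fun i _ => Nat.mul_le_mul_left _ (Nat.pow_le_pow_left h i)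

theorem time_verifier_le {n D χ : ℕ} (M : Model n D) (T : Fin (n + 1) → MPO n D χ) :
    verifier.time (verifierInput M T) ≤ verifier.timePoly.eval ((n + 1) ^ 2 + D + χ) := by
  refine (Program.run_le bounded_verifier _).2.trans (eval_le_eval _ ?_)
  change n + 1 + D + χ ≤ _
  have := Nat.le_self_pow two_ne_zero (n + 1)
  omega

/-- The operators are those which the verifier actually reads, with the last bond fixed, so the
tensors of the witness may be arbitrary. -/
theorem hasZeroEnergyState_of_accepts {n D χ : ℕ} [NeZero D] {M : Model n D}
    {T : Fin (n + 1) → MPO n D χ} (h : verifier.Accepts (verifierInput M T)) :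
    M.HasZeroEnergyState := by
  have : NeZero χ := ⟨(pos_of_accepts_verifier h).ne'⟩
  exact M.hasZeroEnergyState_of_proportional (B := fun C => colOp C (mpoVal T C))
    fun x => accepts_verifier_iff.mp h x x.isLt

theorem accepts_verifier_of_proportional {n D χ : ℕ} [NeZero D] [NeZero χ] {M : Model n D}
    {T : Fin (n + 1) → MPO n D χ} (hT : ∀ C a b, b.val ≠ 0 → T C (Fin.last n) a b = 0)
    (h : ∀ x : Fin n, Proportional (M.twoColumns (fun C => (T C).toOp C) x)
      (M.oneColumn (fun C => (T C).toOp C) x)) :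
    verifier.Accepts (verifierInput M T) := by
  refine accepts_verifier_iff.mpr fun x hx => ?_
  have := h ⟨x, hx⟩
  simp only [toOp_eq_colOp T _ (hT _)] at this
  exact this

end CLH

end

theorem theorem3 :
    ∃ V : CLH.Program,
      -- the verifier runs in polynomial time
      (∃ t : Polynomial ℕ, ∀ (n D χ : ℕ) (M : CLH.Model n D) (T : Fin (n + 1) → CLH.MPO n D χ),
        V.time (CLH.verifierInput M T) ≤ t.eval ((n + 1) ^ 2 + D + χ)) ∧
      -- the verifier accepts no false witness
      (∀ (n D χ : ℕ) [NeZero D] (M : CLH.Model n D) (T : Fin (n + 1) → CLH.MPO n D χ),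
        V.Accepts (CLH.verifierInput M T) → M.HasZeroEnergyState) ∧
      -- under the conditions on the four-site problems there is a witness
      (∀ p : Polynomial ℕ, ∃ t : Polynomial ℕ,
        ∀ (n D : ℕ) [NeZero D] (M : CLH.Model n D) (r : ℝ),
          D ≤ p.eval ((n + 1) ^ 2) → 1 ≤ r → r ≤ (p.eval ((n + 1) ^ 2) : ℕ) →
          M.HasZeroEnergyState → M.FourSiteConditions r →
          ∃ (χ : ℕ) (T : Fin (n + 1) → CLH.MPO n D χ)
            (O : ∀ C : Fin (n + 1),
              Matrix (CLH.RCfg D (CLH.col C)) (CLH.RCfg D (CLH.col C)) ℂ),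
            (χ : ℝ) ≤ (D : ℝ) ^ 2 * r ∧
            (∀ C : Fin (n + 1),
              CLH.IsMinimalCentralProjector (M.leftAlgebra C) (O C) ∧
              CLH.IsProjector ((T C).toOp C) ∧
              CLH.IsProjector (O C - (T C).toOp C) ∧
              CLH.amp (CLH.col C) (O C - (T C).toOp C) * M.projLeft C = 0 ∧
              M.projLeft C * CLH.amp (CLH.col C) (O C - (T C).toOp C) = 0 ∧
              Commute (CLH.amp (CLH.col C) ((T C).toOp C)) (M.projLeft C) ∧
              M.IsMask C ((T C).toOp C)) ∧
            M.Consistent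
              (List.ofFn fun C : Fin (n + 1) => CLH.amp (CLH.col C) ((T C).toOp C)).prod ∧
            V.Accepts (CLH.verifierInput M T) ∧
            V.time (CLH.verifierInput M T) ≤ t.eval ((n + 1) ^ 2) ∧
            (n + 1) ^ 2 * χ ^ 2 * D ^ 2 ≤ t.eval ((n + 1) ^ 2)) := by
  refine ⟨CLH.verifier, ⟨CLH.verifier.timePoly, fun n D χ M T => CLH.time_verifier_le M T⟩,
    fun n D χ _ M T h => CLH.hasZeroEnergyState_of_accepts h, fun p => ?_⟩
  -- With `χ = D ^ 2` and `D` bounded by `p`, the first summand bounds the time on inputs of size at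
  -- most `N + D + χ`, and the second one the number `N * χ ^ 2 * D ^ 2` of entries.
  refine ⟨CLH.verifier.timePoly.comp (.X + p + p ^ 2) + .X * (p ^ 2) ^ 2 * p ^ 2,
    fun n D _ M r hD hr _ hM hcond => ?_⟩
  obtain ⟨O, φ, hφ0, hφ, hO⟩ := M.exists_minimalProjectors hM
  have hφz := M.term_mulVec_eq_zero hφ
  choose B hB using fun C => M.exists_eq_mul_supportProd (hO C).1.1
  -- `hT` records that the last bond is pinned to `0`, so that the verifier reads the same operator.
  choose T hT hTB using fun C => M.exists_mpo hcond C (hO C).1.1.2.1 (hO C).1.1.2.2 (hB C)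
  have hBφ : ∀ C, CLH.amp (CLH.col C) (B C) *ᵥ φ = φ := fun C =>
    M.amp_mulVec_eq (hB C) hφz (hO C).2
  have hDp : D ^ 2 ≤ p.eval ((n + 1) ^ 2) ^ 2 := Nat.pow_le_pow_left hD 2
  refine ⟨D ^ 2, T, O, ?_, fun C => ?_, ?_, ?_, ?_, ?_⟩
  · rw [Nat.cast_pow]
    exact le_mul_of_one_le_right (by positivity) hr
  · rw [hTB]
    exact ⟨(hO C).1, M.isProjector_mask (hO C).1.1 (hB C), M.isProjector_sub_mask (hO C).1.1 (hB C),
      M.sub_mul_projLeft (hB C), M.projLeft_mul_sub (hO C).1.1 (hB C),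
      M.commute_projLeft (hO C).1.1 (hB C), M.isMask (hO C).1 (hB C)⟩
  · refine ⟨φ, hφ0, hφ, φ, ?_⟩
    -- Every mask fixes the ground state `φ`, so the product fixes it and `φ` is its own preimage.
    have key : ∀ l : List (CLH.Op n D), (∀ A ∈ l, A *ᵥ φ = φ) → l.prod *ᵥ φ = φ := by
      intro l
      induction l with
      | nil => exact fun _ => Matrix.one_mulVec φ
      | cons A l ih =>
        intro h
        rw [List.prod_cons, ← Matrix.mulVec_mulVec,
          ih fun A' hA' => h A' (List.mem_cons_of_mem _ hA'), h A List.mem_cons_self]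
    refine key _ fun A hA => ?_
    obtain ⟨C, rfl⟩ := (List.mem_ofFn' _ _).mp hA
    beta_reduce
    rw [hTB]
    exact hBφ C
  · refine CLH.accepts_verifier_of_proportional hT ?_
    simp only [hTB]
    exact M.proportional_of_masks (fun C => (hO C).1) hB hφ0 hφz hBφ
  · refine (CLH.time_verifier_le M T).trans ?_
    simp only [Polynomial.eval_add, Polynomial.eval_comp, Polynomial.eval_X, Polynomial.eval_pow]
    exact (CLH.eval_le_eval _ (add_le_add (Nat.add_le_add_left hD _) hDp)).trans
      (Nat.le_add_right _ _)
  · simp only [Polynomial.eval_add, Polynomial.eval_mul, Polynomial.eval_X, Polynomial.eval_pow]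
    exact (Nat.mul_le_mul (Nat.mul_le_mul_left _ (Nat.pow_le_pow_left hDp 2)) hDp).trans
      (Nat.le_add_left _ _)
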